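/- **Setting.** Let $\mathcal F_{\rm rad}=\bigoplus_{n\ge 0}\bigotimes_s^n L^2(\mathbb R^3\times\{1,2\})$ be the boson Fock space of photons, with second quantization $d\Gamma(\cdot),\Gamma(\cdot)$ and annihilation operators $a(f)$. Let $\mathbf e=(\mathbf e^{(1)},\mathbf e^{(2)})$ be Borel measurable polarization vectors: $\mathbf e^{(\lambda)}(\mathbf k)\cdot\mathbf e^{(\mu)}(\mathbf k)=\delta_{\lambda\mu}$ and $\mathbf e^{(\lambda)}(\mathbf k)\cdot\mathbf k=0$ for almost every $\mathbf k\in\mathbb R^3$. Let $\rho:\mathbb R^3\to\mathbb C$ satisfy $\rho\in L^2(\mathbb R^3)$ and $|\mathbf k|^{-1}\rho\in L^2(\mathbb R^3)$; put $g_a(\mathbf k,\lambda)=|\mathbf k|^{-1/2}\rho(\mathbf k)e^{(\lambda)}_a(\mathbf k)$ and $A_a=2^{-1/2}\,\overline{a(g_a)+a(g_a)^*}$, $a=1,2,3$. For $M,q\in\mathbb R$, $m\ge 0$ and $\mathbf p\in\mathbb R^3$ let $$H_m(\mathbf p)=\vec\alpha\cdot\mathbf p+M\beta+d\Gamma(\omega_m)-\vec\alpha\cdot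 d\Gamma(\mathbf k)-q\,\vec\alpha\cdot\mathbf A,\qquad \omega_m(\mathbf k)=(1+m)|\mathbf k|+m,$$ on $\mathbb C^4\otimes\mathcal F_{\rm rad}$, with domain the intersection of the domains of its terms, where $\vec\alpha,\beta$ are the standard Dirac matrices and $\vec\sigma$ are the Pauli matrices. For a unit vector $\mathbf j$ let $\bar{\mathbf e}^{(1)}(\mathbf k)=\frac{\mathbf k\times\mathbf j}{|\mathbf k\times\mathbf j|}$, $\bar{\mathbf e}^{(2)}(\mathbf k)=\frac{\mathbf k}{|\mathbf k|}\times\bar{\mathbf e}^{(1)}(\mathbf k)$, let $U=\Gamma(u)$ with $(uf)(\mathbf k,\lambda)=\sum_{\mu}\mathbf e^{(\lambda)}(\mathbf k)\cdot\bar{\mathbf e}^{(\mu)}(\mathbf k)\,f(\mathbf k,\mu)$, and define the total angular momentum around $\mathbf j$ by $$J_{\mathbf j}(\mathbf e)=\Big(\tfrac12\mathbf j\cdot\vec\sigma\oplus\tfrac12\mathbf j\cdot\vec\sigma\Big)+U\,d\Gamma\big(\overline{\mathbf j\cdot\vec\ell}\,\big)\,U^*,\qquad \vec\ell=i\nabla_{\mathbf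 k}\times\mathbf k .$$ **Theorem.** Let $\mathbf j$ be a unit vector and $\mathbf p=t\mathbf j$ for some $t\in\mathbb R$. Assume that for every $R\in O(3)$ with $R\mathbf j=\mathbf j$ one has $\rho(R\mathbf k)=\rho(\mathbf k)$ for almost every $\mathbf k$. Then $\overline{H_m(\mathbf p)}$ and $J_{\mathbf j}(\mathbf e)$ are self-adjoint and commute strongly (their spectral projections commute). The space $\mathbb C^4\otimes\mathcal F_{\rm rad}$ is the orthogonal direct sum of the subspaces $\mathcal F(z)=\ker(J_{\mathbf j}(\mathbf e)-z)$, $z\in\mathbb Z_{1/2}=\{\pm\frac12,\pm\frac32,\dots\}$, and with respect to this decomposition $$J_{\mathbf j}(\mathbf e)=\bigoplus_{z\in\mathbb Z_{1/2}}z,\qquad \overline{H_m(\mathbf p)}=\bigoplus_{z\in\mathbb Z_{1/2}}H_m(\mathbf p:z),$$ where $H_m(\mathbf p:z)$ is the part of $\overline{H_m(\mathbf p)}$ in $\mathcal F(z)$. Moreover, for every $z\in\mathbb Z_{1/2}$ the operator $H_m(\mathbf p:z)$ is unitarily equivalent to $H_m(\mathbf p:-z)$, and every eigenvalue of $\overline{H_m(\mathbf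 p)}$ has even or infinite multiplicity. -/

import Mathlib

open MeasureTheory Matrix
open scoped ENNReal

noncomputable section

namespace DiracPolaron

/-! ### Unbounded operators: spectral measures, strong commutation, direct sums -/

section Operators

variable {K : Type*} [NormedAddCommGroup K] [InnerProductSpace ℂ K] [CompleteSpace K]

/-- A projection-valued measure on the Borel sets of the real line. -/
structure PVM (K : Type*) [NormedAddCommGroup K] [InnerProductSpace ℂ K] [CompleteSpace K] where
  /-- the projection attached to a set (only its values on Borel sets matter) -/
  proj : Set ℝ → K →L[ℂ] K
  isStarProjection : ∀ S, MeasurableSet S → IsStarProjection (proj S)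
  proj_empty : proj ∅ = 0
  proj_univ : proj Set.univ = 1
  hasSum_iUnion : ∀ S : ℕ → Set ℝ, (∀ n, MeasurableSet (S n)) → Pairwise (Function.onFun Disjoint S) →
    ∀ ψ, HasSum (fun n => proj (S n) ψ) (proj (⋃ n, S n) ψ)

theorem PVM.inner_eq_norm_sq (E : PVM K) {S : Set ℝ} (hS : MeasurableSet S) (ψ : K) :
    RCLike.re (inner ℂ ψ (E.proj S ψ)) = ‖E.proj S ψ‖ ^ 2 := by
  have h := E.isStarProjection S hS
  have h1 : E.proj S (E.proj S ψ) = E.proj S ψ := by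
    have := congrArg (fun T : K →L[ℂ] K => T ψ) h.isIdempotentElem.eq
    simpa using this
  have h2 : ContinuousLinearMap.adjoint (E.proj S) = E.proj S := h.isSelfAdjoint.star_eq
  calc RCLike.re (inner ℂ ψ (E.proj S ψ))
      = RCLike.re (inner ℂ ψ (ContinuousLinearMap.adjoint (E.proj S) (E.proj S ψ))) := by
        rw [h2, h1]
    _ = ‖E.proj S ψ‖ ^ 2 := by
        rw [ContinuousLinearMap.adjoint_inner_right]
        exact inner_self_eq_norm_sq (𝕜 := ℂ) _

/-- The finite measure `S ↦ ⟨ψ, E(S) ψ⟩ = ‖E(S) ψ‖²`. -/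
def PVM.measure (E : PVM K) (ψ : K) : Measure ℝ :=
  Measure.ofMeasurable (fun S _ => ENNReal.ofReal (‖E.proj S ψ‖ ^ 2))
    (by simp [E.proj_empty])
    (by
      intro S hS hd
      have hsum : HasSum (fun n => ‖E.proj (S n) ψ‖ ^ 2) (‖E.proj (⋃ n, S n) ψ‖ ^ 2) := by
        have h1 := (E.hasSum_iUnion S hS hd ψ).mapL (innerSL ℂ ψ)
        have h2 := h1.mapL (RCLike.reCLM (K := ℂ))
        rw [← E.inner_eq_norm_sq (MeasurableSet.iUnion hS) ψ]
        simp only [← fun n => E.inner_eq_norm_sq (hS n) ψ]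
        exact h2
      rw [← hsum.tsum_eq]
      exact ENNReal.ofReal_tsum_of_nonneg (fun n => by positivity) hsum.summable)

/-- `A = ∫ t dE(t)`: the domain of `A` consists of the `ψ` with `∫ t² d⟨ψ, E(t)ψ⟩ < ∞`, and
`⟨ψ, A ψ⟩ = ∫ t d⟨ψ, E(t)ψ⟩` there. -/
def PVM.IsSpectralMeasureOf (E : PVM K) (A : K →ₗ.[ℂ] K) : Prop :=
  (∀ ψ, ψ ∈ A.domain ↔ ∫⁻ t, ENNReal.ofReal (t ^ 2) ∂(E.measure ψ) < ⊤) ∧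
  ∀ ψ : A.domain, inner ℂ (ψ : K) (A ψ) = ((∫ t, t ∂(E.measure (ψ : K)) : ℝ) : ℂ)

/-- Two self-adjoint operators commute strongly if all the projections of their spectral measures
commute. (By the spectral theorem a self-adjoint operator has exactly one spectral measure.) -/
def StronglyCommute (A B : K →ₗ.[ℂ] K) : Prop :=
  IsSelfAdjoint A ∧ IsSelfAdjoint B ∧
  ∀ E F : PVM K, E.IsSpectralMeasureOf A → F.IsSpectralMeasureOf B →
    ∀ S T : Set ℝ, MeasurableSet S → MeasurableSet T → Commute (E.proj S) (F.proj T)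

end Operators

section Sums

variable {K L : Type*} [NormedAddCommGroup K] [InnerProductSpace ℂ K]
  [NormedAddCommGroup L] [InnerProductSpace ℂ L]

/-- The eigenspace `ker (A - z)`. -/
def eigenspace (A : K →ₗ.[ℂ] K) (z : ℂ) : Submodule ℂ K :=
  A.graph.comap (LinearMap.prod LinearMap.id (z • LinearMap.id))

/-- The part of `A` in the subspace `V`: its domain is `{x ∈ V ∩ Dom A | A x ∈ V}`. -/
def part (A : K →ₗ.[ℂ] K) (V : Submodule ℂ K) : V →ₗ.[ℂ] V :=
  (A.graph.comap (LinearMap.prodMap V.subtype V.subtype)).toLinearPMap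

/-- `K` is the orthogonal Hilbert space direct sum of the subspaces `V i`, and `A` is the direct
sum of its parts in the `V i`. -/
def IsOrthogonalDirectSum {ι : Type*} (A : K →ₗ.[ℂ] K) (V : ι → Submodule ℂ K) : Prop :=
  OrthogonalFamily ℂ (fun i => V i) (fun i => (V i).subtypeₗᵢ) ∧
  (⨆ i, V i).topologicalClosure = ⊤ ∧
  ∀ Ψ Φ : K, (Ψ, Φ) ∈ A.graph ↔
    ∃ x y : ∀ i, V i, HasSum (fun i => (x i : K)) Ψ ∧ HasSum (fun i => (y i : K)) Φ ∧
      ∀ i, (x i, y i) ∈ (part A (V i)).graph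

/-- Unitary equivalence of two operators. -/
def UnitarilyEquivalent (A : K →ₗ.[ℂ] K) (B : L →ₗ.[ℂ] L) : Prop :=
  ∃ U : K ≃ₗᵢ[ℂ] L, ∀ x y : K, (x, y) ∈ A.graph ↔ (U x, U y) ∈ B.graph

end Sums

/-! ### The one-photon space and the boson Fock space -/

/-- Momentum space. -/
abbrev E3 : Type := EuclideanSpace ℝ (Fin 3)

/-- Momentum and helicity of one photon. -/
abbrev Photon : Type := E3 × Fin 2

/-- Lebesgue measure on the momentum, counting measure on the helicity. -/
abbrev photonMeasure : Measure Photon := (volume : Measure E3).prod Measure.count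

/-- The one-photon space `L²(ℝ³ × {1,2})`. -/
abbrev OnePhoton : Type := Lp ℂ 2 photonMeasure

/-- The `n`-fold Hilbert space tensor power of the one-photon space, as `L²((ℝ³ × {1,2})ⁿ)`. -/
abbrev TensorPower (n : ℕ) : Type := Lp ℂ 2 (Measure.pi (fun _ : Fin n => photonMeasure))

theorem measurePreserving_permute {n : ℕ} (σ : Equiv.Perm (Fin n)) :
    MeasurePreserving (fun (x : Fin n → Photon) (i : Fin n) => x (σ i))
      (Measure.pi (fun _ : Fin n => photonMeasure))
      (Measure.pi (fun _ : Fin n => photonMeasure)) := by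
  have h := measurePreserving_arrowCongr' (fun _ : Fin n => photonMeasure)
    (fun _ : Fin n => photonMeasure) σ.symm (MeasurableEquiv.refl Photon)
    (fun _ => MeasurePreserving.id _)
  exact h

/-- Permutation of the `n` photons. -/
def permute {n : ℕ} (σ : Equiv.Perm (Fin n)) : TensorPower n →L[ℂ] TensorPower n :=
  (Lp.compMeasurePreservingₗᵢ ℂ _ (measurePreserving_permute σ)).toContinuousLinearMap

/-- The `n`-fold symmetric tensor power: square-integrable functions that are invariant under
permutations of the `n` photons. -/
def SymPower (n : ℕ) : Submodule ℂ (TensorPower n) :=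
  ⨅ σ : Equiv.Perm (Fin n), LinearMap.ker (permute σ - ContinuousLinearMap.id ℂ _).toLinearMap

instance (n : ℕ) : CompleteSpace (SymPower n) := by
  have h : IsClosed (SymPower n : Set (TensorPower n)) := by
    rw [SymPower, Submodule.coe_iInf]
    exact isClosed_iInter fun σ => (permute σ - ContinuousLinearMap.id ℂ _).isClosed_ker
  exact h.completeSpace_coe

/-- The boson Fock space `⨁ₙ ⊗ₛⁿ L²(ℝ³ × {1,2})`. -/
abbrev Fock : Type := lp (fun n : ℕ => SymPower n) 2

theorem memLp_tensor {n : ℕ} (f : Fin n → OnePhoton) :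
    MemLp (fun x : Fin n → Photon => ∏ i, f i (x i)) 2
      (Measure.pi (fun _ : Fin n => photonMeasure)) := by
  have hm : AEStronglyMeasurable (fun x : Fin n → Photon => ∏ i, f i (x i))
      (Measure.pi (fun _ : Fin n => photonMeasure)) := by
    refine Finset.aestronglyMeasurable_fun_prod _ fun i _ => ?_
    exact (Lp.aestronglyMeasurable (f i)).comp_quasiMeasurePreserving
      (Measure.quasiMeasurePreserving_eval _ i)
  rw [memLp_two_iff_integrable_sq_norm hm]
  have h : Integrable (fun x : Fin n → Photon => ∏ i, ‖f i (x i)‖ ^ 2)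
      (Measure.pi (fun _ : Fin n => photonMeasure)) :=
    Integrable.fintype_prod (f := fun i y => ‖f i y‖ ^ 2)
      fun i => (memLp_two_iff_integrable_sq_norm (Lp.aestronglyMeasurable (f i))).1 (Lp.memLp (f i))
  refine h.congr (Filter.Eventually.of_forall fun x => ?_)
  simp [norm_prod, Finset.prod_pow]

/-- The product vector `f₁ ⊗ ⋯ ⊗ fₙ`. -/
def tensor {n : ℕ} (f : Fin n → OnePhoton) : TensorPower n := (memLp_tensor f).toLp _

/-- `S (f₁ ⊗ ⋯ ⊗ fₙ)` as a vector of the Fock space, where `S` is the orthogonal projection onto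
the symmetric tensor power. For `n = 0` this is the vacuum. -/
def symTensor {n : ℕ} (f : Fin n → OnePhoton) : Fock :=
  lp.single 2 n ((SymPower n).orthogonalProjectionOnto (tensor f))

/-- The second quantization `dΓ(T)`: the closure of
`S (f₁ ⊗ ⋯ ⊗ fₙ) ↦ ∑ᵢ S (f₁ ⊗ ⋯ ⊗ T fᵢ ⊗ ⋯ ⊗ fₙ)`, `fᵢ ∈ Dom T`, extended linearly. -/
def dGamma (T : OnePhoton →ₗ.[ℂ] OnePhoton) : Fock →ₗ.[ℂ] Fock :=
  (Submodule.span ℂ {Ψ : Fock × Fock | ∃ (n : ℕ) (f : Fin n → T.domain),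
    Ψ = (symTensor (fun i => (f i : OnePhoton)),
      ∑ i, symTensor (Function.update (fun l => (f l : OnePhoton)) i (T (f i))))}
    ).topologicalClosure.toLinearPMap

/-- The second quantization `Γ(u)` of an isometry `u`: the bounded linear extension of
`S (f₁ ⊗ ⋯ ⊗ fₙ) ↦ S (u f₁ ⊗ ⋯ ⊗ u fₙ)`. -/
def Gamma (u : OnePhoton →ₗ[ℂ] OnePhoton) : Fock →L[ℂ] Fock :=
  LinearMap.extendOfNorm
    (Finsupp.linearCombination ℂ
      (fun s : Σ n : ℕ, Fin n → OnePhoton => symTensor (fun i => u (s.2 i))))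
    (Finsupp.linearCombination ℂ
      (fun s : Σ n : ℕ, Fin n → OnePhoton => symTensor s.2))

/-- The annihilation operator `a(f)`: the closure of
`S (f₀ ⊗ ⋯ ⊗ fₙ) ↦ (n + 1)^(-1/2) ∑ᵢ ⟨f, fᵢ⟩ S (f₀ ⊗ ⋯ f̂ᵢ ⋯ ⊗ fₙ)`, which maps the vacuum to `0`. -/
def annihilation (f : OnePhoton) : Fock →ₗ.[ℂ] Fock :=
  (Submodule.span ℂ
    ({Ψ : Fock × Fock | ∃ (n : ℕ) (h : Fin (n + 1) → OnePhoton),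
      Ψ = (symTensor h,
        ((Real.sqrt (n + 1) : ℝ) : ℂ)⁻¹ •
          ∑ i, (inner ℂ f (h i)) • symTensor (fun l : Fin n => h (i.succAbove l)))} ∪
     {Ψ : Fock × Fock | ∃ h : Fin 0 → OnePhoton, Ψ = (symTensor h, 0)})
    ).topologicalClosure.toLinearPMap

/-- The field operator `2^(-1/2) · closure (a(f) + a(f)*)`. -/
def field (f : OnePhoton) : Fock →ₗ.[ℂ] Fock :=
  ((Real.sqrt 2 : ℝ) : ℂ)⁻¹ • (annihilation f + (annihilation f).adjoint).closure

/-! ### One-photon operators -/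

/-- Multiplication by a real function of the momentum, on its maximal domain. -/
def mulOp (φ : E3 → ℝ) : OnePhoton →ₗ.[ℂ] OnePhoton :=
  Submodule.toLinearPMap
    { carrier := {F : OnePhoton × OnePhoton |
        F.2 =ᵐ[photonMeasure] fun x => (φ x.1 : ℂ) * F.1 x}
      zero_mem' := by
        filter_upwards [Lp.coeFn_zero ℂ 2 photonMeasure] with x hx
        rw [Prod.fst_zero, Prod.snd_zero, hx, Pi.zero_apply, mul_zero]
      add_mem' := by
        intro F G hF hG
        change _ =ᵐ[photonMeasure] _
        filter_upwards [Lp.coeFn_add F.1 G.1, Lp.coeFn_add F.2 G.2, hF, hG] with x h1 h2 h3 h4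
        rw [Prod.fst_add, Prod.snd_add, h1, h2, Pi.add_apply, Pi.add_apply, h3, h4, mul_add]
      smul_mem' := by
        intro c F hF
        change _ =ᵐ[photonMeasure] _
        filter_upwards [Lp.coeFn_smul c F.1, Lp.coeFn_smul c F.2, hF] with x h1 h2 h3
        rw [Prod.smul_fst, Prod.smul_snd, h1, h2, Pi.smul_apply, Pi.smul_apply, h3, smul_eq_mul,
          smul_eq_mul, mul_left_comm] }

/-- The vector product on `ℝ³`. -/
def cross (a b : E3) : E3 := WithLp.toLp 2 (a.ofLp ⨯₃ b.ofLp)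

/-- The gradient of a complex-valued function on `ℝ³`. -/
def grad (f : E3 → ℂ) (k : E3) : Fin 3 → ℂ := fun a => fderiv ℝ f k (EuclideanSpace.single a 1)

/-- `j · ℓ` for `ℓ = i ∇ × k = - i k × ∇`, as a differential expression. -/
def angularExpr (j : E3) (f : E3 → ℂ) (k : E3) : ℂ :=
  -Complex.I * ((fun a => (j a : ℂ)) ⬝ᵥ ((fun a => (k a : ℂ)) ⨯₃ grad f k))

/-- The closure of `j · ℓ` on the smooth compactly supported functions. -/
def angularOp (j : E3) : OnePhoton →ₗ.[ℂ] OnePhoton :=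
  (Submodule.span ℂ {F : OnePhoton × OnePhoton | ∃ f : Fin 2 → E3 → ℂ,
    (∀ l, ContDiff ℝ ((⊤ : ℕ∞) : WithTop ℕ∞) (f l)) ∧ (∀ l, HasCompactSupport (f l)) ∧
    (F.1 =ᵐ[photonMeasure] fun x => f x.2 x.1) ∧
    (F.2 =ᵐ[photonMeasure] fun x => angularExpr j (f x.2) x.1)}).topologicalClosure.toLinearPMap

/-! ### Polarization vectors -/

/-- A pair of Borel measurable polarization vectors: for almost every `k` the two vectors are
orthonormal and orthogonal to `k`. -/
structure Polarization where
  /-- the vectors `e⁽¹⁾(k)`, `e⁽²⁾(k)` -/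
  vec : Fin 2 → E3 → E3
  measurable_vec : ∀ l, Measurable (vec l)
  inner_vec : ∀ᵐ k : E3, ∀ l l', inner ℝ (vec l k) (vec l' k) = if l = l' then 1 else 0
  inner_momentum : ∀ᵐ k : E3, ∀ l, inner ℝ (vec l k) k = 0

theorem measurePreserving_shift (m : Fin 2) :
    MeasurePreserving (fun x : Photon => (x.1, x.2 + m)) photonMeasure photonMeasure := by
  have h : MeasurePreserving (fun l : Fin 2 => l + m) Measure.count Measure.count :=
    measurePreserving_add_right Measure.count m
  exact (MeasurePreserving.id (volume : Measure E3)).prod h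

theorem ae_helicity {P : Photon → Prop} (h : ∀ᵐ x ∂photonMeasure, P x) :
    ∀ᵐ x ∂photonMeasure, ∀ l : Fin 2, P (x.1, l) := by
  have h' : ∀ᵐ x ∂photonMeasure, ∀ m : Fin 2, P (x.1, x.2 + m) :=
    ae_all_iff.2 fun m => (measurePreserving_shift m).quasiMeasurePreserving.ae h
  filter_upwards [h'] with x hx l
  simpa using hx (l - x.2)

theorem ae_momentum {P : E3 → Prop} (h : ∀ᵐ k : E3, P k) : ∀ᵐ x ∂photonMeasure, P x.1 :=
  Measure.quasiMeasurePreserving_fst.ae h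

theorem Polarization.norm_vec (e : Polarization) :
    ∀ᵐ x ∂photonMeasure, ∀ l, ‖e.vec l x.1‖ = 1 := by
  filter_upwards [ae_momentum e.inner_vec] with x hx l
  have h := hx l l
  rw [real_inner_self_eq_norm_sq, if_pos rfl] at h
  nlinarith [norm_nonneg (e.vec l x.1)]

theorem memLp_change (e e' : Polarization) (f : OnePhoton) :
    MemLp (fun x : Photon => ∑ l, ((inner ℝ (e.vec x.2 x.1) (e'.vec l x.1) : ℝ) : ℂ) * f (x.1, l)) 2
      photonMeasure := by
  have hmeas : ∀ (d : Polarization), Measurable fun x : Photon => d.vec x.2 x.1 := fun d =>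
    measurable_from_prod_countable_left fun l => d.measurable_vec l
  have h : ∀ m : Fin 2, MemLp (fun x : Photon =>
      ((inner ℝ (e.vec x.2 x.1) (e'.vec (x.2 + m) x.1) : ℝ) : ℂ) * f (x.1, x.2 + m)) 2
      photonMeasure := by
    intro m
    have hf : MemLp (fun x : Photon => f (x.1, x.2 + m)) 2 photonMeasure :=
      (Lp.memLp f).comp_measurePreserving (measurePreserving_shift m)
    have hc : Measurable fun x : Photon =>
        ((inner ℝ (e.vec x.2 x.1) (e'.vec (x.2 + m) x.1) : ℝ) : ℂ) :=
      Complex.measurable_ofReal.comp ((hmeas e).inner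
        ((hmeas e').comp (measurePreserving_shift m).measurable))
    refine hf.mono (hc.aestronglyMeasurable.mul hf.1) ?_
    filter_upwards [e.norm_vec, e'.norm_vec] with x h1 h2
    rw [norm_mul, Complex.norm_real]
    have := norm_inner_le_norm (𝕜 := ℝ) (e.vec x.2 x.1) (e'.vec (x.2 + m) x.1)
    rw [h1, h2, one_mul] at this
    exact mul_le_of_le_one_left (norm_nonneg _) this
  refine (memLp_finsetSum' Finset.univ fun m _ => h m).ae_eq ?_
  refine Filter.Eventually.of_forall fun x => ?_
  rw [Finset.sum_apply]
  exact Fintype.sum_equiv (Equiv.addLeft x.2) _ _ fun m => rfl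

/-- The one-photon change of polarization `u(e ← e')`:
`(u f)(k, l) = ∑_{l'} (e⁽ˡ⁾(k) · e'⁽ˡ'⁾(k)) f(k, l')`. It maps the coefficients of a transversal
vector field in the basis `e'` to those in the basis `e`. -/
def changeOnePhoton (e e' : Polarization) : OnePhoton →ₗ[ℂ] OnePhoton where
  toFun f := (memLp_change e e' f).toLp _
  map_add' f g := by
    rw [← MemLp.toLp_add]
    refine MemLp.toLp_congr _ _ ?_
    filter_upwards [ae_helicity (Lp.coeFn_add f g)] with x hx
    rw [Pi.add_apply, ← Finset.sum_add_distrib]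
    refine Finset.sum_congr rfl fun l _ => ?_
    rw [hx l, Pi.add_apply, mul_add]
  map_smul' c f := by
    rw [RingHom.id_apply, ← MemLp.toLp_const_smul]
    refine MemLp.toLp_congr _ _ ?_
    filter_upwards [ae_helicity (Lp.coeFn_smul c f)] with x hx
    rw [Pi.smul_apply, Finset.smul_sum]
    refine Finset.sum_congr rfl fun l _ => ?_
    rw [hx l, Pi.smul_apply, smul_eq_mul, smul_eq_mul, mul_left_comm]

/-- The unitary operator `U(e ← e') = Γ(u(e ← e'))`. -/
def changePolarization (e e' : Polarization) : Fock →L[ℂ] Fock := Gamma (changeOnePhoton e e')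

theorem inner_eq_dotProduct (a b : E3) : inner ℝ a b = a.ofLp ⬝ᵥ b.ofLp := by
  simp [PiLp.inner_apply, dotProduct, mul_comm]

theorem cross_dot_self_left (a b : E3) : inner ℝ (cross a b) a = 0 := by
  rw [inner_eq_dotProduct, dotProduct_comm]
  exact dot_self_cross _ _

theorem norm_cross_sq (a b : E3) :
    inner ℝ (cross a b) (cross a b) = ‖a‖ ^ 2 * ‖b‖ ^ 2 - inner ℝ a b ^ 2 := by
  rw [← real_inner_self_eq_norm_sq, ← real_inner_self_eq_norm_sq]
  simp only [inner_eq_dotProduct]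
  rw [cross, cross_dot_cross, dotProduct_comm b.ofLp a.ofLp]
  ring

theorem measurable_cross {f g : E3 → E3} (hf : Measurable f) (hg : Measurable g) :
    Measurable fun k => cross (f k) (g k) := by
  refine (WithLp.measurable_toLp 2 (Fin 3 → ℝ)).comp ?_
  have h : ∀ {f : E3 → E3}, Measurable f → ∀ i, Measurable fun k => (f k).ofLp i := fun hf i =>
    (measurable_pi_apply i).comp ((WithLp.measurable_ofLp 2 (Fin 3 → ℝ)).comp hf)
  refine measurable_pi_iff.2 fun i => ?_
  fin_cases i <;> simp only [cross_apply] <;> 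
    exact ((h hf _).mul (h hg _)).sub ((h hf _).mul (h hg _))

/-- The polarization vectors `ē⁽¹⁾(k) = k × j / |k × j|`, `ē⁽²⁾(k) = (k / |k|) × ē⁽¹⁾(k)`. -/
def stdVec (j : E3) (l : Fin 2) (k : E3) : E3 :=
  if l = 0 then ‖cross k j‖⁻¹ • cross k j else cross (‖k‖⁻¹ • k) (‖cross k j‖⁻¹ • cross k j)

theorem ae_cross_ne_zero (j : E3) (hj : ‖j‖ = 1) : ∀ᵐ k : E3, cross k j ≠ 0 := by
  have h0 : volume ((Submodule.span ℝ {j} : Submodule ℝ E3) : Set E3) = 0 := by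
    refine Measure.addHaar_submodule _ _ ?_
    intro h
    have h1 := finrank_span_singleton (K := ℝ) (v := j) (by rintro rfl; simp at hj)
    rw [h, finrank_top] at h1
    simp at h1
  filter_upwards [measure_eq_zero_iff_ae_notMem.1 h0] with k hk h
  apply hk
  have h2 := norm_cross_sq k j
  rw [h, inner_zero_left, hj] at h2
  have h3 : k = (inner ℝ k j) • j := by
    rw [← sub_eq_zero, ← norm_eq_zero, ← sq_eq_zero_iff, norm_sub_sq_real, norm_smul,
      inner_smul_right, hj, Real.norm_eq_abs, mul_one, sq_abs]
    linarith
  rw [h3]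
  exact Submodule.smul_mem _ _ (Submodule.mem_span_singleton_self j)

/-- The special polarization vectors attached to the axis `j`. -/
def stdPolarization (j : E3) (hj : ‖j‖ = 1) : Polarization where
  vec := stdVec j
  measurable_vec l := by
    have h1 : Measurable fun k : E3 => cross k j := measurable_cross measurable_id measurable_const
    have h2 : Measurable fun k : E3 => ‖cross k j‖⁻¹ • cross k j := h1.norm.inv.smul h1
    unfold stdVec
    split_ifs
    · exact h2
    · exact measurable_cross (measurable_norm.inv.smul measurable_id) h2
  inner_vec := by
    filter_upwards [ae_cross_ne_zero j hj] with k hk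
    have hk0 : k ≠ 0 := by rintro rfl; exact hk (by simp [cross])
    have hn : ‖cross k j‖ ≠ 0 := norm_ne_zero_iff.2 hk
    set v := ‖cross k j‖⁻¹ • cross k j with hv
    have hv1 : ‖v‖ = 1 := by rw [hv, norm_smul, norm_inv, norm_norm, inv_mul_cancel₀ hn]
    have hu1 : ‖‖k‖⁻¹ • k‖ = 1 := by
      rw [norm_smul, norm_inv, norm_norm, inv_mul_cancel₀ (norm_ne_zero_iff.2 hk0)]
    have hvk : inner ℝ (‖k‖⁻¹ • k) v = 0 := by
      rw [hv, inner_smul_left, inner_smul_right, real_inner_comm, cross_dot_self_left]; simp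
    have hcv : inner ℝ (cross (‖k‖⁻¹ • k) v) v = 0 := by
      rw [inner_eq_dotProduct, dotProduct_comm]; exact dot_cross_self _ _
    intro l l'
    fin_cases l <;> fin_cases l'
    · simp [stdVec, ← hv, hv1]
    · simpa [stdVec, ← hv, real_inner_comm] using hcv
    · simpa [stdVec, ← hv] using hcv
    · have := norm_cross_sq (‖k‖⁻¹ • k) v
      rw [hv1, hu1, hvk] at this
      simpa [stdVec, ← hv] using this
  inner_momentum := by
    filter_upwards [ae_cross_ne_zero j hj] with k hk l
    have hk0 : k ≠ 0 := by rintro rfl; exact hk (by simp [cross])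
    fin_cases l
    · simp [stdVec, inner_smul_left, cross_dot_self_left]
    · have h := cross_dot_self_left (‖k‖⁻¹ • k) (‖cross k j‖⁻¹ • cross k j)
      rw [inner_smul_right] at h
      have := (mul_eq_zero.1 h).resolve_left (inv_ne_zero (norm_ne_zero_iff.2 hk0))
      simpa [stdVec] using this

/-! ### The ultraviolet cutoff and the photon form factors -/

/-- An ultraviolet cutoff `ρ ∈ L²(ℝ³) ∩ Dom(|k|⁻¹)`. -/
structure Cutoff where
  /-- the cutoff function -/
  fn : E3 → ℂ
  memLp : MemLp fn 2 volume
  memLp_inv : MemLp (fun k => ((‖k‖⁻¹ : ℝ) : ℂ) * fn k) 2 volume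

theorem memLp_fst {f : E3 → ℂ} (hf : MemLp f 2 volume) :
    MemLp (fun x : Photon => f x.1) 2 photonMeasure := by
  have := hf.comp_fst (ν := (Measure.count : Measure (Fin 2)))
  exact this

theorem memLp_formFactor (e : Polarization) (ρ : Cutoff) (a : Fin 3) :
    MemLp (fun x : Photon => (((Real.sqrt ‖x.1‖)⁻¹ : ℝ) : ℂ) * ρ.fn x.1 * ((e.vec x.2 x.1 a : ℝ) : ℂ))
      2 photonMeasure := by
  have h1 := memLp_fst ρ.memLp
  have h2 := memLp_fst ρ.memLp_inv
  have hmeas : Measurable fun x : Photon => e.vec x.2 x.1 :=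
    measurable_from_prod_countable_left fun l => e.measurable_vec l
  have hm : AEStronglyMeasurable (fun x : Photon =>
      (((Real.sqrt ‖x.1‖)⁻¹ : ℝ) : ℂ) * ρ.fn x.1 * ((e.vec x.2 x.1 a : ℝ) : ℂ)) photonMeasure := by
    refine (AEStronglyMeasurable.mul ?_ h1.1).mul ?_
    · exact (Complex.measurable_ofReal.comp
        (measurable_fst.norm.sqrt.inv)).aestronglyMeasurable
    · exact (Complex.measurable_ofReal.comp ((measurable_pi_apply a).comp
        ((WithLp.measurable_ofLp 2 (Fin 3 → ℝ)).comp hmeas))).aestronglyMeasurable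
  refine (h1.norm.add h2.norm).mono hm ?_
  filter_upwards [e.norm_vec] with x hx
  have he : ‖e.vec x.2 x.1 a‖ ≤ 1 := (PiLp.norm_apply_le _ _).trans (hx x.2).le
  have hr : 0 ≤ (Real.sqrt ‖x.1‖)⁻¹ := by positivity
  have hs : (Real.sqrt ‖x.1‖)⁻¹ ≤ 1 + ‖x.1‖⁻¹ := by
    have h := Real.sq_sqrt (norm_nonneg x.1)
    have h' : ((Real.sqrt ‖x.1‖)⁻¹) ^ 2 = ‖x.1‖⁻¹ := by rw [inv_pow, h]
    rw [← h']
    nlinarith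
  have hc : ‖(((Real.sqrt ‖x.1‖)⁻¹ : ℝ) : ℂ)‖ = (Real.sqrt ‖x.1‖)⁻¹ := by
    rw [Complex.norm_real, Real.norm_of_nonneg hr]
  have hi : ‖((‖x.1‖⁻¹ : ℝ) : ℂ)‖ = ‖x.1‖⁻¹ := by
    rw [Complex.norm_real, Real.norm_of_nonneg (by positivity)]
  rw [Pi.add_apply, norm_mul, norm_mul, norm_mul, hc, hi, Complex.norm_real]
  calc (Real.sqrt ‖x.1‖)⁻¹ * ‖ρ.fn x.1‖ * ‖e.vec x.2 x.1 a‖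
      ≤ (Real.sqrt ‖x.1‖)⁻¹ * ‖ρ.fn x.1‖ * 1 := by gcongr
    _ ≤ (1 + ‖x.1‖⁻¹) * ‖ρ.fn x.1‖ * 1 := by gcongr
    _ = ‖ρ.fn x.1‖ + ‖x.1‖⁻¹ * ‖ρ.fn x.1‖ := by ring
    _ ≤ ‖‖ρ.fn x.1‖ + ‖x.1‖⁻¹ * ‖ρ.fn x.1‖‖ := Real.le_norm_self _

/-- `g_a(k, l) = |k|^(-1/2) ρ(k) e⁽ˡ⁾_a(k)`. -/
def formFactor (e : Polarization) (ρ : Cutoff) (a : Fin 3) : OnePhoton :=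
  (memLp_formFactor e ρ a).toLp _

/-! ### The Dirac polaron -/

/-- The state space `ℂ⁴ ⊗ Fock`. -/
abbrev StateSpace : Type := PiLp 2 (fun _ : Fin 4 => Fock)

/-- `B ⊗ 1` for a `4 × 4` matrix `B`. -/
def spinor (B : Matrix (Fin 4) (Fin 4) ℂ) : StateSpace →ₗ[ℂ] StateSpace where
  toFun Ψ := WithLp.toLp 2 fun i => ∑ l, B i l • Ψ l
  map_add' Ψ Φ := by
    ext1 i
    simp [smul_add, Finset.sum_add_distrib]
  map_smul' c Ψ := by
    ext1 i
    simp only [PiLp.smul_apply, RingHom.id_apply, Finset.smul_sum]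
    exact Finset.sum_congr rfl fun l _ => smul_comm _ _ _

/-- `1 ⊗ A` for an operator `A` on the Fock space. -/
def ampliation (A : Fock →ₗ.[ℂ] Fock) : StateSpace →ₗ.[ℂ] StateSpace where
  domain :=
    { carrier := {Ψ | ∀ i, Ψ i ∈ A.domain}
      zero_mem' := fun _ => A.domain.zero_mem
      add_mem' := fun h h' i => A.domain.add_mem (h i) (h' i)
      smul_mem' := fun c _ h i => A.domain.smul_mem c (h i) }
  toFun :=
    { toFun := fun Ψ => WithLp.toLp 2 fun i => A ⟨Ψ.1 i, Ψ.2 i⟩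
      map_add' := by
        intro Ψ Φ
        ext1 i
        exact A.map_add ⟨Ψ.1 i, Ψ.2 i⟩ ⟨Φ.1 i, Φ.2 i⟩
      map_smul' := by
        intro c Ψ
        ext1 i
        exact A.map_smul c ⟨Ψ.1 i, Ψ.2 i⟩ }

/-- The Pauli matrices. -/
def pauli : Fin 3 → Matrix (Fin 2) (Fin 2) ℂ :=
  ![!![0, 1; 1, 0], !![0, -Complex.I; Complex.I, 0], !![1, 0; 0, -1]]

/-- The Dirac matrices `α_a`, with `σ_a` in the two off-diagonal blocks. -/
def diracAlpha (a : Fin 3) : Matrix (Fin 4) (Fin 4) ℂ :=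
  (Matrix.fromBlocks 0 (pauli a) (pauli a) 0).reindex finSumFinEquiv finSumFinEquiv

/-- The Dirac matrix `β = diag(1, 1, -1, -1)`. -/
def diracBeta : Matrix (Fin 4) (Fin 4) ℂ :=
  (Matrix.fromBlocks 1 0 0 (-1) : Matrix (Fin 2 ⊕ Fin 2) (Fin 2 ⊕ Fin 2) ℂ).reindex
    finSumFinEquiv finSumFinEquiv

/-- The spin `S_j = (j · σ / 2) ⊕ (j · σ / 2)`. -/
def spin (j : E3) : Matrix (Fin 4) (Fin 4) ℂ :=
  (Matrix.fromBlocks ((1 / 2 : ℂ) • ∑ a, (j a : ℂ) • pauli a) 0 0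
    ((1 / 2 : ℂ) • ∑ a, (j a : ℂ) • pauli a)).reindex finSumFinEquiv finSumFinEquiv

/-- The Hamiltonian
`H_m(p) = α · p + M β + dΓ(ω_m) - α · dΓ(k) - q α · A`, `ω_m(k) = (1 + m) |k| + m`, with
`A_a = field (g_a)`, on the intersection of the domains of its terms. -/
def hamiltonian (e : Polarization) (ρ : Cutoff) (M q m : ℝ) (p : E3) :
    StateSpace →ₗ.[ℂ] StateSpace :=
  spinor ((∑ a, (p a : ℂ) • diracAlpha a) + (M : ℂ) • diracBeta) +ᵥ
    (ampliation (dGamma (mulOp fun k => (1 + m) * ‖k‖ + m))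
      - ∑ a, (spinor (diracAlpha a)).compPMap (ampliation (dGamma (mulOp fun k => k a)))
      - (q : ℂ) • ∑ a, (spinor (diracAlpha a)).compPMap (ampliation (field (formFactor e ρ a))))

/-- The conjugated operator `U A U*`, on `{Ψ | U* Ψ ∈ Dom A}`. -/
def conjugate (U : Fock →L[ℂ] Fock) (A : Fock →ₗ.[ℂ] Fock) : Fock →ₗ.[ℂ] Fock where
  domain := A.domain.comap (ContinuousLinearMap.adjoint U).toLinearMap
  toFun := U.toLinearMap ∘ₗ A.toFun ∘ₗ
    (ContinuousLinearMap.adjoint U).toLinearMap.restrict fun _ h => h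

/-- The angular momentum of the radiation field around `j` for the polarization vectors `e`:
`L_j(e) = U(e ← ē) dΓ(closure (j · ℓ)) U(e ← ē)*`. -/
def fieldAngularMomentum (e : Polarization) (j : E3) (hj : ‖j‖ = 1) : Fock →ₗ.[ℂ] Fock :=
  conjugate (changePolarization e (stdPolarization j hj)) (dGamma (angularOp j))

/-- The total angular momentum `J_j(e) = S_j + L_j(e)`. -/
def totalAngularMomentum (e : Polarization) (j : E3) (hj : ‖j‖ = 1) :
    StateSpace →ₗ.[ℂ] StateSpace :=
  spinor (spin j) +ᵥ ampliation (fieldAngularMomentum e j hj)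

/-- The half-integers `{±1/2, ±3/2, …}`. -/
def halfIntegers : Set ℝ := {z | ∃ n : ℤ, z = n + 1 / 2}

/-- The sector `F(z) = ker (J_j(e) - z)`. -/
def sector (e : Polarization) (j : E3) (hj : ‖j‖ = 1) (z : ℝ) : Submodule ℂ StateSpace :=
  eigenspace (totalAngularMomentum e j hj) z

end DiracPolaron

end

/-! The mechanism is symmetry. The stabilizer of the axis j in O(3) consists of the rotations around
j and the reflections in planes containing j. Each of its elements acts unitarily on the state space
by a spinor matrix tensored with a second quantized photon operator, and preserves the Hamiltonian H
because p is parallel to j and ρ is invariant. The rotations give a unitary group T θ that acts as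
exp(-iθz) on the eigenspace of J for z. A reflection gives a unitary W that commutes with H and
anticommutes with J.

The rest of the argument is abstract and collected in `reduction_by_eigenspaces`. Taking Fourier
coefficients of θ ↦ T θ shows that every eigenprojection of J reduces H. The unitary W exchanges
ker(J - z) and ker(J + z), so the two parts of H are unitarily equivalent. An eigenspace of H of
finite dimension splits into a part with z > 0 and a part with z < 0; no half-integer is zero and W
exchanges the two parts, so its dimension is even. Strong commutation concerns arbitrary spectral
measures, which are given only through quadratic forms. A growth argument for powers of A - c
(`commute_proj`) shows that a bounded self-adjoint operator commuting with A commutes with the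
spectral projections of A; this is used twice.

Three analytic inputs are needed. First, H is essentially self-adjoint
(`selfAdjointGraph_hamiltonian_closure`). This is a commutator theorem with N = 1 + dΓ(ω_m): the
domain of N lies in the domains of all terms, and the only term with a nonzero commutator is the
field, whose commutator is bounded by the form of N because ω_m^(1/2) g_a is square integrable.
Second, J has a total set of eigenvectors with half-integer eigenvalues, so it is self-adjoint.
Fourier components of smooth functions over the circle of rotations are eigenvectors of j · ℓ with
integer eigenvalues, their symmetrized products are eigenvectors of dΓ, and the spin adds ±1/2.
Third, the symmetries must be implemented for arbitrary polarization vectors. The special vectors ē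
transform among themselves under the stabilizer up to a sign (`FixesAxis.stdVec`), so in that gauge
the photon action is a change of variables times a sign; other polarizations are reached by
conjugation.

Unbounded operators are treated through their graphs: symmetry and self-adjointness are stated for
linear relations, which makes closures and transport by unitaries easy to handle. -/

namespace DiracPolaron

/-! ### Symmetric and self-adjoint relations, and criteria for self-adjointness -/

section SelfAdjointGraphs

variable {K : Type*} [NormedAddCommGroup K] [InnerProductSpace ℂ K]

/-- A linear relation that is contained in its adjoint. -/
def SymmetricGraph (G : Submodule ℂ (K × K)) : Prop :=
  ∀ x ∈ G, ∀ y ∈ G, inner ℂ x.2 y.1 = inner ℂ x.1 y.2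

/-- A linear relation that is equal to its adjoint. -/
def SelfAdjointGraph (G : Submodule ℂ (K × K)) : Prop :=
  SymmetricGraph G ∧ ∀ a b : K, (∀ x ∈ G, inner ℂ b x.1 = inner ℂ a x.2) → (a, b) ∈ G

theorem SymmetricGraph.closure {G : Submodule ℂ (K × K)} (hG : SymmetricGraph G) :
    SymmetricGraph G.topologicalClosure := by
  have h1 : ∀ x ∈ G, ∀ y ∈ G.topologicalClosure, inner ℂ x.2 y.1 = inner ℂ x.1 y.2 := by
    intro x hx y hy
    refine closure_minimal (t := {y : K × K | inner ℂ x.2 y.1 = inner ℂ x.1 y.2})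
      (fun y hy => hG x hx y hy) ?_ hy
    exact isClosed_eq (by fun_prop) (by fun_prop)
  intro x hx y hy
  refine closure_minimal (t := {x : K × K | inner ℂ x.2 y.1 = inner ℂ x.1 y.2})
    (fun x hx => h1 x hx y hy) ?_ hx
  exact isClosed_eq (by fun_prop) (by fun_prop)

theorem SymmetricGraph.span {S : Set (K × K)}
    (h : ∀ x ∈ S, ∀ y ∈ S, inner ℂ x.2 y.1 = inner ℂ x.1 y.2) :
    SymmetricGraph (Submodule.span ℂ S) := by
  have h1 : ∀ x ∈ S, ∀ y ∈ Submodule.span ℂ S, inner ℂ x.2 y.1 = inner ℂ x.1 y.2 := by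
    intro x hx y hy
    induction hy using Submodule.span_induction with
    | mem y hy => exact h x hx y hy
    | zero => simp
    | add a b _ _ ha hb => simp [ha, hb]
    | smul c a _ ha => simp [ha]
  intro x hx y hy
  induction hx using Submodule.span_induction with
  | mem x hx => exact h1 x hx y hy
  | zero => simp
  | add a b _ _ ha hb => simp [ha, hb]
  | smul c a _ ha => simp [ha]

/-- By symmetry the value over 0 is orthogonal to the domain. Applied to closures, this is what
makes the closed relations of this file operators. -/
theorem SymmetricGraph.eq_zero {G : Submodule ℂ (K × K)} (hG : SymmetricGraph G)
    (hd : ∀ h : K, (∀ x ∈ G, inner ℂ h x.1 = 0) → h = 0) (x : K × K) (hx : x ∈ G)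
    (h0 : x.1 = 0) : x.2 = 0 := by
  refine hd _ fun y hy => ?_
  rw [hG x hx y hy, h0, inner_zero_left]

theorem SelfAdjointGraph.isClosed {G : Submodule ℂ (K × K)} (hG : SelfAdjointGraph G) :
    IsClosed (G : Set (K × K)) := by
  have : (G : Set (K × K)) = ⋂ x ∈ G, {y : K × K | inner ℂ y.2 x.1 = inner ℂ y.1 x.2} := by
    ext y
    simp only [Set.mem_iInter, Set.mem_ofPred_eq, SetLike.mem_coe]
    exact ⟨fun hy x hx => hG.1 y hy x hx, fun h => hG.2 y.1 y.2 h⟩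
  rw [this]
  exact isClosed_biInter fun x _ => isClosed_eq (by fun_prop) (by fun_prop)

/-- A densely defined symmetric operator is closable. -/
theorem graph_closure_of_symmetric {A : K →ₗ.[ℂ] K} (hA : SymmetricGraph A.graph)
    (hd : ∀ h : K, (∀ x ∈ A.domain, inner ℂ h x = 0) → h = 0) :
    A.closure.graph = A.graph.topologicalClosure := by
  have hcl : A.IsClosable := by
    refine ⟨A.graph.topologicalClosure.toLinearPMap, ?_⟩
    rw [Submodule.toLinearPMap_graph_eq]
    intro x hx h0
    refine SymmetricGraph.eq_zero hA.closure (fun h hh => hd h fun y hy => ?_) x hx h0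
    exact hh _ (subset_closure (A.mem_graph ⟨y, hy⟩))
  exact hcl.graph_closure_eq_closure_graph.symm

variable [CompleteSpace K]

/-- Symmetry gives ‖y + ilx‖² = ‖y‖² + l²‖x‖² on G, so the range of G + il is closed; having trivial
orthogonal complement, it is everything. An element of the adjoint then has the same image as some
element of G, and the difference of their first components is orthogonal to the range of G - il,
hence zero. -/
theorem selfAdjointGraph_of_ranges {G : Submodule ℂ (K × K)} (hc : IsClosed (G : Set (K × K)))
    (hG : SymmetricGraph G) {l : ℝ} (hl : 0 < l)
    (hr : ∀ s : ℝ, (s = l ∨ s = -l) → ∀ h : K,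
      (∀ x ∈ G, inner ℂ h (x.2 + ((s : ℂ) * Complex.I) • x.1) = 0) → h = 0) :
    SelfAdjointGraph G := by
  refine ⟨hG, fun a b hab => ?_⟩
  have : CompleteSpace G := hc.completeSpace_coe
  let f : G →L[ℂ] K := ((ContinuousLinearMap.snd ℂ K K)
    + ((l : ℂ) * Complex.I) • ContinuousLinearMap.fst ℂ K K).comp G.subtypeL
  have hf : ∀ x : G, f x = x.1.2 + ((l : ℂ) * Complex.I) • x.1.1 := fun x => rfl
  have hnorm : ∀ x : G, ‖f x‖ ^ 2 = ‖x.1.2‖ ^ 2 + l ^ 2 * ‖x.1.1‖ ^ 2 := by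
    intro x
    have hs := hG _ x.2 _ x.2
    have him : (inner ℂ x.1.2 x.1.1 : ℂ).im = 0 := by
      have h2 := congrArg Complex.im hs
      rw [← inner_conj_symm x.1.1 x.1.2, Complex.conj_im] at h2
      linarith
    rw [hf, @norm_add_sq ℂ, inner_smul_right, norm_smul, mul_pow]
    have : RCLike.re (((l : ℂ) * Complex.I) * inner ℂ x.1.2 x.1.1) = 0 := by
      simp [him]
    rw [this]
    simp
  obtain ⟨c, hc0, hcl⟩ : ∃ c : ℝ, 0 < c ∧ ∀ x : G, ‖x‖ ≤ c * ‖f x‖ := by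
    refine ⟨1 + l⁻¹, by positivity, fun x => ?_⟩
    have h2 : ‖x.1.2‖ ≤ ‖f x‖ := by
      refine le_of_sq_le_sq ?_ (norm_nonneg _)
      rw [hnorm]; nlinarith [sq_nonneg (l * ‖x.1.1‖)]
    have h1 : l * ‖x.1.1‖ ≤ ‖f x‖ := by
      refine le_of_sq_le_sq ?_ (norm_nonneg _)
      rw [hnorm]; nlinarith [sq_nonneg (‖x.1.2‖)]
    have h1' : ‖x.1.1‖ ≤ l⁻¹ * ‖f x‖ := by
      rw [inv_mul_eq_div, le_div_iff₀ hl]; linarith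
    have h3 : 0 ≤ l⁻¹ * ‖f x‖ := by positivity
    change max ‖x.1.1‖ ‖x.1.2‖ ≤ _
    refine max_le ?_ ?_ <;> nlinarith [norm_nonneg (f x)]
  have hclosed : IsClosed (Set.range f) := by
    have ha : AntilipschitzWith ⟨c, hc0.le⟩ f :=
      AddMonoidHomClass.antilipschitz_of_bound f hcl
    exact ha.isClosed_range f.uniformContinuous
  have htop : LinearMap.range f.toLinearMap = ⊤ := by
    have hcl' : (LinearMap.range f.toLinearMap).topologicalClosure = ⊤ := by
      rw [Submodule.topologicalClosure_eq_top_iff, Submodule.eq_bot_iff]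
      intro h hh
      refine hr l (Or.inl rfl) h fun x hx => ?_
      have := (Submodule.mem_orthogonal' _ _).1 hh (f ⟨x, hx⟩) ⟨⟨x, hx⟩, rfl⟩
      rwa [hf] at this
    rwa [IsClosed.submodule_topologicalClosure_eq] at hcl'
    rwa [LinearMap.coe_range]
  obtain ⟨x, hx⟩ : ∃ x : G, f x = b + ((l : ℂ) * Complex.I) • a := by
    have : b + ((l : ℂ) * Complex.I) • a ∈ LinearMap.range f.toLinearMap := htop ▸ Submodule.mem_top
    exact this
  rw [hf] at hx
  have hd : a - x.1.1 = 0 := by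
    refine hr (-l) (Or.inr rfl) _ fun y hy => ?_
    have e1 := hab y hy
    have e2 := hG _ x.2 _ hy
    have e3 : b - x.1.2 = -(((l : ℂ) * Complex.I) • (a - x.1.1)) := by
      rw [smul_sub, neg_sub, sub_eq_sub_iff_add_eq_add, ← hx, add_comm]
    have e4 : inner ℂ (b - x.1.2) y.1 = inner ℂ (a - x.1.1) y.2 := by
      rw [inner_sub_left, inner_sub_left, e1, e2]
    rw [e3, inner_neg_left, inner_smul_left] at e4
    rw [inner_add_right, ← e4, inner_smul_right]
    simp
  have ha : a = x.1.1 := sub_eq_zero.1 hd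
  have hb : b = x.1.2 := by rw [ha] at hx; exact (add_right_cancel hx).symm
  rw [ha, hb]
  exact x.2

/-- Density of the domain comes for free: if h is orthogonal to the domain, then (0, h) lies in the
adjoint relation, hence in the graph, so h = 0. -/
theorem isSelfAdjoint_of_graph {A : K →ₗ.[ℂ] K} (hA : SelfAdjointGraph A.graph) :
    IsSelfAdjoint A := by
  have hd : Dense (A.domain : Set K) := by
    rw [Submodule.dense_iff_topologicalClosure_eq_top, Submodule.topologicalClosure_eq_top_iff,
      Submodule.eq_bot_iff]
    intro h hh
    have : ((0 : K), h) ∈ A.graph := by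
      refine hA.2 _ _ fun x hx => ?_
      rw [inner_zero_left]
      exact (Submodule.mem_orthogonal' _ _).1 hh _ (A.mem_domain_of_mem_graph hx)
    exact A.graph_fst_eq_zero_snd this rfl
  rw [LinearPMap.isSelfAdjoint_def]
  refine LinearPMap.eq_of_eq_graph ?_
  rw [LinearPMap.adjoint_graph_eq_graph_adjoint hd]
  ext x
  rw [Submodule.mem_adjoint_iff]
  constructor
  · intro h
    refine hA.2 x.1 x.2 fun y hy => ?_
    have h1 := h y.1 y.2 hy
    rw [sub_eq_zero] at h1
    rw [← inner_conj_symm, ← h1, inner_conj_symm]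
  · intro hx a b hab
    have h1 := hA.1 _ hab _ hx
    exact sub_eq_zero.2 h1

/-- The commutator theorem: a symmetric operator whose commutator with a positive operator `N` is
form-bounded by `N`, and which is defined on the range of `N⁻¹`, is essentially self-adjoint. -/
theorem closure_selfAdjoint_of_commutator {A : K →ₗ.[ℂ] K} (hA : SymmetricGraph A.graph) (C : ℝ)
    (hC : 0 ≤ C) (hN : ∀ ψ : K, ∃ φ χ : K, (φ, χ) ∈ A.graph ∧ (φ = 0 → ψ = 0) ∧
      ‖φ‖ ^ 2 ≤ (inner ℂ ψ φ : ℂ).re ∧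
      |(inner ℂ ψ χ : ℂ).im| ≤ C * (inner ℂ ψ φ : ℂ).re) :
    SelfAdjointGraph A.closure.graph ∧ A.closure.graph = A.graph.topologicalClosure := by
  have hd : ∀ h : K, (∀ x ∈ A.domain, inner ℂ h x = 0) → h = 0 := by
    intro h hh
    obtain ⟨φ, χ, hφ, h0, h1, -⟩ := hN h
    rw [hh _ (A.mem_domain_of_mem_graph hφ), Complex.zero_re] at h1
    refine h0 (norm_eq_zero.1 ?_)
    nlinarith [norm_nonneg φ]
  have hg := graph_closure_of_symmetric hA hd
  refine ⟨?_, hg⟩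
  rw [hg]
  -- For h orthogonal to the range, 0 = Im⟨h, χ⟩ + s Re⟨h, φ⟩ with |s| = C + 1. The first term is at
  -- most C Re⟨h, φ⟩, and the surplus 1 forces Re⟨h, φ⟩ ≤ 0, hence φ = 0.
  refine selfAdjointGraph_of_ranges (Submodule.isClosed_topologicalClosure _) hA.closure
    (l := C + 1) (by linarith) fun s hs h hh => ?_
  obtain ⟨φ, χ, hφ, h0, h1, h2⟩ := hN h
  have h3 := hh _ (subset_closure hφ)
  simp only [inner_add_right, inner_smul_right] at h3
  have h4 := congrArg Complex.im h3
  simp only [Complex.add_im, Complex.mul_im, Complex.mul_re, Complex.ofReal_re, Complex.I_re,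
    Complex.ofReal_im, Complex.I_im, Complex.zero_im] at h4
  refine h0 (norm_eq_zero.1 ?_)
  rw [abs_le] at h2
  have h5 : 0 ≤ ‖φ‖ ^ 2 := by positivity
  have : ‖φ‖ ^ 2 = 0 := by
    rcases hs with rfl | rfl <;> nlinarith
  simpa using this

/-- A real number plus ±i is not zero, so a vector orthogonal to the range of G ± i is orthogonal to
all the eigenvectors in V. -/
theorem selfAdjointGraph_of_eigenvectors {G : Submodule ℂ (K × K)}
    (hc : IsClosed (G : Set (K × K))) (hG : SymmetricGraph G) {V : Set (K × ℝ)}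
    (hV : ∀ p ∈ V, (p.1, (p.2 : ℂ) • p.1) ∈ G)
    (ht : ∀ h : K, (∀ p ∈ V, inner ℂ h p.1 = 0) → h = 0) : SelfAdjointGraph G := by
  refine selfAdjointGraph_of_ranges hc hG one_pos fun s hs h hh => ht h fun p hp => ?_
  have h1 := hh _ (hV p hp)
  rw [← add_smul, inner_smul_right] at h1
  refine (mul_eq_zero.1 h1).resolve_left fun h2 => ?_
  have := congrArg Complex.im h2
  rcases hs with rfl | rfl <;> simp at this

end SelfAdjointGraphs

/-! ### Eigenspaces and orthogonal direct sums of operators -/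

section OrthogonalSums

variable {K : Type*} [NormedAddCommGroup K] [InnerProductSpace ℂ K]

theorem mem_eigenspace {A : K →ₗ.[ℂ] K} {z : ℂ} {x : K} :
    x ∈ eigenspace A z ↔ (x, z • x) ∈ A.graph := Iff.rfl

theorem isClosed_eigenspace {A : K →ₗ.[ℂ] K} (hA : IsClosed (A.graph : Set (K × K))) (z : ℂ) :
    IsClosed (eigenspace A z : Set K) :=
  hA.preimage (f := fun x : K => (x, z • x)) (by fun_prop)

theorem mem_part_graph {A : K →ₗ.[ℂ] K} {V : Submodule ℂ K} {x y : V} :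
    (x, y) ∈ (part A V).graph ↔ ((x : K), (y : K)) ∈ A.graph := by
  rw [part, Submodule.toLinearPMap_graph_eq]
  · rfl
  · intro x hx h0
    have h1 : ((x.1 : K), (x.2 : K)) ∈ A.graph := hx
    exact Subtype.ext (A.graph_fst_eq_zero_snd h1 (by rw [h0]; rfl))

theorem eigenspace_inner_eq_zero {A : K →ₗ.[ℂ] K} (hA : SymmetricGraph A.graph) {z w : ℝ}
    (hzw : z ≠ w) {x y : K} (hx : x ∈ eigenspace A z) (hy : y ∈ eigenspace A w) :
    inner ℂ x y = 0 := by
  have h := hA _ (mem_eigenspace.1 hx) _ (mem_eigenspace.1 hy)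
  simp only [inner_smul_left, inner_smul_right, Complex.conj_ofReal] at h
  have h1 : ((z - w : ℝ) : ℂ) * inner ℂ x y = 0 := by push_cast; linear_combination h
  exact (mul_eq_zero.1 h1).resolve_left (by exact_mod_cast sub_ne_zero.2 hzw)

theorem orthogonalFamily_eigenspace {A : K →ₗ.[ℂ] K} (hA : SymmetricGraph A.graph) (S : Set ℝ) :
    OrthogonalFamily ℂ (fun z : S => eigenspace A (z : ℝ))
      (fun z => (eigenspace A (z : ℝ)).subtypeₗᵢ) :=
  fun _ _ hzw x y => eigenspace_inner_eq_zero hA (fun h => hzw (Subtype.ext h)) x.2 y.2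

/-- For v in the eigenspace, ⟨Ax, v⟩ = z⟨x, v⟩; hence the projection of Ax is z times the projection
of x. -/
theorem starProjection_eigenspace_mem {A : K →ₗ.[ℂ] K} (hA : SelfAdjointGraph A.graph) (z : ℝ)
    [CompleteSpace (eigenspace A z)] (x : K × K) (hx : x ∈ A.graph) :
    ((eigenspace A z).starProjection x.1, (eigenspace A z).starProjection x.2) ∈ A.graph := by
  have h1 : (eigenspace A z).starProjection x.2
      = (z : ℂ) • (eigenspace A z).starProjection x.1 := by
    refine Submodule.eq_starProjection_of_mem_of_inner_eq_zero (K := eigenspace A z)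
      (Submodule.smul_mem _ _ (Submodule.starProjection_apply_mem _ _)) fun v hv => ?_
    have h2 : inner ℂ x.2 v = inner ℂ x.1 ((z : ℂ) • v) := hA.1 _ hx _ hv
    rw [inner_smul_right] at h2
    have h3 : inner ℂ ((eigenspace A z).starProjection x.1) v = inner ℂ x.1 v := by
      rw [Submodule.inner_starProjection_left_eq_right, Submodule.starProjection_eq_self_iff.2 hv]
    rw [inner_sub_left, inner_smul_left, Complex.conj_ofReal, h2, h3, sub_self]
  rw [h1]
  exact mem_eigenspace.1 (Submodule.starProjection_apply_mem (eigenspace A z) _)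

variable [CompleteSpace K]

theorem topologicalClosure_iSup_eigenspace {A : K →ₗ.[ℂ] K} {V : Set (K × ℝ)} {S : Set ℝ}
    (hV : ∀ p ∈ V, p.2 ∈ S ∧ (p.1, (p.2 : ℂ) • p.1) ∈ A.graph)
    (ht : ∀ h : K, (∀ p ∈ V, inner ℂ h p.1 = 0) → h = 0) :
    (⨆ z : S, eigenspace A (z : ℝ)).topologicalClosure = ⊤ := by
  rw [Submodule.topologicalClosure_eq_top_iff, Submodule.eq_bot_iff]
  intro h hh
  refine ht h fun p hp => (Submodule.mem_orthogonal' _ _).1 hh _ ?_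
  exact Submodule.mem_iSup_of_mem (⟨p.2, (hV p hp).1⟩ : S) (hV p hp).2

/-- The coordinates of x in the Hilbert sum are recognized as orthogonal projections by pairing the
series with a vector of a single V i. -/
theorem hasSum_starProjection {ι : Type*} {V : ι → Submodule ℂ K} [∀ i, CompleteSpace (V i)]
    (ho : OrthogonalFamily ℂ (fun i => V i) (fun i => (V i).subtypeₗᵢ))
    (ht : (⨆ i, V i).topologicalClosure = ⊤) (x : K) :
    HasSum (fun i => (V i).starProjection x) x := by
  classical
  have hs : IsHilbertSum ℂ (fun i => V i) (fun i => (V i).subtypeₗᵢ) :=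
    IsHilbertSum.mkInternal V ho ht.ge
  have h := hs.hasSum_linearIsometryEquiv_symm (hs.linearIsometryEquiv x)
  rw [LinearIsometryEquiv.symm_apply_apply] at h
  convert h using 2 with i
  refine Submodule.eq_starProjection_of_mem_of_inner_eq_zero (K := V i)
    (Subtype.coe_prop _) fun v hv => ?_
  have h1 := (h.mapL (innerSL ℂ v))
  have h2 : HasSum (fun k => inner ℂ v ((hs.linearIsometryEquiv x k : V k) : K))
      (inner ℂ v ((hs.linearIsometryEquiv x i : V i) : K)) := by
    refine hasSum_single i fun k hk => ?_
    exact ho (Ne.symm hk) ⟨v, hv⟩ (hs.linearIsometryEquiv x k)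
  have h3 : inner ℂ v x = inner ℂ v ((hs.linearIsometryEquiv x i : V i) : K) := h1.unique h2
  rw [← inner_conj_symm, inner_sub_right, h3]
  exact (congrArg _ (sub_self _)).trans (map_zero _)

/-- An operator that is reduced by all members of an orthogonal decomposition is the direct sum
of its parts. -/
theorem isOrthogonalDirectSum_of_reduces {ι : Type*} {V : ι → Submodule ℂ K}
    [∀ i, CompleteSpace (V i)]
    (ho : OrthogonalFamily ℂ (fun i => V i) (fun i => (V i).subtypeₗᵢ))
    (ht : (⨆ i, V i).topologicalClosure = ⊤) {A : K →ₗ.[ℂ] K}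
    (hA : IsClosed (A.graph : Set (K × K)))
    (hr : ∀ i, ∀ x ∈ A.graph, ((V i).starProjection x.1, (V i).starProjection x.2) ∈ A.graph) :
    IsOrthogonalDirectSum A V := by
  refine ⟨ho, ht, fun Ψ Φ => ⟨fun h => ?_, ?_⟩⟩
  · refine ⟨fun i => (V i).orthogonalProjectionOnto Ψ, fun i => (V i).orthogonalProjectionOnto Φ,
      hasSum_starProjection ho ht Ψ, hasSum_starProjection ho ht Φ, fun i => ?_⟩
    rw [mem_part_graph]
    exact hr i _ h
  · rintro ⟨x, y, hx, hy, h⟩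
    refine hA.mem_of_tendsto (hx.prodMk hy) (Filter.Eventually.of_forall fun s => ?_)
    exact A.graph.sum_mem fun i _ => mem_part_graph.1 (h i)

end OrthogonalSums

end DiracPolaron
namespace DiracPolaron

/-! ### Projection-valued measures and commutation with spectral projections -/

section SpectralMeasures

variable {K : Type*} [NormedAddCommGroup K] [InnerProductSpace ℂ K] [CompleteSpace K]

theorem PVM.measure_apply (E : PVM K) (ψ : K) {S : Set ℝ} (hS : MeasurableSet S) :
    E.measure ψ S = ENNReal.ofReal (‖E.proj S ψ‖ ^ 2) :=
  Measure.ofMeasurable_apply S hS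

instance (E : PVM K) (ψ : K) : IsFiniteMeasure (E.measure ψ) :=
  ⟨by rw [E.measure_apply ψ MeasurableSet.univ]; exact ENNReal.ofReal_lt_top⟩

theorem PVM.proj_union (E : PVM K) {S T : Set ℝ} (hS : MeasurableSet S) (hT : MeasurableSet T)
    (hd : Disjoint S T) : E.proj (S ∪ T) = E.proj S + E.proj T := by
  ext ψ
  -- Additivity is available for sequences only, so S and T are followed by empty sets.
  let f : ℕ → Set ℝ := fun n => if n = 0 then S else if n = 1 then T else ∅
  have hf : ∀ n, MeasurableSet (f n) := by
    intro n
    simp only [f]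
    split_ifs <;> simp [*]
  have hu : (⋃ n, f n) = S ∪ T := by
    ext x
    simp only [Set.mem_iUnion, Set.mem_union]
    constructor
    · rintro ⟨n, hn⟩
      simp only [f] at hn
      split_ifs at hn
      · exact Or.inl hn
      · exact Or.inr hn
      · exact hn.elim
    · rintro (h | h)
      · exact ⟨0, by simpa [f] using h⟩
      · exact ⟨1, by simpa [f] using h⟩
  have hp : Pairwise (Function.onFun Disjoint f) := by
    intro a b hab
    simp only [Function.onFun, f]
    split_ifs <;> first | omega | simp [hd.symm]
  have h1 := E.hasSum_iUnion f hf hp ψ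
  rw [hu] at h1
  have h2 : HasSum (fun n => E.proj (f n) ψ) (∑ n ∈ Finset.range 2, E.proj (f n) ψ) := by
    refine hasSum_sum_of_ne_finset_zero fun n hn => ?_
    have : 1 < n := by simpa using hn
    have : f n = ∅ := by
      simp only [f]
      rw [if_neg (by omega), if_neg (by omega)]
    rw [this, E.proj_empty]; rfl
  rw [h1.unique h2]
  simp [Finset.sum_range_succ, f]

theorem PVM.proj_compl (E : PVM K) {S : Set ℝ} (hS : MeasurableSet S) :
    E.proj Sᶜ = 1 - E.proj S := by
  have h := E.proj_union hS hS.compl disjoint_compl_right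
  rw [Set.union_compl_self, E.proj_univ] at h
  rw [h]; abel

/-- P + Q is again idempotent, so PQ + QP = 0. Multiplying by P from the left and from the right
gives PQ = -PQP = QP, whence 2PQ = 0. -/
theorem PVM.proj_mul_of_disjoint (E : PVM K) {S T : Set ℝ} (hS : MeasurableSet S)
    (hT : MeasurableSet T) (hd : Disjoint S T) : E.proj S * E.proj T = 0 := by
  have hi : ∀ {U : Set ℝ}, MeasurableSet U → E.proj U * E.proj U = E.proj U :=
    fun hU => (E.isStarProjection _ hU).isIdempotentElem.eq
  set P := E.proj S with hP
  set Q := E.proj T with hQ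
  have h1 : P * P = P := hi hS
  have h2 : Q * Q = Q := hi hT
  have h3 : (P + Q) * (P + Q) = P + Q := by
    rw [← E.proj_union hS hT hd]; exact hi (hS.union hT)
  have h4 : P * Q + Q * P = 0 := by
    have : (P + Q) * (P + Q) = P * P + Q * Q + (P * Q + Q * P) := by noncomm_ring
    rw [this, h1, h2] at h3
    simpa using h3
  have h5 : P * Q + P * Q * P = 0 := by
    have := congrArg (P * ·) h4
    simp only [mul_add, mul_zero, ← mul_assoc, h1] at this
    exact this
  have h6 : P * Q * P + Q * P = 0 := by
    have := congrArg (· * P) h4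
    simp only [add_mul, zero_mul, mul_assoc, h1] at this
    rw [← mul_assoc] at this
    exact this
  have h7 : P * Q = Q * P := by
    rw [eq_neg_of_add_eq_zero_left h5, eq_neg_of_add_eq_zero_right h6]
  rw [← h7, ← two_smul ℂ] at h4
  exact (smul_eq_zero.1 h4).resolve_left two_ne_zero

theorem PVM.proj_mul (E : PVM K) {S T : Set ℝ} (hS : MeasurableSet S) (hT : MeasurableSet T) :
    E.proj S * E.proj T = E.proj (S ∩ T) := by
  have h1 : E.proj T = E.proj (S ∩ T) + E.proj (T \ S) := by
    rw [← E.proj_union (hS.inter hT) (hT.diff hS)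
      (Set.disjoint_left.2 fun x hx hx' => hx'.2 hx.1), Set.inter_comm, Set.inter_union_sdiff]
  have h2 : E.proj S = E.proj (S ∩ T) + E.proj (S \ T) := by
    rw [← E.proj_union (hS.inter hT) (hS.diff hT)
      (Set.disjoint_left.2 fun x hx hx' => hx'.2 hx.2), Set.inter_union_sdiff]
  have h3 := E.proj_mul_of_disjoint hS (hT.diff hS) (Set.disjoint_left.2 fun x hx hx' => hx'.2 hx)
  have h4 := E.proj_mul_of_disjoint (hS.diff hT) (hS.inter hT)
    (Set.disjoint_left.2 fun x hx hx' => hx.2 hx'.2)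
  have h5 : E.proj (S ∩ T) * E.proj (S ∩ T) = E.proj (S ∩ T) :=
    (E.isStarProjection _ (hS.inter hT)).isIdempotentElem.eq
  rw [h1, mul_add, h3, add_zero, h2, add_mul, h4, add_zero, h5]

theorem PVM.proj_proj (E : PVM K) {S T : Set ℝ} (hS : MeasurableSet S) (hT : MeasurableSet T)
    (ψ : K) : E.proj S (E.proj T ψ) = E.proj (S ∩ T) ψ := by
  rw [← E.proj_mul hS hT]; rfl

theorem PVM.inner_proj (E : PVM K) {S : Set ℝ} (hS : MeasurableSet S) (φ ψ : K) :
    inner ℂ (E.proj S φ) ψ = inner ℂ φ (E.proj S ψ) := by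
  have h2 : ContinuousLinearMap.adjoint (E.proj S) = E.proj S :=
    (E.isStarProjection S hS).isSelfAdjoint.star_eq
  rw [← ContinuousLinearMap.adjoint_inner_left, h2]

theorem PVM.measure_proj (E : PVM K) {T : Set ℝ} (hT : MeasurableSet T) (ψ : K) :
    E.measure (E.proj T ψ) = (E.measure ψ).restrict T := by
  ext S hS
  rw [Measure.restrict_apply hS, E.measure_apply _ hS, E.measure_apply _ (hS.inter hT),
    E.proj_proj hS hT]

/-- Pythagoras: E(S) keeps the ranges of E(T) and E(Tᶜ) orthogonal. This is the source of the
absence of cross terms in the quadratic form of an operator with spectral measure E. -/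
theorem PVM.measure_add (E : PVM K) {T : Set ℝ} (hT : MeasurableSet T) (φ ψ : K) :
    E.measure (E.proj T φ + E.proj Tᶜ ψ)
      = E.measure (E.proj T φ) + E.measure (E.proj Tᶜ ψ) := by
  ext S hS
  rw [Measure.add_apply, E.measure_apply _ hS, E.measure_apply _ hS, E.measure_apply _ hS,
    ← ENNReal.ofReal_add (by positivity) (by positivity), map_add]
  congr 1
  have h : inner ℂ (E.proj S (E.proj T φ)) (E.proj S (E.proj Tᶜ ψ)) = 0 := by
    rw [E.proj_proj hS hT, E.proj_proj hS hT.compl, E.inner_proj (hS.inter hT),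
      E.proj_proj (hS.inter hT) (hS.inter hT.compl)]
    have : S ∩ T ∩ (S ∩ Tᶜ) = ∅ := by ext; simp; tauto
    rw [this, E.proj_empty]
    simp
  rw [@norm_add_sq ℂ, h]
  simp

theorem PVM.measure_univ (E : PVM K) (ψ : K) : (E.measure ψ).real Set.univ = ‖ψ‖ ^ 2 := by
  rw [Measure.real, E.measure_apply _ MeasurableSet.univ, E.proj_univ,
    ENNReal.toReal_ofReal (by positivity)]
  rfl

variable {E : PVM K} {A : K →ₗ.[ℂ] K}

theorem PVM.IsSpectralMeasureOf.proj_mem_domain (hE : E.IsSpectralMeasureOf A) {T : Set ℝ}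
    (hT : MeasurableSet T) {ψ : K} (hψ : ψ ∈ A.domain) : E.proj T ψ ∈ A.domain := by
  rw [hE.1] at hψ ⊢
  rw [E.measure_proj hT]
  exact (lintegral_mono' Measure.restrict_le_self le_rfl).trans_lt hψ

theorem PVM.IsSpectralMeasureOf.integrable (hE : E.IsSpectralMeasureOf A) {ψ : K}
    (hψ : ψ ∈ A.domain) : Integrable (fun t : ℝ => t) (E.measure ψ) := by
  rw [hE.1] at hψ
  have h2 : Integrable (fun t : ℝ => t ^ 2) (E.measure ψ) := by
    refine ⟨by fun_prop, ?_⟩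
    rw [hasFiniteIntegral_iff_ofReal (Filter.Eventually.of_forall fun t => by positivity)]
    exact hψ
  refine (h2.add (integrable_const (1 : ℝ))).mono (by fun_prop) ?_
  refine Filter.Eventually.of_forall fun t => ?_
  rw [Pi.add_apply, Real.norm_eq_abs, Real.norm_eq_abs, abs_of_nonneg (a := t ^ 2 + 1) (by positivity)]
  rcases abs_cases t with h | h <;> nlinarith [sq_nonneg (|t| - 1)]

theorem PVM.IsSpectralMeasureOf.mem_domain_of_bounded (hE : E.IsSpectralMeasureOf A) {T : Set ℝ}
    (hT : MeasurableSet T) {R : ℝ} (hR : ∀ t ∈ T, |t| ≤ R) (ψ : K) : E.proj T ψ ∈ A.domain := by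
  rw [hE.1, E.measure_proj hT]
  calc ∫⁻ t in T, ENNReal.ofReal (t ^ 2) ∂(E.measure ψ)
      ≤ ∫⁻ t in T, ENNReal.ofReal (R ^ 2) ∂(E.measure ψ) := by
        refine setLIntegral_mono measurable_const fun t ht => ENNReal.ofReal_le_ofReal ?_
        exact sq_le_sq' (by linarith [neg_le_of_abs_le (hR t ht)]) (le_of_abs_le (hR t ht))
    _ < ⊤ := by
        rw [setLIntegral_const]
        exact ENNReal.mul_lt_top ENNReal.ofReal_lt_top (measure_lt_top _ _)

theorem PVM.IsSpectralMeasureOf.inner_graph (hE : E.IsSpectralMeasureOf A) {x : K × K}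
    (hx : x ∈ A.graph) : inner ℂ x.1 x.2 = ((∫ t, t ∂(E.measure x.1) : ℝ) : ℂ) := by
  obtain ⟨y, h1, h2⟩ := (LinearPMap.mem_graph_iff A).1 hx
  rw [← h1, ← h2]
  exact hE.2 y

/-- A spectral projection reduces the operator. -/
theorem PVM.IsSpectralMeasureOf.proj_mem_graph (hE : E.IsSpectralMeasureOf A)
    (hA : SelfAdjointGraph A.graph) (hd : Dense (A.domain : Set K)) {T : Set ℝ}
    (hT : MeasurableSet T) {x : K × K} (hx : x ∈ A.graph) :
    (E.proj T x.1, E.proj T x.2) ∈ A.graph := by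
  -- Here v' is A E(Sᶜ)ψ. Additivity of the spectral measures over S and Sᶜ removes the cross term
  -- from the quadratic form, which together with symmetry kills the real part; replacing φ by iφ
  -- kills the imaginary part.
  have key : ∀ S : Set ℝ, MeasurableSet S → ∀ φ ψ v' : K, φ ∈ A.domain → ψ ∈ A.domain →
      (E.proj Sᶜ ψ, v') ∈ A.graph → inner ℂ (E.proj S φ) v' = 0 := by
    intro S hS φ ψ v' hφ hψ hv'
    have h1 : ∀ u ∈ A.domain, (inner ℂ (E.proj S u) v' : ℂ).re = 0 := by
      intro u hu
      have hu' := hE.proj_mem_domain hS hu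
      have hv := hE.proj_mem_domain hS.compl hψ
      obtain ⟨u', hu2⟩ := LinearPMap.mem_domain_iff.1 hu'
      have e1 := hE.inner_graph hu2
      have e2 := hE.inner_graph hv'
      have e3 := hE.inner_graph (A.graph.add_mem hu2 hv')
      simp only [Prod.fst_add, Prod.snd_add] at e3
      rw [E.measure_add hS, integral_add_measure (hE.integrable hu') (hE.integrable hv),
        Complex.ofReal_add, ← e1, ← e2, inner_add_left, inner_add_right, inner_add_right] at e3
      have e4 : inner ℂ (E.proj S u) v' + inner ℂ (E.proj Sᶜ ψ) u' = 0 := by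
        linear_combination e3
      have e5 : inner ℂ (E.proj Sᶜ ψ) u' = inner ℂ v' (E.proj S u) := (hA.1 _ hv' _ hu2).symm
      rw [e5, ← inner_conj_symm v'] at e4
      have := congrArg Complex.re e4
      simp only [Complex.add_re, Complex.conj_re, Complex.zero_re] at this
      linarith
    refine Complex.ext (h1 φ hφ) ?_
    have h2 := h1 (Complex.I • φ) (A.domain.smul_mem _ hφ)
    rw [map_smul, inner_smul_left] at h2
    simpa using h2
  have hψ := A.mem_domain_of_mem_graph hx
  obtain ⟨a', ha⟩ := LinearPMap.mem_domain_iff.1 (hE.proj_mem_domain hT hψ)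
  obtain ⟨b', hb⟩ := LinearPMap.mem_domain_iff.1 (hE.proj_mem_domain hT.compl hψ)
  have hsum : x.2 = a' + b' := by
    refine A.mem_graph_snd_inj hx (A.graph.add_mem ha hb) ?_
    simp [E.proj_compl hT]
  have hzero : ∀ S : Set ℝ, MeasurableSet S → ∀ v', (E.proj Sᶜ x.1, v') ∈ A.graph →
      E.proj S v' = 0 := by
    intro S hS v' hv'
    refine hd.eq_zero_of_inner_right ℂ fun φ hφ => ?_
    rw [← E.inner_proj hS]
    exact key S hS φ x.1 v' hφ hψ hv'
  have hb0 := hzero T hT b' hb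
  have ha0 := hzero Tᶜ hT.compl a' (by rwa [compl_compl])
  rw [E.proj_compl hT] at ha0
  have ha1 : E.proj T a' = a' := (sub_eq_zero.1 ha0).symm
  rw [hsum, map_add, hb0, ha1, add_zero]
  exact ha

theorem PVM.IsSpectralMeasureOf.inner_sub (hE : E.IsSpectralMeasureOf A) (c : ℝ) {x : K × K}
    (hx : x ∈ A.graph) :
    inner ℂ x.1 (x.2 - (c : ℂ) • x.1) = ((∫ t, (t - c) ∂(E.measure x.1) : ℝ) : ℂ) := by
  rw [inner_sub_right, hE.inner_graph hx, inner_smul_right,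
    integral_sub (hE.integrable (A.mem_domain_of_mem_graph hx)) (integrable_const c),
    integral_const, E.measure_univ, inner_self_eq_norm_sq_to_K]
  push_cast
  simp [mul_comm]

/-- On the range of the spectral projection of an interval of radius `r` around `c`, the operator
`A - c` is bounded by `r`. -/
theorem PVM.IsSpectralMeasureOf.norm_sub_le (hE : E.IsSpectralMeasureOf A)
    (hA : SelfAdjointGraph A.graph) (hd : Dense (A.domain : Set K)) {c r : ℝ} (hr : 0 ≤ r)
    {x : K × K} (hx : x ∈ A.graph) (hx1 : E.proj (Set.Icc (c - r) (c + r)) x.1 = x.1) :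
    ‖x.2 - (c : ℂ) • x.1‖ ≤ r * ‖x.1‖ := by
  set T := Set.Icc (c - r) (c + r) with hTdef
  have hT : MeasurableSet T := measurableSet_Icc
  have hquad : ∀ y ∈ A.graph, E.proj T y.1 = y.1 →
      |(inner ℂ y.1 (y.2 - (c : ℂ) • y.1) : ℂ).re| ≤ r * ‖y.1‖ ^ 2 := by
    intro y hy hy1
    rw [hE.inner_sub c hy, Complex.ofReal_re, ← Real.norm_eq_abs, ← E.measure_univ]
    refine norm_integral_le_of_norm_le_const ?_
    rw [← hy1, E.measure_proj hT]
    filter_upwards [ae_restrict_mem hT] with t ht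
    rw [Real.norm_eq_abs, abs_le]
    constructor <;> linarith [ht.1, ht.2]
  set χ := x.2 - (c : ℂ) • x.1 with hχ
  have hχ1 : E.proj T χ = χ := by
    have h1 := hE.proj_mem_graph hA hd hT hx
    rw [hx1] at h1
    have h2 : E.proj T x.2 = x.2 := A.mem_graph_snd_inj h1 hx rfl
    rw [hχ, map_sub, map_smul, hx1, h2]
  rcases eq_or_ne χ 0 with h0 | h0
  · rw [h0, norm_zero]; positivity
  have hn : 0 < ‖χ‖ := norm_pos_iff.2 h0
  obtain ⟨χ', hχ'⟩ := LinearPMap.mem_domain_iff.1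
    (hE.mem_domain_of_bounded hT (R := |c| + r) (fun t ht => by
      have := abs_le.1 (abs_sub_comm t c ▸ (abs_le.2 ⟨by linarith [ht.1], by linarith [ht.2]⟩ :
        |t - c| ≤ r))
      rcases abs_cases t with h | h <;> rcases abs_cases c with h' | h' <;> linarith) χ)
  rw [hχ1] at hχ'
  -- Polarization of the form of A - c at x ± sχ, where χ = (A - c)x. This s makes ‖sχ‖ = ‖x‖, so
  -- the parallelogram law turns the bound of the form by r into 4s‖χ‖² ≤ 4r‖x‖², that is ‖χ‖ ≤
  -- r‖x‖.
  set s : ℝ := ‖x.1‖ / ‖χ‖ with hs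
  have hp := hquad _ (A.graph.add_mem hx (A.graph.smul_mem (s : ℂ) hχ')) (by
    simp [hx1, hχ1])
  have hm := hquad _ (A.graph.sub_mem hx (A.graph.smul_mem (s : ℂ) hχ')) (by
    simp [hx1, hχ1])
  have hpar := parallelogram_law_with_norm ℂ x.1 ((s : ℂ) • χ)
  have hsχ : ‖(s : ℂ) • χ‖ = ‖x.1‖ := by
    rw [norm_smul, Complex.norm_real, Real.norm_of_nonneg (by positivity), hs,
      div_mul_cancel₀ _ hn.ne']
  have hsym : inner ℂ x.1 (χ' - (c : ℂ) • χ) = inner ℂ χ χ := by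
    have h1 := hA.1 _ hx _ hχ'
    simp only at h1
    rw [inner_sub_right, inner_smul_right, ← h1]
    conv_rhs => rw [hχ, inner_sub_left, inner_smul_left, Complex.conj_ofReal]
  have hdiff : (inner ℂ (x.1 + (s : ℂ) • χ)
        (x.2 + (s : ℂ) • χ' - (c : ℂ) • (x.1 + (s : ℂ) • χ)) : ℂ)
      - inner ℂ (x.1 - (s : ℂ) • χ) (x.2 - (s : ℂ) • χ' - (c : ℂ) • (x.1 - (s : ℂ) • χ))
      = ((4 * s * ‖χ‖ ^ (2 : ℕ) : ℝ) : ℂ) := by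
    have e1 : x.2 + (s : ℂ) • χ' - (c : ℂ) • (x.1 + (s : ℂ) • χ)
        = χ + (s : ℂ) • (χ' - (c : ℂ) • χ) := by rw [hχ]; module
    have e2 : x.2 - (s : ℂ) • χ' - (c : ℂ) • (x.1 - (s : ℂ) • χ)
        = χ - (s : ℂ) • (χ' - (c : ℂ) • χ) := by rw [hχ]; module
    rw [e1, e2]
    simp only [inner_add_left, inner_add_right, inner_sub_left, inner_smul_left,
      Complex.conj_ofReal]
    rw [inner_sub_right x.1 χ, inner_sub_right χ χ, inner_smul_right, inner_smul_right, hsym,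
      inner_self_eq_norm_sq_to_K]
    push_cast
    simp only [Complex.coe_algebraMap]
    ring
  have hre := congrArg Complex.re hdiff
  rw [Complex.sub_re] at hre
  rw [Complex.ofReal_re] at hre
  simp only [Prod.fst_add, Prod.snd_add, Prod.fst_sub, Prod.snd_sub, Prod.smul_fst,
    Prod.smul_snd] at hp hm
  have h4 : 4 * s * ‖χ‖ ^ 2 ≤ 4 * r * ‖x.1‖ ^ 2 := by
    rw [← hre]
    have := (abs_le.1 hp).2
    have := (abs_le.1 hm).1
    rw [hsχ] at hpar
    nlinarith
  rw [hs] at h4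
  have h5 : 4 * (‖x.1‖ / ‖χ‖) * ‖χ‖ ^ 2 = 4 * (‖x.1‖ * ‖χ‖) := by field_simp
  rw [h5] at h4
  rcases (norm_nonneg x.1).eq_or_lt with h6 | h6
  · have : x.1 = 0 := norm_eq_zero.1 h6.symm
    have h7 : x.2 = 0 := A.graph_fst_eq_zero_snd (show (x.1, x.2) ∈ A.graph from hx) this
    exact absurd (by rw [hχ, this, h7]; simp) h0
  · nlinarith

/-- Away from the interval of radius `r` around `c`, on one side of it, the operator `A - c` is
bounded below by `r`. -/
theorem PVM.IsSpectralMeasureOf.le_norm_sub (hE : E.IsSpectralMeasureOf A) {c r σ : ℝ}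
    (hσ : |σ| = 1) {T : Set ℝ} (hT : MeasurableSet T) (hTr : ∀ t ∈ T, r ≤ σ * (t - c))
    {x : K × K} (hx : x ∈ A.graph) (hx1 : E.proj T x.1 = x.1) :
    r * ‖x.1‖ ≤ ‖x.2 - (c : ℂ) • x.1‖ := by
  rcases (norm_nonneg x.1).eq_or_lt with h6 | h6
  · rw [← h6, mul_zero]; exact norm_nonneg _
  have h1 := hE.inner_sub c hx
  have hint := hE.integrable (A.mem_domain_of_mem_graph hx)
  have h2 : r * ‖x.1‖ ^ 2 ≤ σ * ∫ t, (t - c) ∂(E.measure x.1) := by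
    rw [← integral_const_mul, ← E.measure_univ, mul_comm, ← smul_eq_mul, ← integral_const]
    refine integral_mono_ae (integrable_const _) ((hint.sub (integrable_const c)).const_mul σ) ?_
    rw [← hx1, E.measure_proj hT]
    filter_upwards [ae_restrict_mem hT] with t ht
    exact hTr t ht
  have h3 : |∫ t, (t - c) ∂(E.measure x.1)| ≤ ‖x.1‖ * ‖x.2 - (c : ℂ) • x.1‖ := by
    have := norm_inner_le_norm (𝕜 := ℂ) x.1 (x.2 - (c : ℂ) • x.1)
    rwa [h1, Complex.norm_real, Real.norm_eq_abs] at this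
  have h4 : σ * ∫ t, (t - c) ∂(E.measure x.1) ≤ ‖x.1‖ * ‖x.2 - (c : ℂ) • x.1‖ := by
    refine (le_abs_self _).trans ?_
    rwa [abs_mul, hσ, one_mul]
  nlinarith

/-- Powers of A - c grow at most like rⁿ on the range of E(I) and at least like r'ⁿ on the range of
E(T). Since W commutes with A, a vector φ in the range of E(I) satisfies r'ⁿ‖E(T)Wφ‖ ≤ rⁿ‖E(T)W‖‖φ‖
for all n, and r < r' forces E(T)Wφ = 0. -/
theorem PVM.IsSpectralMeasureOf.proj_commutes_interval_side (hE : E.IsSpectralMeasureOf A)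
    (hA : SelfAdjointGraph A.graph) (hd : Dense (A.domain : Set K)) {W : K →L[ℂ] K}
    (hW : ∀ x ∈ A.graph, (W x.1, W x.2) ∈ A.graph) {c r r' σ : ℝ} (hr : 0 ≤ r) (hr' : r < r')
    (hσ : |σ| = 1) {T : Set ℝ} (hT : MeasurableSet T) (hTr : ∀ t ∈ T, r' ≤ σ * (t - c)) (ψ : K) :
    E.proj T (W (E.proj (Set.Icc (c - r) (c + r)) ψ)) = 0 := by
  set I := Set.Icc (c - r) (c + r) with hI
  have hIm : MeasurableSet I := measurableSet_Icc
  have hbd : ∀ t ∈ I, |t| ≤ |c| + r := by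
    intro t ht
    rcases abs_cases t with h | h <;> rcases abs_cases c with h' | h' <;>
      linarith [ht.1, ht.2]
  have step : ∀ n : ℕ, ∀ φ : K, E.proj I φ = φ →
      r' ^ n * ‖E.proj T (W φ)‖ ≤ r ^ n * (‖E.proj T ∘L W‖ * ‖φ‖) := by
    intro n
    induction n with
    | zero =>
      intro φ _
      simpa using (E.proj T ∘L W).le_opNorm φ
    | succ n ih =>
      intro φ hφ
      have hdom := hE.mem_domain_of_bounded hIm hbd φ
      rw [hφ] at hdom
      obtain ⟨φ', hφ'⟩ := LinearPMap.mem_domain_iff.1 hdom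
      have h1 := hE.norm_sub_le hA hd hr hφ' hφ
      have h2 : E.proj I (φ' - (c : ℂ) • φ) = φ' - (c : ℂ) • φ := by
        have h3 := hE.proj_mem_graph hA hd hIm hφ'
        simp only [hφ] at h3
        rw [map_sub, map_smul, hφ, A.mem_graph_snd_inj h3 hφ' rfl]
      have h4 := ih _ h2
      have h5 := hE.proj_mem_graph hA hd hT (hW _ hφ')
      have h6 := hE.le_norm_sub hσ hT hTr h5 (by
        simp only [E.proj_proj hT hT, Set.inter_self])
      simp only at h6 h1
      rw [← map_smul, ← map_smul, ← map_sub, ← map_sub] at h6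
      have hrn : 0 ≤ r ^ n := by positivity
      have hrn' : 0 ≤ r' ^ n := pow_nonneg (hr.trans hr'.le) n
      calc r' ^ (n + 1) * ‖E.proj T (W φ)‖ = r' ^ n * (r' * ‖E.proj T (W φ)‖) := by ring
        _ ≤ r' ^ n * ‖E.proj T (W (φ' - (c : ℂ) • φ))‖ := by gcongr
        _ ≤ r ^ n * (‖E.proj T ∘L W‖ * ‖φ' - (c : ℂ) • φ‖) := h4
        _ ≤ r ^ n * (‖E.proj T ∘L W‖ * (r * ‖φ‖)) := by gcongr
        _ = r ^ (n + 1) * (‖E.proj T ∘L W‖ * ‖φ‖) := by ring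
  set φ := E.proj I ψ with hφ
  have hφI : E.proj I φ = φ := by rw [hφ, E.proj_proj hIm hIm, Set.inter_self]
  have hr0 : 0 < r' := hr.trans_lt hr'
  have hlim : Filter.Tendsto (fun n : ℕ => (r / r') ^ n * (‖E.proj T ∘L W‖ * ‖φ‖))
      Filter.atTop (nhds (0 * (‖E.proj T ∘L W‖ * ‖φ‖))) :=
    (tendsto_pow_atTop_nhds_zero_of_lt_one (by positivity)
      ((div_lt_one hr0).2 hr')).mul_const _
  rw [zero_mul] at hlim
  have := ge_of_tendsto' hlim (b := ‖E.proj T (W φ)‖) fun n => by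
    rw [div_pow, div_mul_eq_mul_div, le_div_iff₀ (by positivity), mul_comm]
    exact step n φ hφI
  exact norm_eq_zero.1 (le_antisymm this (norm_nonneg _))

theorem PVM.proj_eq_zero_of_iUnion (E : PVM K) {S : ℕ → Set ℝ} (hS : ∀ n, MeasurableSet (S n))
    {ψ : K} (h : ∀ n, E.proj (S n) ψ = 0) : E.proj (⋃ n, S n) ψ = 0 := by
  have h1 : E.measure ψ (⋃ n, S n) = 0 := by
    rw [measure_iUnion_null_iff]
    intro n
    rw [E.measure_apply _ (hS n), h n]
    simp
  rw [E.measure_apply _ (MeasurableSet.iUnion hS), ENNReal.ofReal_eq_zero] at h1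
  rw [← norm_eq_zero, ← sq_eq_zero_iff]
  exact le_antisymm h1 (by positivity)

/-- The one-sided result needs a strict gap, so the complement of the interval is exhausted by pairs
of half-lines at distance r + 1/(n + 1) from c. -/
theorem PVM.IsSpectralMeasureOf.proj_commutes_interval (hE : E.IsSpectralMeasureOf A)
    (hA : SelfAdjointGraph A.graph) (hd : Dense (A.domain : Set K)) {W : K →L[ℂ] K}
    (hW : ∀ x ∈ A.graph, (W x.1, W x.2) ∈ A.graph) {c r : ℝ} (hr : 0 ≤ r) (ψ : K) :
    E.proj (Set.Icc (c - r) (c + r))ᶜ (W (E.proj (Set.Icc (c - r) (c + r)) ψ)) = 0 := by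
  have hset : (Set.Icc (c - r) (c + r))ᶜ = ⋃ n : ℕ,
      (Set.Iic (c - (r + 1 / ((n : ℝ) + 1))) ∪ Set.Ici (c + (r + 1 / ((n : ℝ) + 1)))) := by
    ext t
    simp only [Set.mem_compl_iff, Set.mem_Icc, not_and_or, not_le, Set.mem_iUnion, Set.mem_union,
      Set.mem_Iic, Set.mem_Ici]
    constructor
    · rintro (h | h)
      · obtain ⟨n, hn⟩ := exists_nat_one_div_lt (sub_pos.2 h)
        exact ⟨n, Or.inl (by linarith)⟩
      · obtain ⟨n, hn⟩ := exists_nat_one_div_lt (sub_pos.2 h)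
        exact ⟨n, Or.inr (by linarith)⟩
    · rintro ⟨n, hn⟩
      have : (0 : ℝ) < 1 / ((n : ℝ) + 1) := Nat.one_div_pos_of_nat
      rcases hn with h | h
      · exact Or.inl (by linarith)
      · exact Or.inr (by linarith)
  rw [hset]
  refine E.proj_eq_zero_of_iUnion (fun n => measurableSet_Iic.union measurableSet_Ici) fun n => ?_
  have hn : (0 : ℝ) < 1 / ((n : ℝ) + 1) := Nat.one_div_pos_of_nat
  rw [E.proj_union measurableSet_Iic measurableSet_Ici]
  · rw [_root_.add_apply,
      hE.proj_commutes_interval_side hA hd hW hr (r' := r + 1 / ((n : ℝ) + 1)) (σ := -1)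
        (by linarith) (by simp) measurableSet_Iic (fun t ht => by
          have := Set.mem_Iic.1 ht; linarith),
      hE.proj_commutes_interval_side hA hd hW hr (r' := r + 1 / ((n : ℝ) + 1)) (σ := 1)
        (by linarith) (by simp) measurableSet_Ici (fun t ht => by
          have := Set.mem_Ici.1 ht; linarith), add_zero]
  · refine Set.disjoint_left.2 fun t ht ht' => ?_
    have := Set.mem_Iic.1 ht
    have := Set.mem_Ici.1 ht'
    linarith

/-- A bounded self-adjoint operator that commutes with a self-adjoint operator `A` commutes with
its spectral projections. -/
theorem PVM.IsSpectralMeasureOf.commute_proj (hE : E.IsSpectralMeasureOf A)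
    (hA : SelfAdjointGraph A.graph) (hd : Dense (A.domain : Set K)) {W : K →L[ℂ] K}
    (hW : ∀ x ∈ A.graph, (W x.1, W x.2) ∈ A.graph)
    (hWs : ∀ φ ψ : K, inner ℂ (W φ) ψ = inner ℂ φ (W ψ)) {S : Set ℝ} (hS : MeasurableSet S) :
    Commute W (E.proj S) := by
  have hb : (inferInstance : MeasurableSpace ℝ)
      = .generateFrom {S : Set ℝ | ∃ l u : ℝ, l ≤ u ∧ Set.Icc l u = S} := by
    rw [← borel_eq_generateFrom_Icc]
    exact BorelSpace.measurable_eq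
  -- Compact intervals form a generating π-system; the sets whose projection commutes with W are
  -- closed under complements and disjoint countable unions.
  refine MeasurableSpace.induction_on_inter (C := fun S _ => Commute W (E.proj S)) hb ?_ ?_ ?_ ?_ ?_
    S hS
  · rintro _ ⟨a, b, hab, rfl⟩ _ ⟨a', b', hab', rfl⟩ hne
    rw [Set.Icc_inter_Icc] at hne ⊢
    exact ⟨_, _, Set.nonempty_Icc.1 hne, rfl⟩
  · rw [E.proj_empty]; exact Commute.zero_right _
  · rintro _ ⟨a, b, hab, rfl⟩
    have hI : Set.Icc a b
        = Set.Icc ((a + b) / 2 - (b - a) / 2) ((a + b) / 2 + (b - a) / 2) := by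
      congr 1 <;> ring
    have hm : MeasurableSet (Set.Icc a b) := measurableSet_Icc
    have h1 : ∀ ψ, W (E.proj (Set.Icc a b) ψ)
        = E.proj (Set.Icc a b) (W (E.proj (Set.Icc a b) ψ)) := by
      intro ψ
      have := hE.proj_commutes_interval hA hd hW (c := (a + b) / 2) (r := (b - a) / 2)
        (by linarith) ψ
      rw [← hI, E.proj_compl hm] at this
      exact sub_eq_zero.1 this
    -- The relation WE = EWE is already known; its adjoint is EW = EWE, since W and E are
    -- self-adjoint.
    refine ContinuousLinearMap.ext fun ψ => ext_inner_left ℂ fun φ => ?_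
    change inner ℂ φ (W (E.proj _ ψ)) = inner ℂ φ (E.proj _ (W ψ))
    rw [h1, ← E.inner_proj hm, ← hWs, ← E.inner_proj hm, ← h1, hWs, E.inner_proj hm]
  · intro T hT h
    rw [E.proj_compl hT]
    exact (Commute.one_right _).sub_right h
  · intro f hf hm h
    refine ContinuousLinearMap.ext fun ψ => ?_
    have h1 := (E.hasSum_iUnion f hm hf ψ).mapL W
    have h2 := E.hasSum_iUnion f hm hf (W ψ)
    refine h1.unique (h2.congr_fun fun n => ?_)
    exact congrArg (fun T : K →L[ℂ] K => T ψ) (h n).eq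

end SpectralMeasures

end DiracPolaron
namespace DiracPolaron

/-! ### Fourier analysis of the symmetry group and the abstract reduction theorem -/

section Reduction

theorem integral_exp_int_mul (n : ℤ) (hn : n ≠ 0) :
    ∫ θ in (0 : ℝ)..(2 * Real.pi), Complex.exp (Complex.I * ((n : ℝ) * θ : ℝ)) = 0 := by
  have hc : Complex.I * (n : ℂ) ≠ 0 := mul_ne_zero Complex.I_ne_zero (by exact_mod_cast hn)
  have h := integral_exp_mul_complex (a := 0) (b := 2 * Real.pi) hc
  have h1 : Complex.exp (Complex.I * n * ((2 * Real.pi : ℝ) : ℂ)) = 1 := by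
    rw [Complex.exp_eq_one_iff]
    exact ⟨n, by push_cast; ring⟩
  rw [h1] at h
  simp only [Complex.ofReal_zero, mul_zero, Complex.exp_zero, sub_self, zero_div] at h
  rw [← h]
  congr 1
  ext θ
  push_cast
  ring_nf

/-- Uniqueness of the coefficients of an absolutely convergent Fourier series. -/
theorem eq_zero_of_fourier_series_eq_zero {S : Set ℝ} (hS : S ⊆ halfIntegers) {c : S → ℂ}
    (hc : Summable c)
    (h : ∀ θ : ℝ, HasSum (fun z : S => c z * Complex.exp (-Complex.I * ((z : ℝ) * θ : ℝ))) 0)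
    (w : S) : c w = 0 := by
  have hcount : Countable S := by
    have : halfIntegers = Set.range fun n : ℤ => (n : ℝ) + 1 / 2 := by
      ext z
      simp only [halfIntegers, Set.mem_ofPred_eq, Set.mem_range, eq_comm]
    have h2 : halfIntegers.Countable := this ▸ Set.countable_range _
    exact (h2.mono hS).to_subtype
  -- The series is multiplied by exp(iwθ). Differences of half-integers are integers, so integration
  -- over [0, 2π] isolates the coefficient at w.
  let f : S → C(ℝ, ℂ) := fun z =>
    ⟨fun θ => c z * Complex.exp (Complex.I * (((w : ℝ) - z) * θ : ℝ)), by fun_prop⟩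
  have hf : ∀ z θ, f z θ = Complex.exp (Complex.I * ((w : ℝ) * θ : ℝ))
      * (c z * Complex.exp (-Complex.I * ((z : ℝ) * θ : ℝ))) := by
    intro z θ
    change c z * _ = _
    rw [mul_left_comm, ← Complex.exp_add]
    congr 2
    push_cast; ring
  have hsum : Summable fun z : S => ‖(f z).restrict
      (⟨Set.uIcc 0 (2 * Real.pi), isCompact_uIcc⟩ : TopologicalSpace.Compacts ℝ)‖ := by
    refine Summable.of_nonneg_of_le (fun _ => norm_nonneg _) (fun z => ?_) hc.norm
    refine (ContinuousMap.norm_le _ (norm_nonneg _)).2 fun θ => ?_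
    change ‖c z * _‖ ≤ _
    rw [norm_mul, mul_comm Complex.I, Complex.norm_exp_ofReal_mul_I, mul_one]
  have h1 := intervalIntegral.hasSum_intervalIntegral_of_summable_norm hsum
  have h2 : ∀ θ, ∑' z, f z θ = 0 := by
    intro θ
    simp only [hf]
    have := (h θ).mul_left (Complex.exp (Complex.I * ((w : ℝ) * θ : ℝ)))
    rw [mul_zero] at this
    exact this.tsum_eq
  simp only [h2, intervalIntegral.integral_zero] at h1
  have h3 : ∀ z, z ≠ w → ∫ θ in (0 : ℝ)..(2 * Real.pi), f z θ = 0 := by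
    intro z hz
    obtain ⟨a, ha⟩ := hS z.2
    obtain ⟨b, hb⟩ := hS w.2
    have hab : ((w : ℝ) - z) = ((b - a : ℤ) : ℝ) := by rw [ha, hb]; push_cast; ring
    have hne : b - a ≠ 0 := by
      intro h0
      rw [h0, Int.cast_zero, sub_eq_zero] at hab
      exact hz (Subtype.ext hab.symm)
    change ∫ θ in (0 : ℝ)..(2 * Real.pi), c z * Complex.exp (Complex.I * (((w : ℝ) - z) * θ : ℝ)) = 0
    rw [intervalIntegral.integral_const_mul, hab, integral_exp_int_mul _ hne, mul_zero]
  have h4 := (hasSum_single w h3).unique h1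
  change ∫ θ in (0 : ℝ)..(2 * Real.pi), c w * Complex.exp (Complex.I * (((w : ℝ) - w) * θ : ℝ)) = 0
    at h4
  simp only [sub_self, zero_mul, Complex.ofReal_zero, mul_zero, Complex.exp_zero, mul_one,
    intervalIntegral.integral_const, sub_zero] at h4
  exact (smul_eq_zero.1 h4).resolve_left (by positivity)

variable {K : Type*} [NormedAddCommGroup K] [InnerProductSpace ℂ K]

/-- The hypothesis on W is only an inclusion; self-adjointness upgrades it to the inclusion for the
inverse of W. The two values c = ±1 cover commuting and anticommuting unitaries. -/
theorem mem_graph_of_unitary {G : Submodule ℂ (K × K)} (hG : SelfAdjointGraph G)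
    (W : K ≃ₗᵢ[ℂ] K) {c : ℝ} (hc : c * c = 1) (hW : ∀ x ∈ G, (W x.1, (c : ℂ) • W x.2) ∈ G)
    {x y : K} (hx : (W x, W y) ∈ G) : (x, (c : ℂ) • y) ∈ G := by
  refine hG.2 _ _ fun a ha => ?_
  have h := hG.1 _ hx _ (hW a ha)
  simp only [inner_smul_right, LinearIsometryEquiv.inner_map_map] at h
  rw [inner_smul_left, Complex.conj_ofReal, h, ← mul_assoc, ← Complex.ofReal_mul, hc,
    Complex.ofReal_one, one_mul]

/-- The action on eigenspaces of a unitary that anticommutes with `B`. -/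
theorem unitary_mem_eigenspace_neg {B : K →ₗ.[ℂ] K} (W : K ≃ₗᵢ[ℂ] K)
    (hWB : ∀ x ∈ B.graph, (W x.1, -W x.2) ∈ B.graph) {z : ℝ} {x : K}
    (hx : x ∈ eigenspace B z) : W x ∈ eigenspace B ((-z : ℝ) : ℂ) := by
  have h := hWB _ (mem_eigenspace.1 hx)
  rw [mem_eigenspace, Complex.ofReal_neg, neg_smul, ← map_smul]
  exact h

theorem unitary_symm_mem_eigenspace_neg {B : K →ₗ.[ℂ] K} (hB : SelfAdjointGraph B.graph)
    (W : K ≃ₗᵢ[ℂ] K) (hWB : ∀ x ∈ B.graph, (W x.1, -W x.2) ∈ B.graph) {z : ℝ} {x : K}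
    (hx : x ∈ eigenspace B ((-z : ℝ) : ℂ)) : W.symm x ∈ eigenspace B z := by
  have h := mem_graph_of_unitary hB W (c := -1) (by norm_num) (by simpa using hWB)
    (x := W.symm x) (y := W.symm (((-z : ℝ) : ℂ) • x))
    (by simpa only [LinearIsometryEquiv.apply_symm_apply] using mem_eigenspace.1 hx)
  rw [mem_eigenspace]
  rwa [map_smul, smul_smul, ← Complex.ofReal_mul, neg_one_mul, neg_neg] at h

variable {A B : K →ₗ.[ℂ] K}

theorem starProjection_unitary_neg (hB : SelfAdjointGraph B.graph)
    [∀ z : ℝ, CompleteSpace (eigenspace B z)]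
    (W : K ≃ₗᵢ[ℂ] K) (hWB : ∀ x ∈ B.graph, (W x.1, -W x.2) ∈ B.graph) (z : ℝ) (x : K) :
    (eigenspace B ((-z : ℝ) : ℂ)).starProjection (W x) = W ((eigenspace B z).starProjection x) := by
  refine Submodule.eq_starProjection_of_mem_of_inner_eq_zero (K := eigenspace B ((-z : ℝ) : ℂ))
    (unitary_mem_eigenspace_neg W hWB (Submodule.starProjection_apply_mem _ _)) fun u hu => ?_
  rw [← map_sub, ← W.apply_symm_apply u, W.inner_map_map]
  exact Submodule.starProjection_inner_eq_zero _ _ (unitary_symm_mem_eigenspace_neg hB W hWB hu)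

theorem unitarilyEquivalent_part_neg (hA : SelfAdjointGraph A.graph)
    (hB : SelfAdjointGraph B.graph) (W : K ≃ₗᵢ[ℂ] K)
    (hWA : ∀ x ∈ A.graph, (W x.1, W x.2) ∈ A.graph)
    (hWB : ∀ x ∈ B.graph, (W x.1, -W x.2) ∈ B.graph) (z : ℝ) :
    UnitarilyEquivalent (part A (eigenspace B z)) (part A (eigenspace B ((-z : ℝ) : ℂ))) := by
  let U : eigenspace B z ≃ₗᵢ[ℂ] eigenspace B ((-z : ℝ) : ℂ) :=
    { toFun := fun x => ⟨W x, unitary_mem_eigenspace_neg W hWB x.2⟩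
      invFun := fun x => ⟨W.symm x, unitary_symm_mem_eigenspace_neg hB W hWB x.2⟩
      map_add' := fun x y => Subtype.ext (map_add W _ _)
      map_smul' := fun c x => Subtype.ext (map_smul W c _)
      left_inv := fun x => Subtype.ext (W.symm_apply_apply _)
      right_inv := fun x => Subtype.ext (W.apply_symm_apply _)
      norm_map' := fun x => W.norm_map _ }
  refine ⟨U, fun x y => ?_⟩
  rw [mem_part_graph, mem_part_graph]
  refine ⟨fun h => hWA _ h, fun h => ?_⟩
  have := mem_graph_of_unitary hA W (c := 1) (by norm_num) (by simpa using hWA)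
    (x := (x : K)) (y := (y : K)) h
  simpa using this

variable [CompleteSpace K]

/-- If a self-adjoint operator commutes with the unitary group of an operator with half-integer
eigenvalues, then the eigenspaces of the latter reduce it. -/
theorem starProjection_mem_graph_of_group {G : Submodule ℂ (K × K)} (hG : SelfAdjointGraph G)
    {V : halfIntegers → Submodule ℂ K} [∀ z, CompleteSpace (V z)]
    (ho : OrthogonalFamily ℂ (fun z => V z) (fun z => (V z).subtypeₗᵢ))
    (ht : (⨆ z, V z).topologicalClosure = ⊤) {T : ℝ → K →L[ℂ] K}
    (hT : ∀ θ, ∀ x ∈ G, (T θ x.1, T θ x.2) ∈ G)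
    (hV : ∀ θ z, ∀ v ∈ V z, T θ v = Complex.exp (-Complex.I * ((z : ℝ) * θ : ℝ)) • v)
    (z : halfIntegers) {x : K × K} (hx : x ∈ G) :
    ((V z).starProjection x.1, (V z).starProjection x.2) ∈ G := by
  -- Membership is tested in the adjoint. For y in G the function θ ↦ ⟨y.1, T θ x.2⟩ - ⟨y.2, T θ
  -- x.1⟩ vanishes identically, and its Fourier coefficient at z is the same expression with the
  -- projection onto V z in place of T θ.
  refine hG.2 _ _ fun y hy => ?_
  have hs : ∀ a b : K, HasSum (fun w => inner ℂ a ((V w).starProjection b)) (inner ℂ a b) :=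
    fun a b => (hasSum_starProjection ho ht b).mapL (innerSL ℂ a)
  have hsθ : ∀ θ, ∀ a b : K, HasSum (fun w => inner ℂ a ((V w).starProjection b)
      * Complex.exp (-Complex.I * ((w : ℝ) * θ : ℝ))) (inner ℂ a (T θ b)) := by
    intro θ a b
    have h := ((hasSum_starProjection ho ht b).mapL (T θ)).mapL (innerSL ℂ a)
    refine h.congr_fun fun w => ?_
    change _ = inner ℂ a (T θ ((V w).starProjection b))
    rw [hV θ w _ (Submodule.starProjection_apply_mem _ _), inner_smul_right, mul_comm]
  have h0 := eq_zero_of_fourier_series_eq_zero (subset_refl halfIntegers)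
    ((hs y.1 x.2).sub (hs y.2 x.1)).summable (fun θ => by
      have h := (hsθ θ y.1 x.2).sub (hsθ θ y.2 x.1)
      rw [sub_eq_zero.2 (hG.1 _ hy _ (hT θ _ hx)).symm] at h
      refine h.congr_fun fun w => ?_
      rw [sub_mul]) z
  have h1 := sub_eq_zero.1 h0
  rw [← inner_conj_symm, h1, inner_conj_symm]

/-- The eigenspace of A is the direct sum of its parts with positive and with negative B. Zero is
not a half-integer, so nothing is left over, and W exchanges the two parts. -/
theorem even_finrank_eigenspace [∀ z : ℝ, CompleteSpace (eigenspace B z)]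
    (hB : SelfAdjointGraph B.graph)
    (ht : (⨆ z : halfIntegers, eigenspace B ((z : ℝ) : ℂ)).topologicalClosure = ⊤)
    (hAB : ∀ z : halfIntegers, ∀ x ∈ A.graph, ((eigenspace B ((z : ℝ) : ℂ)).starProjection x.1,
      (eigenspace B ((z : ℝ) : ℂ)).starProjection x.2) ∈ A.graph)
    (W : K ≃ₗᵢ[ℂ] K) (hWA : ∀ x ∈ A.graph, (W x.1, W x.2) ∈ A.graph)
    (hWB : ∀ x ∈ B.graph, (W x.1, -W x.2) ∈ B.graph) (c : ℂ)
    [FiniteDimensional ℂ (eigenspace A c)] : Even (Module.finrank ℂ (eigenspace A c)) := by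
  have ho := orthogonalFamily_eigenspace hB.1 halfIntegers
  set P : ℝ → K →L[ℂ] K := fun z => (eigenspace B (z : ℂ)).starProjection with hP
  have hsum : ∀ v, HasSum (fun z : halfIntegers => P z v) v := hasSum_starProjection ho ht
  have hPmem : ∀ z : halfIntegers, ∀ v ∈ eigenspace A c, P z v ∈ eigenspace A c := by
    intro z v hv
    have := hAB z _ (mem_eigenspace.1 hv)
    rw [mem_eigenspace]
    simpa only [map_smul] using this
  have hWmem : ∀ v ∈ eigenspace A c, W v ∈ eigenspace A c := by
    intro v hv
    have := hWA _ (mem_eigenspace.1 hv)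
    rw [mem_eigenspace]
    simpa only [map_smul] using this
  -- For s = 1 only components with z > 0 survive, for s = -1 only those with z < 0.
  let Q : ℝ → Submodule ℂ K := fun s => eigenspace A c ⊓
    ⨅ z : halfIntegers, ⨅ _ : s * z < 0, LinearMap.ker (P z).toLinearMap
  have hQ : ∀ s v, v ∈ Q s ↔ v ∈ eigenspace A c ∧ ∀ z : halfIntegers, s * z < 0 → P z v = 0 := by
    intro s v
    simp only [Q, Submodule.mem_inf, Submodule.mem_iInf, LinearMap.mem_ker]
    rfl
  have hne : ∀ z : halfIntegers, (z : ℝ) ≠ 0 := by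
    rintro ⟨z, n, rfl⟩ h
    have h2 : ((2 * n + 1 : ℤ) : ℝ) = 0 := by push_cast; linear_combination 2 * h
    have h3 : 2 * n + 1 = 0 := by exact_mod_cast h2
    omega
  have hneg : ∀ z : halfIntegers, -(z : ℝ) ∈ halfIntegers := by
    rintro ⟨z, n, rfl⟩
    exact ⟨-n - 1, by push_cast; ring⟩
  have hmap : ∀ s, (Q s).map W.toLinearEquiv.toLinearMap ≤ Q (-s) := by
    rintro s _ ⟨v, hv, rfl⟩
    rw [SetLike.mem_coe, hQ] at hv
    rw [hQ]
    refine ⟨hWmem v hv.1, fun z hz => ?_⟩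
    have h1 := starProjection_unitary_neg hB W hWB (-(z : ℝ)) v
    rw [neg_neg] at h1
    change P z (W v) = 0
    rw [hP]
    simp only
    rw [h1]
    have h2 := hv.2 ⟨-(z : ℝ), hneg z⟩ (by simpa using hz)
    change P (-(z : ℝ)) v = 0 at h2
    rw [hP] at h2
    simp only at h2
    rw [h2, map_zero]
  have hfin : ∀ s, FiniteDimensional ℂ (Q s) := fun s =>
    Submodule.finiteDimensional_of_le (inf_le_left : Q s ≤ eigenspace A c)
  have hle : ∀ s, Module.finrank ℂ (Q s) ≤ Module.finrank ℂ (Q (-s)) := by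
    intro s
    rw [← LinearEquiv.finrank_map_eq W.toLinearEquiv (Q s)]
    exact Submodule.finrank_mono (hmap s)
  -- The inclusion of W (Q s) in Q (-s), used for both signs, already gives equality of the
  -- dimensions.
  have heq : Module.finrank ℂ (Q 1) = Module.finrank ℂ (Q (-1)) := by
    refine le_antisymm (hle 1) ?_
    conv_rhs => rw [← neg_neg (1 : ℝ)]
    exact hle (-1)
  have hinf : Q 1 ⊓ Q (-1) = ⊥ := by
    rw [Submodule.eq_bot_iff]
    intro v hv
    have h1 := ((hQ _ _).1 hv.1).2
    have h2 := ((hQ _ _).1 hv.2).2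
    refine (hsum v).unique (hasSum_zero.congr_fun fun z => ?_)
    rcases lt_or_gt_of_ne (hne z) with h | h
    · exact h1 z (by linarith)
    · exact h2 z (by linarith)
  have hPP : ∀ z w : halfIntegers, z ≠ w → ∀ v, P z (P w v) = 0 := by
    intro z w hzw v
    refine (Submodule.starProjection_apply_eq_zero_iff _).2 ?_
    rw [Submodule.mem_orthogonal]
    intro u hu
    exact ho hzw ⟨u, hu⟩ ⟨P w v, Submodule.starProjection_apply_mem _ _⟩
  have hsup : Q 1 ⊔ Q (-1) = eigenspace A c := by
    refine le_antisymm (sup_le inf_le_left inf_le_left) fun v hv => ?_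
    -- The components of v on one side of zero may be infinitely many; their sum stays in the
    -- eigenspace because a finite-dimensional subspace is closed.
    have hclosed : IsClosed (eigenspace A c : Set K) := Submodule.closed_of_finiteDimensional _
    have hpart : ∀ s : ℝ, ∑' z : halfIntegers, Set.indicator {z : halfIntegers | 0 < s * z}
        (fun z => P z v) z ∈ Q s := by
      intro s
      have hs := ((hsum v).summable.indicator {z : halfIntegers | 0 < s * (z : ℝ)}).hasSum
      rw [hQ]
      constructor
      · refine hclosed.mem_of_tendsto hs (Filter.Eventually.of_forall fun t => ?_)
        refine Submodule.sum_mem _ fun z _ => ?_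
        rw [Set.indicator_apply]
        split_ifs
        · exact hPmem z v hv
        · exact Submodule.zero_mem _
      · intro w hw
        refine (hs.mapL (P w)).unique (hasSum_zero.congr_fun fun z => ?_)
        rw [Set.indicator_apply]
        split_ifs with h
        · refine hPP w z ?_ v
          rintro rfl
          exact absurd h (not_lt.2 hw.le)
        · exact map_zero _
    have hv2 : v = (∑' z : halfIntegers, Set.indicator {z : halfIntegers | 0 < 1 * (z : ℝ)}
        (fun z => P z v) z) + ∑' z : halfIntegers, Set.indicator
          {z : halfIntegers | 0 < -1 * (z : ℝ)} (fun z => P z v) z := by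
      rw [← ((hsum v).summable.indicator _).tsum_add ((hsum v).summable.indicator _),
        ← (hsum v).tsum_eq]
      conv_rhs => rw [(hsum v).tsum_eq]
      refine tsum_congr fun z => ?_
      rw [Set.indicator_apply, Set.indicator_apply]
      simp only [Set.mem_ofPred_eq]
      rcases lt_or_gt_of_ne (hne z) with h | h
      · rw [if_neg (by linarith), if_pos (by linarith), zero_add]
      · rw [if_pos (by linarith), if_neg (by linarith), add_zero]
    rw [hv2]
    exact Submodule.add_mem_sup (hpart 1) (hpart (-1))
  have h := Submodule.finrank_sup_add_finrank_inf_eq (Q 1) (Q (-1))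
  rw [hinf, hsup, finrank_bot, add_zero, ← heq] at h
  exact ⟨_, h⟩

/-- Reduction of a self-adjoint operator `A` by the eigenspaces of an operator `B` with half-integer
eigenvalues, when `A` commutes with the unitary group generated by `B` and with a unitary operator
that anticommutes with `B`. -/
theorem reduction_by_eigenspaces (hA : SelfAdjointGraph A.graph)
    (hBc : IsClosed (B.graph : Set (K × K))) (hBs : SymmetricGraph B.graph) {V : Set (K × ℝ)}
    (hV : ∀ p ∈ V, p.2 ∈ halfIntegers ∧ (p.1, (p.2 : ℂ) • p.1) ∈ B.graph)
    (ht : ∀ h : K, (∀ p ∈ V, inner ℂ h p.1 = 0) → h = 0) (T : ℝ → K ≃ₗᵢ[ℂ] K)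
    (hTA : ∀ θ, ∀ x ∈ A.graph, (T θ x.1, T θ x.2) ∈ A.graph)
    (hTV : ∀ θ, ∀ p ∈ V, T θ p.1 = Complex.exp (-Complex.I * (p.2 * θ : ℝ)) • p.1)
    (W : K ≃ₗᵢ[ℂ] K) (hWA : ∀ x ∈ A.graph, (W x.1, W x.2) ∈ A.graph)
    (hWB : ∀ x ∈ B.graph, (W x.1, -W x.2) ∈ B.graph) :
    StronglyCommute A B ∧
    IsOrthogonalDirectSum B (fun z : halfIntegers => eigenspace B ((z : ℝ) : ℂ)) ∧
    IsOrthogonalDirectSum A (fun z : halfIntegers => eigenspace B ((z : ℝ) : ℂ)) ∧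
    (∀ z ∈ halfIntegers,
      UnitarilyEquivalent (part A (eigenspace B (z : ℂ))) (part A (eigenspace B ((-z : ℝ) : ℂ)))) ∧
    ∀ c : ℂ, FiniteDimensional ℂ (eigenspace A c) → Even (Module.finrank ℂ (eigenspace A c)) := by
  have hB : SelfAdjointGraph B.graph :=
    selfAdjointGraph_of_eigenvectors hBc hBs (fun p hp => (hV p hp).2) ht
  have hcomp : ∀ z : ℝ, CompleteSpace (eigenspace B z) := fun z =>
    (isClosed_eigenspace hBc _).completeSpace_coe
  have ho := orthogonalFamily_eigenspace hBs halfIntegers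
  have htop : (⨆ z : halfIntegers, eigenspace B ((z : ℝ) : ℂ)).topologicalClosure = ⊤ :=
    topologicalClosure_iSup_eigenspace hV ht
  -- The action of T θ is prescribed only on the total set V. Pairing with V extends it to whole
  -- eigenspaces, because members of V with another eigenvalue are orthogonal to v.
  have hTeig : ∀ θ, ∀ z : halfIntegers, ∀ v ∈ eigenspace B ((z : ℝ) : ℂ),
      T θ v = Complex.exp (-Complex.I * ((z : ℝ) * θ : ℝ)) • v := by
    intro θ z v hv
    rw [← sub_eq_zero]
    refine ht _ fun p hp => ?_
    have hp1 := hTV θ p hp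
    set w := Complex.exp (-Complex.I * (p.2 * θ : ℝ)) with hw
    have hw1 : (starRingEnd ℂ) w * w = 1 := by
      rw [mul_comm, Complex.mul_conj, Complex.normSq_eq_norm_sq, hw,
        show -Complex.I * ((p.2 * θ : ℝ) : ℂ) = ((-(p.2 * θ) : ℝ) : ℂ) * Complex.I by
          push_cast; ring, Complex.norm_exp_ofReal_mul_I]
      simp
    have h1 : inner ℂ (T θ v) p.1 = (starRingEnd ℂ) w * inner ℂ v p.1 := by
      have h2 := (T θ).inner_map_map v p.1
      rw [hp1, inner_smul_right] at h2
      rw [← h2, ← mul_assoc, hw1, one_mul]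
    rw [inner_sub_left, inner_smul_left, h1]
    by_cases hz : p.2 = z
    · rw [hw, hz, sub_self]
    · rw [eigenspace_inner_eq_zero hBs (Ne.symm hz) hv (hV p hp).2]
      simp
  have hAB : ∀ z : halfIntegers, ∀ x ∈ A.graph,
      ((eigenspace B ((z : ℝ) : ℂ)).starProjection x.1,
      (eigenspace B ((z : ℝ) : ℂ)).starProjection x.2) ∈ A.graph := fun z x hx =>
    starProjection_mem_graph_of_group hA ho htop
      (T := fun θ => ((T θ).toContinuousLinearEquiv : K →L[ℂ] K)) hTA hTeig z hx
  have hAsa := isSelfAdjoint_of_graph hA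
  have hBsa := isSelfAdjoint_of_graph hB
  refine ⟨⟨hAsa, hBsa, fun E F hE hF S R hS hR => ?_⟩,
    isOrthogonalDirectSum_of_reduces ho htop hBc fun z x hx =>
      starProjection_eigenspace_mem hB z x hx,
    isOrthogonalDirectSum_of_reduces ho htop hA.isClosed hAB,
    fun z _ => unitarilyEquivalent_part_neg hA hB W hWA hWB z,
    fun c hc => even_finrank_eigenspace hB htop hAB W hWA hWB c⟩
  -- The eigenprojections of B reduce A, hence commute with E(S). Summing over z then shows that
  -- E(S) preserves the closed graph of B, and the commutation criterion applies once more with B in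
  -- place of A.
  have hcomm : ∀ z : halfIntegers,
      Commute (eigenspace B ((z : ℝ) : ℂ)).starProjection (E.proj S) := fun z =>
    hE.commute_proj hA hAsa.dense_domain (hAB z)
      (fun φ ψ => Submodule.inner_starProjection_left_eq_right _ φ ψ) hS
  refine hF.commute_proj hB hBsa.dense_domain (fun x hx => ?_) (fun φ ψ => E.inner_proj hS φ ψ) hR
  refine hBc.mem_of_tendsto ((hasSum_starProjection ho htop (E.proj S x.1)).prodMk
    (hasSum_starProjection ho htop (E.proj S x.2))) (Filter.Eventually.of_forall fun s => ?_)
  refine B.graph.sum_mem fun z _ => ?_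
  have h1 : ∀ v, (eigenspace B ((z : ℝ) : ℂ)).starProjection (E.proj S v)
      = E.proj S ((eigenspace B ((z : ℝ) : ℂ)).starProjection v) := fun v =>
    congrArg (fun T : K →L[ℂ] K => T v) (hcomm z).eq
  have h2 := starProjection_eigenspace_mem hB z x hx
  have h3 : (eigenspace B ((z : ℝ) : ℂ)).starProjection x.2
      = ((z : ℝ) : ℂ) • (eigenspace B ((z : ℝ) : ℂ)).starProjection x.1 :=
    B.mem_graph_snd_inj h2
      (mem_eigenspace.1 (Submodule.starProjection_apply_mem (eigenspace B ((z : ℝ) : ℂ)) x.1)) rfl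
  rw [h1 x.2, h3, map_smul, ← h1]
  exact mem_eigenspace.1 (Submodule.starProjection_apply_mem _ _)

end Reduction

end DiracPolaron
namespace DiracPolaron

/-! ### Product vectors, permutations and the symmetrizer -/

section Tensors

/-- The measure on the configurations of `n` photons. -/
noncomputable abbrev powMeasure (n : ℕ) : Measure (Fin n → Photon) := Measure.pi (fun _ : Fin n => photonMeasure)

theorem ae_eval {n : ℕ} (i : Fin n) {P : Photon → Prop} (h : ∀ᵐ x ∂photonMeasure, P x) :
    ∀ᵐ x ∂(powMeasure n), P (x i) :=
  (Measure.quasiMeasurePreserving_eval (fun _ : Fin n => photonMeasure) i).ae h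

theorem coeFn_tensor {n : ℕ} (f : Fin n → OnePhoton) :
    tensor f =ᵐ[powMeasure n] fun x => ∏ i, f i (x i) :=
  (memLp_tensor f).coeFn_toLp

theorem inner_tensor {n : ℕ} (f g : Fin n → OnePhoton) :
    inner ℂ (tensor f) (tensor g) = ∏ i, inner ℂ (f i) (g i) := by
  rw [L2.inner_def]
  simp only [L2.inner_def]
  rw [← integral_fintype_prod_eq_prod (𝕜 := ℂ) (fun i x => inner ℂ (f i x) (g i x))]
  refine integral_congr_ae ?_
  filter_upwards [coeFn_tensor f, coeFn_tensor g] with x h1 h2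
  rw [h1, h2]
  simp only [RCLike.inner_apply, map_prod, Finset.prod_mul_distrib]

theorem norm_tensor {n : ℕ} (f : Fin n → OnePhoton) : ‖tensor f‖ = ∏ i, ‖f i‖ := by
  have h := inner_tensor f f
  simp only [inner_self_eq_norm_sq_to_K] at h
  rw [Finset.prod_pow] at h
  have h2 : ‖tensor f‖ ^ 2 = (∏ i, ‖f i‖) ^ 2 := by exact_mod_cast h
  exact (sq_eq_sq₀ (norm_nonneg _) (Finset.prod_nonneg fun _ _ => norm_nonneg _)).1 h2

/-- The tensor product as a continuous multilinear map. -/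
noncomputable def tensorM (n : ℕ) : ContinuousMultilinearMap ℂ (fun _ : Fin n => OnePhoton) (TensorPower n) :=
  MultilinearMap.mkContinuous
    { toFun := tensor
      map_update_add' := by
        intro d f i x y
        have hd : d = instDecidableEqFin n := Subsingleton.elim _ _
        subst hd
        refine Lp.ext ?_
        filter_upwards [coeFn_tensor (Function.update f i (x + y)),
          coeFn_tensor (Function.update f i x), coeFn_tensor (Function.update f i y),
          Lp.coeFn_add (tensor (Function.update f i x)) (tensor (Function.update f i y)),
          ae_eval i (Lp.coeFn_add x y)] with k h1 h2 h3 h4 h5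
        rw [h1, h4, Pi.add_apply, h2, h3]
        rw [← Finset.mul_prod_erase _ _ (Finset.mem_univ i),
          ← Finset.mul_prod_erase _ (fun j => Function.update f i x j (k j)) (Finset.mem_univ i),
          ← Finset.mul_prod_erase _ (fun j => Function.update f i y j (k j)) (Finset.mem_univ i)]
        simp only [Function.update_self, h5, Pi.add_apply, add_mul]
        congr 1 <;> congr 1 <;> refine Finset.prod_congr rfl fun j hj => ?_ <;>
          rw [Function.update_of_ne (Finset.ne_of_mem_erase hj),
            Function.update_of_ne (Finset.ne_of_mem_erase hj)]
      map_update_smul' := by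
        intro d f i c x
        have hd : d = instDecidableEqFin n := Subsingleton.elim _ _
        subst hd
        refine Lp.ext ?_
        filter_upwards [coeFn_tensor (Function.update f i (c • x)),
          coeFn_tensor (Function.update f i x),
          Lp.coeFn_smul c (tensor (Function.update f i x)),
          ae_eval i (Lp.coeFn_smul c x)] with k h1 h2 h4 h5
        rw [h1, h4, Pi.smul_apply, h2]
        rw [← Finset.mul_prod_erase _ _ (Finset.mem_univ i),
          ← Finset.mul_prod_erase _ (fun j => Function.update f i x j (k j)) (Finset.mem_univ i)]
        simp only [Function.update_self, h5, Pi.smul_apply, smul_eq_mul, mul_assoc]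
        congr 2
        refine Finset.prod_congr rfl fun j hj => ?_
        rw [Function.update_of_ne (Finset.ne_of_mem_erase hj),
          Function.update_of_ne (Finset.ne_of_mem_erase hj)] }
    1 (fun f => by rw [one_mul]; exact (norm_tensor f).le)

theorem tensorM_apply {n : ℕ} (f : Fin n → OnePhoton) : tensorM n f = tensor f := rfl

/-- The box `B ^ n` in the configuration space, for a spanning set `B` of finite measure. -/
theorem ae_eq_zero_of_setIntegral_boxes {n : ℕ} {h : (Fin n → Photon) → ℂ}
    (hh : MemLp h 2 (powMeasure n))
    (h0 : ∀ s : Fin n → Set Photon, (∀ i, MeasurableSet (s i)) → (∀ i, photonMeasure (s i) < ⊤) →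
      ∫ x in Set.univ.pi s, h x ∂(powMeasure n) = 0) :
    h =ᵐ[powMeasure n] 0 := by
  -- These boxes of finite measure exhaust the configuration space. On each of them h is integrable,
  -- and the measurable boxes form a generating π-system, so vanishing integrals over boxes
  -- propagate to all measurable sets.
  let B : ℕ → Set (Fin n → Photon) := fun N => Set.univ.pi fun _ => spanningSets photonMeasure N
  have hBm : ∀ N, MeasurableSet (B N) := fun N =>
    MeasurableSet.univ_pi fun _ => measurableSet_spanningSets _ _
  have hBfin : ∀ N, powMeasure n (B N) < ⊤ := fun N => by
    rw [Measure.pi_pi]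
    exact ENNReal.prod_lt_top fun _ _ => measure_spanningSets_lt_top _ _
  have hBu : ⋃ N, B N = Set.univ := by
    refine Set.eq_univ_of_forall fun x => Set.mem_iUnion.2 ?_
    have h1 : ∀ i, ∃ N, x i ∈ spanningSets photonMeasure N := fun i =>
      Set.mem_iUnion.1 (by rw [iUnion_spanningSets]; trivial)
    choose N hN using h1
    exact ⟨Finset.univ.sup N, fun i _ =>
      monotone_spanningSets _ (Finset.le_sup (f := N) (Finset.mem_univ i)) (hN i)⟩
  have key : ∀ N, h =ᵐ[(powMeasure n).restrict (B N)] 0 := by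
    intro N
    have hfin : IsFiniteMeasure ((powMeasure n).restrict (B N)) :=
      ⟨by rw [Measure.restrict_apply_univ]; exact hBfin N⟩
    have hint : Integrable h ((powMeasure n).restrict (B N)) :=
      (hh.restrict _).integrable (by norm_num)
    refine hint.ae_eq_zero_of_forall_setIntegral_eq_zero fun s hs _ => ?_
    refine MeasurableSpace.induction_on_inter
      (C := fun s _ => ∫ x in s, h x ∂((powMeasure n).restrict (B N)) = 0)
      generateFrom_pi.symm isPiSystem_pi ?_ ?_ ?_ ?_ s hs
    · simp
    · rintro _ ⟨s, hs, rfl⟩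
      have hs' : ∀ i, MeasurableSet (s i) := fun i => hs i trivial
      rw [Measure.restrict_restrict (MeasurableSet.univ_pi hs'), ← Set.pi_inter_distrib]
      exact h0 _ (fun i => (hs' i).inter (measurableSet_spanningSets _ _))
        fun i => (measure_mono Set.inter_subset_right).trans_lt (measure_spanningSets_lt_top _ N)
    · intro t ht h1
      have h2 := integral_add_compl ht hint
      rw [h1, zero_add] at h2
      rw [h2]
      exact h0 _ (fun i => measurableSet_spanningSets _ _)
        fun i => measure_spanningSets_lt_top _ N
    · intro f hd hm h1
      rw [integral_iUnion hm hd hint.integrableOn]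
      simp [h1]
  have := ae_restrict_iUnion_iff B (fun x => h x = 0) |>.2 fun N => key N
  rwa [hBu, Measure.restrict_univ] at this

/-- Products of indicator functions are indicator functions of boxes, so the hypothesis says that h
has zero integral over every box with sides of finite measure. -/
theorem eq_zero_of_inner_tensor {n : ℕ} {h : TensorPower n}
    (h0 : ∀ f : Fin n → OnePhoton, inner ℂ (tensor f) h = 0) : h = 0 := by
  rw [Lp.eq_zero_iff_ae_eq_zero]
  refine ae_eq_zero_of_setIntegral_boxes (Lp.memLp h) fun s hs hfin => ?_
  have h1 := h0 fun i => indicatorConstLp 2 (hs i) (hfin i).ne 1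
  rw [L2.inner_def] at h1
  rw [← integral_indicator (MeasurableSet.univ_pi hs), ← h1]
  refine integral_congr_ae ?_
  have h2 : ∀ᵐ x ∂(powMeasure n), ∀ i, indicatorConstLp 2 (hs i) (hfin i).ne (1 : ℂ) (x i)
      = (s i).indicator (fun _ => 1) (x i) :=
    ae_all_iff.2 fun i => ae_eval i indicatorConstLp_coeFn
  filter_upwards [coeFn_tensor fun i => indicatorConstLp 2 (hs i) (hfin i).ne (1 : ℂ), h2]
    with x h3 h4
  rw [h3]
  simp only [h4, RCLike.inner_apply]
  by_cases hx : x ∈ Set.univ.pi s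
  · rw [Set.indicator_of_mem hx, Finset.prod_eq_one, map_one, mul_one]
    exact fun i _ => Set.indicator_of_mem (hx i trivial) _
  · rw [Set.indicator_of_notMem hx]
    obtain ⟨i, hi⟩ : ∃ i, x i ∉ s i := by simpa [Set.mem_pi] using hx
    rw [Finset.prod_eq_zero (Finset.mem_univ i) (Set.indicator_of_notMem hi _), map_zero, mul_zero]

theorem dense_span_tensor (n : ℕ) :
    (Submodule.span ℂ (Set.range (tensor (n := n)))).topologicalClosure = ⊤ := by
  rw [Submodule.topologicalClosure_eq_top_iff, Submodule.eq_bot_iff]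
  intro h hh
  refine eq_zero_of_inner_tensor fun f => ?_
  exact (Submodule.mem_orthogonal _ _).1 hh _ (Submodule.subset_span ⟨f, rfl⟩)

/-- Two bounded operators that agree on product vectors are equal. -/
theorem ext_tensor {n : ℕ} {F : Type*} [NormedAddCommGroup F] [NormedSpace ℂ F]
    {S T : TensorPower n →L[ℂ] F} (h : ∀ f, S (tensor f) = T (tensor f)) : S = T := by
  refine ContinuousLinearMap.ext_on (s := Set.range (tensor (n := n))) ?_ ?_
  · rw [Submodule.dense_iff_topologicalClosure_eq_top]
    exact dense_span_tensor n
  · rintro _ ⟨f, rfl⟩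
    exact h f

theorem permute_tensor {n : ℕ} (σ : Equiv.Perm (Fin n)) (f : Fin n → OnePhoton) :
    permute σ (tensor f) = tensor (fun i => f (σ.symm i)) := by
  refine Lp.ext ?_
  have h1 : permute σ (tensor f) =ᵐ[powMeasure n] (tensor f) ∘ fun x i => x (σ i) :=
    Lp.coeFn_compMeasurePreserving _ (measurePreserving_permute σ)
  have h2 := (measurePreserving_permute σ).quasiMeasurePreserving.ae (coeFn_tensor f)
  filter_upwards [h1, h2, coeFn_tensor fun i => f (σ.symm i)] with x h1 h2 h3
  rw [h1, h3, Function.comp_apply, h2]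
  exact Fintype.prod_equiv σ _ _ fun i => by simp

theorem permute_mul {n : ℕ} (σ τ : Equiv.Perm (Fin n)) (Ψ : TensorPower n) :
    permute σ (permute τ Ψ) = permute (σ * τ) Ψ := by
  have : (permute σ).comp (permute τ) = permute (σ * τ) := by
    refine ext_tensor fun f => ?_
    rw [ContinuousLinearMap.comp_apply, permute_tensor, permute_tensor, permute_tensor]
    rfl
  rw [← this]; rfl

theorem mem_symPower {n : ℕ} {Ψ : TensorPower n} :
    Ψ ∈ SymPower n ↔ ∀ σ, permute σ Ψ = Ψ := by
  simp only [SymPower, Submodule.mem_iInf, LinearMap.mem_ker]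
  refine forall_congr' fun σ => ?_
  exact sub_eq_zero

theorem inner_permute {n : ℕ} (σ : Equiv.Perm (Fin n)) (Ψ Φ : TensorPower n) :
    inner ℂ (permute σ Ψ) (permute σ Φ) = inner ℂ Ψ Φ :=
  (Lp.compMeasurePreservingₗᵢ ℂ _ (measurePreserving_permute σ)).inner_map_map Ψ Φ

/-- The symmetrizer. -/
noncomputable def symmetrize (n : ℕ) : TensorPower n →L[ℂ] SymPower n :=
  (SymPower n).orthogonalProjectionOnto

/-- The average over permutations is invariant, and each permutation preserves inner products with
invariant vectors, so Ψ minus its average is orthogonal to `SymPower n`. -/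
theorem symmetrize_eq {n : ℕ} (Ψ : TensorPower n) :
    (symmetrize n Ψ : TensorPower n)
      = ((Nat.factorial n : ℕ) : ℂ)⁻¹ • ∑ σ : Equiv.Perm (Fin n), permute σ Ψ := by
  have hn : ((Nat.factorial n : ℕ) : ℂ) ≠ 0 := by exact_mod_cast Nat.factorial_ne_zero n
  refine Submodule.eq_starProjection_of_mem_of_inner_eq_zero (K := SymPower n) ?_ fun Φ hΦ => ?_
  · rw [mem_symPower]
    intro τ
    rw [map_smul, map_sum]
    congr 1
    simp only [permute_mul]
    exact Fintype.sum_equiv (Equiv.mulLeft τ) _ _ fun σ => rfl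
  · have h1 : ∀ σ : Equiv.Perm (Fin n), inner ℂ (permute σ Ψ) Φ = inner ℂ Ψ Φ := by
      intro σ
      conv_lhs => rw [← mem_symPower.1 hΦ σ]
      exact inner_permute σ Ψ Φ
    rw [inner_sub_left, inner_smul_left, sum_inner]
    simp only [h1, Finset.sum_const, Finset.card_univ, Fintype.card_perm, Fintype.card_fin,
      nsmul_eq_mul, map_inv₀, map_natCast]
    rw [inv_mul_cancel_left₀ hn, sub_self]

theorem inner_symmetrize_left {n : ℕ} (Ψ : TensorPower n) (Φ : SymPower n) :
    inner ℂ (symmetrize n Ψ) Φ = inner ℂ Ψ (Φ : TensorPower n) :=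
  Submodule.inner_orthogonalProjectionOnto_eq_of_mem_right Φ Ψ

theorem inner_symmetrize_tensor {n : ℕ} (f g : Fin n → OnePhoton) :
    inner ℂ (symmetrize n (tensor f)) (symmetrize n (tensor g))
      = ((Nat.factorial n : ℕ) : ℂ)⁻¹ *
        ∑ σ : Equiv.Perm (Fin n), ∏ i, inner ℂ (f i) (g (σ i)) := by
  rw [inner_symmetrize_left, symmetrize_eq, inner_smul_right, inner_sum]
  congr 1
  simp only [permute_tensor, inner_tensor]
  exact Fintype.sum_equiv (Equiv.inv _) _ _ fun σ => rfl

theorem symTensor_eq {n : ℕ} (f : Fin n → OnePhoton) :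
    symTensor f = lp.single 2 n (symmetrize n (tensor f)) := rfl

theorem inner_symTensor_left {n : ℕ} (f : Fin n → OnePhoton) (Ψ : Fock) :
    inner ℂ (symTensor f) Ψ = inner ℂ (tensor f) (Ψ n : TensorPower n) := by
  rw [symTensor_eq, lp.inner_single_left, inner_symmetrize_left]

theorem inner_symTensor {n : ℕ} (f g : Fin n → OnePhoton) :
    inner ℂ (symTensor f) (symTensor g) = ((Nat.factorial n : ℕ) : ℂ)⁻¹ *
        ∑ σ : Equiv.Perm (Fin n), ∏ i, inner ℂ (f i) (g (σ i)) := by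
  rw [symTensor_eq, lp.inner_single_left, symTensor_eq, lp.single_apply_self,
    inner_symmetrize_tensor]

theorem inner_symTensor_of_ne {n m : ℕ} (h : n ≠ m) (f : Fin n → OnePhoton)
    (g : Fin m → OnePhoton) : inner ℂ (symTensor f) (symTensor g) = 0 := by
  rw [symTensor_eq, lp.inner_single_left, symTensor_eq, lp.single_apply_ne _ _ _ h,
    inner_zero_right]

theorem eq_zero_of_inner_symTensor {Ψ : Fock}
    (h : ∀ (n : ℕ) (f : Fin n → OnePhoton), inner ℂ (symTensor f) Ψ = 0) : Ψ = 0 := by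
  ext n : 2
  refine Subtype.ext (eq_zero_of_inner_tensor fun f => ?_)
  rw [← inner_symTensor_left, h]

theorem dense_span_symTensor :
    (Submodule.span ℂ (Set.range fun s : Σ n : ℕ, Fin n → OnePhoton =>
      symTensor s.2)).topologicalClosure = ⊤ := by
  rw [Submodule.topologicalClosure_eq_top_iff, Submodule.eq_bot_iff]
  intro h hh
  refine eq_zero_of_inner_symTensor fun n f => ?_
  exact (Submodule.mem_orthogonal _ _).1 hh _ (Submodule.subset_span ⟨⟨n, f⟩, rfl⟩)

/-- A vector that is orthogonal to all product vectors with factors in a total set vanishes on all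
product vectors. -/
theorem inner_tensor_eq_zero_of_total {n : ℕ} {T : Set OnePhoton}
    (hT : ∀ h : OnePhoton, (∀ t ∈ T, inner ℂ h t = 0) → h = 0) {Ψ : TensorPower n}
    (h : ∀ f : Fin n → OnePhoton, (∀ i, f i ∈ T) → inner ℂ Ψ (tensor f) = 0) : Ψ = 0 := by
  have hd : (Submodule.span ℂ T).topologicalClosure = ⊤ := by
    rw [Submodule.topologicalClosure_eq_top_iff, Submodule.eq_bot_iff]
    intro a ha
    exact hT a fun t ht => (Submodule.mem_orthogonal' _ _).1 ha _ (Submodule.subset_span ht)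
  -- The factors are released one at a time: s is the set of slots that may hold any vector. In each
  -- slot the pairing is a bounded linear functional vanishing on a total set.
  have key : ∀ s : Finset (Fin n), ∀ f : Fin n → OnePhoton, (∀ i, i ∉ s → f i ∈ T) →
      inner ℂ Ψ (tensor f) = 0 := by
    intro s
    induction s using Finset.induction_on with
    | empty => exact fun f hf => h f fun i => hf i (Finset.notMem_empty i)
    | insert a s ha ih =>
      intro f hf
      let L : OnePhoton →L[ℂ] ℂ := (innerSL ℂ Ψ).comp ((tensorM n).toContinuousLinearMap f a)
      have hL : ∀ x, L x = inner ℂ Ψ (tensor (Function.update f a x)) := fun x => rfl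
      have h0 : L = 0 := by
        refine ContinuousLinearMap.ext_on (s := T) ?_ ?_
        · rw [Submodule.dense_iff_topologicalClosure_eq_top]
          exact hd
        · intro t ht
          rw [hL]
          refine ih _ fun i hi => ?_
          by_cases hia : i = a
          · subst hia; rwa [Function.update_self]
          · rw [Function.update_of_ne hia]
            exact hf i (by simp [hia, hi])
      have h1 := hL (f a)
      rw [Function.update_eq_self, h0] at h1
      exact h1.symm
  refine eq_zero_of_inner_tensor fun f => ?_
  rw [← inner_conj_symm, key Finset.univ f (fun i hi => absurd (Finset.mem_univ i) hi), map_zero]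

theorem eq_zero_of_inner_symTensor_total {T : Set OnePhoton}
    (hT : ∀ h : OnePhoton, (∀ t ∈ T, inner ℂ h t = 0) → h = 0) {Ψ : Fock}
    (h : ∀ (n : ℕ) (f : Fin n → OnePhoton), (∀ i, f i ∈ T) → inner ℂ Ψ (symTensor f) = 0) :
    Ψ = 0 := by
  ext n : 2
  refine Subtype.ext (inner_tensor_eq_zero_of_total hT fun f hf => ?_)
  have := h n f hf
  rw [← inner_conj_symm, inner_symTensor_left, inner_conj_symm] at this
  exact this

end Tensors

end DiracPolaron
namespace DiracPolaron

/-! ### The operators Γ(u) and dΓ(T) -/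

section SecondQuantization

theorem symTensor_update_smul {n : ℕ} (f : Fin n → OnePhoton) (i : Fin n) (c : ℂ) (x : OnePhoton) :
    symTensor (Function.update f i (c • x)) = c • symTensor (Function.update f i x) := by
  rw [symTensor_eq, symTensor_eq, ← tensorM_apply, ← tensorM_apply,
    ContinuousMultilinearMap.map_update_smul, map_smul, lp.single_smul]

/-- Two bounded operators that agree on symmetrized product vectors are equal. -/
theorem ext_symTensor {F : Type*} [NormedAddCommGroup F] [NormedSpace ℂ F]
    {S T : Fock →L[ℂ] F}
    (h : ∀ (n : ℕ) (f : Fin n → OnePhoton), S (symTensor f) = T (symTensor f)) : S = T := by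
  refine ContinuousLinearMap.ext_on
    (s := Set.range fun s : Σ n : ℕ, Fin n → OnePhoton => symTensor s.2) ?_ ?_
  · rw [Submodule.dense_iff_topologicalClosure_eq_top]
    exact dense_span_symTensor
  · rintro _ ⟨⟨n, f⟩, rfl⟩
    exact h n f

section Gamma

variable {u v : OnePhoton →ₗ[ℂ] OnePhoton}

theorem inner_symTensor_map (hu : ∀ f g, inner ℂ (u f) (u g) = inner ℂ f g) {n m : ℕ}
    (f : Fin n → OnePhoton) (g : Fin m → OnePhoton) :
    inner ℂ (symTensor fun i => u (f i)) (symTensor fun i => u (g i))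
      = inner ℂ (symTensor f) (symTensor g) := by
  by_cases h : n = m
  · subst h
    simp only [inner_symTensor, hu]
  · rw [inner_symTensor_of_ne h, inner_symTensor_of_ne h]

/-- The extension by density has the intended values only when a norm bound holds. Here u preserves
all inner products of symmetrized product vectors, so the bound holds with constant 1. -/
theorem Gamma_symTensor (hu : ∀ f g, inner ℂ (u f) (u g) = inner ℂ f g) {n : ℕ}
    (f : Fin n → OnePhoton) : Gamma u (symTensor f) = symTensor fun i => u (f i) := by
  have hd : DenseRange (Finsupp.linearCombination ℂ
      (fun s : Σ n : ℕ, Fin n → OnePhoton => symTensor s.2)) := by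
    rw [DenseRange, ← LinearMap.coe_range, Submodule.dense_iff_topologicalClosure_eq_top,
      Finsupp.range_linearCombination]
    exact dense_span_symTensor
  have hn : ∀ x : (Σ n : ℕ, Fin n → OnePhoton) →₀ ℂ,
      ‖Finsupp.linearCombination ℂ
        (fun s : Σ n : ℕ, Fin n → OnePhoton => symTensor (fun i => u (s.2 i))) x‖
      ≤ 1 * ‖Finsupp.linearCombination ℂ
        (fun s : Σ n : ℕ, Fin n → OnePhoton => symTensor s.2) x‖ := by
    intro x
    rw [one_mul, ← sq_le_sq₀ (norm_nonneg _) (norm_nonneg _), ← inner_self_eq_norm_sq (𝕜 := ℂ),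
      ← inner_self_eq_norm_sq (𝕜 := ℂ)]
    refine le_of_eq (congrArg _ ?_)
    simp only [Finsupp.linearCombination_apply, Finsupp.sum, sum_inner, inner_sum, inner_smul_left,
      inner_smul_right, inner_symTensor_map hu]
  have h := LinearMap.extendOfNorm_eq hd ⟨1, hn⟩ (Finsupp.single ⟨n, f⟩ 1)
  rw [Finsupp.linearCombination_single, Finsupp.linearCombination_single, one_smul, one_smul] at h
  exact h

theorem inner_Gamma (hu : ∀ f g, inner ℂ (u f) (u g) = inner ℂ f g) (Ψ Φ : Fock) :
    inner ℂ (Gamma u Ψ) (Gamma u Φ) = inner ℂ Ψ Φ := by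
  have h : (ContinuousLinearMap.adjoint (Gamma u)).comp (Gamma u)
      = ContinuousLinearMap.id ℂ Fock := by
    refine ext_symTensor fun n f => ?_
    rw [← sub_eq_zero]
    refine eq_zero_of_inner_symTensor fun m g => ?_
    rw [inner_sub_right, ContinuousLinearMap.comp_apply, ContinuousLinearMap.adjoint_inner_right,
      Gamma_symTensor hu, Gamma_symTensor hu, inner_symTensor_map hu]
    exact sub_self _
  rw [← ContinuousLinearMap.adjoint_inner_right, ← ContinuousLinearMap.comp_apply, h]
  rfl

theorem Gamma_Gamma (hu : ∀ f g, inner ℂ (u f) (u g) = inner ℂ f g)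
    (hv : ∀ f g, inner ℂ (v f) (v g) = inner ℂ f g) (Ψ : Fock) :
    Gamma u (Gamma v Ψ) = Gamma (u ∘ₗ v) Ψ := by
  have h : (Gamma u).comp (Gamma v) = Gamma (u ∘ₗ v) := by
    refine ext_symTensor fun n f => ?_
    rw [ContinuousLinearMap.comp_apply, Gamma_symTensor hv, Gamma_symTensor hu,
      Gamma_symTensor (u := u ∘ₗ v) fun f g => (hu (v f) (v g)).trans (hv f g)]
    rfl
  rw [← h]; rfl

theorem Gamma_id (Ψ : Fock) : Gamma LinearMap.id Ψ = Ψ := by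
  have h : Gamma LinearMap.id = ContinuousLinearMap.id ℂ Fock := by
    refine ext_symTensor fun n f => ?_
    rw [Gamma_symTensor fun f g => rfl]
    rfl
  rw [h]; rfl

/-- The second quantization of a unitary operator, as a unitary operator. -/
noncomputable def GammaEquiv (u : OnePhoton ≃ₗᵢ[ℂ] OnePhoton) : Fock ≃ₗᵢ[ℂ] Fock where
  toLinearEquiv := LinearEquiv.ofLinearMap (Gamma u.toLinearEquiv.toLinearMap).toLinearMap
    (Gamma u.symm.toLinearEquiv.toLinearMap).toLinearMap
    (LinearMap.ext fun Ψ => by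
      refine (Gamma_Gamma u.inner_map_map u.symm.inner_map_map Ψ).trans ?_
      rw [show u.toLinearEquiv.toLinearMap ∘ₗ u.symm.toLinearEquiv.toLinearMap = LinearMap.id from
        LinearMap.ext u.apply_symm_apply]
      exact Gamma_id Ψ)
    (LinearMap.ext fun Ψ => by
      refine (Gamma_Gamma u.symm.inner_map_map u.inner_map_map Ψ).trans ?_
      rw [show u.symm.toLinearEquiv.toLinearMap ∘ₗ u.toLinearEquiv.toLinearMap = LinearMap.id from
        LinearMap.ext u.symm_apply_apply]
      exact Gamma_id Ψ)
  norm_map' Ψ := by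
    rw [← sq_eq_sq₀ (norm_nonneg _) (norm_nonneg _), ← inner_self_eq_norm_sq (𝕜 := ℂ),
      ← inner_self_eq_norm_sq (𝕜 := ℂ)]
    exact congrArg _ (inner_Gamma u.inner_map_map Ψ Ψ)

theorem GammaEquiv_symTensor (u : OnePhoton ≃ₗᵢ[ℂ] OnePhoton) {n : ℕ} (f : Fin n → OnePhoton) :
    GammaEquiv u (symTensor f) = symTensor fun i => u (f i) :=
  Gamma_symTensor u.inner_map_map f

end Gamma

section DGamma

variable {T T' : OnePhoton →ₗ.[ℂ] OnePhoton}

/-- The linear span of the pairs that define `dΓ(T)`. -/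
noncomputable def dGammaSpan (T : OnePhoton →ₗ.[ℂ] OnePhoton) : Submodule ℂ (Fock × Fock) :=
  Submodule.span ℂ {Ψ : Fock × Fock | ∃ (n : ℕ) (f : Fin n → T.domain),
    Ψ = (symTensor (fun i => (f i : OnePhoton)),
      ∑ i, symTensor (Function.update (fun l => (f l : OnePhoton)) i (T (f i))))}

/-- Both sides are sums over pairs of a slot and a permutation σ. The term with T on slot i on the
left equals the term with T on slot σ i on the right. -/
theorem inner_dGamma_generators (hT : SymmetricGraph T.graph) {n : ℕ} (f g : Fin n → T.domain) :
    inner ℂ (∑ i, symTensor (Function.update (fun l => (f l : OnePhoton)) i (T (f i))))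
        (symTensor fun i => (g i : OnePhoton))
      = inner ℂ (symTensor fun i => (f i : OnePhoton))
        (∑ i, symTensor (Function.update (fun l => (g l : OnePhoton)) i (T (g i)))) := by
  rw [sum_inner, inner_sum]
  simp only [inner_symTensor]
  rw [← Finset.mul_sum, ← Finset.mul_sum, Finset.sum_comm, Finset.sum_comm (s := Finset.univ)
    (t := Finset.univ) (f := fun i (σ : Equiv.Perm (Fin n)) => ∏ l, inner ℂ (f l : OnePhoton)
      (Function.update (fun l => (g l : OnePhoton)) i (T (g i)) (σ l)))]
  congr 1
  refine Finset.sum_congr rfl fun σ _ => ?_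
  refine Fintype.sum_equiv σ _ _ fun i => ?_
  rw [← Finset.mul_prod_erase _ _ (Finset.mem_univ i), ← Finset.mul_prod_erase _
    (fun l => inner ℂ (f l : OnePhoton) _) (Finset.mem_univ i)]
  rw [Function.update_self, Function.update_self]
  congr 1
  · exact hT _ (T.mem_graph (f i)) _ (T.mem_graph (g (σ i)))
  · refine Finset.prod_congr rfl fun l hl => ?_
    have hl' := Finset.ne_of_mem_erase hl
    rw [Function.update_of_ne hl', Function.update_of_ne fun h => hl' (σ.injective h)]

theorem symmetricGraph_dGammaSpan (hT : SymmetricGraph T.graph) :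
    SymmetricGraph (dGammaSpan T) := by
  refine SymmetricGraph.span ?_
  rintro _ ⟨n, f, rfl⟩ _ ⟨m, g, rfl⟩
  by_cases h : n = m
  · subst h
    exact inner_dGamma_generators hT f g
  · simp only [sum_inner, inner_sum, inner_symTensor_of_ne h, Finset.sum_const_zero]



/-- `T` is symmetric and densely defined. -/
def IsDenseSymmetric (T : OnePhoton →ₗ.[ℂ] OnePhoton) : Prop :=
  SymmetricGraph T.graph ∧ ∀ h : OnePhoton, (∀ x ∈ T.domain, inner ℂ h x = 0) → h = 0

/-- `Submodule.toLinearPMap` keeps a relation intact only if it is single-valued. The closed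
relation is symmetric, and products of vectors from the domain of T are total, so 0 has the only
value 0. -/
theorem dGamma_graph (hT : IsDenseSymmetric T) :
    (dGamma T).graph = (dGammaSpan T).topologicalClosure := by
  refine Submodule.toLinearPMap_graph_eq _ fun x hx h0 => ?_
  refine (symmetricGraph_dGammaSpan hT.1).closure.eq_zero (fun h hh => ?_) x hx h0
  refine eq_zero_of_inner_symTensor_total (T := T.domain) hT.2 fun n f hf => ?_
  exact hh _ (subset_closure (Submodule.subset_span ⟨n, fun i => ⟨f i, hf i⟩, rfl⟩))

theorem isClosed_dGamma_graph (hT : IsDenseSymmetric T) :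
    IsClosed ((dGamma T).graph : Set (Fock × Fock)) := by
  rw [dGamma_graph hT]
  exact Submodule.isClosed_topologicalClosure _

theorem symmetricGraph_dGamma (hT : IsDenseSymmetric T) : SymmetricGraph (dGamma T).graph := by
  rw [dGamma_graph hT]
  exact (symmetricGraph_dGammaSpan hT.1).closure

theorem symTensor_mem_dGamma_graph (hT : IsDenseSymmetric T) {n : ℕ} {f g : Fin n → OnePhoton}
    (h : ∀ i, (f i, g i) ∈ T.graph) :
    (symTensor f, ∑ i, symTensor (Function.update f i (g i))) ∈ (dGamma T).graph := by
  rw [dGamma_graph hT]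
  refine subset_closure (Submodule.subset_span
    ⟨n, fun i => ⟨f i, T.mem_domain_of_mem_graph (h i)⟩, ?_⟩)
  congr 1
  refine Finset.sum_congr rfl fun i _ => ?_
  obtain ⟨y, h1, h2⟩ := (LinearPMap.mem_graph_iff T).1 (h i)
  have : (⟨f i, T.mem_domain_of_mem_graph (h i)⟩ : T.domain) = y := Subtype.ext h1.symm
  beta_reduce
  rw [this, h2]

/-- Induction for closed properties of the graph of `dΓ(T)`. -/
theorem dGamma_graph_le (hT : IsDenseSymmetric T) {G : Submodule ℂ (Fock × Fock)}
    (hG : IsClosed (G : Set (Fock × Fock)))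
    (h : ∀ (n : ℕ) (f g : Fin n → OnePhoton), (∀ i, (f i, g i) ∈ T.graph) →
      (symTensor f, ∑ i, symTensor (Function.update f i (g i))) ∈ G) :
    (dGamma T).graph ≤ G := by
  rw [dGamma_graph hT]
  refine Submodule.topologicalClosure_minimal _ (Submodule.span_le.2 ?_) hG
  rintro _ ⟨n, f, rfl⟩
  exact h n _ _ fun i => T.mem_graph (f i)

theorem dGamma_eigenvector (hT : IsDenseSymmetric T) {n : ℕ} {f : Fin n → OnePhoton}
    {z : Fin n → ℂ} (h : ∀ i, (f i, z i • f i) ∈ T.graph) :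
    (symTensor f, (∑ i, z i) • symTensor f) ∈ (dGamma T).graph := by
  have := symTensor_mem_dGamma_graph hT h
  simpa only [symTensor_update_smul, Function.update_eq_self, ← Finset.sum_smul] using this

/-- Transport of `dΓ(T)` by a unitary operator. -/
theorem GammaEquiv_mem_dGamma_graph (hT : IsDenseSymmetric T) (hT' : IsDenseSymmetric T')
    (u : OnePhoton ≃ₗᵢ[ℂ] OnePhoton) (c : ℂ)
    (h : ∀ x ∈ T.graph, (u x.1, c • u x.2) ∈ T'.graph) (X : Fock × Fock)
    (hX : X ∈ (dGamma T).graph) :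
    (GammaEquiv u X.1, c • GammaEquiv u X.2) ∈ (dGamma T').graph := by
  let L : Fock × Fock →L[ℂ] Fock × Fock :=
    (((GammaEquiv u).toContinuousLinearEquiv : Fock →L[ℂ] Fock).prodMap
      (c • ((GammaEquiv u).toContinuousLinearEquiv : Fock →L[ℂ] Fock)))
  refine dGamma_graph_le hT (G := (dGamma T').graph.comap L.toLinearMap)
    ((isClosed_dGamma_graph hT').preimage L.continuous) (fun n f g hfg => ?_) hX
  change (GammaEquiv u (symTensor f),
    c • GammaEquiv u (∑ i, symTensor (Function.update f i (g i)))) ∈ (dGamma T').graph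
  have h1 := symTensor_mem_dGamma_graph hT' (f := fun i => u (f i)) (g := fun i => c • u (g i))
    fun i => h _ (hfg i)
  convert h1 using 2
  · exact GammaEquiv_symTensor u f
  · rw [map_sum, Finset.smul_sum]
    refine Finset.sum_congr rfl fun i _ => ?_
    rw [symTensor_update_smul, GammaEquiv_symTensor]
    congr 2
    ext1 l
    by_cases hl : l = i
    · subst hl; simp
    · simp [Function.update_of_ne hl]

end DGamma

theorem mem_conjugate_graph (U : Fock ≃ₗᵢ[ℂ] Fock) {V : Fock →L[ℂ] Fock}
    (hV : ∀ Ψ, V Ψ = U Ψ) (A : Fock →ₗ.[ℂ] Fock) (x : Fock × Fock) :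
    x ∈ (conjugate V A).graph ↔ (U.symm x.1, U.symm x.2) ∈ A.graph := by
  have hadj : ∀ Ψ, ContinuousLinearMap.adjoint V Ψ = U.symm Ψ := by
    intro Ψ
    refine ext_inner_left ℂ fun Φ => ?_
    rw [ContinuousLinearMap.adjoint_inner_right, hV, ← U.inner_map_map Φ, U.apply_symm_apply]
  rw [LinearPMap.mem_graph_iff, LinearPMap.mem_graph_iff]
  constructor
  · rintro ⟨y, h1, h2⟩
    refine ⟨⟨ContinuousLinearMap.adjoint V y, y.2⟩, ?_, ?_⟩
    · rw [← h1]; exact hadj _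
    · rw [← h2]
      change _ = U.symm (V _)
      rw [hV, U.symm_apply_apply]
      rfl
  · rintro ⟨y, h1, h2⟩
    have hy : ContinuousLinearMap.adjoint V x.1 = y := (hadj _).trans h1.symm
    have hx : x.1 ∈ (conjugate V A).domain := by
      change ContinuousLinearMap.adjoint V x.1 ∈ A.domain
      rw [hy]; exact y.2
    refine ⟨⟨x.1, hx⟩, rfl, ?_⟩
    change V (A ⟨ContinuousLinearMap.adjoint V x.1, hx⟩) = x.2
    have : (⟨ContinuousLinearMap.adjoint V x.1, hx⟩ : A.domain) = y := Subtype.ext hy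
    rw [this, h2, hV, U.apply_symm_apply]

theorem mem_ampliation_graph (A : Fock →ₗ.[ℂ] Fock) (Ψ Φ : StateSpace) :
    (Ψ, Φ) ∈ (ampliation A).graph ↔ ∀ i, (Ψ i, Φ i) ∈ A.graph := by
  rw [LinearPMap.mem_graph_iff]
  constructor
  · rintro ⟨y, h1, h2⟩ i
    simp only at h1 h2
    rw [← h1, ← h2]
    exact A.mem_graph ⟨_, y.2 i⟩
  · intro h
    refine ⟨⟨Ψ, fun i => A.mem_domain_of_mem_graph (h i)⟩, rfl, ?_⟩
    ext1 i
    exact A.mem_graph_snd_inj (A.mem_graph ⟨Ψ i, A.mem_domain_of_mem_graph (h i)⟩) (h i) rfl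

end SecondQuantization

end DiracPolaron
namespace DiracPolaron

/-! ### Multiplication operators and their second quantization -/

section MultiplicationOperators

theorem mem_mulOp_graph {φ : E3 → ℝ} {F : OnePhoton × OnePhoton} :
    F ∈ (mulOp φ).graph ↔ F.2 =ᵐ[photonMeasure] fun x => (φ x.1 : ℂ) * F.1 x := by
  rw [mulOp, Submodule.toLinearPMap_graph_eq]
  · rfl
  · intro x hx h0
    have hx' : x.2 =ᵐ[photonMeasure] fun y => (φ y.1 : ℂ) * x.1 y := hx
    rw [Lp.eq_zero_iff_ae_eq_zero]
    rw [Lp.eq_zero_iff_ae_eq_zero] at h0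
    filter_upwards [hx', h0] with y h1 h2
    rw [h1, h2, Pi.zero_apply, mul_zero]

variable {φ : E3 → ℝ} (hφ : Measurable φ)

/-- The configurations on which `|φ| ≤ N` for all photons. -/
def boundedSet (φ : E3 → ℝ) (N : ℕ) : Set Photon := {x | |φ x.1| ≤ N}

/-- The number `∑ᵢ φ(kᵢ)`. -/
def sumFn (φ : E3 → ℝ) {n : ℕ} (x : Fin n → Photon) : ℝ := ∑ i, φ (x i).1

include hφ in
theorem measurableSet_boundedSet (N : ℕ) : MeasurableSet (boundedSet φ N) :=
  measurableSet_le (hφ.comp measurable_fst).abs measurable_const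

include hφ in
theorem measurable_sumFn {n : ℕ} : Measurable (sumFn φ (n := n)) := by
  unfold sumFn
  exact Finset.measurable_sum _ fun i _ =>
    hφ.comp (measurable_fst.comp (measurable_pi_apply i))

include hφ in
-- Cutting f off to the region |φ| ≤ N makes the product with φ square integrable. These vectors
-- serve as test functions in the domain.
theorem exists_mulOp_cutoff (N : ℕ) (f : OnePhoton) : ∃ F ∈ (mulOp φ).graph,
    F.1 =ᵐ[photonMeasure] (boundedSet φ N).indicator f := by
  have h1 : MemLp ((boundedSet φ N).indicator f) 2 photonMeasure :=
    (Lp.memLp f).indicator (measurableSet_boundedSet hφ N)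
  have hm : AEStronglyMeasurable (fun x : Photon => (φ x.1 : ℂ)) photonMeasure :=
    (Complex.measurable_ofReal.comp (hφ.comp measurable_fst)).aestronglyMeasurable
  have h2 : MemLp (fun x => (φ x.1 : ℂ) * (boundedSet φ N).indicator f x) 2 photonMeasure := by
    refine (Lp.memLp f).of_le_mul (c := N) (hm.mul h1.1) (Filter.Eventually.of_forall fun x => ?_)
    by_cases hx : x ∈ boundedSet φ N
    · rw [Set.indicator_of_mem hx, norm_mul, Complex.norm_real]
      exact mul_le_mul_of_nonneg_right hx (norm_nonneg _)
    · rw [Set.indicator_of_notMem hx, mul_zero, norm_zero]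
      positivity
  refine ⟨(h1.toLp _, h2.toLp _), mem_mulOp_graph.2 ?_, h1.coeFn_toLp⟩
  filter_upwards [h1.coeFn_toLp, h2.coeFn_toLp] with x e1 e2
  rw [e1, e2]

include hφ in
theorem isDenseSymmetric_mulOp : IsDenseSymmetric (mulOp φ) := by
  constructor
  · intro F hF G hG
    rw [mem_mulOp_graph] at hF hG
    rw [L2.inner_def, L2.inner_def]
    refine integral_congr_ae ?_
    filter_upwards [hF, hG] with x h1 h2
    rw [h1, h2, RCLike.inner_apply, RCLike.inner_apply, map_mul]
    simp only [Complex.conj_ofReal]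
    ring
  · intro h hh
    have key : ∀ N : ℕ, ∀ᵐ x ∂photonMeasure, x ∈ boundedSet φ N → h x = 0 := by
      intro N
      obtain ⟨F, hF, hF1⟩ := exists_mulOp_cutoff hφ N h
      have h0 := hh _ ((mulOp φ).mem_domain_of_mem_graph (x := F.1) (y := F.2) hF)
      have h1 : inner ℂ F.1 F.1 = (0 : ℂ) := by
        rw [← h0, L2.inner_def, L2.inner_def]
        refine integral_congr_ae ?_
        filter_upwards [hF1] with x hx
        rw [hx]
        by_cases hxN : x ∈ boundedSet φ N
        · rw [Set.indicator_of_mem hxN]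
        · rw [Set.indicator_of_notMem hxN, inner_zero_right, inner_zero_right]
      have h2 : F.1 = 0 := inner_self_eq_zero.1 h1
      rw [Lp.eq_zero_iff_ae_eq_zero] at h2
      filter_upwards [hF1, h2] with x e1 e2 hx
      rw [e2, Set.indicator_of_mem hx] at e1
      exact e1.symm
    rw [Lp.eq_zero_iff_ae_eq_zero]
    filter_upwards [ae_all_iff.2 key] with x hx
    obtain ⟨N, hN⟩ := exists_nat_ge |φ x.1|
    exact hx N hN

theorem sum_tensor_update_ae {n : ℕ} {f g : Fin n → OnePhoton}
    (h : ∀ i, (f i, g i) ∈ (mulOp φ).graph) :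
    ((∑ i, tensor (Function.update f i (g i)) : TensorPower n) : (Fin n → Photon) → ℂ)
      =ᵐ[powMeasure n] fun x => (sumFn φ x : ℂ) * ∏ i, f i (x i) := by
  have h1 : ∀ᵐ x ∂(powMeasure n), ∀ i, tensor (Function.update f i (g i)) x
      = ∏ l, Function.update f i (g i) l (x l) :=
    ae_all_iff.2 fun i => coeFn_tensor _
  have h2 : ∀ᵐ x ∂(powMeasure n), ∀ i, g i (x i) = (φ (x i).1 : ℂ) * f i (x i) :=
    ae_all_iff.2 fun i => ae_eval i (mem_mulOp_graph.1 (h i))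
  filter_upwards [Lp.coeFn_finsetSum (Finset.univ)
    (fun i => tensor (Function.update f i (g i))), h1, h2] with x e0 e1 e2
  rw [e0, Finset.sum_apply]
  simp only [e1, sumFn, Complex.ofReal_sum, Finset.sum_mul]
  refine Finset.sum_congr rfl fun i _ => ?_
  rw [← Finset.mul_prod_erase _ _ (Finset.mem_univ i),
    ← Finset.mul_prod_erase _ (fun i => f i (x i)) (Finset.mem_univ i), Function.update_self, e2,
    mul_assoc]
  congr 2
  exact Finset.prod_congr rfl fun l hl => by rw [Function.update_of_ne (Finset.ne_of_mem_erase hl)]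

theorem inner_eq_of_mul {n : ℕ} {a b : TensorPower n}
    (hab : b =ᵐ[powMeasure n] fun x => (sumFn φ x : ℂ) * a x) {f g : Fin n → OnePhoton}
    (h : ∀ i, (f i, g i) ∈ (mulOp φ).graph) :
    inner ℂ b (tensor f) = inner ℂ a (∑ i, tensor (Function.update f i (g i))) := by
  rw [L2.inner_def, L2.inner_def]
  refine integral_congr_ae ?_
  filter_upwards [hab, coeFn_tensor f, sum_tensor_update_ae h] with x h1 h2 h3
  rw [h1, h2, h3, RCLike.inner_apply, RCLike.inner_apply, map_mul, Complex.conj_ofReal]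
  ring

include hφ in
-- A weak identity becomes a pointwise one. Restricted to configurations with |φ| ≤ N for every
-- photon, both b and the product of ∑ᵢ φ(kᵢ) with a are square integrable, and product vectors with
-- cut-off factors show that they agree; then N is arbitrary.
theorem mul_of_inner_eq {n : ℕ} {a b : TensorPower n}
    (hab : ∀ f g : Fin n → OnePhoton, (∀ i, (f i, g i) ∈ (mulOp φ).graph) →
      inner ℂ b (tensor f) = inner ℂ a (∑ i, tensor (Function.update f i (g i)))) :
    b =ᵐ[powMeasure n] fun x => (sumFn φ x : ℂ) * a x := by
  have key : ∀ N : ℕ, ∀ᵐ x ∂(powMeasure n), (∀ i, x i ∈ boundedSet φ N) →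
      b x = (sumFn φ x : ℂ) * a x := by
    intro N
    set C : Set (Fin n → Photon) := Set.univ.pi fun _ => boundedSet φ N with hC
    have hCm : MeasurableSet C := MeasurableSet.univ_pi fun _ => measurableSet_boundedSet hφ N
    have hsm : AEStronglyMeasurable (fun x : Fin n → Photon => (sumFn φ x : ℂ)) (powMeasure n) :=
      (Complex.measurable_ofReal.comp (measurable_sumFn hφ)).aestronglyMeasurable
    have hν : MemLp (C.indicator fun x => (sumFn φ x : ℂ) * a x) 2 (powMeasure n) := by
      refine (Lp.memLp a).of_le_mul (c := n * N) ((hsm.mul (Lp.aestronglyMeasurable a)).indicator hCm)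
        (Filter.Eventually.of_forall fun x => ?_)
      by_cases hx : x ∈ C
      · rw [Set.indicator_of_mem hx, norm_mul, Complex.norm_real]
        refine mul_le_mul_of_nonneg_right ?_ (norm_nonneg _)
        calc ‖sumFn φ x‖ ≤ ∑ i, ‖φ (x i).1‖ := norm_sum_le _ _
          _ ≤ ∑ _i : Fin n, (N : ℝ) := Finset.sum_le_sum fun i _ => hx i trivial
          _ = n * N := by simp
      · rw [Set.indicator_of_notMem hx, norm_zero]; positivity
    have hb : MemLp (C.indicator b) 2 (powMeasure n) := (Lp.memLp b).indicator hCm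
    have hzero : hb.toLp _ = hν.toLp _ := by
      rw [← sub_eq_zero]
      refine eq_zero_of_inner_tensor fun f => ?_
      choose F hF hF1 using fun i => exists_mulOp_cutoff hφ N (f i)
      have h1 := hab (fun i => (F i).1) (fun i => (F i).2) hF
      have hcut : ∀ᵐ x ∂(powMeasure n), (∏ i, (F i).1 (x i)) = C.indicator (tensor f) x := by
        filter_upwards [ae_all_iff.2 fun i => ae_eval i (hF1 i), coeFn_tensor f] with x e1 e2
        simp only [e1]
        by_cases hx : x ∈ C
        · rw [Set.indicator_of_mem hx, e2]
          exact Finset.prod_congr rfl fun i _ => Set.indicator_of_mem (hx i trivial) _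
        · rw [Set.indicator_of_notMem hx]
          obtain ⟨i, hi⟩ : ∃ i, x i ∉ boundedSet φ N := by simpa [hC, Set.mem_pi] using hx
          exact Finset.prod_eq_zero (Finset.mem_univ i) (Set.indicator_of_notMem hi _)
      have h2 : inner ℂ (hb.toLp _) (tensor f) = inner ℂ b (tensor fun i => (F i).1) := by
        rw [L2.inner_def, L2.inner_def]
        refine integral_congr_ae ?_
        filter_upwards [hb.coeFn_toLp, coeFn_tensor fun i => (F i).1, hcut] with x e1 e2 e3
        rw [e1, e2, e3]
        by_cases hx : x ∈ C
        · rw [Set.indicator_of_mem hx, Set.indicator_of_mem hx]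
        · rw [Set.indicator_of_notMem hx, Set.indicator_of_notMem hx, inner_zero_left,
            inner_zero_right]
      have h3 : inner ℂ (hν.toLp _) (tensor f)
          = inner ℂ a (∑ i, tensor (Function.update (fun i => (F i).1) i (F i).2)) := by
        rw [L2.inner_def, L2.inner_def]
        refine integral_congr_ae ?_
        filter_upwards [hν.coeFn_toLp, sum_tensor_update_ae hF, hcut] with x e1 e2 e3
        rw [e1, e2, e3]
        by_cases hx : x ∈ C
        · rw [Set.indicator_of_mem hx, Set.indicator_of_mem hx, RCLike.inner_apply,
            RCLike.inner_apply, map_mul, Complex.conj_ofReal]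
          ring
        · rw [Set.indicator_of_notMem hx, Set.indicator_of_notMem hx, inner_zero_left, mul_zero,
            inner_zero_right]
      rw [← inner_conj_symm, inner_sub_left, h2, h3, h1, sub_self, map_zero]
    filter_upwards [hb.coeFn_toLp, hν.coeFn_toLp] with x e1 e2 hx
    have hx' : x ∈ C := fun i _ => hx i
    rw [hzero, e2, Set.indicator_of_mem hx', Set.indicator_of_mem hx'] at e1
    exact e1.symm
  filter_upwards [ae_all_iff.2 key] with x hx
  choose N hN using fun i => exists_nat_ge |φ (x i).1|
  refine hx (Finset.univ.sup N) fun i => (hN i).trans ?_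
  exact_mod_cast Finset.le_sup (f := N) (Finset.mem_univ i)

theorem inner_symTensor_right {n : ℕ} (Ψ : Fock) (f : Fin n → OnePhoton) :
    inner ℂ Ψ (symTensor f) = inner ℂ (Ψ n : TensorPower n) (tensor f) := by
  rw [← inner_conj_symm, inner_symTensor_left, inner_conj_symm]

theorem inner_sum_symTensor {n : ℕ} {ι : Type*} (s : Finset ι) (Ψ : Fock)
    (f : ι → Fin n → OnePhoton) :
    inner ℂ Ψ (∑ i ∈ s, symTensor (f i))
      = inner ℂ (Ψ n : TensorPower n) (∑ i ∈ s, tensor (f i)) := by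
  simp only [inner_sum, inner_symTensor_right]

include hφ in
/-- `dΓ` of a multiplication operator is the maximal multiplication operator by `∑ᵢ φ(kᵢ)`. -/
theorem mem_dGamma_mulOp_graph {Ψ Φ : Fock} :
    (Ψ, Φ) ∈ (dGamma (mulOp φ)).graph ↔
      ∀ n, (Φ n : TensorPower n) =ᵐ[powMeasure n]
        fun x => (sumFn φ x : ℂ) * (Ψ n : TensorPower n) x := by
  have hT := isDenseSymmetric_mulOp hφ
  have hsym := symmetricGraph_dGamma hT
  constructor
  · intro h n
    refine mul_of_inner_eq hφ fun f g hfg => ?_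
    have := hsym _ h _ (symTensor_mem_dGamma_graph hT hfg)
    simpa only [inner_symTensor_right, inner_sum_symTensor] using this
  · intro h
    have hsa : SelfAdjointGraph (dGamma (mulOp φ)).graph := by
      refine selfAdjointGraph_of_ranges (isClosed_dGamma_graph hT) hsym one_pos
        fun s hs X hX => ?_
      ext n : 2
      refine Subtype.ext ?_
      -- A deficiency vector satisfies ∑ᵢ φ(kᵢ) X = isX pointwise. A real number is never ±i, so X
      -- vanishes almost everywhere.
      have h1 : (((s : ℂ) * Complex.I) • (X n : TensorPower n) : TensorPower n)
          =ᵐ[powMeasure n] fun x => (sumFn φ x : ℂ) * (X n : TensorPower n) x := by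
        refine mul_of_inner_eq hφ fun f g hfg => ?_
        have h2 := hX _ (symTensor_mem_dGamma_graph hT hfg)
        rw [inner_add_right, inner_sum_symTensor, inner_smul_right, inner_symTensor_right] at h2
        rw [inner_smul_left, eq_neg_of_add_eq_zero_left h2]
        simp
      have hz : (X n : TensorPower n) = 0 := by
        rw [Lp.eq_zero_iff_ae_eq_zero]
        filter_upwards [h1, Lp.coeFn_smul ((s : ℂ) * Complex.I) (X n : TensorPower n)] with x e1 e2
        rw [e2, Pi.smul_apply, smul_eq_mul] at e1
        have e3 : ((s : ℂ) * Complex.I - (sumFn φ x : ℂ)) * (X n : TensorPower n) x = 0 := by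
          rw [sub_mul, e1, sub_self]
        refine (mul_eq_zero.1 e3).resolve_left fun e4 => ?_
        have e5 := congrArg Complex.im e4
        rcases hs with rfl | rfl <;> simp at e5
      exact hz
    refine hsa.2 _ _ fun x hx => ?_
    have hle := dGamma_graph_le hT (G := LinearMap.ker
      ((innerSL ℂ Φ).comp (ContinuousLinearMap.fst ℂ Fock Fock)
        - (innerSL ℂ Ψ).comp (ContinuousLinearMap.snd ℂ Fock Fock)).toLinearMap)
      (ContinuousLinearMap.isClosed_ker _) (fun n f g hfg => ?_)
    · exact sub_eq_zero.1 (hle hx)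
    · rw [LinearMap.mem_ker]
      change inner ℂ Φ (symTensor f) - inner ℂ Ψ (∑ i, symTensor (Function.update f i (g i))) = 0
      rw [inner_symTensor_right, inner_sum_symTensor, inner_eq_of_mul (h n) hfg, sub_self]

end MultiplicationOperators

end DiracPolaron
namespace DiracPolaron

/-! ### Adding and contracting one photon; the commutation relation -/

section Prepend

theorem measurePreserving_headTail (n : ℕ) :
    MeasurePreserving (fun x : Fin (n + 1) → Photon => (x 0, fun i : Fin n => x i.succ))
      (powMeasure (n + 1)) (photonMeasure.prod (powMeasure n)) :=
  measurePreserving_piFinSuccAbove (fun _ : Fin (n + 1) => photonMeasure) 0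

theorem ae_tail {n : ℕ} {P : (Fin n → Photon) → Prop} (h : ∀ᵐ x ∂(powMeasure n), P x) :
    ∀ᵐ x ∂(powMeasure (n + 1)), P fun i => x i.succ :=
  (Measure.quasiMeasurePreserving_snd.comp
    (measurePreserving_headTail n).quasiMeasurePreserving).ae h

theorem memLp_prepend {n : ℕ} (f : OnePhoton) (Φ : TensorPower n) :
    MemLp (fun x : Fin (n + 1) → Photon => f (x 0) * Φ fun i => x i.succ) 2
      (powMeasure (n + 1)) := by
  have h : MemLp (fun p : Photon × (Fin n → Photon) => f p.1 * Φ p.2) 2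
      (photonMeasure.prod (powMeasure n)) := by
    have hm : AEStronglyMeasurable (fun p : Photon × (Fin n → Photon) => f p.1 * Φ p.2)
        (photonMeasure.prod (powMeasure n)) :=
      ((Lp.aestronglyMeasurable f).comp_quasiMeasurePreserving
        Measure.quasiMeasurePreserving_fst).mul
        ((Lp.aestronglyMeasurable Φ).comp_quasiMeasurePreserving
        Measure.quasiMeasurePreserving_snd)
    rw [memLp_two_iff_integrable_sq_norm hm]
    refine (Integrable.mul_prod
      ((memLp_two_iff_integrable_sq_norm (Lp.aestronglyMeasurable f)).1 (Lp.memLp f))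
      ((memLp_two_iff_integrable_sq_norm (Lp.aestronglyMeasurable Φ)).1 (Lp.memLp Φ))).congr
      (Filter.Eventually.of_forall fun p => ?_)
    simp [mul_pow]
  exact h.comp_measurePreserving (measurePreserving_headTail n)

theorem inner_toLp_prepend {n : ℕ} (f g : OnePhoton) (Φ Ψ : TensorPower n) :
    inner ℂ ((memLp_prepend f Φ).toLp _) ((memLp_prepend g Ψ).toLp _)
      = inner ℂ f g * inner ℂ Φ Ψ := by
  have hme : MeasurableEmbedding
      (fun x : Fin (n + 1) → Photon => (x 0, fun i : Fin n => x i.succ)) :=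
    (MeasurableEquiv.piFinSuccAbove (fun _ : Fin (n + 1) => Photon) 0).measurableEmbedding
  rw [L2.inner_def, L2.inner_def, L2.inner_def,
    ← integral_prod_mul (μ := photonMeasure) (ν := powMeasure n),
    ← (measurePreserving_headTail n).integral_comp hme]
  refine integral_congr_ae ?_
  filter_upwards [(memLp_prepend f Φ).coeFn_toLp, (memLp_prepend g Ψ).coeFn_toLp] with x h1 h2
  rw [h1, h2]
  simp only [RCLike.inner_apply, map_mul]
  ring

/-- The operator `Φ ↦ f ⊗ Φ`. -/
noncomputable def prepend (f : OnePhoton) (n : ℕ) : TensorPower n →L[ℂ] TensorPower (n + 1) :=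
  LinearMap.mkContinuous
    { toFun := fun Φ => (memLp_prepend f Φ).toLp _
      map_add' := fun Φ Ψ => by
        rw [← MemLp.toLp_add]
        refine MemLp.toLp_congr _ _ ?_
        filter_upwards [ae_tail (Lp.coeFn_add Φ Ψ)] with x hx
        rw [hx, Pi.add_apply, Pi.add_apply, mul_add]
      map_smul' := fun c Φ => by
        rw [RingHom.id_apply, ← MemLp.toLp_const_smul]
        refine MemLp.toLp_congr _ _ ?_
        filter_upwards [ae_tail (Lp.coeFn_smul c Φ)] with x hx
        rw [hx, Pi.smul_apply, Pi.smul_apply, smul_eq_mul, smul_eq_mul, mul_left_comm] }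
    ‖f‖ (fun Φ => by
      change ‖(memLp_prepend f Φ).toLp _‖ ≤ _
      refine le_of_sq_le_sq ?_ (by positivity)
      have h := inner_toLp_prepend f f Φ Φ
      simp only [inner_self_eq_norm_sq_to_K] at h
      rw [mul_pow]
      exact le_of_eq (by exact_mod_cast h))

variable {n : ℕ}

theorem coeFn_prepend (f : OnePhoton) (Φ : TensorPower n) :
    prepend f n Φ =ᵐ[powMeasure (n + 1)] fun x => f (x 0) * Φ fun i => x i.succ :=
  (memLp_prepend f Φ).coeFn_toLp

theorem inner_prepend (f g : OnePhoton) (Φ Ψ : TensorPower n) :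
    inner ℂ (prepend f n Φ) (prepend g n Ψ) = inner ℂ f g * inner ℂ Φ Ψ :=
  inner_toLp_prepend f g Φ Ψ

theorem norm_prepend (f : OnePhoton) (Φ : TensorPower n) : ‖prepend f n Φ‖ = ‖f‖ * ‖Φ‖ := by
  have h := inner_prepend f f Φ Φ
  simp only [inner_self_eq_norm_sq_to_K] at h
  have h2 : ‖prepend f n Φ‖ ^ 2 = (‖f‖ * ‖Φ‖) ^ 2 := by rw [mul_pow]; exact_mod_cast h
  exact (sq_eq_sq₀ (norm_nonneg _) (by positivity)).1 h2

theorem prepend_add (f g : OnePhoton) (Φ : TensorPower n) :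
    prepend (f + g) n Φ = prepend f n Φ + prepend g n Φ := by
  refine Lp.ext ?_
  filter_upwards [coeFn_prepend (f + g) Φ, coeFn_prepend f Φ, coeFn_prepend g Φ,
    Lp.coeFn_add (prepend f n Φ) (prepend g n Φ), ae_eval 0 (Lp.coeFn_add f g)]
    with x h1 h2 h3 h4 h5
  rw [h1, h4, Pi.add_apply, h2, h3, h5, Pi.add_apply, add_mul]

theorem prepend_smul (c : ℂ) (f : OnePhoton) (Φ : TensorPower n) :
    prepend (c • f) n Φ = c • prepend f n Φ := by
  refine Lp.ext ?_
  filter_upwards [coeFn_prepend (c • f) Φ, coeFn_prepend f Φ, Lp.coeFn_smul c (prepend f n Φ),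
    ae_eval 0 (Lp.coeFn_smul c f)] with x h1 h2 h4 h5
  rw [h1, h4, Pi.smul_apply, h2, h5, Pi.smul_apply, smul_eq_mul, smul_eq_mul, mul_assoc]

theorem prepend_tensor (f : OnePhoton) (g : Fin n → OnePhoton) :
    prepend f n (tensor g) = tensor (Fin.cons f g : Fin (n + 1) → OnePhoton) := by
  refine Lp.ext ?_
  filter_upwards [coeFn_prepend f (tensor g),
    coeFn_tensor (Fin.cons f g : Fin (n + 1) → OnePhoton), ae_tail (coeFn_tensor g)]
    with x h1 h2 h3
  rw [h1, h2, h3, Fin.prod_univ_succ]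
  rfl

/-- The adjoint of `Φ ↦ f ⊗ Φ`. -/
noncomputable def contract (f : OnePhoton) (n : ℕ) : TensorPower (n + 1) →L[ℂ] TensorPower n :=
  ContinuousLinearMap.adjoint (prepend f n)

theorem inner_contract_right (f : OnePhoton) (Φ : TensorPower n) (Ψ : TensorPower (n + 1)) :
    inner ℂ Φ (contract f n Ψ) = inner ℂ (prepend f n Φ) Ψ :=
  ContinuousLinearMap.adjoint_inner_right _ _ _

theorem inner_contract_left (f : OnePhoton) (Φ : TensorPower n) (Ψ : TensorPower (n + 1)) :
    inner ℂ (contract f n Ψ) Φ = inner ℂ Ψ (prepend f n Φ) :=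
  ContinuousLinearMap.adjoint_inner_left _ _ _

theorem contract_tensor (f : OnePhoton) (h : Fin (n + 1) → OnePhoton) :
    contract f n (tensor h) = inner ℂ f (h 0) • tensor fun i => h i.succ := by
  rw [← sub_eq_zero]
  refine eq_zero_of_inner_tensor fun g => ?_
  rw [inner_sub_right, inner_contract_right, prepend_tensor, inner_tensor, inner_smul_right,
    inner_tensor, Fin.prod_univ_succ, sub_eq_zero]
  rfl

/-- The permutation of `{0, …, n}` that extends a permutation of `{1, …, n}`. -/
theorem decomposeFin_symm_eq (p : Fin (n + 1)) (e : Equiv.Perm (Fin n)) :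
    Equiv.Perm.decomposeFin.symm (p, e)
      = Equiv.swap 0 p * Equiv.Perm.decomposeFin.symm (0, e) := by
  ext i
  refine Fin.cases ?_ (fun l => ?_) i
  · simp
  · simp [Equiv.Perm.decomposeFin_symm_apply_succ]

theorem permute_prepend (f : OnePhoton) (e : Equiv.Perm (Fin n)) (Φ : TensorPower n) :
    permute (Equiv.Perm.decomposeFin.symm (0, e)) (prepend f n Φ)
      = prepend f n (permute e Φ) := by
  have h : (permute (Equiv.Perm.decomposeFin.symm (0, e))).comp (prepend f n)
      = (prepend f n).comp (permute e) := by
    refine ext_tensor fun g => ?_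
    rw [ContinuousLinearMap.comp_apply, ContinuousLinearMap.comp_apply, prepend_tensor,
      permute_tensor, permute_tensor, prepend_tensor]
    congr 1
    ext1 i
    obtain ⟨j, rfl⟩ := (Equiv.Perm.decomposeFin.symm ((0 : Fin (n + 1)), e)).surjective i
    rw [Equiv.symm_apply_apply]
    refine Fin.cases ?_ (fun l => ?_) j
    · simp
    · rw [Equiv.Perm.decomposeFin_symm_apply_succ]
      simp
  exact congrArg (fun T => T Φ) h

/-- After the transposition the first slot holds the factor l of Φ and f sits in slot l + 1.
Contracting the first slot therefore amounts to contracting slot l of Φ with f and putting f back in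
the same place. -/
theorem contract_permute_prepend (f : OnePhoton) (l : Fin (n + 1)) (Φ : TensorPower (n + 1)) :
    contract f (n + 1) (permute (Equiv.swap 0 l.succ) (prepend f (n + 1) Φ))
      = permute (Equiv.swap 0 l) (prepend f n (contract f n (permute (Equiv.swap 0 l) Φ))) := by
  have h : ((contract f (n + 1)).comp (permute (Equiv.swap 0 l.succ))).comp (prepend f (n + 1))
      = (permute (Equiv.swap 0 l)).comp ((prepend f n).comp
        ((contract f n).comp (permute (Equiv.swap 0 l)))) := by
    refine ext_tensor fun g => ?_
    simp only [ContinuousLinearMap.comp_apply, prepend_tensor, permute_tensor, contract_tensor,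
      map_smul, Equiv.symm_swap]
    simp only [Equiv.swap_apply_left, Fin.cons_succ]
    congr 2
    ext1 i
    by_cases hi : i = l
    · subst hi
      rw [Equiv.swap_apply_right, Equiv.swap_apply_right, Fin.cons_zero, Fin.cons_zero]
    · rw [Equiv.swap_apply_of_ne_of_ne (Fin.succ_ne_zero i) (fun h => hi (Fin.succ_injective _ h)),
        Fin.cons_succ]
      by_cases hi0 : i = 0
      · subst hi0
        rw [Equiv.swap_apply_left]
        obtain ⟨m, rfl⟩ := Fin.exists_succ_eq.2 (Ne.symm hi)
        rw [Fin.cons_succ, Equiv.swap_apply_right]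
      · rw [Equiv.swap_apply_of_ne_of_ne hi0 hi]
        obtain ⟨m, rfl⟩ := Fin.exists_succ_eq.2 hi0
        rw [Fin.cons_succ, Equiv.swap_apply_of_ne_of_ne hi0 hi]
  exact congrArg (fun T => T Φ) h

/-- The canonical commutation relation, as an identity for the norm of `f ⊗ₛ Φ`. -/
theorem norm_symmetrize_prepend_sq (f : OnePhoton) (Φ : SymPower (n + 1)) :
    ((n : ℝ) + 2) * ‖symmetrize (n + 2) (prepend f (n + 1) Φ)‖ ^ 2
      = ‖f‖ ^ 2 * ‖Φ‖ ^ 2 + ((n : ℝ) + 1) * ‖contract f n Φ‖ ^ 2 := by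
  have hfac : ((Nat.factorial (n + 2) : ℕ) : ℂ) = ((n : ℂ) + 2) * (Nat.factorial (n + 1) : ℕ) := by
    rw [Nat.factorial_succ]; push_cast; ring
  have hn1 : ((Nat.factorial (n + 1) : ℕ) : ℂ) ≠ 0 := by exact_mod_cast Nat.factorial_ne_zero _
  have hn2 : ((n : ℂ) + 2) ≠ 0 := by exact_mod_cast (Nat.succ_ne_zero (n + 1))
  have hΦ : ∀ σ, permute σ (Φ : TensorPower (n + 1)) = Φ := mem_symPower.1 Φ.2
  -- Every permutation is a transposition (0 p) times one that fixes slot 0, and the latter is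
  -- absorbed by the symmetric Φ. Only n + 2 distinct terms remain: p = 0 gives ‖f‖²‖Φ‖², every
  -- other p gives the norm square of the contraction.
  have hterm : ∀ (p : Fin (n + 2)) (e : Equiv.Perm (Fin (n + 1))),
      inner ℂ (prepend f (n + 1) Φ)
        (permute (Equiv.Perm.decomposeFin.symm (p, e)) (prepend f (n + 1) Φ))
      = inner ℂ (prepend f (n + 1) Φ) (permute (Equiv.swap 0 p) (prepend f (n + 1) Φ)) := by
    intro p e
    rw [decomposeFin_symm_eq, ← permute_mul, permute_prepend, hΦ]
  have hsucc : ∀ l : Fin (n + 1),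
      inner ℂ (prepend f (n + 1) Φ) (permute (Equiv.swap 0 l.succ) (prepend f (n + 1) Φ))
        = ((‖contract f n Φ‖ ^ 2 : ℝ) : ℂ) := by
    intro l
    rw [← inner_contract_right, contract_permute_prepend, hΦ]
    conv_lhs => rw [← hΦ (Equiv.swap 0 l)]
    rw [inner_permute, hΦ, ← inner_contract_left, inner_self_eq_norm_sq_to_K]
    push_cast; rfl
  have h1 : inner ℂ (symmetrize (n + 2) (prepend f (n + 1) Φ))
      (symmetrize (n + 2) (prepend f (n + 1) Φ))
      = ((n : ℂ) + 2)⁻¹ * (inner ℂ f f * inner ℂ Φ Φ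
        + ((n : ℂ) + 1) * ((‖contract f n Φ‖ ^ 2 : ℝ) : ℂ)) := by
    rw [inner_symmetrize_left, symmetrize_eq, inner_smul_right, inner_sum,
      ← Equiv.sum_comp Equiv.Perm.decomposeFin.symm, Fintype.sum_prod_type]
    simp only [hterm, Finset.sum_const, Finset.card_univ, Fintype.card_perm, Fintype.card_fin,
      nsmul_eq_mul, ← Finset.mul_sum]
    rw [Fin.sum_univ_succ]
    simp only [hsucc, Finset.sum_const, Finset.card_univ, Fintype.card_fin, nsmul_eq_mul]
    rw [Equiv.swap_self, hfac]
    have : permute (Equiv.refl (Fin (n + 2))) (prepend f (n + 1) Φ) = prepend f (n + 1) Φ := by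
      have h := decomposeFin_symm_eq (0 : Fin (n + 2)) (1 : Equiv.Perm (Fin (n + 1)))
      have h2 := permute_prepend f (1 : Equiv.Perm (Fin (n + 1))) Φ
      rw [hΦ, Equiv.Perm.decomposeFin_symm_of_one, Equiv.swap_self] at h2
      exact h2
    rw [this, inner_prepend]
    push_cast
    field_simp
    rfl
  have e1 : inner ℂ f f = ((‖f‖ : ℝ) : ℂ) ^ 2 := inner_self_eq_norm_sq_to_K f
  have e2 : inner ℂ Φ Φ = ((‖Φ‖ : ℝ) : ℂ) ^ 2 := inner_self_eq_norm_sq_to_K Φ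
  have e3 := inner_self_eq_norm_sq_to_K (𝕜 := ℂ) (symmetrize (n + 2) (prepend f (n + 1) Φ))
  rw [e1, e2, e3] at h1
  have h2 : ((n : ℂ) + 2) * ((‖symmetrize (n + 2) (prepend f (n + 1) Φ)‖ : ℝ) : ℂ) ^ 2
      = ((‖f‖ : ℝ) : ℂ) ^ 2 * ((‖Φ‖ : ℝ) : ℂ) ^ 2
        + ((n : ℂ) + 1) * ((‖contract f n Φ‖ ^ 2 : ℝ) : ℂ) := by
    rw [eq_inv_mul_iff_mul_eq₀ hn2] at h1
    exact h1
  exact_mod_cast h2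

end Prepend

end DiracPolaron
namespace DiracPolaron

/-! ### Annihilation, creation and field operators -/

section Annihilation

/-- Expansion of a permanent along its first row. -/
theorem sum_perm_succ {n : ℕ} (F : Fin (n + 1) → ℂ) (G : Fin n → Fin (n + 1) → ℂ) :
    ∑ σ : Equiv.Perm (Fin (n + 1)), F (σ 0) * ∏ l, G l (σ l.succ)
      = ∑ p, F p * ∑ τ : Equiv.Perm (Fin n), ∏ l, G l (p.succAbove (τ l)) := by
  rw [← Equiv.sum_comp Equiv.Perm.decomposeFin.symm, Fintype.sum_prod_type]
  refine Finset.sum_congr rfl fun p _ => ?_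
  simp only [Equiv.Perm.decomposeFin_symm_apply_zero, Equiv.Perm.decomposeFin_symm_apply_succ]
  rw [← Finset.mul_sum]
  congr 1
  have hne : ∀ l : Fin n, Equiv.swap 0 p l.succ ≠ p := fun l h => by
    have : Equiv.swap 0 p l.succ = Equiv.swap 0 p 0 := by rw [h, Equiv.swap_apply_left]
    exact Fin.succ_ne_zero l ((Equiv.swap 0 p).injective this)
  -- The transposition and `succAbove` list the indices other than p in different orders; π is the
  -- reordering, and the sum over τ absorbs it.
  choose π hπ using fun l => Fin.exists_succAbove_eq (hne l)
  have hinj : Function.Injective π := fun l l' h => by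
    have : Equiv.swap 0 p l.succ = Equiv.swap 0 p l'.succ := by rw [← hπ, ← hπ, h]
    exact Fin.succ_injective _ ((Equiv.swap 0 p).injective this)
  simp only [← hπ]
  exact Equiv.sum_comp (Equiv.mulLeft (Equiv.ofBijective π (Finite.injective_iff_bijective.1 hinj)))
    fun τ : Equiv.Perm (Fin n) => ∏ l, G l (p.succAbove (τ l))

/-- The action of the annihilation operator on a symmetrized product vector. -/
noncomputable def annihilateTensor (f : OnePhoton) {n : ℕ} (h : Fin (n + 1) → OnePhoton) : Fock :=
  ((Real.sqrt (n + 1) : ℝ) : ℂ)⁻¹ •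
    ∑ i, (inner ℂ f (h i)) • symTensor (fun l : Fin n => h (i.succAbove l))

theorem sqrt_succ_mul_self (n : ℕ) :
    ((Real.sqrt (n + 1) : ℝ) : ℂ) * ((Real.sqrt (n + 1) : ℝ) : ℂ) = (n : ℂ) + 1 := by
  rw [← Complex.ofReal_mul, Real.mul_self_sqrt (by positivity)]; push_cast; rfl

theorem sqrt_succ_ne_zero (n : ℕ) : ((Real.sqrt (n + 1) : ℝ) : ℂ) ≠ 0 := by
  rw [Complex.ofReal_ne_zero]; positivity

/-- Inner products of symmetrized products are permanents divided by factorials, so adjointness of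
annihilation and creation on product vectors is the expansion of a permanent along the row of f. The
factors (n + 1)! and n! account for the square roots. -/
theorem inner_annihilateTensor (f : OnePhoton) {n m : ℕ} (h : Fin (n + 1) → OnePhoton)
    (g : Fin m → OnePhoton) :
    inner ℂ (symTensor g) (annihilateTensor f h) = ((Real.sqrt (m + 1) : ℝ) : ℂ) *
      inner ℂ (symTensor (Fin.cons f g : Fin (m + 1) → OnePhoton)) (symTensor h) := by
  rw [annihilateTensor, inner_smul_right, inner_sum]
  simp only [inner_smul_right]
  by_cases hmn : m = n
  · subst hmn
    simp only [inner_symTensor]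
    have h1 : ∀ σ : Equiv.Perm (Fin (m + 1)),
        ∏ i, inner ℂ ((Fin.cons f g : Fin (m + 1) → OnePhoton) i) (h (σ i))
          = inner ℂ f (h (σ 0)) * ∏ l : Fin m, inner ℂ (g l) (h (σ l.succ)) := fun σ => by
      rw [Fin.prod_univ_succ]; rfl
    simp only [h1]
    rw [sum_perm_succ (fun p => inner ℂ f (h p)) (fun l p => inner ℂ (g l) (h p)), Finset.mul_sum,
      Finset.mul_sum, Finset.mul_sum]
    refine Finset.sum_congr rfl fun p _ => ?_
    rw [Nat.factorial_succ]
    have h2 := sqrt_succ_mul_self m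
    have h3 := sqrt_succ_ne_zero m
    have h4 : ((m : ℂ) + 1) ≠ 0 := by exact_mod_cast Nat.succ_ne_zero m
    have h5 : ((Nat.factorial m : ℕ) : ℂ) ≠ 0 := by exact_mod_cast Nat.factorial_ne_zero _
    push_cast
    field_simp
    rw [← h2]
    ring
  · rw [inner_symTensor_of_ne (fun h => hmn (Nat.succ_injective h)), mul_zero]
    simp [inner_symTensor_of_ne hmn]

/-- The annihilation operator on the `n + 1`-photon space. -/
noncomputable def annN (f : OnePhoton) (n : ℕ) : SymPower (n + 1) →L[ℂ] SymPower n :=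
  ((Real.sqrt (n + 1) : ℝ) : ℂ) • (symmetrize n).comp ((contract f n).comp (SymPower (n + 1)).subtypeL)

/-- The creation operator on the `n`-photon space. -/
noncomputable def creN (f : OnePhoton) (n : ℕ) : SymPower n →L[ℂ] SymPower (n + 1) :=
  ((Real.sqrt (n + 1) : ℝ) : ℂ) • (symmetrize (n + 1)).comp ((prepend f n).comp (SymPower n).subtypeL)

variable {f : OnePhoton} {n : ℕ}

theorem annN_apply (Ψ : SymPower (n + 1)) : annN f n Ψ =
    ((Real.sqrt (n + 1) : ℝ) : ℂ) • symmetrize n (contract f n (Ψ : TensorPower (n + 1))) := rfl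

theorem creN_apply (Φ : SymPower n) : creN f n Φ =
    ((Real.sqrt (n + 1) : ℝ) : ℂ) • symmetrize (n + 1) (prepend f n (Φ : TensorPower n)) := rfl

theorem inner_creN_left (Φ : SymPower n) (Ψ : SymPower (n + 1)) :
    inner ℂ (creN f n Φ) Ψ = ((Real.sqrt (n + 1) : ℝ) : ℂ) *
      inner ℂ (prepend f n (Φ : TensorPower n)) (Ψ : TensorPower (n + 1)) := by
  rw [creN_apply, inner_smul_left (symmetrize (n + 1) (prepend f n (Φ : TensorPower n))) Ψ _,
    inner_symmetrize_left, Complex.conj_ofReal]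

theorem inner_annN_left (Φ : SymPower n) (Ψ : SymPower (n + 1)) :
    inner ℂ (annN f n Ψ) Φ = ((Real.sqrt (n + 1) : ℝ) : ℂ) *
      inner ℂ (Ψ : TensorPower (n + 1)) (prepend f n (Φ : TensorPower n)) := by
  rw [annN_apply, inner_smul_left (symmetrize n (contract f n (Ψ : TensorPower (n + 1)))) Φ _,
    inner_symmetrize_left, Complex.conj_ofReal, inner_contract_left]

theorem inner_annN_right (Φ : SymPower n) (Ψ : SymPower (n + 1)) :
    inner ℂ Φ (annN f n Ψ) = inner ℂ (creN f n Φ) Ψ := by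
  rw [← inner_conj_symm Φ (annN f n Ψ), inner_annN_left, inner_creN_left, map_mul,
    Complex.conj_ofReal, inner_conj_symm]

theorem symmetrize_of_mem (Ψ : SymPower n) : symmetrize n (Ψ : TensorPower n) = Ψ :=
  Submodule.orthogonalProjectionOnto_mem_subspace_eq_self Ψ

theorem coe_single (n : ℕ) (Ψ : SymPower n) : (lp.single 2 n Ψ : Fock) n = Ψ :=
  lp.single_apply_self (E := fun n : ℕ => SymPower n) 2 n Ψ

/-- A permutation of the remaining photons extends to all photons by fixing the contracted one.
Consequently the symmetrizer in `annN` does nothing. -/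
theorem contract_mem (Ψ : SymPower (n + 1)) :
    contract f n (Ψ : TensorPower (n + 1)) ∈ SymPower n := by
  refine mem_symPower.2 fun σ => ext_inner_left ℂ fun Φ => ?_
  have h1 : permute σ (permute σ⁻¹ Φ) = Φ := by
    rw [permute_mul, mul_inv_cancel]
    refine Lp.ext ?_
    exact Lp.coeFn_compMeasurePreserving _ (measurePreserving_permute 1)
  conv_lhs => rw [← h1]
  rw [inner_permute, inner_contract_right, inner_contract_right,
    ← inner_permute (Equiv.Perm.decomposeFin.symm (0, σ)), permute_prepend, h1,
    mem_symPower.1 Ψ.2]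

theorem coe_annN (Ψ : SymPower (n + 1)) : (annN f n Ψ : TensorPower n) =
    ((Real.sqrt (n + 1) : ℝ) : ℂ) • contract f n (Ψ : TensorPower (n + 1)) := by
  rw [annN_apply, Submodule.coe_smul, symmetrize_of_mem ⟨_, contract_mem Ψ⟩]

/-- `a(f)` is the adjoint of `S (g₁ ⊗ ⋯ ⊗ gₙ) ↦ (n + 1)^(1/2) S (f ⊗ g₁ ⊗ ⋯ ⊗ gₙ)`. -/
theorem inner_symTensor_single_annN {m : ℕ} (g : Fin m → OnePhoton) (a : Fock) :
    inner ℂ (tensor g) (annN f m (a (m + 1)) : TensorPower m) = ((Real.sqrt (m + 1) : ℝ) : ℂ) *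
        inner ℂ (symTensor (Fin.cons f g : Fin (m + 1) → OnePhoton)) a := by
  rw [inner_symTensor_left, coe_annN, inner_smul_right, inner_contract_right, prepend_tensor]

theorem annihilateTensor_eq (h : Fin (n + 1) → OnePhoton) :
    annihilateTensor f h = lp.single 2 n (annN f n (symmetrize (n + 1) (tensor h))) := by
  rw [← sub_eq_zero]
  refine eq_zero_of_inner_symTensor fun m g => ?_
  rw [inner_sub_right, sub_eq_zero, inner_annihilateTensor]
  by_cases hmn : m = n
  · subst hmn
    have h1 := inner_symTensor_single_annN (f := f) g (symTensor h)
    rw [← h1, inner_symTensor_left, coe_single, symTensor_eq h, coe_single]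
  · rw [inner_symTensor_of_ne (fun h => hmn (Nat.succ_injective h)), mul_zero,
      inner_symTensor_left, lp.single_apply_ne _ _ _ hmn]
    simp

/-- The graph of the annihilation operator on finite sums of symmetrized product vectors. -/
noncomputable def annihilationSpan (f : OnePhoton) : Submodule ℂ (Fock × Fock) :=
  Submodule.span ℂ
    ({Ψ : Fock × Fock | ∃ (n : ℕ) (h : Fin (n + 1) → OnePhoton),
      Ψ = (symTensor h, annihilateTensor f h)} ∪
     {Ψ : Fock × Fock | ∃ h : Fin 0 → OnePhoton, Ψ = (symTensor h, 0)})

/-- The maximal graph of the annihilation operator. -/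
noncomputable def annihilationGraph (f : OnePhoton) : Submodule ℂ (Fock × Fock) :=
  ⨅ n : ℕ, LinearMap.ker (((lp.evalCLM ℂ (fun n : ℕ => SymPower n) 2 n).comp
      (ContinuousLinearMap.snd ℂ Fock Fock)
    - ((annN f n).comp (lp.evalCLM ℂ (fun n : ℕ => SymPower n) 2 (n + 1))).comp
      (ContinuousLinearMap.fst ℂ Fock Fock)).toLinearMap)

theorem mem_annihilationGraph {x : Fock × Fock} :
    x ∈ annihilationGraph f ↔ ∀ n, x.2 n = annN f n (x.1 (n + 1)) := by
  simp only [annihilationGraph, Submodule.mem_iInf, LinearMap.mem_ker]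
  refine forall_congr' fun n => ?_
  exact sub_eq_zero

theorem isClosed_annihilationGraph : IsClosed (annihilationGraph f : Set (Fock × Fock)) := by
  rw [annihilationGraph, Submodule.coe_iInf]
  exact isClosed_iInter fun n => ContinuousLinearMap.isClosed_ker _

/-- On a fixed sector annihilation is bounded, so the pairs known for product vectors extend by
density to the whole sector. -/
theorem single_mem_closure_annihilationSpan (Ψ : SymPower (n + 1)) :
    ((lp.single 2 (n + 1) Ψ : Fock), (lp.single 2 n (annN f n Ψ) : Fock))
      ∈ (annihilationSpan f).topologicalClosure := by
  let L : TensorPower (n + 1) →L[ℂ] Fock × Fock :=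
    ((lp.singleContinuousLinearMap ℂ (fun n : ℕ => SymPower n) 2 (n + 1)).prod
      ((lp.singleContinuousLinearMap ℂ (fun n : ℕ => SymPower n) 2 n).comp (annN f n))).comp
      (symmetrize (n + 1))
  have h : ((annihilationSpan f).topologicalClosure.comap L.toLinearMap) = ⊤ := by
    rw [eq_top_iff, ← dense_span_tensor]
    refine Submodule.topologicalClosure_minimal _ (Submodule.span_le.2 ?_)
      ((Submodule.isClosed_topologicalClosure _).preimage L.continuous)
    rintro _ ⟨h, rfl⟩
    refine subset_closure (Submodule.subset_span (Or.inl ⟨n, h, ?_⟩))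
    rw [annihilateTensor_eq]
    rfl
  have h2 : (Ψ : TensorPower (n + 1)) ∈ (annihilationSpan f).topologicalClosure.comap L.toLinearMap := by
    rw [h]; trivial
  have h3 : L (Ψ : TensorPower (n + 1)) = ((lp.single 2 (n + 1) Ψ : Fock),
      (lp.single 2 n (annN f n Ψ) : Fock)) := by
    change ((lp.single 2 (n + 1) (symmetrize (n + 1) (Ψ : TensorPower (n + 1))) : Fock),
      (lp.single 2 n (annN f n (symmetrize (n + 1) (Ψ : TensorPower (n + 1)))) : Fock)) = _
    rw [symmetrize_of_mem]
  rw [← h3]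
  exact h2

theorem vacuum_mem_closure_annihilationSpan (Ψ : SymPower 0) :
    ((lp.single 2 0 Ψ : Fock), (0 : Fock)) ∈ (annihilationSpan f).topologicalClosure := by
  let L : TensorPower 0 →L[ℂ] Fock × Fock :=
    ((lp.singleContinuousLinearMap ℂ (fun n : ℕ => SymPower n) 2 0).prod 0).comp (symmetrize 0)
  have h : ((annihilationSpan f).topologicalClosure.comap L.toLinearMap) = ⊤ := by
    rw [eq_top_iff, ← dense_span_tensor]
    refine Submodule.topologicalClosure_minimal _ (Submodule.span_le.2 ?_)
      ((Submodule.isClosed_topologicalClosure _).preimage L.continuous)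
    rintro _ ⟨h, rfl⟩
    exact subset_closure (Submodule.subset_span (Or.inr ⟨h, rfl⟩))
  have h2 : (Ψ : TensorPower 0) ∈ (annihilationSpan f).topologicalClosure.comap L.toLinearMap := by
    rw [h]; trivial
  have h3 : L (Ψ : TensorPower 0) = ((lp.single 2 0 Ψ : Fock), (0 : Fock)) := by
    change ((lp.single 2 0 (symmetrize 0 (Ψ : TensorPower 0)) : Fock), (0 : Fock)) = _
    rw [symmetrize_of_mem]
  rw [← h3]
  exact h2

/-- Sectorwise action is a closed condition, which gives one inclusion. Conversely, if both a and
its sectorwise image b are square summable, truncations to finitely many sectors converge in the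
graph norm. Thus a(f) has its maximal domain. -/
theorem closure_annihilationSpan :
    (annihilationSpan f).topologicalClosure = annihilationGraph f := by
  refine le_antisymm (Submodule.topologicalClosure_minimal _ (Submodule.span_le.2 ?_)
    isClosed_annihilationGraph) ?_
  · rintro _ (⟨n, h, rfl⟩ | ⟨h, rfl⟩)
    · refine mem_annihilationGraph.2 fun m => ?_
      simp only
      rw [annihilateTensor_eq, symTensor_eq]
      by_cases hmn : m = n
      · subst hmn
        rw [coe_single, coe_single]
      · rw [lp.single_apply_ne _ _ _ hmn, lp.single_apply_ne _ _ _ (fun h => hmn (Nat.succ_injective h)),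
          map_zero]
    · refine mem_annihilationGraph.2 fun m => ?_
      simp only
      rw [symTensor_eq, lp.single_apply_ne _ _ _ (Nat.succ_ne_zero m), map_zero]
      rfl
  · rintro ⟨a, b⟩ hx
    rw [mem_annihilationGraph] at hx
    simp only at hx
    have h0 := vacuum_mem_closure_annihilationSpan (f := f) (a 0)
    -- Annihilation lowers the photon number: sector n + 1 of a is paired with sector n of b, and
    -- the vacuum component of a is added back separately.
    have ha := (hasSum_nat_add_iff' 1).2 (lp.hasSum_single (by simp) a)
    have hb := lp.hasSum_single (by simp) b
    have hab := (ha.prodMk hb)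
    rw [Finset.sum_range_one] at hab
    have h1 : (a - lp.single 2 0 (a 0), b) ∈ (annihilationSpan f).topologicalClosure := by
      refine (Submodule.isClosed_topologicalClosure _).mem_of_tendsto hab
        (Filter.Eventually.of_forall fun s => Submodule.sum_mem _ fun n _ => ?_)
      rw [hx]
      exact single_mem_closure_annihilationSpan _
    have h2 := Submodule.add_mem _ h1 h0
    simpa using h2

theorem mem_annihilation_graph {a b : Fock} :
    (a, b) ∈ (annihilation f).graph ↔ ∀ n, b n = annN f n (a (n + 1)) := by
  have h : (annihilation f).graph = annihilationGraph f := by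
    rw [← closure_annihilationSpan]
    refine Submodule.toLinearPMap_graph_eq _ fun x hx h0 => ?_
    change x ∈ (annihilationSpan f).topologicalClosure at hx
    rw [closure_annihilationSpan, mem_annihilationGraph] at hx
    refine lp.ext (funext fun n => ?_)
    rw [hx n, h0]
    exact map_zero _
  rw [h, mem_annihilationGraph]

/-- The action of the annihilation operator on symmetrized product vectors, including the
vacuum. -/
noncomputable def annTensor (f : OnePhoton) : ∀ {n : ℕ}, (Fin n → OnePhoton) → Fock
  | 0, _ => 0
  | _ + 1, h => annihilateTensor f h

theorem annTensor_mem {n : ℕ} (h : Fin n → OnePhoton) :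
    (symTensor h, annTensor f h) ∈ (annihilation f).graph := by
  rw [mem_annihilation_graph, ← mem_annihilationGraph (x := (symTensor h, annTensor f h)),
    ← closure_annihilationSpan]
  refine subset_closure (Submodule.subset_span ?_)
  cases n with
  | zero => exact Or.inr ⟨h, rfl⟩
  | succ n => exact Or.inl ⟨n, h, rfl⟩

theorem dense_annihilation_domain : Dense ((annihilation f).domain : Set Fock) := by
  rw [Submodule.dense_iff_topologicalClosure_eq_top, eq_top_iff, ← dense_span_symTensor]
  refine Submodule.topologicalClosure_mono (Submodule.span_le.2 ?_)
  rintro _ ⟨⟨n, h⟩, rfl⟩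
  exact LinearPMap.mem_domain_of_mem_graph (annTensor_mem h)

theorem mem_adjoint_annihilation_graph {a b : Fock} :
    (a, b) ∈ (annihilation f).adjoint.graph ↔
      ∀ x ∈ (annihilation f).graph, inner ℂ x.2 a = inner ℂ x.1 b := by
  rw [LinearPMap.adjoint_graph_eq_graph_adjoint dense_annihilation_domain,
    Submodule.mem_adjoint_iff]
  simp only [sub_eq_zero]
  exact ⟨fun h x hx => h x.1 x.2 hx, fun h x y hx => h (x, y) hx⟩

theorem creation_mem_adjoint_graph {a b : Fock} (h0 : b 0 = 0)
    (h : ∀ n, b (n + 1) = creN f n (a n)) : (a, b) ∈ (annihilation f).adjoint.graph := by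
  refine mem_adjoint_annihilation_graph.2 fun x hx => ?_
  have hx' := mem_annihilation_graph.1 hx
  have h1 := lp.hasSum_inner (𝕜 := ℂ) (G := fun n : ℕ => SymPower n) x.2 a
  have h2 := (hasSum_nat_add_iff' 1).2
    (lp.hasSum_inner (𝕜 := ℂ) (G := fun n : ℕ => SymPower n) x.1 b)
  rw [Finset.sum_range_one, h0, inner_zero_right (x.1 0), sub_zero] at h2
  refine h1.unique (h2.congr_fun fun n => ?_)
  rw [hx', h, ← inner_conj_symm, inner_annN_right]
  exact inner_conj_symm (𝕜 := ℂ) (E := SymPower (n + 1)) (x.1 (n + 1)) (creN f n (a n))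

/-- The action of the creation operator on symmetrized product vectors. -/
noncomputable def creTensor (f : OnePhoton) {n : ℕ} (h : Fin n → OnePhoton) : Fock :=
  ((Real.sqrt (n + 1) : ℝ) : ℂ) • symTensor (Fin.cons f h : Fin (n + 1) → OnePhoton)

theorem symTensor_mem_adjoint_annihilation_graph {n : ℕ} (h : Fin n → OnePhoton) :
    (symTensor h, creTensor f h) ∈ (annihilation f).adjoint.graph := by
  refine mem_adjoint_annihilation_graph.2 fun x hx => ?_
  have hx' := mem_annihilation_graph.1 hx
  rw [creTensor, inner_smul_right, ← inner_conj_symm, ← inner_conj_symm x.1, inner_symTensor_left,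
    hx', inner_symTensor_single_annN, map_mul, Complex.conj_ofReal]

theorem add_mem_field_graph {a b c : Fock} (hb : (a, b) ∈ (annihilation f).graph)
    (hc : (a, c) ∈ (annihilation f).adjoint.graph) :
    (a, ((Real.sqrt 2 : ℝ) : ℂ)⁻¹ • (b + c)) ∈ (field f).graph := by
  have h : (a, b + c) ∈ (annihilation f + (annihilation f).adjoint).closure.graph := by
    refine LinearPMap.le_graph_of_le (LinearPMap.le_closure _) ?_
    obtain ⟨y, h1, h2⟩ := (LinearPMap.mem_graph_iff _).1 hb
    obtain ⟨z, h3, h4⟩ := (LinearPMap.mem_graph_iff _).1 hc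
    simp only at h1 h2 h3 h4
    subst h1
    refine (LinearPMap.mem_graph_iff _).2 ⟨⟨y, y.2, h3 ▸ z.2⟩, rfl, ?_⟩
    rw [LinearPMap.add_apply, ← h2, ← h4]
    congr 2
    exact Subtype.ext h3.symm
  rw [field, LinearPMap.smul_graph]
  exact ⟨(a, b + c), h, rfl⟩

theorem symmetricGraph_field : SymmetricGraph (field f).graph := by
  have h1 : SymmetricGraph (annihilation f + (annihilation f).adjoint).graph := by
    intro x hx y hy
    obtain ⟨x', h1, h2⟩ := (LinearPMap.mem_graph_iff _).1 hx
    obtain ⟨y', h3, h4⟩ := (LinearPMap.mem_graph_iff _).1 hy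
    rw [LinearPMap.add_apply] at h2 h4
    have hxa := (annihilation f).mem_graph ⟨x', x'.2.1⟩
    have hxc := (annihilation f).adjoint.mem_graph ⟨x', x'.2.2⟩
    have hya := (annihilation f).mem_graph ⟨y', y'.2.1⟩
    have hyc := (annihilation f).adjoint.mem_graph ⟨y', y'.2.2⟩
    have e1 := mem_adjoint_annihilation_graph.1 hyc _ hxa
    have e2 := mem_adjoint_annihilation_graph.1 hxc _ hya
    have e3 := congrArg (starRingEnd ℂ) e2
    rw [inner_conj_symm, inner_conj_symm] at e3
    simp only at e1 e3
    rw [← h2, ← h4, ← h1, ← h3, inner_add_left, inner_add_right, e1, ← e3, add_comm]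
  have h2 := graph_closure_of_symmetric h1 fun h hh => ?_
  · rw [field, LinearPMap.smul_graph, h2]
    rintro _ ⟨x, hx, rfl⟩ _ ⟨y, hy, rfl⟩
    have := h1.closure x hx y hy
    simp only [LinearMap.prodMap_apply, LinearMap.id_apply, LinearMap.smul_apply] 
    rw [inner_smul_left, inner_smul_right, map_inv₀, Complex.conj_ofReal, this]
  · refine eq_zero_of_inner_symTensor fun m g => ?_
    rw [inner_eq_zero_symm]
    refine hh _ ⟨LinearPMap.mem_domain_of_mem_graph (annTensor_mem g), ?_⟩
    exact LinearPMap.mem_domain_of_mem_graph (symTensor_mem_adjoint_annihilation_graph g)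


/-- The action of the field operator on symmetrized product vectors. -/
noncomputable def fieldTensor (f : OnePhoton) {n : ℕ} (h : Fin n → OnePhoton) : Fock :=
  ((Real.sqrt 2 : ℝ) : ℂ)⁻¹ • (annTensor f h + creTensor f h)

/-- Symmetrized products are total and lie in the domain, so values of the closed field operator can
be identified weakly, without following the closure. -/
theorem inner_field_eq {a c : Fock} (hc : (a, c) ∈ (field f).graph) {n : ℕ}
    (h : Fin n → OnePhoton) :
    inner ℂ (symTensor h) c = inner ℂ (fieldTensor f h) a :=
  (symmetricGraph_field _ (add_mem_field_graph (annTensor_mem h)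
    (symTensor_mem_adjoint_annihilation_graph h)) _ hc).symm

theorem symTensor_cons_eq (f : OnePhoton) {n : ℕ} (h : Fin n → OnePhoton) :
    symTensor (Fin.cons f h : Fin (n + 1) → OnePhoton)
      = lp.single 2 (n + 1) (symmetrize (n + 1) (prepend f n (tensor h))) := by
  rw [symTensor_eq, prepend_tensor]

theorem fieldTensor_add (f g : OnePhoton) {n : ℕ} (h : Fin n → OnePhoton) :
    fieldTensor (f + g) h = fieldTensor f h + fieldTensor g h := by
  have h1 : annTensor (f + g) h = annTensor f h + annTensor g h := by
    cases n with
    | zero => exact (add_zero _).symm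
    | succ n =>
      simp only [annTensor, annihilateTensor, inner_add_left, add_smul, Finset.sum_add_distrib,
        smul_add]
  rw [fieldTensor, fieldTensor, fieldTensor, h1, creTensor, creTensor, creTensor,
    symTensor_cons_eq, symTensor_cons_eq, symTensor_cons_eq, prepend_add, map_add, lp.single_add]
  module

/-- Real scalars are essential, because annihilation is antilinear in f and creation is linear.
Rotation matrices have real entries, so this suffices for the symmetries. -/
theorem fieldTensor_smul (r : ℝ) (f : OnePhoton) {n : ℕ} (h : Fin n → OnePhoton) :
    fieldTensor ((r : ℂ) • f) h = (r : ℂ) • fieldTensor f h := by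
  have h1 : annTensor ((r : ℂ) • f) h = (r : ℂ) • annTensor f h := by
    cases n with
    | zero => exact (smul_zero _).symm
    | succ n =>
      simp only [annTensor, annihilateTensor, inner_smul_left, Complex.conj_ofReal, mul_smul,
        ← Finset.smul_sum]
      rw [smul_comm]
  rw [fieldTensor, fieldTensor, h1, creTensor, creTensor, symTensor_cons_eq, symTensor_cons_eq,
    prepend_smul, map_smul, lp.single_smul]
  module

theorem fieldTensor_sum {ι : Type*} [Fintype ι] (r : ι → ℝ) (g : ι → OnePhoton) {n : ℕ}
    (h : Fin n → OnePhoton) :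
    fieldTensor (∑ b, (r b : ℂ) • g b) h = ∑ b, (r b : ℂ) • fieldTensor (g b) h := by
  have := map_sum (AddMonoidHom.mk' (fun f => fieldTensor f h) fun f g => fieldTensor_add f g h)
    (fun b => (r b : ℂ) • g b) Finset.univ
  simp only [AddMonoidHom.mk'_apply, fieldTensor_smul] at this
  exact this

theorem GammaEquiv_fieldTensor (u : OnePhoton ≃ₗᵢ[ℂ] OnePhoton) (h : Fin n → OnePhoton) :
    GammaEquiv u (fieldTensor f h) = fieldTensor (u f) fun i => u (h i) := by
  have h1 : (GammaEquiv u) (creTensor f h) = creTensor (u f) fun i => u (h i) := by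
    rw [creTensor, creTensor, map_smul, GammaEquiv_symTensor]
    congr 2
    ext1 i
    refine Fin.cases rfl (fun l => rfl) i
  have h2 : (GammaEquiv u) (annTensor f h) = annTensor (u f) fun i => u (h i) := by
    cases n with
    | zero => exact map_zero _
    | succ n =>
      simp only [annTensor, annihilateTensor, map_smul, map_sum, GammaEquiv_symTensor,
        LinearIsometryEquiv.inner_map_map]
  rw [fieldTensor, fieldTensor, map_smul, map_add, h1, h2]

/-- Transport of the field operators by `Γ(u)`. -/
theorem GammaEquiv_field {ι : Type*} [Fintype ι] (u : OnePhoton ≃ₗᵢ[ℂ] OnePhoton)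
    (r : ι → ℝ) (g : ι → OnePhoton) (hu : u f = ∑ b, (r b : ℂ) • g b) {a c : Fock}
    (hc : (a, c) ∈ (field f).graph) {d : ι → Fock}
    (hd : ∀ b, (GammaEquiv u a, d b) ∈ (field (g b)).graph) :
    GammaEquiv u c = ∑ b, (r b : ℂ) • d b := by
  rw [← sub_eq_zero]
  refine eq_zero_of_inner_symTensor fun n h => ?_
  have h1 : symTensor h = GammaEquiv u (symTensor fun i => u.symm (h i)) := by
    rw [GammaEquiv_symTensor]
    simp
  rw [inner_sub_right, sub_eq_zero, inner_sum]
  simp only [inner_smul_right, inner_field_eq (hd _)]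
  rw [h1, LinearIsometryEquiv.inner_map_map, inner_field_eq hc,
    ← LinearIsometryEquiv.inner_map_map (GammaEquiv u), GammaEquiv_fieldTensor, hu,
    fieldTensor_sum, sum_inner]
  simp only [inner_smul_left, Complex.conj_ofReal, LinearIsometryEquiv.apply_symm_apply]

end Annihilation

end DiracPolaron
namespace DiracPolaron

/-! ### Relative bounds and commutators of the field with dΓ(φ) -/

section FieldBounds

theorem norm_sq_eq_integral {α : Type*} [MeasurableSpace α] {μ : Measure α} (f : Lp ℂ 2 μ) :
    ‖f‖ ^ 2 = ∫ x, ‖f x‖ ^ 2 ∂μ := by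
  have h : inner ℂ f f = ((‖f‖ : ℝ) : ℂ) ^ 2 := inner_self_eq_norm_sq_to_K f
  have h2 : inner ℂ f f = ((∫ x, ‖f x‖ ^ 2 ∂μ : ℝ) : ℂ) := by
    rw [L2.inner_def, ← integral_complex_ofReal]
    refine integral_congr_ae (Filter.Eventually.of_forall fun x => ?_)
    simp only [inner_self_eq_norm_sq_to_K]
    push_cast
    rfl
  exact_mod_cast h.symm.trans h2

variable {φ : E3 → ℝ} (hφ : Measurable φ) (h0 : ∀ k, 0 ≤ φ k)

include hφ h0 in
/-- On the domain of `dΓ(φ)` one may multiply by `φ(k₀)^(1/2)`. -/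
theorem exists_sqrt_mul {n : ℕ} (Ψ : SymPower (n + 1)) (X : TensorPower (n + 1))
    (hX : X =ᵐ[powMeasure (n + 1)] fun x => (sumFn φ x : ℂ) * (Ψ : TensorPower (n + 1)) x) :
    ∃ η : TensorPower (n + 1),
      (η =ᵐ[powMeasure (n + 1)]
        fun x => ((Real.sqrt (φ (x 0).1) : ℝ) : ℂ) * (Ψ : TensorPower (n + 1)) x) ∧
      ((n : ℝ) + 1) * ‖η‖ ^ 2 = (inner ℂ (Ψ : TensorPower (n + 1)) X).re := by
  set P : TensorPower (n + 1) := (Ψ : TensorPower (n + 1)) with hP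
  let w : Fin (n + 1) → (Fin (n + 1) → Photon) → ℝ := fun i x => φ (x i).1 * ‖P x‖ ^ 2
  have hint : Integrable (fun x => (inner ℂ (P x) (X x) : ℂ).re) (powMeasure (n + 1)) :=
    (L2.integrable_inner (𝕜 := ℂ) P X).re
  have hsum : (fun x => (inner ℂ (P x) (X x) : ℂ).re) =ᵐ[powMeasure (n + 1)]
      fun x => ∑ i, w i x := by
    filter_upwards [hX] with x hx
    rw [hx, ← Finset.sum_mul, RCLike.inner_apply, mul_assoc, Complex.mul_conj, ← Complex.ofReal_mul,
      Complex.ofReal_re, Complex.normSq_eq_norm_sq]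
    rfl
  have hφm : ∀ i : Fin (n + 1), Measurable fun x : Fin (n + 1) → Photon => φ (x i).1 := fun i =>
    hφ.comp (measurable_fst.comp (measurable_pi_apply i))
  have hPm : AEStronglyMeasurable (fun x => ‖P x‖ ^ 2) (powMeasure (n + 1)) :=
    (Lp.aestronglyMeasurable P).norm.pow 2
  have hwm : ∀ i, AEStronglyMeasurable (w i) (powMeasure (n + 1)) := fun i =>
    (hφm i).aestronglyMeasurable.mul hPm
  have hw0 : ∀ i x, 0 ≤ w i x := fun i x => mul_nonneg (h0 _) (by positivity)
  have hwi : ∀ i, Integrable (w i) (powMeasure (n + 1)) := fun i => by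
    refine (hint.congr hsum).mono' (hwm i) (Filter.Eventually.of_forall fun x => ?_)
    rw [Real.norm_of_nonneg (hw0 i x)]
    exact Finset.single_le_sum (f := fun i => w i x) (fun i _ => hw0 i x) (Finset.mem_univ i)
  -- Permutation symmetry of Ψ makes all n + 1 summands φ(kᵢ)|Ψ|² contribute equally; this is the
  -- origin of the factor n + 1.
  have hweq : ∀ i, ∫ x, w i x ∂(powMeasure (n + 1)) = ∫ x, w 0 x ∂(powMeasure (n + 1)) := by
    intro i
    have hp := measurePreserving_permute (Equiv.swap 0 i)
    have h1 := integral_map (φ := fun (x : Fin (n + 1) → Photon) l => x (Equiv.swap 0 i l))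
      hp.aemeasurable (f := w 0) (by rw [hp.map_eq]; exact hwm 0)
    rw [hp.map_eq] at h1
    rw [h1]
    have h2 : permute (Equiv.swap 0 i) P =ᵐ[powMeasure (n + 1)]
        P ∘ fun x l => x (Equiv.swap 0 i l) := Lp.coeFn_compMeasurePreserving _ hp
    rw [mem_symPower.1 Ψ.2] at h2
    refine integral_congr_ae ?_
    filter_upwards [h2] with x hx
    simp only [w, Equiv.swap_apply_left]
    rw [hx]
    rfl
  have hηm : MemLp (fun x => ((Real.sqrt (φ (x 0).1) : ℝ) : ℂ) * P x) 2 (powMeasure (n + 1)) := by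
    have hm : AEStronglyMeasurable (fun x => ((Real.sqrt (φ (x 0).1) : ℝ) : ℂ) * P x)
        (powMeasure (n + 1)) :=
      (Complex.measurable_ofReal.comp (hφm 0).sqrt).aestronglyMeasurable.mul
        (Lp.aestronglyMeasurable P)
    rw [memLp_two_iff_integrable_sq_norm hm]
    refine (hwi 0).congr (Filter.Eventually.of_forall fun x => ?_)
    simp only [w, norm_mul, mul_pow, Complex.norm_real, Real.norm_eq_abs, sq_abs, Real.sq_sqrt (h0 _)]
  refine ⟨hηm.toLp _, hηm.coeFn_toLp, ?_⟩
  have h1 : ‖hηm.toLp _‖ ^ 2 = ∫ x, w 0 x ∂(powMeasure (n + 1)) := by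
    rw [norm_sq_eq_integral]
    refine integral_congr_ae ?_
    filter_upwards [hηm.coeFn_toLp] with x hx
    rw [hx]
    simp only [w, norm_mul, mul_pow, Complex.norm_real, Real.norm_eq_abs, sq_abs, Real.sq_sqrt (h0 _)]
  have h2 : (inner ℂ P X).re = ∫ x, (inner ℂ (P x) (X x) : ℂ).re ∂(powMeasure (n + 1)) := by
    rw [L2.inner_def]
    exact (integral_re (L2.integrable_inner (𝕜 := ℂ) P X)).symm
  rw [h1, h2, integral_congr_ae hsum, integral_finsetSum _ fun i _ => hwi i]
  simp [hweq]

/-- `η` is `φ(k₀)^(1/2) Ψ`. -/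
def IsSqrtMul (φ : E3 → ℝ) {n : ℕ} (η Ψ : TensorPower (n + 1)) : Prop :=
  η =ᵐ[powMeasure (n + 1)] fun x => ((Real.sqrt (φ (x 0).1) : ℝ) : ℂ) * Ψ x

theorem contract_sqrt {n : ℕ} {f f₁ : OnePhoton} {η Ψ : TensorPower (n + 1)}
    (hη : IsSqrtMul φ η Ψ)
    (hf : f =ᵐ[photonMeasure] fun x => ((Real.sqrt (φ x.1) : ℝ) : ℂ) * f₁ x) :
    contract f n Ψ = contract f₁ n η := by
  refine ext_inner_left ℂ fun Φ => ?_
  rw [inner_contract_right, inner_contract_right, L2.inner_def, L2.inner_def]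
  refine integral_congr_ae ?_
  filter_upwards [hη, coeFn_prepend f Φ, coeFn_prepend f₁ Φ, ae_eval 0 hf] with x h1 h2 h3 h4
  rw [h1, h2, h3, h4]
  simp only [RCLike.inner_apply, map_mul, Complex.conj_ofReal]
  ring

/-- The additional photon changes ∑ᵢ φ(kᵢ) by φ(k₀), so the commutator of dΓ(φ) with creation is
multiplication by φ(k₀). It is split into two square roots, one for the state and one for f. -/
theorem inner_prepend_commutator {n : ℕ} {f f₂ : OnePhoton} {η Ψ X : TensorPower (n + 1)}
    {Φ Y : TensorPower n} (h0 : ∀ k, 0 ≤ φ k) (hη : IsSqrtMul φ η Ψ)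
    (hX : X =ᵐ[powMeasure (n + 1)] fun x => (sumFn φ x : ℂ) * Ψ x)
    (hY : Y =ᵐ[powMeasure n] fun x => (sumFn φ x : ℂ) * Φ x)
    (hf : f₂ =ᵐ[photonMeasure] fun x => ((Real.sqrt (φ x.1) : ℝ) : ℂ) * f x) :
    inner ℂ X (prepend f n Φ) - inner ℂ Ψ (prepend f n Y) = inner ℂ η (prepend f₂ n Φ) := by
  rw [L2.inner_def, L2.inner_def, L2.inner_def,
    ← integral_sub (L2.integrable_inner _ _) (L2.integrable_inner _ _)]
  refine integral_congr_ae ?_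
  filter_upwards [hη, hX, ae_tail hY, coeFn_prepend f Φ, coeFn_prepend f Y, coeFn_prepend f₂ Φ,
    ae_eval 0 hf] with x h1 h2 h3 h4 h5 h6 h7
  have hs : sumFn φ x = φ (x 0).1 + sumFn φ fun i : Fin n => x i.succ := Fin.sum_univ_succ _
  have hq : ((Real.sqrt (φ (x 0).1) : ℝ) : ℂ) * ((Real.sqrt (φ (x 0).1) : ℝ) : ℂ) = (φ (x 0).1 : ℂ) := by
    rw [← Complex.ofReal_mul, Real.mul_self_sqrt (h0 _)]
  rw [h1, h2, h4, h5, h6, h7, h3, hs]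
  simp only [RCLike.inner_apply, map_mul, Complex.conj_ofReal]
  push_cast
  rw [← hq]
  ring

theorem hasSum_inner_fock (a b : Fock) :
    HasSum (fun n => inner ℂ (a n : TensorPower n) (b n : TensorPower n)) (inner ℂ a b) :=
  lp.hasSum_inner (𝕜 := ℂ) (G := fun n : ℕ => SymPower n) a b

theorem hasSum_norm_sq_fock (a : Fock) : HasSum (fun n => ‖a n‖ ^ 2) (‖a‖ ^ 2) := by
  have := lp.hasSum_norm (E := fun n : ℕ => SymPower n) (p := 2) (by simp) a
  simpa using this

theorem exists_fock (v : ∀ n, SymPower n) (hv : Summable fun n => ‖v n‖ ^ 2) :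
    ∃ a : Fock, ∀ n, a n = v n :=
  ⟨⟨v, memℓp_gen (by simpa using hv)⟩, fun _ => rfl⟩

theorem norm_symmetrize_le {n : ℕ} (Ψ : TensorPower n) : ‖symmetrize n Ψ‖ ≤ ‖Ψ‖ :=
  (SymPower n).norm_orthogonalProjectionOnto_apply_le Ψ

theorem norm_contract_le {n : ℕ} (f : OnePhoton) (Ψ : TensorPower (n + 1)) :
    ‖contract f n Ψ‖ ≤ ‖f‖ * ‖Ψ‖ := by
  refine ContinuousLinearMap.le_of_opNorm_le _ ?_ Ψ
  rw [contract, LinearIsometryEquiv.norm_map]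
  exact ContinuousLinearMap.opNorm_le_bound _ (norm_nonneg _) fun Φ => (norm_prepend f Φ).le

variable {f f₁ f₂ : OnePhoton}

include hφ h0 in
-- The standard estimate ‖a(f)Ψ‖² ≤ ‖φ^(-1/2)f‖² ⟨Ψ, dΓ(φ)Ψ⟩, sector by sector: the square root of φ
-- is moved from f to the state before contracting.
theorem annihilation_bound {n : ℕ}
    (hf : f =ᵐ[photonMeasure] fun x => ((Real.sqrt (φ x.1) : ℝ) : ℂ) * f₁ x)
    {a x : Fock} (hx : (a, x) ∈ (dGamma (mulOp φ)).graph) :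
    ((n : ℝ) + 1) * ‖contract f n (a (n + 1) : TensorPower (n + 1))‖ ^ 2
      ≤ ‖f₁‖ ^ 2 * (inner ℂ (a (n + 1) : TensorPower (n + 1)) (x (n + 1) : TensorPower (n + 1))).re := by
  obtain ⟨η, h1, h2⟩ := exists_sqrt_mul hφ h0 (a (n + 1)) _ ((mem_dGamma_mulOp_graph hφ).1 hx (n + 1))
  rw [← h2, contract_sqrt h1 hf]
  have := norm_contract_le f₁ η
  calc ((n : ℝ) + 1) * ‖contract f₁ n η‖ ^ 2 ≤ ((n : ℝ) + 1) * (‖f₁‖ * ‖η‖) ^ 2 := by gcongr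
    _ = _ := by ring

include hφ h0 in
/-- Relative boundedness of the annihilation and creation operators on the domain of `dΓ(φ)`. -/
theorem exists_annihilation_creation
    (hf : f =ᵐ[photonMeasure] fun x => ((Real.sqrt (φ x.1) : ℝ) : ℂ) * f₁ x)
    {a x : Fock} (hx : (a, x) ∈ (dGamma (mulOp φ)).graph) :
    ∃ b c : Fock, (∀ n, b n = annN f n (a (n + 1))) ∧ c 0 = 0 ∧
      ∀ n, c (n + 1) = creN f n (a n) := by
  have hs : Summable fun n => (inner ℂ (a n : TensorPower n) (x n : TensorPower n)).re :=
    (Complex.hasSum_re (hasSum_inner_fock a x)).summable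
  have hs1 := (summable_nat_add_iff 1).2 hs
  have ha := (hasSum_norm_sq_fock a).summable
  have hb1 := fun n => annihilation_bound hφ h0 (n := n) hf hx
  have hsq : ∀ n : ℕ, Real.sqrt (n + 1) ^ 2 = (n : ℝ) + 1 := fun n => Real.sq_sqrt (by positivity)
  have hb : Summable fun n => ‖annN f n (a (n + 1))‖ ^ 2 := by
    refine (hs1.mul_left (‖f₁‖ ^ 2)).of_nonneg_of_le (fun n => by positivity) fun n => ?_
    refine le_trans ?_ (hb1 n)
    rw [annN_apply, norm_smul, mul_pow, Complex.norm_real, Real.norm_eq_abs, sq_abs, hsq]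
    have := norm_symmetrize_le (contract f n (a (n + 1) : TensorPower (n + 1)))
    gcongr
  have hc : Summable fun n => ‖creN f n (a n)‖ ^ 2 := by
    rw [← summable_nat_add_iff 1]
    refine (((summable_nat_add_iff 1).2 ha).mul_left (‖f‖ ^ 2) |>.add
      (hs1.mul_left (‖f₁‖ ^ 2))).of_nonneg_of_le (fun n => by positivity) fun n => ?_
    rw [creN_apply, norm_smul, mul_pow, Complex.norm_real, Real.norm_eq_abs, sq_abs, hsq]
    -- The commutation relation reduces the norm of the creation part to that of the annihilation
    -- part plus ‖f‖²‖a‖².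
    have h1 := norm_symmetrize_prepend_sq f (a (n + 1))
    have h2 := hb1 n
    push_cast
    rw [show (n : ℝ) + 1 + 1 = n + 2 by ring, h1]
    linarith
  obtain ⟨b, hb'⟩ := exists_fock (fun n => annN f n (a (n + 1))) hb
  obtain ⟨c, hc'⟩ := exists_fock (fun n => match n with
    | 0 => 0
    | n + 1 => creN f n (a n)) ((summable_nat_add_iff 1).1 hc)
  exact ⟨b, c, hb', hc' 0, fun n => hc' (n + 1)⟩

include hφ h0 in
theorem re_inner_dGamma_sector_nonneg {a x : Fock} (hx : (a, x) ∈ (dGamma (mulOp φ)).graph)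
    (n : ℕ) : 0 ≤ (inner ℂ (a n : TensorPower n) (x n : TensorPower n)).re := by
  cases n with
  | zero =>
    have h0 : (x 0 : TensorPower 0) = 0 := by
      refine Lp.ext ?_
      filter_upwards [(mem_dGamma_mulOp_graph hφ).1 hx 0, Lp.coeFn_zero ℂ 2 (powMeasure 0)]
        with y h1 h2
      rw [h1, h2]
      simp [sumFn]
    rw [h0, inner_zero_right]
    rfl
  | succ n =>
    obtain ⟨η, h1, h2⟩ := exists_sqrt_mul hφ h0 (a (n + 1)) _
      ((mem_dGamma_mulOp_graph hφ).1 hx (n + 1))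
    rw [← h2]; positivity

include hφ h0 in
theorem re_inner_dGamma_nonneg {a x : Fock} (hx : (a, x) ∈ (dGamma (mulOp φ)).graph) :
    0 ≤ (inner ℂ a x).re :=
  (Complex.hasSum_re (hasSum_inner_fock a x)).nonneg fun n =>
    re_inner_dGamma_sector_nonneg hφ h0 hx n

/-- `dΓ(φ)` and `dΓ(ψ)` commute. -/
theorem inner_dGamma_comm {ψ : E3 → ℝ} (hφ : Measurable φ) (hψ : Measurable ψ) {a x y a' x' y' : Fock}
    (hx : (a, x) ∈ (dGamma (mulOp φ)).graph) (hy : (a, y) ∈ (dGamma (mulOp ψ)).graph)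
    (hx' : (a', x') ∈ (dGamma (mulOp φ)).graph) (hy' : (a', y') ∈ (dGamma (mulOp ψ)).graph) :
    inner ℂ x y' = inner ℂ y x' := by
  refine (hasSum_inner_fock x y').unique ((hasSum_inner_fock y x').congr_fun fun n => ?_)
  rw [L2.inner_def, L2.inner_def]
  refine integral_congr_ae ?_
  filter_upwards [(mem_dGamma_mulOp_graph hφ).1 hx n, (mem_dGamma_mulOp_graph hψ).1 hy n,
    (mem_dGamma_mulOp_graph hφ).1 hx' n, (mem_dGamma_mulOp_graph hψ).1 hy' n] with z h1 h2 h3 h4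
  rw [h1, h2, h3, h4]
  simp only [RCLike.inner_apply, map_mul, Complex.conj_ofReal]
  ring

include hφ in
/-- The domain of `dΓ(φ)` is contained in the domain of `dΓ(ψ)` if `|ψ| ≤ φ`. -/
theorem exists_dGamma_of_abs_le {ψ : E3 → ℝ} (hψ : Measurable ψ) (h : ∀ k, |ψ k| ≤ φ k) {a x : Fock}
    (hx : (a, x) ∈ (dGamma (mulOp φ)).graph) : ∃ y, (a, y) ∈ (dGamma (mulOp ψ)).graph := by
  have hle : ∀ (n : ℕ) (z : Fin n → Photon), |sumFn ψ z| ≤ |sumFn φ z| := fun n z =>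
    (Finset.abs_sum_le_sum_abs _ _).trans
      ((Finset.sum_le_sum fun i _ => h (z i).1).trans (le_abs_self _))
  have hm : ∀ n, MemLp (fun z => (sumFn ψ z : ℂ) * (a n : TensorPower n) z) 2 (powMeasure n) := by
    intro n
    refine (Lp.memLp (x n : TensorPower n)).mono
      ((Complex.measurable_ofReal.comp (measurable_sumFn hψ)).aestronglyMeasurable.mul
        (Lp.aestronglyMeasurable _)) ?_
    filter_upwards [(mem_dGamma_mulOp_graph hφ).1 hx n] with z hz
    rw [hz, norm_mul, norm_mul, Complex.norm_real, Complex.norm_real]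
    exact mul_le_mul_of_nonneg_right (hle n z) (norm_nonneg _)
  have hs : ∀ n, (hm n).toLp _ ∈ SymPower n := by
    intro n
    refine mem_symPower.2 fun σ => Lp.ext ?_
    have h1 : ∀ Ψ : TensorPower n, permute σ Ψ =ᵐ[powMeasure n] Ψ ∘ fun x i => x (σ i) := fun Ψ =>
      Lp.coeFn_compMeasurePreserving Ψ (measurePreserving_permute σ)
    have h2 := h1 (a n)
    rw [mem_symPower.1 (a n).2] at h2
    filter_upwards [h1 ((hm n).toLp _), h2, (hm n).coeFn_toLp,
      (measurePreserving_permute σ).quasiMeasurePreserving.ae (hm n).coeFn_toLp] with z h3 h4 h5 h6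
    rw [h3, h5, Function.comp_apply, h6, h4, Function.comp_apply]
    congr 2
    exact Equiv.sum_comp σ fun i => ψ (z i).1
  obtain ⟨y, hy⟩ := exists_fock (fun n => ⟨(hm n).toLp _, hs n⟩) (by
    refine (hasSum_norm_sq_fock x).summable.of_nonneg_of_le (fun n => by positivity) fun n => ?_
    have : ‖(hm n).toLp _‖ ≤ ‖(x n : TensorPower n)‖ := by
      refine Lp.norm_le_norm_of_ae_le ?_
      filter_upwards [(mem_dGamma_mulOp_graph hφ).1 hx n, (hm n).coeFn_toLp] with z hz hz'
      rw [hz, hz', norm_mul, norm_mul, Complex.norm_real, Complex.norm_real]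
      exact mul_le_mul_of_nonneg_right (hle n z) (norm_nonneg _)
    exact pow_le_pow_left₀ (norm_nonneg _) this 2)
  refine ⟨y, (mem_dGamma_mulOp_graph hψ).2 fun n => ?_⟩
  rw [hy]
  exact (hm n).coeFn_toLp

include hφ h0 in
/-- `1 + dΓ(φ)` is surjective. -/
theorem exists_resolvent_dGamma (ψ : Fock) :
    ∃ a x : Fock, (a, x) ∈ (dGamma (mulOp φ)).graph ∧ ψ = a + x := by
  have hs0 : ∀ (n : ℕ) (z : Fin n → Photon), 0 ≤ sumFn φ z := fun n z =>
    Finset.sum_nonneg fun i _ => h0 _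
  have hle : ∀ (n : ℕ) (z : Fin n → Photon), ‖(((1 + sumFn φ z)⁻¹ : ℝ) : ℂ)‖ ≤ 1 := fun n z => by
    have := hs0 n z
    rw [Complex.norm_real, Real.norm_of_nonneg (by positivity)]
    exact inv_le_one_of_one_le₀ (by linarith)
  -- The resolvent is multiplication by (1 + ∑ᵢ φ(kᵢ))⁻¹, which is bounded by 1 and permutation
  -- invariant.
  have hm : ∀ n, MemLp (fun z => (((1 + sumFn φ z)⁻¹ : ℝ) : ℂ) * (ψ n : TensorPower n) z) 2
      (powMeasure n) := by
    intro n
    refine (Lp.memLp (ψ n : TensorPower n)).mono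
      ((Complex.measurable_ofReal.comp
        ((measurable_sumFn hφ).const_add 1).inv).aestronglyMeasurable.mul
        (Lp.aestronglyMeasurable _)) (Filter.Eventually.of_forall fun z => ?_)
    rw [norm_mul]
    exact mul_le_of_le_one_left (norm_nonneg _) (hle n z)
  have hs : ∀ n, (hm n).toLp _ ∈ SymPower n := by
    intro n
    refine mem_symPower.2 fun σ => Lp.ext ?_
    have h1 : ∀ Ψ : TensorPower n, permute σ Ψ =ᵐ[powMeasure n] Ψ ∘ fun x i => x (σ i) := fun Ψ =>
      Lp.coeFn_compMeasurePreserving Ψ (measurePreserving_permute σ)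
    have h2 := h1 (ψ n)
    rw [mem_symPower.1 (ψ n).2] at h2
    filter_upwards [h1 ((hm n).toLp _), h2, (hm n).coeFn_toLp,
      (measurePreserving_permute σ).quasiMeasurePreserving.ae (hm n).coeFn_toLp] with z h3 h4 h5 h6
    rw [h3, h5, Function.comp_apply, h6, h4, Function.comp_apply]
    congr 4
    exact Equiv.sum_comp σ fun i => φ (z i).1
  obtain ⟨a, ha⟩ := exists_fock (fun n => ⟨(hm n).toLp _, hs n⟩) (by
    refine (hasSum_norm_sq_fock ψ).summable.of_nonneg_of_le (fun n => by positivity) fun n => ?_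
    have : ‖(hm n).toLp _‖ ≤ ‖(ψ n : TensorPower n)‖ := by
      refine Lp.norm_le_norm_of_ae_le ?_
      filter_upwards [(hm n).coeFn_toLp] with z hz'
      rw [hz', norm_mul]
      exact mul_le_of_le_one_left (norm_nonneg _) (hle n z)
    exact pow_le_pow_left₀ (norm_nonneg _) this 2)
  refine ⟨a, ψ - a, (mem_dGamma_mulOp_graph hφ).2 fun n => ?_, by abel⟩
  have h1 : (a n : TensorPower n) = (hm n).toLp _ := by rw [ha]
  have h2 : ((ψ - a : Fock) n : TensorPower n) = (ψ n : TensorPower n) - (a n : TensorPower n) := rfl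
  rw [h2, h1]
  filter_upwards [(hm n).coeFn_toLp, Lp.coeFn_sub (ψ n : TensorPower n) ((hm n).toLp _)] with z h3 h4
  rw [h4, Pi.sub_apply, h3]
  have h5 : (1 + (sumFn φ z : ℂ)) ≠ 0 := by
    have := hs0 n z
    exact_mod_cast (by positivity : (1 + sumFn φ z) ≠ 0)
  push_cast
  field_simp
  ring

include hφ h0 in
-- In each sector the commutator is √(n + 1) ⟨η, f₂ ⊗ a'⟩ with η = φ(k₀)^(1/2) a. By the
-- arithmetic-geometric inequality it is at most ‖f₂‖/2 times (n + 1)‖η‖² + ‖a'‖², and the first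
-- summand is the form of dΓ(φ) in sector n + 1.
theorem inner_creation_commutator_le
    (hf : f₂ =ᵐ[photonMeasure] fun x => ((Real.sqrt (φ x.1) : ℝ) : ℂ) * f x)
    {a x a' x' b c' : Fock} (hx : (a, x) ∈ (dGamma (mulOp φ)).graph)
    (hx' : (a', x') ∈ (dGamma (mulOp φ)).graph) (hb : ∀ n, b n = annN f n (a (n + 1)))
    (hc0 : c' 0 = 0) (hc : ∀ n, c' (n + 1) = creN f n (a' n)) :
    ‖(inner ℂ x c' - inner ℂ b x' : ℂ)‖ ≤ ‖f₂‖ / 2 * ((inner ℂ a x).re + ‖a'‖ ^ 2) := by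
  have h1 := (hasSum_nat_add_iff' 1).2 (hasSum_inner_fock x c')
  rw [Finset.sum_range_one, hc0, Submodule.coe_zero, inner_zero_right, sub_zero] at h1
  have h2 := h1.sub (hasSum_inner_fock b x')
  have hs := (Complex.hasSum_re (hasSum_inner_fock a x))
  have hs1 := ((summable_nat_add_iff 1).2 hs.summable).hasSum
  have hs2 := (hs1.add (hasSum_norm_sq_fock a')).mul_left (‖f₂‖ / 2)
  have hnn := fun n => re_inner_dGamma_sector_nonneg hφ h0 hx n
  have hle : ∑' n, (inner ℂ (a (n + 1) : TensorPower (n + 1)) (x (n + 1) : TensorPower (n + 1))).re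
      ≤ (inner ℂ a x).re := by
    have := hs.summable.sum_add_tsum_nat_add 1
    rw [Finset.sum_range_one, hs.tsum_eq] at this
    linarith [hnn 0]
  have hfn : 0 ≤ ‖f₂‖ / 2 := by positivity
  refine le_trans ?_ (mul_le_mul_of_nonneg_left (add_le_add_left hle _) hfn)
  refine h2.norm_le_of_bounded hs2 fun n => ?_
  obtain ⟨η, h3, h4⟩ := exists_sqrt_mul hφ h0 (a (n + 1)) _
    ((mem_dGamma_mulOp_graph hφ).1 hx (n + 1))
  have h5 := inner_prepend_commutator h0 h3 ((mem_dGamma_mulOp_graph hφ).1 hx (n + 1))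
    ((mem_dGamma_mulOp_graph hφ).1 hx' n) hf
  have h6 : inner ℂ (b n : TensorPower n) (x' n : TensorPower n) = ((Real.sqrt (n + 1) : ℝ) : ℂ) *
      inner ℂ (a (n + 1) : TensorPower (n + 1)) (prepend f n (x' n : TensorPower n)) := by
    rw [hb]; exact inner_annN_left _ _
  have h7 : inner ℂ (x (n + 1) : TensorPower (n + 1)) (c' (n + 1) : TensorPower (n + 1))
      = ((Real.sqrt (n + 1) : ℝ) : ℂ) *
      inner ℂ (x (n + 1) : TensorPower (n + 1)) (prepend f n (a' n : TensorPower n)) := by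
    rw [hc, ← inner_conj_symm, ← inner_conj_symm (x (n + 1) : TensorPower (n + 1)) (prepend f n _)]
    rw [show inner ℂ (creN f n (a' n) : TensorPower (n + 1)) (x (n + 1) : TensorPower (n + 1))
      = _ from inner_creN_left (a' n) (x (n + 1)), map_mul, Complex.conj_ofReal]
  rw [h6, h7, ← mul_sub, h5, norm_mul, Complex.norm_real, Real.norm_of_nonneg (Real.sqrt_nonneg _)]
  have h8 := norm_inner_le_norm (𝕜 := ℂ) η (prepend f₂ n (a' n : TensorPower n))
  rw [norm_prepend] at h8
  have h9 : ‖(a' n : TensorPower n)‖ = ‖a' n‖ := rfl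
  rw [← h4, ← h9]
  have h10 : Real.sqrt (n + 1) ^ 2 = (n : ℝ) + 1 := Real.sq_sqrt (by positivity)
  calc Real.sqrt (n + 1) * ‖(inner ℂ η (prepend f₂ n (a' n : TensorPower n)) : ℂ)‖
      ≤ Real.sqrt (n + 1) * (‖η‖ * (‖f₂‖ * ‖(a' n : TensorPower n)‖)) := by gcongr
    _ ≤ _ := by
      have h11 : ((n : ℝ) + 1) * ‖η‖ ^ 2 = (Real.sqrt (n + 1) * ‖η‖) ^ 2 := by rw [mul_pow, h10]
      rw [h11]
      nlinarith [mul_nonneg hfn (sq_nonneg (Real.sqrt (n + 1) * ‖η‖ - ‖(a' n : TensorPower n)‖))]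

include hφ h0 in
theorem exists_field
    (hf : f =ᵐ[photonMeasure] fun x => ((Real.sqrt (φ x.1) : ℝ) : ℂ) * f₁ x)
    {a x : Fock} (hx : (a, x) ∈ (dGamma (mulOp φ)).graph) :
    ∃ b c : Fock, (∀ n, b n = annN f n (a (n + 1))) ∧ c 0 = 0 ∧
      (∀ n, c (n + 1) = creN f n (a n)) ∧
      (a, ((Real.sqrt 2 : ℝ) : ℂ)⁻¹ • (b + c)) ∈ (field f).graph := by
  obtain ⟨b, c, h1, h2, h3⟩ := exists_annihilation_creation hφ h0 hf hx
  exact ⟨b, c, h1, h2, h3, add_mem_field_graph (mem_annihilation_graph.2 h1)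
    (creation_mem_adjoint_graph h2 h3)⟩

include hφ h0 in
/-- The commutator of the field with `dΓ(φ)` is form bounded by `1 + dΓ(φ)`. -/
theorem field_commutator_le
    (hf : f =ᵐ[photonMeasure] fun x => ((Real.sqrt (φ x.1) : ℝ) : ℂ) * f₁ x)
    (hf' : f₂ =ᵐ[photonMeasure] fun x => ((Real.sqrt (φ x.1) : ℝ) : ℂ) * f x)
    {a x y a' x' y' : Fock} (hx : (a, x) ∈ (dGamma (mulOp φ)).graph)
    (hx' : (a', x') ∈ (dGamma (mulOp φ)).graph) (hy : (a, y) ∈ (field f).graph)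
    (hy' : (a', y') ∈ (field f).graph) :
    ‖(inner ℂ x y' - inner ℂ y x' : ℂ)‖
      ≤ ‖f₂‖ * ((‖a‖ ^ 2 + (inner ℂ a x).re) + (‖a'‖ ^ 2 + (inner ℂ a' x').re)) := by
  obtain ⟨b, c, hb, hc0, hc, h⟩ := exists_field hφ h0 hf hx
  obtain ⟨b', c', hb', hc0', hc', h'⟩ := exists_field hφ h0 hf hx'
  rw [LinearPMap.mem_graph_snd_inj _ hy h rfl, LinearPMap.mem_graph_snd_inj _ hy' h' rfl]
  have h1 := inner_creation_commutator_le hφ h0 hf' hx hx' hb hc0' hc'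
  have h2 := inner_creation_commutator_le hφ h0 hf' hx' hx hb' hc0 hc
  -- The annihilation half of the commutator is, up to sign and complex conjugation, the creation
  -- half with the two states exchanged.
  have h3 : ‖(inner ℂ x b' - inner ℂ c x' : ℂ)‖ = ‖(inner ℂ x' c - inner ℂ b' x : ℂ)‖ := by
    rw [← RCLike.norm_conj (inner ℂ x' c - inner ℂ b' x : ℂ), map_sub, inner_conj_symm,
      inner_conj_symm, norm_sub_rev]
  have h4 : (inner ℂ x (((Real.sqrt 2 : ℝ) : ℂ)⁻¹ • (b' + c'))
      - inner ℂ (((Real.sqrt 2 : ℝ) : ℂ)⁻¹ • (b + c)) x' : ℂ)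
      = ((Real.sqrt 2 : ℝ) : ℂ)⁻¹ * ((inner ℂ x c' - inner ℂ b x')
        + (inner ℂ x b' - inner ℂ c x')) := by
    rw [inner_smul_right, inner_smul_left, map_inv₀, Complex.conj_ofReal, inner_add_left,
      inner_add_right]
    ring
  have h5 : ‖((Real.sqrt 2 : ℝ) : ℂ)⁻¹‖ ≤ 1 := by
    rw [norm_inv, Complex.norm_real, Real.norm_of_nonneg (Real.sqrt_nonneg _)]
    exact inv_le_one_of_one_le₀ (Real.one_le_sqrt.2 (by norm_num))
  have h6 := norm_add_le (inner ℂ x c' - inner ℂ b x' : ℂ) (inner ℂ x b' - inner ℂ c x')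
  rw [h4, norm_mul]
  have h7 := mul_le_of_le_one_left (norm_nonneg ((inner ℂ x c' - inner ℂ b x' : ℂ)
        + (inner ℂ x b' - inner ℂ c x'))) h5
  have h8 := norm_nonneg (inner ℂ x c' - inner ℂ b x' : ℂ)
  have h9 := norm_nonneg (inner ℂ x' c - inner ℂ b' x : ℂ)
  linarith

end FieldBounds

end DiracPolaron
namespace DiracPolaron

/-! ### Weighted square integrability of the photon form factors -/

section FormFactors

/-- The photon dispersion relation `ω_m(k) = (1 + m) |k| + m`. -/
noncomputable def dispersion (m : ℝ) (k : E3) : ℝ := (1 + m) * ‖k‖ + m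

theorem measurable_dispersion (m : ℝ) : Measurable (dispersion m) :=
  (measurable_norm.const_mul _).add_const _

theorem norm_le_dispersion {m : ℝ} (hm : 0 ≤ m) (k : E3) : ‖k‖ ≤ dispersion m k := by
  have := mul_nonneg hm (norm_nonneg k)
  unfold dispersion
  linarith

theorem dispersion_nonneg {m : ℝ} (hm : 0 ≤ m) (k : E3) : 0 ≤ dispersion m k :=
  (norm_nonneg k).trans (norm_le_dispersion hm k)

theorem ae_ne_zero : ∀ᵐ x ∂photonMeasure, x.1 ≠ 0 :=
  ae_momentum (measure_eq_zero_iff_ae_notMem.1 (measure_singleton (0 : E3)))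

theorem norm_formFactor_le (e : Polarization) (ρ : Cutoff) (a : Fin 3) :
    ∀ᵐ x ∂photonMeasure, ‖formFactor e ρ a x‖ ≤ (Real.sqrt ‖x.1‖)⁻¹ * ‖ρ.fn x.1‖ := by
  filter_upwards [e.norm_vec, (memLp_formFactor e ρ a).coeFn_toLp] with x hx h
  rw [formFactor, h]
  have he : ‖e.vec x.2 x.1 a‖ ≤ 1 := (PiLp.norm_apply_le _ _).trans (hx x.2).le
  rw [norm_mul, norm_mul, Complex.norm_real, Complex.norm_real, Real.norm_of_nonneg (by positivity)]
  exact mul_le_of_le_one_right (by positivity) he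

/-- Since ω_m(k) ≥ |k|, the quotient is dominated by |ρ|/|k|. It is the vector needed for the
relative bound of the field. -/
theorem exists_formFactor_div (e : Polarization) (ρ : Cutoff) (a : Fin 3) {m : ℝ} (hm : 0 ≤ m) :
    ∃ f₁ : OnePhoton, formFactor e ρ a =ᵐ[photonMeasure]
      fun x => ((Real.sqrt (dispersion m x.1) : ℝ) : ℂ) * f₁ x := by
  have hmem : MemLp (fun x => (((Real.sqrt (dispersion m x.1))⁻¹ : ℝ) : ℂ) * formFactor e ρ a x) 2
      photonMeasure := by
    refine (memLp_fst ρ.memLp_inv).mono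
      ((Complex.measurable_ofReal.comp
        ((measurable_dispersion m).comp measurable_fst).sqrt.inv).aestronglyMeasurable.mul
        (Lp.aestronglyMeasurable _)) ?_
    filter_upwards [norm_formFactor_le e ρ a, ae_ne_zero] with x h1 h2
    have hx : 0 < ‖x.1‖ := norm_pos_iff.2 h2
    have h3 := Real.sqrt_le_sqrt (norm_le_dispersion hm x.1)
    have h4 : 0 < Real.sqrt ‖x.1‖ := Real.sqrt_pos.2 hx
    rw [norm_mul, norm_mul, Complex.norm_real, Complex.norm_real,
      Real.norm_of_nonneg (by positivity), Real.norm_of_nonneg (by positivity)]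
    calc (Real.sqrt (dispersion m x.1))⁻¹ * ‖formFactor e ρ a x‖
        ≤ (Real.sqrt ‖x.1‖)⁻¹ * ((Real.sqrt ‖x.1‖)⁻¹ * ‖ρ.fn x.1‖) := by gcongr
      _ = ‖x.1‖⁻¹ * ‖ρ.fn x.1‖ := by
        rw [← mul_assoc, ← mul_inv, Real.mul_self_sqrt hx.le]
  refine ⟨hmem.toLp _, ?_⟩
  filter_upwards [hmem.coeFn_toLp, ae_ne_zero] with x h1 h2
  have h3 : Real.sqrt (dispersion m x.1) ≠ 0 :=
    (Real.sqrt_pos.2 ((norm_pos_iff.2 h2).trans_le (norm_le_dispersion hm x.1))).ne'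
  rw [h1, ← mul_assoc, ← Complex.ofReal_mul, mul_inv_cancel₀ h3, Complex.ofReal_one, one_mul]

/-- Here ω_m(k)/|k| = (1 + m) + m/|k|, whose root is at most (1 + m)(1 + 1/|k|); both |ρ| and
|ρ|/|k| are square integrable. This is the vector needed for the commutator. -/
theorem exists_formFactor_mul (e : Polarization) (ρ : Cutoff) (a : Fin 3) {m : ℝ} (hm : 0 ≤ m) :
    ∃ f₂ : OnePhoton, f₂ =ᵐ[photonMeasure]
      fun x => ((Real.sqrt (dispersion m x.1) : ℝ) : ℂ) * formFactor e ρ a x := by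
  have hmem : MemLp (fun x => ((Real.sqrt (dispersion m x.1) : ℝ) : ℂ) * formFactor e ρ a x) 2
      photonMeasure := by
    refine (((memLp_fst ρ.memLp).norm.add (memLp_fst ρ.memLp_inv).norm).const_mul (1 + m)).mono
      ((Complex.measurable_ofReal.comp
        ((measurable_dispersion m).comp measurable_fst).sqrt).aestronglyMeasurable.mul
        (Lp.aestronglyMeasurable _)) ?_
    filter_upwards [norm_formFactor_le e ρ a, ae_ne_zero] with x h1 h2
    have hx : 0 < ‖x.1‖ := norm_pos_iff.2 h2
    rw [Pi.add_apply, norm_mul, norm_mul, Complex.norm_real,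
      Real.norm_of_nonneg (Real.sqrt_nonneg _), Real.norm_of_nonneg (show 0 ≤ 1 + m by positivity),
      Real.norm_of_nonneg (add_nonneg (norm_nonneg _) (norm_nonneg _))]
    have hr : 0 ≤ ‖ρ.fn x.1‖ := norm_nonneg _
    have h4 : Real.sqrt (dispersion m x.1) * (Real.sqrt ‖x.1‖)⁻¹ ≤ (1 + m) * (1 + ‖x.1‖⁻¹) := by
      rw [← div_eq_mul_inv, ← Real.sqrt_div (dispersion_nonneg hm _)]
      refine Real.sqrt_le_iff.2 ⟨by positivity, ?_⟩
      have h5 : dispersion m x.1 / ‖x.1‖ = (1 + m) + m * ‖x.1‖⁻¹ := by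
        unfold dispersion
        field_simp
      rw [h5]
      have h6 : 0 < ‖x.1‖⁻¹ := by positivity
      set y := ‖x.1‖⁻¹
      nlinarith [mul_nonneg hm h6.le, mul_nonneg hm hm, mul_nonneg (mul_nonneg hm hm) h6.le,
        mul_nonneg hm (mul_nonneg h6.le h6.le), sq_nonneg ((1 + m) * y)]
    have h7 : ‖(‖x.1‖⁻¹ : ℝ)‖ = ‖x.1‖⁻¹ := Real.norm_of_nonneg (by positivity)
    calc Real.sqrt (dispersion m x.1) * ‖formFactor e ρ a x‖
        ≤ Real.sqrt (dispersion m x.1) * ((Real.sqrt ‖x.1‖)⁻¹ * ‖ρ.fn x.1‖) := by gcongr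
      _ = (Real.sqrt (dispersion m x.1) * (Real.sqrt ‖x.1‖)⁻¹) * ‖ρ.fn x.1‖ := by ring
      _ ≤ ((1 + m) * (1 + ‖x.1‖⁻¹)) * ‖ρ.fn x.1‖ := by gcongr
      _ = _ := by
        rw [norm_mul, Complex.norm_real, h7]
        ring
  exact ⟨hmem.toLp _, hmem.coeFn_toLp⟩

end FormFactors

/-! ### Graphs of sums, multiples and compositions of partial operators -/

section Graphs

variable {R E F : Type*} [CommRing R] [AddCommGroup E] [Module R E] [AddCommGroup F] [Module R F]

theorem mem_graph_add {f g : E →ₗ.[R] F} {x : E} {z : F} :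
    (x, z) ∈ (f + g).graph ↔ ∃ y y', (x, y) ∈ f.graph ∧ (x, y') ∈ g.graph ∧ z = y + y' := by
  constructor
  · intro h
    obtain ⟨w, rfl, h2⟩ := (LinearPMap.mem_graph_iff _).1 h
    exact ⟨_, _, f.mem_graph ⟨w, w.2.1⟩, g.mem_graph ⟨w, w.2.2⟩, h2.symm⟩
  · rintro ⟨y, y', h1, h2, rfl⟩
    obtain ⟨w, rfl, h4⟩ := (LinearPMap.mem_graph_iff _).1 h1
    obtain ⟨w', h5, h6⟩ := (LinearPMap.mem_graph_iff _).1 h2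
    refine (LinearPMap.mem_graph_iff _).2 ⟨⟨w, w.2, ?_⟩, rfl, ?_⟩
    · simp only at h5; rw [← h5]; exact w'.2
    · rw [LinearPMap.add_apply]
      simp only at h4 h6
      rw [← h4, ← h6]
      congr 2
      exact Subtype.ext h5.symm

theorem mem_graph_neg {f : E →ₗ.[R] F} {x : E} {z : F} :
    (x, z) ∈ (-f).graph ↔ (x, -z) ∈ f.graph := by
  constructor
  · intro h
    obtain ⟨w, rfl, h2⟩ := (LinearPMap.mem_graph_iff _).1 h
    simp only [LinearPMap.neg_apply] at h2
    rw [← h2, neg_neg]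
    exact f.mem_graph w
  · intro h
    obtain ⟨w, rfl, h2⟩ := (LinearPMap.mem_graph_iff _).1 h
    refine (LinearPMap.mem_graph_iff _).2 ⟨w, rfl, ?_⟩
    rw [LinearPMap.neg_apply]
    simp only at h2
    rw [h2, neg_neg]

theorem mem_graph_sub {f g : E →ₗ.[R] F} {x : E} {z : F} :
    (x, z) ∈ (f - g).graph ↔ ∃ y y', (x, y) ∈ f.graph ∧ (x, y') ∈ g.graph ∧ z = y - y' := by
  rw [sub_eq_add_neg, mem_graph_add]
  constructor
  · rintro ⟨y, y', h1, h2, rfl⟩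
    exact ⟨y, -y', h1, mem_graph_neg.1 h2, by abel⟩
  · rintro ⟨y, y', h1, h2, rfl⟩
    exact ⟨y, -y', h1, mem_graph_neg.2 (by rwa [neg_neg]), by abel⟩

theorem mem_graph_smul {f : E →ₗ.[R] F} {c : R} {x : E} {z : F} :
    (x, z) ∈ (c • f).graph ↔ ∃ y, (x, y) ∈ f.graph ∧ z = c • y := by
  rw [LinearPMap.smul_graph]
  constructor
  · rintro ⟨⟨a, b⟩, h, h2⟩
    obtain ⟨rfl, rfl⟩ := Prod.ext_iff.1 h2
    exact ⟨b, h, rfl⟩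
  · rintro ⟨y, h, rfl⟩
    exact ⟨(x, y), h, rfl⟩

theorem mem_graph_vadd {f : E →ₗ[R] F} {g : E →ₗ.[R] F} {x : E} {z : F} :
    (x, z) ∈ (f +ᵥ g).graph ↔ ∃ y, (x, y) ∈ g.graph ∧ z = f x + y := by
  constructor
  · intro h
    obtain ⟨w, rfl, h2⟩ := (LinearPMap.mem_graph_iff _).1 h
    exact ⟨_, g.mem_graph w, h2.symm⟩
  · rintro ⟨y, h1, rfl⟩
    obtain ⟨w, rfl, h4⟩ := (LinearPMap.mem_graph_iff _).1 h1
    refine (LinearPMap.mem_graph_iff _).2 ⟨w, rfl, ?_⟩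
    simp only at h4
    rw [← h4]
    rfl

theorem mem_graph_compPMap {f : F →ₗ[R] F} {g : E →ₗ.[R] F} {x : E} {z : F} :
    (x, z) ∈ (f.compPMap g).graph ↔ ∃ y, (x, y) ∈ g.graph ∧ z = f y := by
  constructor
  · intro h
    obtain ⟨w, rfl, h2⟩ := (LinearPMap.mem_graph_iff _).1 h
    exact ⟨_, g.mem_graph w, h2.symm⟩
  · rintro ⟨y, h1, rfl⟩
    obtain ⟨w, rfl, h4⟩ := (LinearPMap.mem_graph_iff _).1 h1
    refine (LinearPMap.mem_graph_iff _).2 ⟨w, rfl, ?_⟩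
    simp only at h4
    rw [← h4]
    rfl

theorem mem_graph_sum {f : Fin 3 → E →ₗ.[R] F} {x : E} {z : F} :
    (x, z) ∈ (∑ a, f a).graph ↔ ∃ y : Fin 3 → F, (∀ a, (x, y a) ∈ (f a).graph) ∧ z = ∑ a, y a := by
  rw [Fin.sum_univ_three, mem_graph_add]
  simp only [mem_graph_add]
  constructor
  · rintro ⟨_, y2, ⟨y0, y1, h0, h1, rfl⟩, h2, rfl⟩
    refine ⟨![y0, y1, y2], fun a => ?_, by simp [Fin.sum_univ_three]⟩
    fin_cases a
    · exact h0
    · exact h1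
    · exact h2
  · rintro ⟨y, hy, rfl⟩
    exact ⟨y 0 + y 1, y 2, ⟨y 0, y 1, hy 0, hy 1, rfl⟩, hy 2, Fin.sum_univ_three y⟩

end Graphs

/-! ### Essential self-adjointness of the Hamiltonian -/

section Hamiltonian

theorem inner_spinor_right (B : Matrix (Fin 4) (Fin 4) ℂ) (X Y : StateSpace) :
    inner ℂ X (spinor B Y) = ∑ i, ∑ l, B i l * inner ℂ (X i) (Y l) := by
  rw [PiLp.inner_apply]
  refine Finset.sum_congr rfl fun i _ => ?_
  change inner ℂ (X i) (∑ l, B i l • Y l) = _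
  rw [inner_sum]
  simp only [inner_smul_right]

theorem inner_spinor_left {B : Matrix (Fin 4) (Fin 4) ℂ} (hB : B.IsHermitian) (X Y : StateSpace) :
    inner ℂ (spinor B X) Y = ∑ i, ∑ l, B i l * inner ℂ (X i) (Y l) := by
  rw [← inner_conj_symm, inner_spinor_right, map_sum, Finset.sum_comm]
  simp only [map_sum, map_mul, inner_conj_symm]
  refine Finset.sum_congr rfl fun i _ => Finset.sum_congr rfl fun l _ => ?_
  rw [show starRingEnd ℂ (B i l) = B l i from hB.apply l i]

/-- If `X = N x` and `Y = T y` with commutators bounded by the form `q`, then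
`Im ⟨X, B Y⟩` is bounded by `q`. -/
theorem abs_im_inner_spinor_le {B : Matrix (Fin 4) (Fin 4) ℂ} (hB : B.IsHermitian)
    {X Y : StateSpace} {q : Fin 4 → ℝ} (hq : ∀ i, 0 ≤ q i) {C : ℝ}
    (h : ∀ i l, ‖(inner ℂ (X i) (Y l) - inner ℂ (Y i) (X l) : ℂ)‖ ≤ C * (q i + q l)) (hC : 0 ≤ C) :
    |(inner ℂ X (spinor B Y)).im| ≤ (∑ i, ∑ l, ‖B i l‖) * C * ∑ i, q i := by
  -- The left side is 2i times the imaginary part. Its factor 2 cancels the one arising from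
  -- bounding q i + q l by twice the total.
  have h1 : inner ℂ X (spinor B Y) - starRingEnd ℂ (inner ℂ X (spinor B Y))
      = ∑ i, ∑ l, B i l * (inner ℂ (X i) (Y l) - inner ℂ (Y i) (X l)) := by
    rw [inner_conj_symm, inner_spinor_right, inner_spinor_left hB]
    simp only [mul_sub, Finset.sum_sub_distrib]
  have h2 : ‖(∑ i, ∑ l, B i l * (inner ℂ (X i) (Y l) - inner ℂ (Y i) (X l)) : ℂ)‖
      ≤ ∑ i, ∑ l, ‖B i l‖ * (C * (2 * ∑ i, q i)) := by
    refine (norm_sum_le _ _).trans (Finset.sum_le_sum fun i _ => (norm_sum_le _ _).trans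
      (Finset.sum_le_sum fun l _ => ?_))
    rw [norm_mul]
    have hqi := Finset.single_le_sum (fun i _ => hq i) (Finset.mem_univ i)
    have hql := Finset.single_le_sum (fun i _ => hq i) (Finset.mem_univ l)
    have := h i l
    refine mul_le_mul_of_nonneg_left (this.trans ?_) (norm_nonneg _)
    exact mul_le_mul_of_nonneg_left (by linarith) hC
  rw [← h1, Complex.sub_conj, norm_mul, Complex.norm_I, mul_one, Complex.norm_real,
    Real.norm_eq_abs, abs_mul, abs_two] at h2
  simp only [← Finset.sum_mul] at h2
  linarith

theorem inner_spinor_eq {B : Matrix (Fin 4) (Fin 4) ℂ} (hB : B.IsHermitian)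
    {X Y X' Y' : StateSpace} (h : ∀ i l, inner ℂ (X i) (Y' l) = inner ℂ (X' i) (Y l)) :
    inner ℂ (spinor B X) Y' = inner ℂ X' (spinor B Y) := by
  rw [inner_spinor_left hB, inner_spinor_right]
  simp only [h]

theorem isHermitian_pauli (a : Fin 3) : (pauli a).IsHermitian := by
  ext i l
  fin_cases a <;> fin_cases i <;> fin_cases l <;> simp [pauli]

theorem isHermitian_diracAlpha (a : Fin 3) : (diracAlpha a).IsHermitian := by
  rw [IsHermitian, diracAlpha, conjTranspose_reindex, fromBlocks_conjTranspose,
    (isHermitian_pauli a).eq, conjTranspose_zero]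

theorem isHermitian_diracBeta : diracBeta.IsHermitian := by
  rw [IsHermitian, diracBeta, conjTranspose_reindex, fromBlocks_conjTranspose]
  simp

/-- The matrix `α · p + M β`. -/
noncomputable def diracMatrix (M : ℝ) (p : E3) : Matrix (Fin 4) (Fin 4) ℂ :=
  (∑ a, (p a : ℂ) • diracAlpha a) + (M : ℂ) • diracBeta

theorem isHermitian_diracMatrix (M : ℝ) (p : E3) : (diracMatrix M p).IsHermitian := by
  rw [IsHermitian, diracMatrix, conjTranspose_add, conjTranspose_sum]
  simp only [conjTranspose_smul, (isHermitian_diracAlpha _).eq, isHermitian_diracBeta.eq]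
  simp

variable {e : Polarization} {ρ : Cutoff} {M q m : ℝ} {p : E3}

theorem mem_hamiltonian_graph {Ψ Φ : StateSpace} :
    (Ψ, Φ) ∈ (hamiltonian e ρ M q m p).graph ↔
      ∃ (X : StateSpace) (K Y : Fin 3 → StateSpace),
        (∀ i, (Ψ i, X i) ∈ (dGamma (mulOp (dispersion m))).graph) ∧
        (∀ a i, (Ψ i, K a i) ∈ (dGamma (mulOp fun k => k a)).graph) ∧
        (∀ a i, (Ψ i, Y a i) ∈ (field (formFactor e ρ a)).graph) ∧
        Φ = spinor (diracMatrix M p) Ψ + (X - ∑ a, spinor (diracAlpha a) (K a)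
          - (q : ℂ) • ∑ a, spinor (diracAlpha a) (Y a)) := by
  rw [hamiltonian, mem_graph_vadd]
  simp only [mem_graph_sub, mem_graph_smul, mem_graph_sum, mem_graph_compPMap, mem_ampliation_graph]
  constructor
  · rintro ⟨_, ⟨_, _, ⟨X, _, hX, ⟨K', hK, rfl⟩, rfl⟩, ⟨_, ⟨Y', hY, rfl⟩, rfl⟩, rfl⟩, rfl⟩
    choose K hK1 hK2 using hK
    choose Y hY1 hY2 using hY
    refine ⟨X, K, Y, hX, hK1, hY1, ?_⟩
    simp only [hK2, hY2]
    rfl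
  · rintro ⟨X, K, Y, hX, hK, hY, rfl⟩
    exact ⟨_, ⟨_, _, ⟨X, _, hX, ⟨_, fun a => ⟨K a, hK a, rfl⟩, rfl⟩, rfl⟩,
      ⟨_, ⟨_, fun a => ⟨Y a, hY a, rfl⟩, rfl⟩, rfl⟩, rfl⟩, rfl⟩

theorem measurable_coord (a : Fin 3) : Measurable fun k : E3 => k a :=
  (measurable_pi_apply a).comp (WithLp.measurable_ofLp 2 (Fin 3 → ℝ))

theorem symmetricGraph_hamiltonian : SymmetricGraph (hamiltonian e ρ M q m p).graph := by
  rintro ⟨Ψ, Φ⟩ h ⟨Ψ', Φ'⟩ h'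
  obtain ⟨X, K, Y, hX, hK, hY, rfl⟩ := mem_hamiltonian_graph.1 h
  obtain ⟨X', K', Y', hX', hK', hY', rfl⟩ := mem_hamiltonian_graph.1 h'
  have h1 := inner_spinor_eq (isHermitian_diracMatrix M p) (X := Ψ) (Y := Ψ') (X' := Ψ) (Y' := Ψ')
    fun i l => rfl
  have h2 : inner ℂ X Ψ' = inner ℂ Ψ X' := by
    rw [PiLp.inner_apply, PiLp.inner_apply]
    exact Finset.sum_congr rfl fun i _ =>
      symmetricGraph_dGamma (isDenseSymmetric_mulOp (measurable_dispersion m)) _ (hX i) _ (hX' i)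
  have h3 : ∀ a, inner ℂ (spinor (diracAlpha a) (K a)) Ψ' = inner ℂ Ψ (spinor (diracAlpha a) (K' a)) :=
    fun a => inner_spinor_eq (isHermitian_diracAlpha a) fun i l =>
      symmetricGraph_dGamma (isDenseSymmetric_mulOp (measurable_coord a)) _ (hK a i) _ (hK' a l)
  have h4 : ∀ a, inner ℂ (spinor (diracAlpha a) (Y a)) Ψ' = inner ℂ Ψ (spinor (diracAlpha a) (Y' a)) :=
    fun a => inner_spinor_eq (isHermitian_diracAlpha a) fun i l =>
      symmetricGraph_field _ (hY a i) _ (hY' a l)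
  simp only [inner_add_left, inner_add_right, inner_sub_left, inner_sub_right, inner_smul_left,
    inner_smul_right, sum_inner, inner_sum, h1, h2, h3, h4, Complex.conj_ofReal]

/-- The domain of dΓ(ω_m) lies in the domains of all other terms, for |k_a| ≤ ω_m and the field is
controlled through ω_m^(-1/2) g_a. The domain of the Hamiltonian is therefore that of dΓ(ω_m). -/
theorem exists_hamiltonian (hm : 0 ≤ m) {Ψ X : StateSpace}
    (hX : ∀ i, (Ψ i, X i) ∈ (dGamma (mulOp (dispersion m))).graph) :
    ∃ K Y : Fin 3 → StateSpace, (∀ a i, (Ψ i, K a i) ∈ (dGamma (mulOp fun k => k a)).graph) ∧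
        (∀ a i, (Ψ i, Y a i) ∈ (field (formFactor e ρ a)).graph) := by
  have h1 : ∀ a i, ∃ y, (Ψ i, y) ∈ (dGamma (mulOp fun k => k a)).graph := fun a i =>
    exists_dGamma_of_abs_le (measurable_dispersion m) (measurable_coord a)
      (fun k => (PiLp.norm_apply_le k a).trans (norm_le_dispersion hm k)) (hX i)
  have h2 : ∀ a i, ∃ y, (Ψ i, y) ∈ (field (formFactor e ρ a)).graph := fun a i => by
    obtain ⟨f₁, hf⟩ := exists_formFactor_div e ρ a hm
    obtain ⟨b, c, -, -, -, h⟩ := exists_field (measurable_dispersion m) (dispersion_nonneg hm) hf (hX i)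
    exact ⟨_, h⟩
  choose K hK using h1
  choose Y hY using h2
  exact ⟨fun a => WithLp.toLp 2 (K a), fun a => WithLp.toLp 2 (Y a), hK, hY⟩

/-- The Hamiltonian is essentially self-adjoint. -/
theorem selfAdjointGraph_hamiltonian_closure (hm : 0 ≤ m) :
    SelfAdjointGraph (hamiltonian e ρ M q m p).closure.graph ∧
      (hamiltonian e ρ M q m p).closure.graph
        = (hamiltonian e ρ M q m p).graph.topologicalClosure := by
  choose f₁ hf₁ using fun a => exists_formFactor_div e ρ a hm
  choose f₂ hf₂ using fun a => exists_formFactor_mul e ρ a hm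
  have hω := measurable_dispersion m
  have hω0 := dispersion_nonneg hm
  -- Only the field term fails to commute with dΓ(ω_m), so C collects the coupling, the entries of
  -- the Dirac matrices and the norms of ω_m^(1/2) g_a.
  set C : ℝ := |q| * ∑ a, (∑ i, ∑ l, ‖diracAlpha a i l‖) * ‖f₂ a‖ with hCdef
  have hC : 0 ≤ C := by positivity
  refine closure_selfAdjoint_of_commutator symmetricGraph_hamiltonian C hC fun ψ => ?_
  -- The comparison operator is N = 1 + dΓ(ω_m): each component of ψ is N applied to φ i, with X i =
  -- dΓ(ω_m) φ i.
  choose φ X hX hψ using fun i => exists_resolvent_dGamma hω hω0 (ψ i)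
  obtain ⟨K, Y, hK, hY⟩ := exists_hamiltonian (e := e) (ρ := ρ) hm (Ψ := WithLp.toLp 2 φ)
    (X := WithLp.toLp 2 X) hX
  set Ψ : StateSpace := WithLp.toLp 2 φ with hΨ
  set Ξ : StateSpace := WithLp.toLp 2 X with hΞ
  have hψ' : ψ = Ψ + Ξ := by ext1 i; exact hψ i
  have hmem := mem_hamiltonian_graph (M := M) (q := q) (p := p).2 ⟨Ξ, K, Y, hX, hK, hY, rfl⟩
  let w : Fin 4 → ℝ := fun i => ‖φ i‖ ^ 2 + (inner ℂ (φ i) (X i)).re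
  have hw : ∀ i, 0 ≤ w i := fun i =>
    add_nonneg (by positivity) (re_inner_dGamma_nonneg hω hω0 (hX i))
  have hform : (inner ℂ ψ Ψ).re = ∑ i, w i := by
    rw [PiLp.inner_apply, Complex.re_sum]
    refine Finset.sum_congr rfl fun i _ => ?_
    change (inner ℂ (ψ i) (φ i)).re = _
    rw [hψ, inner_add_left, Complex.add_re]
    congr 1
    · exact inner_self_eq_norm_sq (𝕜 := ℂ) _
    · rw [← inner_conj_symm, Complex.conj_re]
  refine ⟨Ψ, _, hmem, fun h0 => ?_, ?_, ?_⟩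
  · have hφ0 : ∀ i, φ i = 0 := fun i => congrArg (fun Z : StateSpace => Z i) h0
    ext1 i
    rw [hψ, hφ0]
    have h1 := hX i
    rw [hφ0] at h1
    rw [LinearPMap.mem_graph_snd_inj _ h1 (Submodule.zero_mem _) rfl, add_zero]
    rfl
  · rw [hform, PiLp.norm_sq_eq_of_L2]
    exact Finset.sum_le_sum fun i _ =>
      le_add_of_nonneg_right (re_inner_dGamma_nonneg hω hω0 (hX i))
  · have hs := symmetricGraph_hamiltonian _ hmem _ hmem
    have hsym : ∀ i l, (inner ℂ (X i) (φ l) - inner ℂ (φ i) (X l) : ℂ) = 0 := fun i l =>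
      sub_eq_zero.2 (symmetricGraph_dGamma (isDenseSymmetric_mulOp hω) _ (hX i) _ (hX l))
    have h0 : (inner ℂ Ξ (spinor (diracMatrix M p) Ψ)).im = 0 := by
      have := abs_im_inner_spinor_le (isHermitian_diracMatrix M p) (X := Ξ) (Y := Ψ) hw (C := 0)
        (fun i l => by
          change ‖(inner ℂ (X i) (φ l) - inner ℂ (φ i) (X l) : ℂ)‖ ≤ _
          rw [hsym i l]; simp) le_rfl
      simpa using this
    have hk : ∀ a, (inner ℂ Ξ (spinor (diracAlpha a) (K a))).im = 0 := fun a => by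
      have := abs_im_inner_spinor_le (isHermitian_diracAlpha a) (X := Ξ) (Y := K a) hw (C := 0)
        (fun i l => by
          rw [sub_eq_zero.2 (inner_dGamma_comm hω (measurable_coord a) (hX i) (hK a i) (hX l) (hK a l))]
          simp) le_rfl
      simpa using this
    have hy : ∀ a, |(inner ℂ Ξ (spinor (diracAlpha a) (Y a))).im|
        ≤ (∑ i, ∑ l, ‖diracAlpha a i l‖) * ‖f₂ a‖ * ∑ i, w i := fun a =>
      abs_im_inner_spinor_le (isHermitian_diracAlpha a) hw (fun i l =>
        field_commutator_le hω hω0 (hf₁ a) (hf₂ a) (hX i) (hX l) (hY a i) (hY a l)) (norm_nonneg _)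
    have hself : (inner ℂ Ξ Ξ).im = 0 := inner_self_im (𝕜 := ℂ) Ξ
    rw [hform]
    -- With ψ = Ψ + Ξ, the pairing of Ψ with its image is real by symmetry. In the pairing of Ξ all
    -- terms but the field are real too, since dΓ(ω_m) commutes with dΓ(k) and with the matrices.
    have him : (inner ℂ ψ (spinor (diracMatrix M p) Ψ + (Ξ - ∑ a, spinor (diracAlpha a) (K a)
          - (q : ℂ) • ∑ a, spinor (diracAlpha a) (Y a)))).im
        = -(q * ∑ a, (inner ℂ Ξ (spinor (diracAlpha a) (Y a))).im) := by
      have h1 : (inner ℂ Ψ (spinor (diracMatrix M p) Ψ + (Ξ - ∑ a, spinor (diracAlpha a) (K a)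
          - (q : ℂ) • ∑ a, spinor (diracAlpha a) (Y a)))).im = 0 := by
        have := congrArg Complex.im hs
        simp only at this
        rw [← inner_conj_symm, Complex.conj_im] at this
        linarith
      rw [hψ', inner_add_left, Complex.add_im, h1, zero_add]
      simp only [inner_add_right, inner_sub_right, inner_smul_right, inner_sum, Complex.add_im,
        Complex.sub_im, Complex.im_sum, h0, hk, hself, Complex.im_ofReal_mul]
      simp
    rw [him, abs_neg, abs_mul, hCdef, mul_assoc, Finset.sum_mul]
    refine mul_le_mul_of_nonneg_left ?_ (abs_nonneg _)
    exact (Finset.abs_sum_le_sum_abs _ _).trans (Finset.sum_le_sum fun a _ => hy a)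

end Hamiltonian

end DiracPolaron
namespace DiracPolaron

/-! ### Symmetries of the form spinor matrix tensor Γ(u) -/

section SpinorSymmetry

theorem spinor_apply (B : Matrix (Fin 4) (Fin 4) ℂ) (Ψ : StateSpace) (i : Fin 4) :
    spinor B Ψ i = ∑ l, B i l • Ψ l := rfl

theorem spinor_mul (A B : Matrix (Fin 4) (Fin 4) ℂ) (Ψ : StateSpace) :
    spinor (A * B) Ψ = spinor A (spinor B Ψ) := by
  ext1 i
  simp only [spinor_apply, Matrix.mul_apply, Finset.sum_smul, Finset.smul_sum, mul_smul]
  exact Finset.sum_comm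

theorem spinor_one (Ψ : StateSpace) : spinor 1 Ψ = Ψ := by
  ext1 i
  simp [spinor_apply, Matrix.one_apply]

theorem spinor_sum {ι : Type*} (s : Finset ι) (B : ι → Matrix (Fin 4) (Fin 4) ℂ) (Ψ : StateSpace) :
    spinor (∑ b ∈ s, B b) Ψ = ∑ b ∈ s, spinor (B b) Ψ := by
  ext1 i
  simp only [spinor_apply, Matrix.sum_apply, Finset.sum_smul, WithLp.ofLp_sum, Finset.sum_apply]
  exact Finset.sum_comm

theorem spinor_add (A B : Matrix (Fin 4) (Fin 4) ℂ) (Ψ : StateSpace) :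
    spinor (A + B) Ψ = spinor A Ψ + spinor B Ψ := by
  ext1 i
  simp [spinor_apply, add_smul, Finset.sum_add_distrib]

theorem spinor_smul (c : ℂ) (B : Matrix (Fin 4) (Fin 4) ℂ) (Ψ : StateSpace) :
    spinor (c • B) Ψ = c • spinor B Ψ := by
  ext1 i
  simp [spinor_apply, Finset.smul_sum, mul_smul]

theorem inner_spinor_conjTranspose (B : Matrix (Fin 4) (Fin 4) ℂ) (X Y : StateSpace) :
    inner ℂ (spinor B X) Y = inner ℂ X (spinor Bᴴ Y) := by
  rw [← inner_conj_symm, inner_spinor_right, inner_spinor_right, map_sum, Finset.sum_comm]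
  simp only [map_sum, map_mul, inner_conj_symm]
  rfl

/-- The unitary operator `B ⊗ 1` of a unitary matrix. -/
noncomputable def spinorEquiv (B : Matrix (Fin 4) (Fin 4) ℂ) (hB : Bᴴ * B = 1) :
    StateSpace ≃ₗᵢ[ℂ] StateSpace where
  toFun := spinor B
  invFun := spinor Bᴴ
  map_add' := map_add _
  map_smul' := map_smul _
  left_inv Ψ := by rw [← spinor_mul, hB, spinor_one]
  right_inv Ψ := by rw [← spinor_mul, mul_eq_one_comm.1 hB, spinor_one]
  norm_map' Ψ := by
    change ‖spinor B Ψ‖ = ‖Ψ‖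
    rw [← sq_eq_sq₀ (norm_nonneg _) (norm_nonneg _), ← inner_self_eq_norm_sq (𝕜 := ℂ),
      ← inner_self_eq_norm_sq (𝕜 := ℂ), inner_spinor_conjTranspose, ← spinor_mul, hB, spinor_one]

/-- The unitary operator `1 ⊗ Γ(u)`. -/
noncomputable def ampliationEquiv (U : Fock ≃ₗᵢ[ℂ] Fock) : StateSpace ≃ₗᵢ[ℂ] StateSpace :=
  LinearIsometryEquiv.piLpCongrRight 2 fun _ => U

theorem ampliationEquiv_apply (U : Fock ≃ₗᵢ[ℂ] Fock) (Ψ : StateSpace) (i : Fin 4) :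
    ampliationEquiv U Ψ i = U (Ψ i) := rfl

theorem ampliationEquiv_spinor (U : Fock ≃ₗᵢ[ℂ] Fock) (B : Matrix (Fin 4) (Fin 4) ℂ)
    (Ψ : StateSpace) : ampliationEquiv U (spinor B Ψ) = spinor B (ampliationEquiv U Ψ) := by
  ext1 i
  simp only [ampliationEquiv_apply, spinor_apply, map_sum, map_smul]

/-- The unitary operator `B ⊗ U`. -/
noncomputable def symmetryEquiv (B : Matrix (Fin 4) (Fin 4) ℂ) (hB : Bᴴ * B = 1)
    (U : Fock ≃ₗᵢ[ℂ] Fock) : StateSpace ≃ₗᵢ[ℂ] StateSpace :=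
  (ampliationEquiv U).trans (spinorEquiv B hB)

theorem symmetryEquiv_apply (B : Matrix (Fin 4) (Fin 4) ℂ) (hB : Bᴴ * B = 1)
    (U : Fock ≃ₗᵢ[ℂ] Fock) (Ψ : StateSpace) :
    symmetryEquiv B hB U Ψ = spinor B (ampliationEquiv U Ψ) := rfl

theorem spinor_mem {G : Submodule ℂ (Fock × Fock)} (B : Matrix (Fin 4) (Fin 4) ℂ)
    {X Y : StateSpace} (h : ∀ i, (X i, Y i) ∈ G) (i : Fin 4) :
    (spinor B X i, spinor B Y i) ∈ G := by
  have : (spinor B X i, spinor B Y i) = ∑ l, B i l • (X l, Y l) := by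
    refine Prod.ext ?_ ?_
    · rw [Prod.fst_sum]; rfl
    · rw [Prod.snd_sum]; rfl
  rw [this]
  exact Submodule.sum_mem _ fun l _ => Submodule.smul_mem _ _ (h l)

variable {e : Polarization} {ρ : Cutoff} {M q m : ℝ} {p : E3}

theorem dGamma_mulOp_sum {Ψ : Fock} {K : Fin 3 → Fock}
    (hK : ∀ a, (Ψ, K a) ∈ (dGamma (mulOp fun k => k a)).graph) (r : Fin 3 → ℝ) :
    (Ψ, ∑ a, (r a : ℂ) • K a) ∈ (dGamma (mulOp fun k => ∑ a, r a * k a)).graph := by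
  rw [mem_dGamma_mulOp_graph (Finset.measurable_sum _ fun a _ => (measurable_coord a).const_mul _)]
  intro n
  have h1 : ((∑ a, (r a : ℂ) • K a : Fock) n : TensorPower n)
      = ∑ a, (r a : ℂ) • (K a n : TensorPower n) := by
    have := map_sum ((SymPower n).subtype ∘ₗ (lp.evalCLM ℂ (fun n : ℕ => SymPower n) 2 n).toLinearMap)
      (fun a => (r a : ℂ) • K a) Finset.univ
    exact this
  rw [h1, Fin.sum_univ_three]
  have h2 := fun a => (mem_dGamma_mulOp_graph (measurable_coord a)).1 (hK a) n
  have h3 := fun a => Lp.coeFn_smul (r a : ℂ) (K a n : TensorPower n)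
  filter_upwards [Lp.coeFn_add ((r 0 : ℂ) • (K 0 n : TensorPower n) + (r 1 : ℂ) • (K 1 n : TensorPower n))
    ((r 2 : ℂ) • (K 2 n : TensorPower n)), Lp.coeFn_add ((r 0 : ℂ) • (K 0 n : TensorPower n))
    ((r 1 : ℂ) • (K 1 n : TensorPower n)), h2 0, h2 1, h2 2, h3 0, h3 1, h3 2]
    with x g1 g2 k0 k1 k2 s0 s1 s2
  rw [g1, Pi.add_apply, g2, Pi.add_apply, s0, s1, s2]
  simp only [Pi.smul_apply, smul_eq_mul]
  rw [k0, k1, k2]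
  simp only [sumFn, Fin.sum_univ_three, Finset.sum_add_distrib, ← Finset.mul_sum]
  push_cast
  ring

theorem spinor_sum_diracAlpha {R : Matrix (Fin 3) (Fin 3) ℝ} {B : Matrix (Fin 4) (Fin 4) ℂ}
    (hBα : ∀ a, B * diracAlpha a = ∑ b, (R b a : ℂ) • (diracAlpha b * B)) (W : Fin 3 → StateSpace) :
    spinor B (∑ a, spinor (diracAlpha a) (W a))
      = ∑ b, spinor (diracAlpha b) (spinor B (∑ a, (R b a : ℂ) • W a)) := by
  have hα : ∀ a Z, spinor B (spinor (diracAlpha a) Z)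
      = ∑ b, (R b a : ℂ) • spinor (diracAlpha b) (spinor B Z) := fun a Z => by
    rw [← spinor_mul, hBα, spinor_sum]
    simp only [spinor_smul, spinor_mul]
  simp only [map_sum, hα, map_smul]
  exact Finset.sum_comm

theorem sum_smul_of_orthogonal {R : Matrix (Fin 3) (Fin 3) ℝ} (hR : R * Rᵀ = 1)
    {V : Type*} [AddCommGroup V] [Module ℂ V] {W W' : Fin 3 → V}
    (h : ∀ a, W a = ∑ b, (R b a : ℂ) • W' b) (b : Fin 3) : ∑ a, (R b a : ℂ) • W a = W' b := by
  have hRR : ∀ c, ∑ a, (R b a : ℂ) * (R c a : ℂ) = if b = c then 1 else 0 := fun c => by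
    have := congrFun (congrFun hR b) c
    rw [Matrix.mul_apply, Matrix.one_apply] at this
    simp only [transpose_apply] at this
    split_ifs at this ⊢ <;> exact_mod_cast this
  simp only [h, Finset.smul_sum, smul_smul]
  rw [Finset.sum_comm]
  simp only [← Finset.sum_smul, hRR, ite_smul, one_smul, zero_smul, Finset.sum_ite_eq,
    Finset.mem_univ, if_true]

/-- A rotation or reflection `R` of the physical space that is implemented by `u` on the photons
and by `B` on the spinors is a symmetry of the Hamiltonian. -/
theorem hamiltonian_symmetry (hm : 0 ≤ m) (R : Matrix (Fin 3) (Fin 3) ℝ) (hR : R * Rᵀ = 1)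
    (B : Matrix (Fin 4) (Fin 4) ℂ) (hB : Bᴴ * B = 1)
    (hBD : B * diracMatrix M p = diracMatrix M p * B)
    (hBα : ∀ a, B * diracAlpha a = ∑ b, (R b a : ℂ) • (diracAlpha b * B))
    (u : OnePhoton ≃ₗᵢ[ℂ] OnePhoton)
    (hω : ∀ x ∈ (mulOp (dispersion m)).graph, (u x.1, u x.2) ∈ (mulOp (dispersion m)).graph)
    (hk : ∀ b, ∀ x ∈ (mulOp fun k => ∑ a, R b a * k a).graph,
      (u x.1, u x.2) ∈ (mulOp fun k => k b).graph)
    (hg : ∀ a, u (formFactor e ρ a) = ∑ b, (R b a : ℂ) • formFactor e ρ b)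
    (x : StateSpace × StateSpace) (hx : x ∈ (hamiltonian e ρ M q m p).graph) :
    (symmetryEquiv B hB (GammaEquiv u) x.1, symmetryEquiv B hB (GammaEquiv u) x.2)
      ∈ (hamiltonian e ρ M q m p).graph := by
  obtain ⟨Ψ, Φ⟩ := x
  obtain ⟨X, K, Y, hX, hK, hY, rfl⟩ := mem_hamiltonian_graph.1 hx
  set U := ampliationEquiv (GammaEquiv u)
  have hωm := measurable_dispersion m
  have hX' : ∀ i, (U Ψ i, U X i) ∈ (dGamma (mulOp (dispersion m))).graph := fun i => by
    have := GammaEquiv_mem_dGamma_graph (isDenseSymmetric_mulOp hωm) (isDenseSymmetric_mulOp hωm) u 1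
      (fun x hx => by rw [one_smul]; exact hω x hx) _ (hX i)
    rw [one_smul] at this
    exact this
  have hK' : ∀ b i, (U Ψ i, (∑ a, (R b a : ℂ) • U (K a)) i) ∈ (dGamma (mulOp fun k => k b)).graph := by
    intro b i
    have := GammaEquiv_mem_dGamma_graph
      (isDenseSymmetric_mulOp (Finset.measurable_sum _ fun a _ => (measurable_coord a).const_mul (R b a)))
      (isDenseSymmetric_mulOp (measurable_coord b)) u 1
      (fun x hx => by rw [one_smul]; exact hk b x hx) _ (dGamma_mulOp_sum (fun a => hK a i) (R b))
    rw [one_smul, map_sum] at this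
    simp only [map_smul] at this
    rw [WithLp.ofLp_sum, Finset.sum_apply]
    exact this
  -- The field acts on U Ψ because U preserves the domain of dΓ(ω_m). The values Y' are then linked
  -- to U (Y a) through R, and orthogonality of R inverts the relation.
  obtain ⟨-, Y', -, hY'⟩ := exists_hamiltonian (e := e) (ρ := ρ) hm hX'
  have hYa : ∀ a, U (Y a) = ∑ b, (R b a : ℂ) • Y' b := fun a => by
    ext1 i
    rw [WithLp.ofLp_sum, Finset.sum_apply]
    exact GammaEquiv_field u (fun b => R b a) (fun b => formFactor e ρ b) (hg a) (hY a i)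
      fun b => hY' b i
  refine mem_hamiltonian_graph.2 ⟨spinor B (U X), fun b => spinor B (∑ a, (R b a : ℂ) • U (K a)),
    fun b => spinor B (Y' b), spinor_mem B hX', fun b => spinor_mem B (hK' b),
    fun b => spinor_mem B (hY' b), ?_⟩
  have hV : ∀ (A : Matrix (Fin 4) (Fin 4) ℂ) Z, ampliationEquiv (GammaEquiv u) (spinor A Z)
      = spinor A (U Z) := fun A Z => ampliationEquiv_spinor _ _ _
  have h1 := spinor_sum_diracAlpha hBα fun a => U (K a)
  have h2 := spinor_sum_diracAlpha hBα fun a => U (Y a)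
  simp only [sum_smul_of_orthogonal hR hYa] at h2
  have h3 : spinor B (spinor (diracMatrix M p) (U Ψ)) = spinor (diracMatrix M p) (spinor B (U Ψ)) := by
    rw [← spinor_mul, hBD, spinor_mul]
  simp only [symmetryEquiv_apply]
  rw [← h3, ← h1, ← h2]
  simp only [map_add, map_sub, map_smul, map_sum, hV]
  rfl

theorem hamiltonian_closure_symmetry (hm : 0 ≤ m) (V : StateSpace ≃ₗᵢ[ℂ] StateSpace)
    (hV : ∀ x ∈ (hamiltonian e ρ M q m p).graph, (V x.1, V x.2) ∈ (hamiltonian e ρ M q m p).graph)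
    (x : StateSpace × StateSpace) (hx : x ∈ (hamiltonian e ρ M q m p).closure.graph) :
    (V x.1, V x.2) ∈ (hamiltonian e ρ M q m p).closure.graph := by
  rw [(selfAdjointGraph_hamiltonian_closure hm).2] at hx ⊢
  let L : StateSpace × StateSpace →L[ℂ] StateSpace × StateSpace :=
    (V.toContinuousLinearEquiv : StateSpace →L[ℂ] StateSpace).prodMap
      (V.toContinuousLinearEquiv : StateSpace →L[ℂ] StateSpace)
  exact Submodule.topologicalClosure_minimal
    (t := (hamiltonian e ρ M q m p).graph.topologicalClosure.comap L.toLinearMap) _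
    (fun y hy => subset_closure (hV y hy))
    ((Submodule.isClosed_topologicalClosure _).preimage L.continuous) hx

end SpinorSymmetry

end DiracPolaron
namespace DiracPolaron

/-! ### Change of polarization vectors -/

section Polarizations

theorem sum_shift {V : Type*} [AddCommMonoid V] (F : Fin 2 → V) (i : Fin 2) :
    ∑ m, F (i + m) = ∑ l, F l :=
  Fintype.sum_equiv (Equiv.addLeft i) _ _ fun _ => rfl

/-- The inner product, symmetrized over the helicity. -/
theorem inner_eq_half_integral (f g : OnePhoton) :
    inner ℂ f g = (1 / 2 : ℂ) * ∫ x, ∑ l, inner ℂ (f (x.1, l)) (g (x.1, l)) ∂photonMeasure := by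
  set F : Photon → ℂ := fun x => inner ℂ (f x) (g x) with hF
  have hFi : Integrable F photonMeasure := L2.integrable_inner f g
  have hi : ∀ m : Fin 2, Integrable (fun x : Photon => F (x.1, x.2 + m)) photonMeasure := fun m =>
    (measurePreserving_shift m).integrable_comp_of_integrable hFi
  have he : ∀ m : Fin 2, ∫ x, F (x.1, x.2 + m) ∂photonMeasure = ∫ x, F x ∂photonMeasure := fun m => by
    have hp := measurePreserving_shift m
    have h1 := integral_map (φ := fun x : Photon => (x.1, x.2 + m)) hp.aemeasurable (f := F)
      (by rw [hp.map_eq]; exact hFi.1)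
    rw [hp.map_eq] at h1
    exact h1.symm
  have h : ∀ x : Photon, ∑ l, inner ℂ (f (x.1, l)) (g (x.1, l)) = ∑ m, F (x.1, x.2 + m) := fun x =>
    (sum_shift (fun l => F (x.1, l)) x.2).symm
  simp only [h]
  rw [integral_finsetSum _ fun m _ => hi m]
  simp only [he]
  rw [L2.inner_def, Fin.sum_univ_two]
  ring

/-- The polarization vectors are complete in the orthogonal complement of `k`. -/
theorem Polarization.sum_inner_mul_inner (e : Polarization) :
    ∀ᵐ k : E3, ∀ v w : E3, inner ℝ v k = 0 →
      ∑ l, inner ℝ v (e.vec l k) * inner ℝ (e.vec l k) w = inner ℝ v w := by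
  filter_upwards [e.inner_vec, e.inner_momentum, measure_eq_zero_iff_ae_notMem.1
    (measure_singleton (0 : E3))] with k h1 h2 h3 v w hv
  have hk : ‖k‖ ≠ 0 := norm_ne_zero_iff.2 h3
  -- Adding k/|k| completes the polarization vectors to an orthonormal basis; its term drops out of
  -- the expansion because v is orthogonal to k.
  have hon : Orthonormal ℝ ![e.vec 0 k, e.vec 1 k, ‖k‖⁻¹ • k] := by
    rw [orthonormal_iff_ite]
    intro i l
    have h00 := h1 0 0
    have h01 := h1 0 1
    have h10 := h1 1 0
    have h11 := h1 1 1
    have hk0 := h2 0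
    have hk1 := h2 1
    have hk0' : inner ℝ k (e.vec 0 k) = 0 := by rw [real_inner_comm]; exact hk0
    have hk1' : inner ℝ k (e.vec 1 k) = 0 := by rw [real_inner_comm]; exact hk1
    have hkk : inner ℝ (‖k‖⁻¹ • k) (‖k‖⁻¹ • k) = 1 := by
      rw [inner_smul_left, inner_smul_right, real_inner_self_eq_norm_sq]
      simp only [map_inv₀, conj_trivial]
      field_simp
    fin_cases i <;> fin_cases l <;> simp_all [inner_smul_left, inner_smul_right]
  let b : OrthonormalBasis (Fin 3) ℝ E3 := OrthonormalBasis.mk hon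
    (hon.linearIndependent.span_eq_top_of_card_eq_finrank' (by simp)).ge
  have hb := b.sum_inner_mul_inner v w
  rw [Fin.sum_univ_three] at hb
  simp only [b, OrthonormalBasis.coe_mk] at hb
  rw [Fin.sum_univ_two, ← hb]
  simp [inner_smul_right, hv]

variable (e e' e'' : Polarization)

theorem coeFn_changeOnePhoton (f : OnePhoton) : changeOnePhoton e e' f =ᵐ[photonMeasure]
    fun x => ∑ l, ((inner ℝ (e.vec x.2 x.1) (e'.vec l x.1) : ℝ) : ℂ) * f (x.1, l) :=
  (memLp_change e e' f).coeFn_toLp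

/-- The matrices e · e' satisfy a cocycle relation: the vectors of e are orthogonal to k, where the
pair e' is complete. -/
theorem changeOnePhoton_comp (f : OnePhoton) :
    changeOnePhoton e e' (changeOnePhoton e' e'' f) = changeOnePhoton e e'' f := by
  refine Lp.ext ?_
  filter_upwards [coeFn_changeOnePhoton e e' (changeOnePhoton e' e'' f),
    ae_helicity (coeFn_changeOnePhoton e' e'' f), coeFn_changeOnePhoton e e'' f,
    ae_momentum e'.sum_inner_mul_inner, ae_momentum e.inner_momentum] with x h1 h2 h3 h4 h5
  rw [h1, h3]
  simp only [h2, Finset.mul_sum]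
  rw [Finset.sum_comm]
  refine Finset.sum_congr rfl fun l _ => ?_
  rw [← h4 _ (e''.vec l x.1) (h5 x.2)]
  push_cast
  rw [Finset.sum_mul]
  exact Finset.sum_congr rfl fun i _ => by ring

theorem changeOnePhoton_self (f : OnePhoton) : changeOnePhoton e e f = f := by
  refine Lp.ext ?_
  filter_upwards [coeFn_changeOnePhoton e e f, ae_momentum e.inner_vec] with x h1 h2
  rw [h1]
  obtain ⟨k, l⟩ := x
  fin_cases l <;> simp [h2]

/-- For almost every k the change of polarization is an orthogonal 2 × 2 matrix. The inner product
is first summed over the helicities at fixed k, so that this matrix identity can be used pointwise.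
-/
theorem inner_changeOnePhoton (f g : OnePhoton) :
    inner ℂ (changeOnePhoton e e' f) (changeOnePhoton e e' g) = inner ℂ f g := by
  rw [inner_eq_half_integral, inner_eq_half_integral]
  congr 1
  refine integral_congr_ae ?_
  filter_upwards [ae_helicity (coeFn_changeOnePhoton e e' f),
    ae_helicity (coeFn_changeOnePhoton e e' g), ae_momentum e.sum_inner_mul_inner,
    ae_momentum e'.inner_momentum, ae_momentum e'.inner_vec] with x h1 h2 h3 h4 h5
  simp only [h1, h2, RCLike.inner_apply, map_sum, map_mul, Complex.conj_ofReal]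
  have h6 : ∀ i l, ∑ n, ((inner ℝ (e.vec n x.1) (e'.vec i x.1) : ℝ) : ℂ) *
      ((inner ℝ (e.vec n x.1) (e'.vec l x.1) : ℝ) : ℂ) = if i = l then 1 else 0 := fun i l => by
    have := h3 (e'.vec i x.1) (e'.vec l x.1) (h4 i)
    rw [h5 i l] at this
    simp only [real_inner_comm (e.vec _ x.1) (e'.vec i x.1)]  at this
    split_ifs at this ⊢ <;> exact_mod_cast this
  have h00 := h6 0 0
  have h01 := h6 0 1
  have h11 := h6 1 1
  simp only [Fin.sum_univ_two, if_true, Fin.isValue, zero_ne_one, if_false] at h00 h01 h11 ⊢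
  linear_combination (g (x.1, 0) * starRingEnd ℂ (f (x.1, 0))) * h00
    + (g (x.1, 1) * starRingEnd ℂ (f (x.1, 0)) + g (x.1, 0) * starRingEnd ℂ (f (x.1, 1))) * h01
    + (g (x.1, 1) * starRingEnd ℂ (f (x.1, 1))) * h11

/-- The unitary change of polarization vectors. -/
noncomputable def changeEquiv : OnePhoton ≃ₗᵢ[ℂ] OnePhoton where
  toFun := changeOnePhoton e e'
  invFun := changeOnePhoton e' e
  map_add' := map_add _
  map_smul' := map_smul _
  left_inv f := by rw [changeOnePhoton_comp, changeOnePhoton_self]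
  right_inv f := by rw [changeOnePhoton_comp, changeOnePhoton_self]
  norm_map' f := by
    change ‖changeOnePhoton e e' f‖ = ‖f‖
    rw [← sq_eq_sq₀ (norm_nonneg _) (norm_nonneg _), ← inner_self_eq_norm_sq (𝕜 := ℂ),
      ← inner_self_eq_norm_sq (𝕜 := ℂ), inner_changeOnePhoton]

theorem changeEquiv_apply (f : OnePhoton) : changeEquiv e e' f = changeOnePhoton e e' f := rfl

theorem changeEquiv_mulOp {φ : E3 → ℝ} (x : OnePhoton × OnePhoton) (hx : x ∈ (mulOp φ).graph) :
    (changeEquiv e e' x.1, changeEquiv e e' x.2) ∈ (mulOp φ).graph := by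
  rw [mem_mulOp_graph] at hx ⊢
  simp only [changeEquiv_apply]
  filter_upwards [coeFn_changeOnePhoton e e' x.1, coeFn_changeOnePhoton e e' x.2, ae_helicity hx]
    with y h1 h2 h3
  rw [h1, h2, Finset.mul_sum]
  refine Finset.sum_congr rfl fun l _ => ?_
  rw [h3 l]
  ring

theorem inner_single_right' (v : E3) (a : Fin 3) :
    inner ℝ v (EuclideanSpace.single a (1 : ℝ)) = v a := by
  simp [EuclideanSpace.inner_single_right]

/-- Apart from a scalar function of k, the form factor lists the coefficients of the a-th unit
vector in the polarization basis, so it changes like the basis. -/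
theorem changeEquiv_formFactor (ρ : Cutoff) (a : Fin 3) :
    changeEquiv e e' (formFactor e' ρ a) = formFactor e ρ a := by
  refine Lp.ext ?_
  rw [changeEquiv_apply]
  filter_upwards [coeFn_changeOnePhoton e e' (formFactor e' ρ a),
    ae_helicity (memLp_formFactor e' ρ a).coeFn_toLp, (memLp_formFactor e ρ a).coeFn_toLp,
    ae_momentum e'.sum_inner_mul_inner, ae_momentum e.inner_momentum] with x h1 h2 h3 h4 h5
  have h6 := h4 _ (EuclideanSpace.single a (1 : ℝ)) (h5 x.2)
  simp only [inner_single_right'] at h6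
  rw [h1]
  simp only [formFactor] at h2 h3 ⊢
  simp only [h2]
  rw [h3, ← h6]
  push_cast
  rw [Finset.mul_sum]
  exact Finset.sum_congr rfl fun i _ => by ring

end Polarizations

end DiracPolaron
namespace DiracPolaron

/-! ### Action of the stabilizer of the axis on photons -/

section Rotations

/-- The sign `(ε, 1)` with which a rotation or reflection of determinant `ε` acts on the
polarization vectors attached to an axis. -/
def signFn (ε : ℝ) (l : Fin 2) : ℝ := if l = 0 then ε else 1

theorem signFn_mul_self {ε : ℝ} (hε : ε * ε = 1) (l : Fin 2) : signFn ε l * signFn ε l = 1 := by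
  unfold signFn
  split_ifs <;> simp [hε]

theorem measurePreserving_rotate (R : E3 ≃ₗᵢ[ℝ] E3) :
    MeasurePreserving (fun x : Photon => (R x.1, x.2)) photonMeasure photonMeasure :=
  R.measurePreserving.prod (MeasurePreserving.id Measure.count)

theorem norm_sign_mul {ε : ℝ} (hε : ε * ε = 1) (l : Fin 2) (z : ℂ) :
    ‖((signFn ε l : ℝ) : ℂ) * z‖ = ‖z‖ := by
  have h := signFn_mul_self hε l
  have h2 : |signFn ε l| = 1 := by
    have := abs_mul_self (signFn ε l)
    rw [abs_mul, h] at this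
    nlinarith [abs_nonneg (signFn ε l)]
  rw [norm_mul, Complex.norm_real, Real.norm_eq_abs, h2, one_mul]

theorem memLp_rotate (R : E3 ≃ₗᵢ[ℝ] E3) {ε : ℝ} (hε : ε * ε = 1) (f : OnePhoton) :
    MemLp (fun x : Photon => ((signFn ε x.2 : ℝ) : ℂ) * f (R.symm x.1, x.2)) 2 photonMeasure := by
  have h := (Lp.memLp f).comp_measurePreserving (measurePreserving_rotate R.symm)
  have hm : Measurable fun x : Photon => ((signFn ε x.2 : ℝ) : ℂ) :=
    Complex.measurable_ofReal.comp ((measurable_of_countable (signFn ε)).comp measurable_snd)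
  exact h.mono (hm.aestronglyMeasurable.mul h.1)
    (Filter.Eventually.of_forall fun x => (norm_sign_mul hε x.2 _).le)

/-- The action of a rotation or reflection on one photon. -/
noncomputable def rotateOp (R : E3 ≃ₗᵢ[ℝ] E3) {ε : ℝ} (hε : ε * ε = 1) :
    OnePhoton →ₗ[ℂ] OnePhoton where
  toFun f := (memLp_rotate R hε f).toLp _
  map_add' f g := by
    rw [← MemLp.toLp_add]
    refine MemLp.toLp_congr _ _ ?_
    filter_upwards [(measurePreserving_rotate R.symm).quasiMeasurePreserving.ae (Lp.coeFn_add f g)]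
      with x hx
    rw [Pi.add_apply, hx, Pi.add_apply, mul_add]
  map_smul' c f := by
    rw [RingHom.id_apply, ← MemLp.toLp_const_smul]
    refine MemLp.toLp_congr _ _ ?_
    filter_upwards [(measurePreserving_rotate R.symm).quasiMeasurePreserving.ae (Lp.coeFn_smul c f)]
      with x hx
    rw [Pi.smul_apply, hx, Pi.smul_apply, smul_eq_mul, smul_eq_mul, mul_left_comm]

theorem coeFn_rotateOp (R : E3 ≃ₗᵢ[ℝ] E3) {ε : ℝ} (hε : ε * ε = 1) (f : OnePhoton) :
    rotateOp R hε f =ᵐ[photonMeasure]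
      fun x => ((signFn ε x.2 : ℝ) : ℂ) * f (R.symm x.1, x.2) :=
  (memLp_rotate R hε f).coeFn_toLp

theorem norm_rotateOp (R : E3 ≃ₗᵢ[ℝ] E3) {ε : ℝ} (hε : ε * ε = 1) (f : OnePhoton) :
    ‖rotateOp R hε f‖ = ‖f‖ := by
  change ‖(memLp_rotate R hε f).toLp _‖ = ‖f‖
  rw [Lp.norm_toLp, Lp.norm_def]
  congr 1
  rw [← eLpNorm_comp_measurePreserving (Lp.aestronglyMeasurable f)
    (measurePreserving_rotate R.symm)]
  exact eLpNorm_congr_norm_ae (Filter.Eventually.of_forall fun x => norm_sign_mul hε x.2 _)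

theorem rotateOp_rotateOp (R R' : E3 ≃ₗᵢ[ℝ] E3) {ε ε' : ℝ} (hε : ε * ε = 1) (hε' : ε' * ε' = 1)
    (hεε : ε * ε' * (ε * ε') = 1) (f : OnePhoton) :
    rotateOp R hε (rotateOp R' hε' f) = rotateOp (R'.trans R) hεε f := by
  refine Lp.ext ?_
  filter_upwards [coeFn_rotateOp R hε (rotateOp R' hε' f), coeFn_rotateOp (R'.trans R) hεε f,
    (measurePreserving_rotate R.symm).quasiMeasurePreserving.ae (coeFn_rotateOp R' hε' f)]
    with x h1 h2 h3
  rw [h1, h2, h3, ← mul_assoc, ← Complex.ofReal_mul]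
  congr 2
  unfold signFn
  split_ifs <;> simp

theorem rotateOp_refl (hε : (1 : ℝ) * 1 = 1) (f : OnePhoton) :
    rotateOp (LinearIsometryEquiv.refl ℝ E3) hε f = f := by
  refine Lp.ext ?_
  filter_upwards [coeFn_rotateOp (LinearIsometryEquiv.refl ℝ E3) hε f] with x h1
  rw [h1, show (LinearIsometryEquiv.refl ℝ E3).symm x.1 = x.1 from rfl]
  simp [signFn]

theorem rotateOp_congr {R R' : E3 ≃ₗᵢ[ℝ] E3} {ε ε' : ℝ} (hR : R = R') (h : ε = ε')
    (hε : ε * ε = 1) (hε' : ε' * ε' = 1) (f : OnePhoton) :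
    rotateOp R hε f = rotateOp R' hε' f := by
  subst hR h
  rfl

/-- The unitary action of a rotation or reflection on one photon. -/
noncomputable def rotateEquiv (R : E3 ≃ₗᵢ[ℝ] E3) {ε : ℝ} (hε : ε * ε = 1) :
    OnePhoton ≃ₗᵢ[ℂ] OnePhoton where
  toFun := rotateOp R hε
  invFun := rotateOp R.symm hε
  map_add' := map_add _
  map_smul' := map_smul _
  left_inv f := by
    rw [rotateOp_rotateOp _ _ _ _ (by rw [hε, one_mul]),
      rotateOp_congr (R' := LinearIsometryEquiv.refl ℝ E3) (ε' := 1) (by simp) hε _ (one_mul 1),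
      rotateOp_refl]
  right_inv f := by
    rw [rotateOp_rotateOp _ _ _ _ (by rw [hε, one_mul]),
      rotateOp_congr (R' := LinearIsometryEquiv.refl ℝ E3) (ε' := 1) (by simp) hε _ (one_mul 1),
      rotateOp_refl]
  norm_map' f := norm_rotateOp R hε f

theorem rotateEquiv_apply (R : E3 ≃ₗᵢ[ℝ] E3) {ε : ℝ} (hε : ε * ε = 1) (f : OnePhoton) :
    rotateEquiv R hε f = rotateOp R hε f := rfl

theorem rotateEquiv_mulOp (R : E3 ≃ₗᵢ[ℝ] E3) {ε : ℝ} (hε : ε * ε = 1) {φ ψ : E3 → ℝ}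
    (h : ∀ k, φ (R.symm k) = ψ k) (x : OnePhoton × OnePhoton) (hx : x ∈ (mulOp φ).graph) :
    (rotateEquiv R hε x.1, rotateEquiv R hε x.2) ∈ (mulOp ψ).graph := by
  rw [mem_mulOp_graph] at hx ⊢
  simp only [rotateEquiv_apply]
  filter_upwards [coeFn_rotateOp R hε x.1, coeFn_rotateOp R hε x.2,
    (measurePreserving_rotate R.symm).quasiMeasurePreserving.ae hx] with y h1 h2 h3
  rw [h1, h2, h3, ← h]
  ring

/-- `R` is orthogonal with determinant `ε` and fixes the axis `j`. -/
structure FixesAxis (j : E3) (R : E3 ≃ₗᵢ[ℝ] E3) (ε : ℝ) : Prop where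
  sign : ε * ε = 1
  axis : R j = j
  cross_map : ∀ a b, cross (R a) (R b) = ε • R (cross a b)

theorem cross_smul_left (c : ℝ) (a b : E3) : cross (c • a) b = c • cross a b := by
  simp [cross]

theorem cross_smul_right (c : ℝ) (a b : E3) : cross a (c • b) = c • cross a b := by
  simp [cross]

/-- The first special vector contains one vector product and picks up the determinant ε; the second
contains two and picks up ε² = 1. This is why a scalar sign suffices in `rotateOp`. -/
theorem FixesAxis.stdVec {j : E3} {R : E3 ≃ₗᵢ[ℝ] E3} {ε : ℝ} (h : FixesAxis j R ε) (l : Fin 2)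
    (k : E3) : stdVec j l (R k) = signFn ε l • R (stdVec j l k) := by
  have h1 : cross (R k) j = ε • R (cross k j) := by
    conv_lhs => rw [← h.axis]
    exact h.cross_map k j
  have h2 : ‖ε • R (cross k j)‖ = ‖cross k j‖ := by
    have h3 : |ε| = 1 := by
      have := abs_mul_self ε
      rw [abs_mul, h.sign] at this
      nlinarith [abs_nonneg ε]
    rw [norm_smul, Real.norm_eq_abs, h3, one_mul, LinearIsometryEquiv.norm_map]
  unfold DiracPolaron.stdVec signFn
  split_ifs
  · rw [h1, h2, map_smul, smul_comm]
  · rw [h1, h2, LinearIsometryEquiv.norm_map, ← map_smul R, smul_comm, cross_smul_right, ← map_smul R,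
      h.cross_map, smul_smul, h.sign]

/-- The matrix of `R`. -/
noncomputable def rotationMatrix (R : E3 ≃ₗᵢ[ℝ] E3) : Matrix (Fin 3) (Fin 3) ℝ :=
  Matrix.of fun b a => R (EuclideanSpace.single a 1) b

theorem symm_apply_coord (R : E3 ≃ₗᵢ[ℝ] E3) (v : E3) (a : Fin 3) :
    R.symm v a = ∑ b, rotationMatrix R b a * v b := by
  rw [← inner_single_right', ← LinearIsometryEquiv.inner_map_map R, R.apply_symm_apply,
    inner_eq_dotProduct]
  simp only [dotProduct, rotationMatrix, Matrix.of_apply]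
  exact Finset.sum_congr rfl fun b _ => mul_comm _ _

theorem apply_coord (R : E3 ≃ₗᵢ[ℝ] E3) (v : E3) (b : Fin 3) :
    R v b = ∑ a, rotationMatrix R b a * v a := by
  have h := symm_apply_coord R.symm v b
  rw [LinearIsometryEquiv.symm_symm] at h
  rw [h]
  refine Finset.sum_congr rfl fun a _ => ?_
  congr 1
  have := symm_apply_coord R (EuclideanSpace.single b 1) a
  rw [rotationMatrix, Matrix.of_apply, this]
  simp

theorem rotationMatrix_mul_transpose (R : E3 ≃ₗᵢ[ℝ] E3) :
    rotationMatrix R * (rotationMatrix R)ᵀ = 1 := by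
  ext b c
  have h := apply_coord R (R.symm (EuclideanSpace.single c 1)) b
  rw [R.apply_symm_apply] at h
  rw [Matrix.mul_apply, Matrix.one_apply]
  simp only [symm_apply_coord] at h
  simp only [transpose_apply]
  rw [show (EuclideanSpace.single c (1 : ℝ) : E3) b = if b = c then 1 else 0 by simp] at h
  rw [h]
  refine Finset.sum_congr rfl fun a _ => ?_
  simp

variable {j : E3} {hj : ‖j‖ = 1} {R : E3 ≃ₗᵢ[ℝ] E3} {ε : ℝ}

/-- The functions |k| and ρ are invariant and the special polarization vectors are equivariant up to
the sign built into the photon action. The three form factors therefore transform as a vector. -/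
theorem rotateEquiv_formFactor (h : FixesAxis j R ε) (ρ : Cutoff)
    (hρ : ∀ᵐ k : E3, ρ.fn (R k) = ρ.fn k) (a : Fin 3) :
    rotateEquiv R h.sign (formFactor (stdPolarization j hj) ρ a)
      = ∑ b, (rotationMatrix R b a : ℂ) • formFactor (stdPolarization j hj) ρ b := by
  refine Lp.ext ?_
  have hs := fun b => Lp.coeFn_smul (rotationMatrix R b a : ℂ) (formFactor (stdPolarization j hj) ρ b)
  have hf := fun b => (memLp_formFactor (stdPolarization j hj) ρ b).coeFn_toLp
  rw [Fin.sum_univ_three, rotateEquiv_apply]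
  have hT := (measurePreserving_rotate R.symm).quasiMeasurePreserving
  filter_upwards [coeFn_rotateOp R h.sign (formFactor (stdPolarization j hj) ρ a),
    hT.ae (hf a), hT.ae (ae_momentum hρ), hs 0, hs 1, hs 2, hf 0, hf 1, hf 2,
    Lp.coeFn_add ((rotationMatrix R 0 a : ℂ) • formFactor (stdPolarization j hj) ρ 0
      + (rotationMatrix R 1 a : ℂ) • formFactor (stdPolarization j hj) ρ 1)
      ((rotationMatrix R 2 a : ℂ) • formFactor (stdPolarization j hj) ρ 2),
    Lp.coeFn_add ((rotationMatrix R 0 a : ℂ) • formFactor (stdPolarization j hj) ρ 0)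
      ((rotationMatrix R 1 a : ℂ) • formFactor (stdPolarization j hj) ρ 1)]
    with x h1 h2 h3 s0 s1 s2 f0 f1 f2 a1 a2
  rw [h1, a1, Pi.add_apply, a2, Pi.add_apply, s0, s1, s2]
  simp only [Pi.smul_apply, smul_eq_mul]
  simp only [formFactor]
  rw [h2, f0, f1, f2]
  simp only [R.apply_symm_apply] at h3
  have h4 := h.stdVec x.2 (R.symm x.1)
  rw [R.apply_symm_apply] at h4
  have h5 : signFn ε x.2 • stdVec j x.2 (R.symm x.1) = R.symm (stdVec j x.2 x.1) := by
    rw [h4, map_smul, R.symm_apply_apply]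
  have h6 := congrArg (fun v : E3 => v a) h5
  simp only [symm_apply_coord, Fin.sum_univ_three, PiLp.smul_apply, smul_eq_mul] at h6
  have h7 : (stdPolarization j hj).vec = stdVec j := rfl
  rw [h7, LinearIsometryEquiv.norm_map, ← h3]
  have h8 : ((signFn ε x.2 : ℝ) : ℂ) * ((stdVec j x.2 (R.symm x.1) a : ℝ) : ℂ)
    = (rotationMatrix R 0 a : ℂ) * ((stdVec j x.2 x.1 0 : ℝ) : ℂ)
      + (rotationMatrix R 1 a : ℂ) * ((stdVec j x.2 x.1 1 : ℝ) : ℂ)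
      + (rotationMatrix R 2 a : ℂ) * ((stdVec j x.2 x.1 2 : ℝ) : ℂ) := by exact_mod_cast h6
  linear_combination ((((Real.sqrt ‖x.1‖)⁻¹ : ℝ) : ℂ) * ρ.fn x.1) * h8

/-- The action of a rotation or reflection on one photon, for arbitrary polarization vectors. -/
noncomputable def photonSymmetry (e : Polarization) (hj : ‖j‖ = 1) (h : FixesAxis j R ε) :
    OnePhoton ≃ₗᵢ[ℂ] OnePhoton :=
  ((changeEquiv (stdPolarization j hj) e).trans (rotateEquiv R h.sign)).trans
    (changeEquiv e (stdPolarization j hj))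

theorem photonSymmetry_mulOp (e : Polarization) (h : FixesAxis j R ε) {φ ψ : E3 → ℝ}
    (hφ : ∀ k, φ (R.symm k) = ψ k) (x : OnePhoton × OnePhoton) (hx : x ∈ (mulOp φ).graph) :
    (photonSymmetry e hj h x.1, photonSymmetry e hj h x.2) ∈ (mulOp ψ).graph := by
  have h1 := changeEquiv_mulOp (stdPolarization j hj) e x hx
  have h2 := rotateEquiv_mulOp R h.sign hφ _ h1
  have h3 := changeEquiv_mulOp e (stdPolarization j hj) _ h2
  simp only [photonSymmetry, LinearIsometryEquiv.trans_apply]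
  exact h3

theorem photonSymmetry_formFactor (e : Polarization) (h : FixesAxis j R ε) (ρ : Cutoff)
    (hρ : ∀ᵐ k : E3, ρ.fn (R k) = ρ.fn k) (a : Fin 3) :
    photonSymmetry e hj h (formFactor e ρ a)
      = ∑ b, (rotationMatrix R b a : ℂ) • formFactor e ρ b := by
  simp only [photonSymmetry, LinearIsometryEquiv.trans_apply]
  rw [changeEquiv_formFactor, rotateEquiv_formFactor h ρ hρ, map_sum]
  simp only [map_smul, changeEquiv_formFactor]

/-- Rotations around the axis and reflections in planes containing the axis are symmetries of the
Hamiltonian. -/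
theorem hamiltonian_photonSymmetry {e : Polarization} {ρ : Cutoff} {M q m : ℝ} {p : E3} (hm : 0 ≤ m)
    (h : FixesAxis j R ε) (hρ : ∀ᵐ k : E3, ρ.fn (R k) = ρ.fn k)
    (B : Matrix (Fin 4) (Fin 4) ℂ) (hB : Bᴴ * B = 1)
    (hBD : B * diracMatrix M p = diracMatrix M p * B)
    (hBα : ∀ a, B * diracAlpha a = ∑ b, (rotationMatrix R b a : ℂ) • (diracAlpha b * B))
    (x : StateSpace × StateSpace) (hx : x ∈ (hamiltonian e ρ M q m p).closure.graph) :
    (symmetryEquiv B hB (GammaEquiv (photonSymmetry e hj h)) x.1,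
      symmetryEquiv B hB (GammaEquiv (photonSymmetry e hj h)) x.2)
      ∈ (hamiltonian e ρ M q m p).closure.graph := by
  refine hamiltonian_closure_symmetry hm _ (fun y hy => ?_) x hx
  refine hamiltonian_symmetry hm (rotationMatrix R) (rotationMatrix_mul_transpose R) B hB hBD hBα _
    (fun x hx => photonSymmetry_mulOp e h (fun k => ?_) x hx) (fun b x hx =>
    photonSymmetry_mulOp e h (fun k => ?_) x hx) (photonSymmetry_formFactor e h ρ hρ) y hy
  · rw [dispersion, dispersion, LinearIsometryEquiv.norm_map]
  · rw [← apply_coord, R.apply_symm_apply]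

end Rotations

end DiracPolaron
namespace DiracPolaron

/-! ### Explicit Dirac matrices and their product rules -/

section DiracMatrices

theorem diracAlpha_zero : diracAlpha 0 = !![0, 0, 0, 1; 0, 0, 1, 0; 0, 1, 0, 0; 1, 0, 0, 0] := by
  ext i l
  fin_cases i <;> fin_cases l <;> rfl

theorem diracAlpha_one : diracAlpha 1 = !![0, 0, 0, -Complex.I; 0, 0, Complex.I, 0;
    0, -Complex.I, 0, 0; Complex.I, 0, 0, 0] := by
  ext i l
  fin_cases i <;> fin_cases l <;> rfl

theorem diracAlpha_two : diracAlpha 2 = !![0, 0, 1, 0; 0, 0, 0, -1; 1, 0, 0, 0; 0, -1, 0, 0] := by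
  ext i l
  fin_cases i <;> fin_cases l <;> rfl

theorem diracBeta_eq : diracBeta = !![1, 0, 0, 0; 0, 1, 0, 0; 0, 0, -1, 0; 0, 0, 0, -1] := by
  ext i l
  fin_cases i <;> fin_cases l <;> simp [diracBeta] <;>
    first | rfl | exact neg_zero

/-- The matrix `α · v`. -/
noncomputable def alphaVec (v : E3) : Matrix (Fin 4) (Fin 4) ℂ := ∑ a, (v a : ℂ) • diracAlpha a

theorem alphaVec_eq (v : E3) : alphaVec v =
    !![0, 0, (v 2 : ℂ), v 0 - Complex.I * v 1; 0, 0, v 0 + Complex.I * v 1, -v 2;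
      (v 2 : ℂ), v 0 - Complex.I * v 1, 0, 0; v 0 + Complex.I * v 1, -v 2, 0, 0] := by
  rw [alphaVec, Fin.sum_univ_three, diracAlpha_zero, diracAlpha_one, diracAlpha_two]
  ext i l
  fin_cases i <;> fin_cases l <;> simp <;> ring

/-- Twice the spin, `σ · v ⊕ σ · v`. -/
noncomputable def spinVec (v : E3) : Matrix (Fin 4) (Fin 4) ℂ := (2 : ℂ) • spin v

theorem spinVec_eq (v : E3) : spinVec v =
    !![(v 2 : ℂ), v 0 - Complex.I * v 1, 0, 0; v 0 + Complex.I * v 1, -v 2, 0, 0;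
      0, 0, (v 2 : ℂ), v 0 - Complex.I * v 1; 0, 0, v 0 + Complex.I * v 1, -v 2] := by
  have h : (∑ a, (v a : ℂ) • pauli a) = !![(v 2 : ℂ), v 0 - Complex.I * v 1;
      v 0 + Complex.I * v 1, -v 2] := by
    rw [Fin.sum_univ_three]
    ext i l
    fin_cases i <;> fin_cases l <;> simp [pauli] <;> ring
  rw [spinVec, spin, h]
  have h1 : ∀ z : ℂ, (2 : ℂ) * (1 / 2 * z) = z := fun z => by ring
  ext i l
  fin_cases i <;> fin_cases l <;> first | exact h1 _ | exact mul_zero _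

/-- The matrix `γ₅`. -/
def gammaFive : Matrix (Fin 4) (Fin 4) ℂ := !![0, 0, 1, 0; 0, 0, 0, 1; 1, 0, 0, 0; 0, 1, 0, 0]

theorem cross_apply_zero (a b : E3) : cross a b 0 = a 1 * b 2 - a 2 * b 1 := by
  simp [cross, cross_apply]

theorem cross_apply_one (a b : E3) : cross a b 1 = a 2 * b 0 - a 0 * b 2 := by
  simp [cross, cross_apply]

theorem cross_apply_two (a b : E3) : cross a b 2 = a 0 * b 1 - a 1 * b 0 := by
  simp [cross, cross_apply]

theorem inner_eq_coord (a b : E3) : inner ℝ a b = a 0 * b 0 + a 1 * b 1 + a 2 * b 2 := by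
  rw [inner_eq_dotProduct, dotProduct, Fin.sum_univ_three]

/-- Together with the reversed product this yields a commutator 2i α · (v × w), the infinitesimal
rotation of α. The part proportional to γ₅ commutes. -/
theorem spinVec_mul_alphaVec (v w : E3) : spinVec v * alphaVec w
    = ((inner ℝ v w : ℝ) : ℂ) • gammaFive + Complex.I • alphaVec (cross v w) := by
  rw [spinVec_eq, alphaVec_eq, alphaVec_eq, gammaFive, cross_apply_zero, cross_apply_one,
    cross_apply_two, inner_eq_coord]
  have hI := Complex.I_mul_I
  ext i l
  fin_cases i <;> fin_cases l <;> simp [Matrix.mul_apply, Fin.sum_univ_four] <;> ring_nf <;>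
    simp only [Complex.I_sq] <;> ring

theorem alphaVec_mul_spinVec (v w : E3) : alphaVec w * spinVec v
    = ((inner ℝ v w : ℝ) : ℂ) • gammaFive - Complex.I • alphaVec (cross v w) := by
  rw [spinVec_eq, alphaVec_eq, alphaVec_eq, gammaFive, cross_apply_zero, cross_apply_one,
    cross_apply_two, inner_eq_coord]
  ext i l
  fin_cases i <;> fin_cases l <;> simp [Matrix.mul_apply, Fin.sum_univ_four] <;> ring_nf <;>
    simp only [Complex.I_sq] <;> ring

theorem spinVec_mul_spinVec (v w : E3) : spinVec v * spinVec w + spinVec w * spinVec v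
    = (2 * (inner ℝ v w : ℝ) : ℂ) • (1 : Matrix (Fin 4) (Fin 4) ℂ) := by
  rw [spinVec_eq, spinVec_eq, inner_eq_coord]
  ext i l
  fin_cases i <;> fin_cases l <;> simp <;> ring_nf <;>
    simp only [Complex.I_sq] <;> ring

theorem isHermitian_spinVec (v : E3) : (spinVec v).IsHermitian := by
  rw [IsHermitian, spinVec_eq]
  ext i l
  fin_cases i <;> fin_cases l <;> simp [sub_eq_add_neg]

theorem spinVec_mul_diracBeta (v : E3) : spinVec v * diracBeta = diracBeta * spinVec v := by
  rw [spinVec_eq, diracBeta_eq]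
  ext i l
  fin_cases i <;> fin_cases l <;> simp [Matrix.mul_apply, Fin.sum_univ_four]

theorem diracBeta_mul_self : diracBeta * diracBeta = 1 := by
  rw [diracBeta_eq]
  ext i l
  fin_cases i <;> fin_cases l <;> simp [Matrix.mul_apply, Fin.sum_univ_four]

theorem diracBeta_mul_alphaVec (v : E3) : diracBeta * alphaVec v = -(alphaVec v * diracBeta) := by
  rw [alphaVec_eq, diracBeta_eq]
  ext i l
  fin_cases i <;> fin_cases l <;> simp [Matrix.mul_apply, Fin.sum_univ_four]

end DiracMatrices

/-! ### Rotations around the axis and reflections in planes containing it -/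

section AxisRotations

theorem cross_add_right (a b c : E3) : cross a (b + c) = cross a b + cross a c := by
  simp [cross]

theorem cross_self (a : E3) : cross a a = 0 := by
  simp [cross]

theorem cross_neg_swap (a b : E3) : cross a b = -cross b a := by
  simp only [cross]
  rw [← cross_anticomm]
  rfl

theorem ext_coord {a b : E3} (h0 : a 0 = b 0) (h1 : a 1 = b 1) (h2 : a 2 = b 2) : a = b := by
  ext i
  fin_cases i
  · exact h0
  · exact h1
  · exact h2

theorem cross_cross_self (a b : E3) :
    cross a (cross a b) = (inner ℝ a b : ℝ) • a - (inner ℝ a a : ℝ) • b := by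
  apply ext_coord <;>
    simp only [cross_apply_zero, cross_apply_one, cross_apply_two, inner_eq_coord, PiLp.sub_apply,
      PiLp.smul_apply, smul_eq_mul] <;> ring

theorem inner_cross_left (a b : E3) : inner ℝ a (cross a b) = 0 := by
  rw [real_inner_comm]
  exact cross_dot_self_left a b

theorem inner_cross_right (a b : E3) : inner ℝ b (cross a b) = 0 := by
  rw [cross_neg_swap, inner_neg_right, inner_cross_left, neg_zero]

/-- The rotation around the axis `j` by the angle `θ`. -/
noncomputable def axisRotationFun (j : E3) (θ : ℝ) (v : E3) : E3 :=
  Real.cos θ • v + Real.sin θ • cross j v + ((1 - Real.cos θ) * inner ℝ j v) • j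

variable {j : E3} (hj : ‖j‖ = 1)

include hj in
theorem inner_axis_self : inner ℝ j j = (1 : ℝ) := by
  rw [real_inner_self_eq_norm_sq, hj, one_pow]

include hj in
theorem inner_axisRotationFun (θ : ℝ) (v : E3) :
    inner ℝ j (axisRotationFun j θ v) = (inner ℝ j v : ℝ) := by
  simp only [axisRotationFun, inner_add_right, inner_smul_right, inner_cross_left,
    inner_axis_self hj]
  ring

include hj in
theorem cross_axisRotationFun (θ : ℝ) (v : E3) : cross j (axisRotationFun j θ v)
    = Real.cos θ • cross j v + Real.sin θ • ((inner ℝ j v : ℝ) • j - v) := by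
  simp only [axisRotationFun, cross_add_right, cross_smul_right, cross_cross_self, cross_self,
    inner_axis_self hj, one_smul, smul_zero, add_zero]

include hj in
theorem axisRotationFun_add (θ φ : ℝ) (v : E3) :
    axisRotationFun j θ (axisRotationFun j φ v) = axisRotationFun j (θ + φ) v := by
  have h1 := cross_axisRotationFun hj φ v
  have h2 := inner_axisRotationFun hj φ v
  have h3 : axisRotationFun j θ (axisRotationFun j φ v)
      = Real.cos θ • axisRotationFun j φ v + Real.sin θ • cross j (axisRotationFun j φ v)
        + ((1 - Real.cos θ) * inner ℝ j (axisRotationFun j φ v)) • j := rfl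
  rw [h3, h1, h2, axisRotationFun, axisRotationFun, Real.cos_add, Real.sin_add]
  module

theorem axisRotationFun_zero (v : E3) : axisRotationFun j 0 v = v := by
  simp [axisRotationFun]

include hj in
theorem norm_axisRotationFun (θ : ℝ) (v : E3) : ‖axisRotationFun j θ v‖ = ‖v‖ := by
  rw [← sq_eq_sq₀ (norm_nonneg _) (norm_nonneg _), ← real_inner_self_eq_norm_sq,
    ← real_inner_self_eq_norm_sq]
  have h1 := norm_cross_sq j v
  rw [hj, ← real_inner_self_eq_norm_sq] at h1
  have h2 : inner ℝ (cross j v) v = (0 : ℝ) := by rw [real_inner_comm]; exact inner_cross_right j v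
  have h3 : inner ℝ (cross j v) j = (0 : ℝ) := cross_dot_self_left j v
  have h4 : inner ℝ v j = (inner ℝ j v : ℝ) := real_inner_comm _ _
  simp only [axisRotationFun, inner_add_right, inner_add_left, inner_smul_right, inner_smul_left,
    inner_cross_left, inner_cross_right, inner_axis_self hj, h1, h2, h3, h4, conj_trivial]
  have := Real.sin_sq_add_cos_sq θ
  linear_combination (inner ℝ v v - inner ℝ j v ^ 2) * this

/-- The rotation around the axis `j` by the angle `θ`, as an isometry. -/
noncomputable def axisRotation (θ : ℝ) : E3 ≃ₗᵢ[ℝ] E3 where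
  toFun := axisRotationFun j θ
  invFun := axisRotationFun j (-θ)
  map_add' v w := by
    simp only [axisRotationFun, cross_add_right, inner_add_right]
    module
  map_smul' c v := by
    simp only [axisRotationFun, cross_smul_right, inner_smul_right, RingHom.id_apply]
    module
  left_inv v := by rw [axisRotationFun_add hj, neg_add_cancel, axisRotationFun_zero]
  right_inv v := by rw [axisRotationFun_add hj, add_neg_cancel, axisRotationFun_zero]
  norm_map' v := norm_axisRotationFun hj θ v

theorem axisRotation_apply (θ : ℝ) (v : E3) : axisRotation hj θ v = axisRotationFun j θ v := rfl

theorem axisRotation_trans (θ φ : ℝ) :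
    (axisRotation hj θ).trans (axisRotation hj φ) = axisRotation hj (φ + θ) := by
  ext1 v
  exact axisRotationFun_add hj φ θ v

/-- An orthogonal transformation preserves the vector product up to its determinant. -/
theorem exists_cross_map (R : E3 ≃ₗᵢ[ℝ] E3) : ∃ d : ℝ, d * d = 1 ∧
    ∀ a b, cross (R a) (R b) = d • R (cross a b) := by
  let β := (EuclideanSpace.basisFun (Fin 3) ℝ).toBasis
  have hdet : ∀ u v w : E3, inner ℝ u (cross v w) = β.det ![u, v, w] := fun u v w => by
    rw [inner_eq_dotProduct]
    -- The triple product is a determinant, so R multiplies it by det R; testing against all vectors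
    -- R v gives the rule for the vector product.
    change u.ofLp ⬝ᵥ (v.ofLp ⨯₃ w.ofLp) = _
    rw [triple_product_eq_det, Module.Basis.det_apply, ← Matrix.det_transpose]
    congr 1
    ext i l
    fin_cases l <;> fin_cases i <;> simp [Module.Basis.toMatrix_apply, β]
  have hmain : ∀ a b, cross (R a) (R b)
      = LinearMap.det (R.toLinearEquiv : E3 →ₗ[ℝ] E3) • R (cross a b) := fun a b => by
    refine ext_inner_left ℝ fun v => ?_
    rw [← R.apply_symm_apply v, inner_smul_right, LinearIsometryEquiv.inner_map_map, hdet, hdet,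
      ← Module.Basis.det_comp]
    congr 1
    ext i : 1
    fin_cases i <;> rfl
  refine ⟨_, ?_, hmain⟩
  set d := LinearMap.det (R.toLinearEquiv : E3 →ₗ[ℝ] E3)
  -- An isometry preserves the area spanned by two basis vectors, whereas the rule just proved
  -- multiplies its square by d²; hence d² = 1.
  have h1 := norm_cross_sq (R (EuclideanSpace.single 0 1)) (R (EuclideanSpace.single 1 1))
  have h2 := norm_cross_sq (EuclideanSpace.single 0 1) (EuclideanSpace.single 1 1)
  rw [hmain, R.norm_map, R.norm_map, R.inner_map_map, ← h2, inner_smul_left, inner_smul_right,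
    R.inner_map_map, h2] at h1
  have h3 : inner ℝ (EuclideanSpace.single 0 1 : E3) (EuclideanSpace.single 1 1) = (0 : ℝ) := by
    simp [inner_eq_coord]
  simp [h3] at h1
  linarith

/-- The determinant is 1 because the rotation by θ is the square of the rotation by θ/2. -/
theorem fixesAxis_axisRotation (θ : ℝ) : FixesAxis j (axisRotation hj θ) 1 where
  sign := one_mul 1
  axis := by
    rw [axisRotation_apply, axisRotationFun, cross_self, inner_axis_self hj]
    module
  cross_map a b := by
    obtain ⟨d, h1, h2⟩ := exists_cross_map (axisRotation hj (θ / 2))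
    have h3 : ∀ v, axisRotation hj θ v = axisRotation hj (θ / 2) (axisRotation hj (θ / 2) v) :=
      fun v => by
        rw [← LinearIsometryEquiv.trans_apply, axisRotation_trans, add_halves]
    rw [h3, h3, h3, h2, h2, map_smul, smul_smul, h1]

/-- The reflection in the plane orthogonal to `n`. -/
noncomputable def planeReflection (n : E3) : E3 ≃ₗᵢ[ℝ] E3 := (ℝ ∙ n)ᗮ.reflection

theorem planeReflection_apply {n : E3} (hn : ‖n‖ = 1) (v : E3) :
    planeReflection n v = v - (2 * inner ℝ n v) • n := by
  rw [planeReflection, Submodule.reflection_orthogonal_apply, Submodule.reflection_singleton_apply,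
    hn]
  simp
  module

include hj in
-- The sign is read off from n × j: the reflection fixes j and n × j but reverses n.
theorem fixesAxis_planeReflection {n : E3} (hn : ‖n‖ = 1) (hnj : inner ℝ n j = (0 : ℝ)) :
    FixesAxis j (planeReflection n) (-1) := by
  obtain ⟨d, h1, h2⟩ := exists_cross_map (planeReflection n)
  have hRj : planeReflection n j = j := by
    rw [planeReflection_apply hn, hnj, mul_zero, zero_smul, sub_zero]
  have hd : d = -1 := by
    have h3 : planeReflection n n = (-1 : ℝ) • n := by
      rw [planeReflection_apply hn, inner_axis_self hn]
      module
    have h4 : planeReflection n (cross n j) = cross n j := by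
      rw [planeReflection_apply hn, inner_cross_left, mul_zero, zero_smul, sub_zero]
    have h5 := h2 n j
    rw [h3, hRj, h4, cross_smul_left] at h5
    have h6 := congrArg (fun v => inner ℝ (cross n j) v) h5
    simp only [inner_smul_right, norm_cross_sq, hn, hj, hnj] at h6
    linarith
  subst hd
  exact ⟨h1, hRj, h2⟩

end AxisRotations

/-! ### Spinor matrices implementing rotations and reflections -/

section SpinRotations

variable {j : E3} (hj : ‖j‖ = 1)

theorem alphaVec_add (v w : E3) : alphaVec (v + w) = alphaVec v + alphaVec w := by
  simp [alphaVec, add_smul, Finset.sum_add_distrib]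

theorem alphaVec_smul (c : ℝ) (v : E3) : alphaVec (c • v) = (c : ℂ) • alphaVec v := by
  simp [alphaVec, Finset.smul_sum, mul_smul]

theorem alphaVec_single (a : Fin 3) : alphaVec (EuclideanSpace.single a 1) = diracAlpha a := by
  rw [alphaVec, Finset.sum_eq_single a]
  · simp
  · intro b _ hb
    simp [hb]
  · simp

theorem mul_diracAlpha_of_alphaVec {B : Matrix (Fin 4) (Fin 4) ℂ} {R : E3 ≃ₗᵢ[ℝ] E3}
    (h : ∀ v, B * alphaVec v = alphaVec (R v) * B) (a : Fin 3) :
    B * diracAlpha a = ∑ b, (rotationMatrix R b a : ℂ) • (diracAlpha b * B) := by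
  rw [← alphaVec_single, h, alphaVec, Finset.sum_mul]
  simp only [smul_mul_assoc]
  rfl

theorem mul_diracMatrix_of_alphaVec {B : Matrix (Fin 4) (Fin 4) ℂ} {R : E3 ≃ₗᵢ[ℝ] E3}
    (h : ∀ v, B * alphaVec v = alphaVec (R v) * B) (hβ : B * diracBeta = diracBeta * B)
    {p : E3} (hp : R p = p) (M : ℝ) : B * diracMatrix M p = diracMatrix M p * B := by
  have h1 : diracMatrix M p = alphaVec p + (M : ℂ) • diracBeta := rfl
  rw [h1, mul_add, add_mul, h, hp, mul_smul_comm, smul_mul_assoc, hβ]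

include hj in
theorem spinVec_mul_self : spinVec j * spinVec j = 1 := by
  have h := spinVec_mul_spinVec j j
  rw [inner_axis_self hj, ← two_smul ℂ (spinVec j * spinVec j)] at h
  have h2 := congrArg (fun A => (2 : ℂ)⁻¹ • A) h
  simp only [smul_smul] at h2
  simpa using h2

/-- The rotation of the spin around the axis `j` by the angle `θ`. -/
noncomputable def axisSpin (j : E3) (θ : ℝ) : Matrix (Fin 4) (Fin 4) ℂ :=
  (Real.cos (θ / 2) : ℂ) • (1 : Matrix (Fin 4) (Fin 4) ℂ)
    - (Complex.I * (Real.sin (θ / 2) : ℂ)) • spinVec j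

include hj in
theorem axisSpin_unitary (θ : ℝ) : (axisSpin j θ)ᴴ * axisSpin j θ = 1 := by
  have h1 : (axisSpin j θ)ᴴ = (Real.cos (θ / 2) : ℂ) • (1 : Matrix (Fin 4) (Fin 4) ℂ)
    + (Complex.I * (Real.sin (θ / 2) : ℂ)) • spinVec j := by
    rw [axisSpin, conjTranspose_sub, conjTranspose_smul, conjTranspose_smul, conjTranspose_one,
      (isHermitian_spinVec j).eq]
    simp [-Complex.ofReal_cos, -Complex.ofReal_sin]
  have h3 : ((Real.cos (θ / 2) : ℝ) : ℂ) * ((Real.cos (θ / 2) : ℝ) : ℂ)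
      + ((Real.sin (θ / 2) : ℝ) : ℂ) * ((Real.sin (θ / 2) : ℝ) : ℂ) = 1 := by
    have := Real.sin_sq_add_cos_sq (θ / 2)
    exact_mod_cast (by linarith : Real.cos (θ / 2) * Real.cos (θ / 2)
      + Real.sin (θ / 2) * Real.sin (θ / 2) = 1)
  rw [h1, axisSpin]
  simp only [add_mul, mul_sub, smul_mul_smul_comm, one_mul, mul_one, spinVec_mul_self hj]
  have h2 := Complex.I_mul_I
  set c : ℂ := ((Real.cos (θ / 2) : ℝ) : ℂ)
  set s : ℂ := ((Real.sin (θ / 2) : ℝ) : ℂ)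
  have h4 : Complex.I * s * (Complex.I * s) = -(s * s) := by linear_combination (s * s) * h2
  rw [h4, mul_comm c (Complex.I * s)]
  have h5 : (c * c) • (1 : Matrix (Fin 4) (Fin 4) ℂ) + (Complex.I * s * c) • spinVec j
      - ((Complex.I * s * c) • spinVec j + (-(s * s)) • (1 : Matrix (Fin 4) (Fin 4) ℂ))
      = (c * c + s * s) • (1 : Matrix (Fin 4) (Fin 4) ℂ) := by module
  rw [h5, h3, one_smul]

include hj in
-- The product rules turn both sides into combinations of α and γ₅. The γ₅ terms agree since
-- rotation preserves the component along j, and the rest is an identity between vectors with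
-- half-angle coefficients.
theorem axisSpin_mul_alphaVec (θ : ℝ) (v : E3) :
    axisSpin j θ * alphaVec v = alphaVec (axisRotation hj θ v) * axisSpin j θ := by
  set w := axisRotation hj θ v with hw
  have hin : inner ℝ j w = (inner ℝ j v : ℝ) := inner_axisRotationFun hj θ v
  have hcr : cross j w = Real.cos θ • cross j v + Real.sin θ • ((inner ℝ j v : ℝ) • j - v) :=
    cross_axisRotationFun hj θ v
  have hwv : w = Real.cos θ • v + Real.sin θ • cross j v + ((1 - Real.cos θ) * inner ℝ j v) • j := rfl
  have hc : Real.cos θ = 2 * Real.cos (θ / 2) ^ 2 - 1 := by rw [← Real.cos_two_mul]; congr 1; ring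
  have hs : Real.sin θ = 2 * Real.sin (θ / 2) * Real.cos (θ / 2) := by
    rw [← Real.sin_two_mul]; congr 1; ring
  have hsc := Real.sin_sq_add_cos_sq (θ / 2)
  -- Rotating w back by θ/2 and rotating v forward by θ/2 agree orthogonally to j, and both sides
  -- have the same component along j; the half-angle formulas verify this.
  have hv : Real.cos (θ / 2) • w + (-Real.sin (θ / 2)) • cross j w
      = Real.cos (θ / 2) • v + Real.sin (θ / 2) • cross j v := by
    rw [hcr, hwv, hc, hs]
    set c := Real.cos (θ / 2)
    set s := Real.sin (θ / 2)
    set P : ℝ := inner ℝ j v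
    have e1 : c * (2 * c ^ 2 - 1) + s * (2 * s * c) = c := by linear_combination (2 * c) * hsc
    have e2 : c * (2 * s * c) - s * (2 * c ^ 2 - 1) = s := by ring
    have e3 : c * ((1 - (2 * c ^ 2 - 1)) * P) - s * (2 * s * c * P) = 0 := by
      linear_combination (-2 * c * P) * hsc
    have e4 : c • ((2 * c ^ 2 - 1) • v + (2 * s * c) • cross j v + ((1 - (2 * c ^ 2 - 1)) * P) • j)
        + (-s) • ((2 * c ^ 2 - 1) • cross j v + (2 * s * c) • (P • j - v))
        = (c * (2 * c ^ 2 - 1) + s * (2 * s * c)) • v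
          + (c * (2 * s * c) - s * (2 * c ^ 2 - 1)) • cross j v
          + (c * ((1 - (2 * c ^ 2 - 1)) * P) - s * (2 * s * c * P)) • j := by module
    rw [e4, e1, e2, e3, zero_smul, add_zero]
  have hα := congrArg alphaVec hv
  simp only [alphaVec_add, alphaVec_smul, Complex.ofReal_neg] at hα
  rw [axisSpin, sub_mul, mul_sub, smul_mul_assoc, smul_mul_assoc, mul_smul_comm, mul_smul_comm,
    one_mul, mul_one, spinVec_mul_alphaVec, alphaVec_mul_spinVec, hin]
  set c : ℂ := ((Real.cos (θ / 2) : ℝ) : ℂ)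
  set s : ℂ := ((Real.sin (θ / 2) : ℝ) : ℂ)
  set P : ℂ := ((inner ℝ j v : ℝ) : ℂ)
  have hI : Complex.I * s * Complex.I = -s := by linear_combination s * Complex.I_mul_I
  have e1 : c • alphaVec v - (Complex.I * s) • (P • gammaFive + Complex.I • alphaVec (cross j v))
      = c • alphaVec v - (Complex.I * s * Complex.I) • alphaVec (cross j v)
        - (Complex.I * s * P) • gammaFive := by module
  have e2 : c • alphaVec w - (Complex.I * s) • (P • gammaFive - Complex.I • alphaVec (cross j w))
      = c • alphaVec w + (Complex.I * s * Complex.I) • alphaVec (cross j w)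
        - (Complex.I * s * P) • gammaFive := by module
  rw [e1, e2, hI, hα, neg_smul, sub_neg_eq_add]

theorem axisSpin_mul_diracBeta (θ : ℝ) :
    axisSpin j θ * diracBeta = diracBeta * axisSpin j θ := by
  rw [axisSpin, sub_mul, mul_sub, smul_mul_assoc, smul_mul_assoc, mul_smul_comm, mul_smul_comm,
    one_mul, mul_one, spinVec_mul_diracBeta]

variable {n : E3} (hn : ‖n‖ = 1)

include hn in
theorem reflectSpin_unitary : (diracBeta * spinVec n)ᴴ * (diracBeta * spinVec n) = 1 := by
  rw [conjTranspose_mul, isHermitian_diracBeta.eq, (isHermitian_spinVec n).eq, mul_assoc,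
    ← mul_assoc diracBeta, diracBeta_mul_self, one_mul, spinVec_mul_self hn]

include hn in
-- Conjugation with σ · n alone sends α · v to minus its reflection. The factor β anticommutes with
-- α and corrects the sign, while it commutes with the mass term.
theorem reflectSpin_mul_alphaVec (v : E3) :
    (diracBeta * spinVec n) * alphaVec v
      = alphaVec (planeReflection n v) * (diracBeta * spinVec n) := by
  have h1 : spinVec n * alphaVec v = -(alphaVec (planeReflection n v) * spinVec n) := by
    rw [spinVec_mul_alphaVec, alphaVec_mul_spinVec]
    have h2 : inner ℝ n (planeReflection n v) = -(inner ℝ n v : ℝ) := by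
      rw [planeReflection_apply hn, inner_sub_right, inner_smul_right, inner_axis_self hn]
      ring
    have h3 : cross n (planeReflection n v) = cross n v := by
      rw [planeReflection_apply hn, sub_eq_add_neg, ← neg_smul, cross_add_right, cross_smul_right,
        cross_self, smul_zero, add_zero]
    rw [h2, h3, Complex.ofReal_neg]
    module
  rw [mul_assoc, h1, mul_neg, ← mul_assoc, diracBeta_mul_alphaVec, neg_mul, neg_neg, mul_assoc]

theorem reflectSpin_mul_diracBeta :
    (diracBeta * spinVec n) * diracBeta = diracBeta * (diracBeta * spinVec n) := by
  rw [mul_assoc, spinVec_mul_diracBeta]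

/-- Spin components in orthogonal directions anticommute, and β commutes with the spin. -/
theorem reflectSpin_mul_spin (hnj : inner ℝ n j = (0 : ℝ)) :
    (diracBeta * spinVec n) * spin j = -(spin j * (diracBeta * spinVec n)) := by
  have h1 : spinVec n * spinVec j = -(spinVec j * spinVec n) := by
    have := spinVec_mul_spinVec n j
    rw [hnj] at this
    rw [eq_neg_iff_add_eq_zero, this]
    simp
  have h2 : spin j = (2 : ℂ)⁻¹ • spinVec j := by rw [spinVec, smul_smul]; simp
  rw [h2, mul_smul_comm, smul_mul_assoc, mul_assoc, h1, mul_neg, ← mul_assoc, ← spinVec_mul_diracBeta,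
    mul_assoc, smul_neg]

end SpinRotations

end DiracPolaron
namespace DiracPolaron

/-! ### The operator j · ℓ on smooth functions as generator of rotations -/

section AngularGenerators

/-- The smooth compactly supported one-photon functions together with their images under `j · ℓ`. -/
def angularGenerators (j : E3) : Set (OnePhoton × OnePhoton) :=
  {F | ∃ f : Fin 2 → E3 → ℂ,
    (∀ l, ContDiff ℝ ((⊤ : ℕ∞) : WithTop ℕ∞) (f l)) ∧ (∀ l, HasCompactSupport (f l)) ∧
    (F.1 =ᵐ[photonMeasure] fun x => f x.2 x.1) ∧
    (F.2 =ᵐ[photonMeasure] fun x => angularExpr j (f x.2) x.1)}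

theorem sum_smul_single (v : E3) : ∑ a, v a • (EuclideanSpace.single a 1 : E3) = v := by
  ext i
  simp [Finset.sum_apply, Pi.single_apply]

theorem angularExpr_eq (j : E3) (f : E3 → ℂ) (k : E3) :
    angularExpr j f k = -Complex.I * fderiv ℝ f k (cross j k) := by
  have h : fderiv ℝ f k (cross j k) = ∑ a, (cross j k a : ℂ) * grad f k a := by
    conv_lhs => rw [← sum_smul_single (cross j k)]
    simp [grad]
  rw [angularExpr, h, Fin.sum_univ_three, cross_apply_zero, cross_apply_one, cross_apply_two,
    dotProduct, Fin.sum_univ_three, cross_apply]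
  simp
  ring

/-- The expression is a derivative along the field j × k, and R⁻¹ maps j × k to ε times j × R⁻¹k. -/
theorem angularExpr_rotate {j : E3} {R : E3 ≃ₗᵢ[ℝ] E3} {ε : ℝ} (h : FixesAxis j R ε) (c : ℂ)
    {f : E3 → ℂ} (hf : Differentiable ℝ f) (k : E3) :
    angularExpr j (fun k => c * f (R.symm k)) k = ε * (c * angularExpr j f (R.symm k)) := by
  have h1 : HasFDerivAt (fun k => c * f (R.symm k))
      (c • (fderiv ℝ f (R.symm k)).comp (R.symm.toContinuousLinearEquiv : E3 →L[ℝ] E3)) k := by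
    refine HasFDerivAt.const_mul ?_ c
    exact (hf (R.symm k)).hasFDerivAt.comp k (R.symm.toContinuousLinearEquiv : E3 →L[ℝ] E3).hasFDerivAt
  have h2 : R.symm (cross j k) = ε • cross j (R.symm k) := by
    apply R.injective
    have := h.cross_map j (R.symm k)
    rw [h.axis, R.apply_symm_apply] at this
    rw [R.apply_symm_apply, map_smul, this]
  rw [angularExpr_eq, angularExpr_eq, h1.fderiv]
  simp [h2]
  ring

theorem rotate_mem_angularGenerators {j : E3} {R : E3 ≃ₗᵢ[ℝ] E3} {ε : ℝ} (h : FixesAxis j R ε)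
    {F : OnePhoton × OnePhoton} (hF : F ∈ angularGenerators j) :
    (rotateOp R h.sign F.1, (ε : ℂ) • rotateOp R h.sign F.2) ∈ angularGenerators j := by
  obtain ⟨f, hf1, hf2, hF1, hF2⟩ := hF
  refine ⟨fun l k => (signFn ε l : ℂ) * f l (R.symm k), fun l => ?_, fun l => ?_, ?_, ?_⟩
  · exact contDiff_const.mul ((hf1 l).comp R.symm.toContinuousLinearEquiv.contDiff)
  · exact ((hf2 l).comp_homeomorph R.symm.toHomeomorph).mul_left
  · filter_upwards [coeFn_rotateOp R h.sign F.1,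
      (measurePreserving_rotate R.symm).quasiMeasurePreserving.ae hF1] with x h1 h2
    rw [h1, h2]
  · filter_upwards [Lp.coeFn_smul (ε : ℂ) (rotateOp R h.sign F.2), coeFn_rotateOp R h.sign F.2,
      (measurePreserving_rotate R.symm).quasiMeasurePreserving.ae hF2] with x h1 h2 h3
    rw [h1, Pi.smul_apply, h2, h3, angularExpr_rotate h _ ((hf1 x.2).differentiable (by simp)),
      smul_eq_mul]

theorem inner_onePhoton (g f : OnePhoton) :
    inner ℂ g f = ∫ x, (starRingEnd ℂ) (g x) * f x ∂photonMeasure := by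
  rw [L2.inner_def]
  simp [mul_comm]

theorem measurable_helicity {f : Fin 2 → E3 → ℂ} (h : ∀ l, Continuous (f l)) :
    Measurable fun x : Photon => f x.2 x.1 :=
  measurable_from_prod_countable_left fun l => (h l).measurable

theorem exists_bound {f : Fin 2 → E3 → ℂ} (h : ∀ l, Continuous (f l))
    (hc : ∀ l, HasCompactSupport (f l)) :
    ∃ C r : ℝ, ∀ l k, ‖f l k‖ ≤ Set.indicator (Metric.closedBall 0 r) (fun _ => C) k := by
  have h1 : ∀ l, ∃ C, ∀ k, ‖f l k‖ ≤ C := fun l => (h l).bounded_above_of_compact_support (hc l)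
  have h2 : ∀ l, ∃ r, tsupport (f l) ⊆ Metric.closedBall 0 r :=
    fun l => (hc l).isBounded.subset_closedBall 0
  choose C hC using h1
  choose r hr using h2
  refine ⟨max (C 0) (C 1), max (r 0) (r 1), fun l k => ?_⟩
  by_cases hk : k ∈ Metric.closedBall (0 : E3) (max (r 0) (r 1))
  · rw [Set.indicator_of_mem hk]
    refine (hC l k).trans ?_
    fin_cases l
    · exact le_max_left _ _
    · exact le_max_right _ _
  · rw [Set.indicator_of_notMem hk]
    have : f l k = 0 := by
      by_contra h0
      refine hk (Metric.closedBall_subset_closedBall ?_ (hr l (subset_tsupport _ h0)))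
      fin_cases l
      · exact le_max_left _ _
      · exact le_max_right _ _
    rw [this, norm_zero]

theorem memLp_ball (C r : ℝ) : MemLp (fun x : Photon =>
    Set.indicator (Metric.closedBall 0 r) (fun _ : E3 => C) x.1) 2 photonMeasure := by
  have h := memLp_indicator_const 2 (measurableSet_closedBall (x := (0 : E3)) (ε := r)) C
    (μ := volume) (Or.inr measure_closedBall_lt_top.ne)
  have := h.comp_fst (ν := (Measure.count : Measure (Fin 2)))
  exact this

theorem memLp_helicity {f : Fin 2 → E3 → ℂ} (h : ∀ l, Continuous (f l))
    (hc : ∀ l, HasCompactSupport (f l)) :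
    MemLp (fun x : Photon => f x.2 x.1) 2 photonMeasure := by
  obtain ⟨C, r, hb⟩ := exists_bound h hc
  refine (memLp_ball C r).mono (measurable_helicity h).aestronglyMeasurable ?_
  exact Filter.Eventually.of_forall fun x => (hb _ _).trans (le_abs_self _)

theorem continuous_cross_left (j : E3) : Continuous fun k => cross j k := by
  refine (PiLp.continuous_toLp 2 (fun _ : Fin 3 => ℝ)).comp ?_
  refine continuous_pi fun i => ?_
  fin_cases i <;> simp only [cross_apply] <;> simp <;> fun_prop

theorem continuous_angularExpr (j : E3) {f : E3 → ℂ}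
    (hf : ContDiff ℝ ((⊤ : ℕ∞) : WithTop ℕ∞) f) : Continuous (angularExpr j f) := by
  have h1 : Continuous fun k => fderiv ℝ f k (cross j k) := by
    exact (hf.continuous_fderiv (by simp)).clm_apply (continuous_cross_left j)
  have h2 : angularExpr j f = fun k => -Complex.I * fderiv ℝ f k (cross j k) :=
    funext (angularExpr_eq j f)
  rw [h2]
  exact continuous_const.mul h1

theorem hasCompactSupport_angularExpr (j : E3) {f : E3 → ℂ} (hf : HasCompactSupport f) :
    HasCompactSupport (angularExpr j f) := by
  refine (hf.fderiv (𝕜 := ℝ)).mono fun k hk h0 => hk ?_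
  rw [angularExpr_eq, h0]
  simp

theorem exists_mem_angularGenerators (j : E3) {f : Fin 2 → E3 → ℂ}
    (h : ∀ l, ContDiff ℝ ((⊤ : ℕ∞) : WithTop ℕ∞) (f l)) (hc : ∀ l, HasCompactSupport (f l)) :
    ∃ F ∈ angularGenerators j, F.1 =ᵐ[photonMeasure] fun x => f x.2 x.1 := by
  have h1 := memLp_helicity (fun l => (h l).continuous) hc
  have h2 := memLp_helicity (fun l => continuous_angularExpr j (h l))
    (fun l => hasCompactSupport_angularExpr j (hc l))
  exact ⟨(h1.toLp _, h2.toLp _), ⟨f, h, hc, h1.coeFn_toLp, h2.coeFn_toLp⟩, h1.coeFn_toLp⟩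

/-- Test functions supported in a single helicity reduce the claim to the fundamental lemma of the
calculus of variations on ℝ³. -/
theorem total_angularGenerators (j : E3) (g : OnePhoton)
    (hg : ∀ F ∈ angularGenerators j, inner ℂ g F.1 = 0) : g = 0 := by
  have hgl : ∀ l : Fin 2, MemLp (fun k => g (k, l)) 2 (volume : Measure E3) := fun l => by
    have h1 : Measure.map (fun k : E3 => (k, l)) volume ≤ photonMeasure := by
      rw [← Measure.prod_dirac]
      refine Measure.prod_mono le_rfl ?_
      rw [Measure.count]
      exact Measure.le_sum (fun i : Fin 2 => Measure.dirac i) l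
    exact (memLp_map_measure_iff ((Lp.aestronglyMeasurable g).mono_measure h1)
      (by fun_prop)).1 ((Lp.memLp g).mono_measure h1)
  have h0 : ∀ l : Fin 2, ∀ᵐ k : E3, g (k, l) = 0 := by
    intro l
    have hs := ae_eq_zero_of_integral_contDiff_smul_eq_zero (μ := (volume : Measure E3))
      (f := fun k => (starRingEnd ℂ) (g (k, l))) ?_ ?_
    · filter_upwards [hs] with k hk
      simpa using hk
    · exact ((hgl l).star.locallyIntegrable (by norm_num))
    · intro φ hφ hφc
      obtain ⟨F, hF, hF1⟩ := exists_mem_angularGenerators j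
        (f := fun l' k => if l' = l then (φ k : ℂ) else 0)
        (fun l' => by
          by_cases h : l' = l
          · simp only [h, if_true]
            exact Complex.ofRealCLM.contDiff.comp hφ
          · simp only [h, if_false]
            exact contDiff_const)
        (fun l' => by
          by_cases h : l' = l
          · simp only [h, if_true]
            exact hφc.comp_left Complex.ofReal_zero
          · simp only [h, if_false]
            exact HasCompactSupport.zero)
      have h1 := hg F hF
      have h2 : (fun x => inner ℂ (g x) (F.1 x)) =ᵐ[photonMeasure] fun x =>
          (starRingEnd ℂ) (g x) * (if x.2 = l then (φ x.1 : ℂ) else 0) := by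
        filter_upwards [hF1] with x hx
        rw [hx, RCLike.inner_apply, mul_comm]
      rw [L2.inner_def, integral_congr_ae h2,
        integral_prod _ ((L2.integrable_inner g F.1).congr h2)] at h1
      rw [← h1]
      refine integral_congr_ae (Filter.Eventually.of_forall fun k => ?_)
      simp [mul_comm]
  refine Lp.ext ?_
  have h1 : ∀ᵐ x ∂photonMeasure, g x = 0 := by
    refine (Measure.ae_prod_iff_ae_ae
      ((Lp.stronglyMeasurable g).measurable (measurableSet_singleton (0 : ℂ)))).2 ?_
    filter_upwards [ae_all_iff.2 h0] with k hk
    exact Filter.Eventually.of_forall hk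
  filter_upwards [h1, Lp.coeFn_zero ℂ 2 photonMeasure] with x h2 h3
  rw [h2, h3, Pi.zero_apply]

variable {j : E3} (hj : ‖j‖ = 1)

include hj in
theorem hasDerivAt_axisRotationFun (k : E3) (θ : ℝ) :
    HasDerivAt (fun θ => axisRotationFun j (-θ) k) (-cross j (axisRotationFun j (-θ) k)) θ := by
  have h1 : HasDerivAt (fun θ : ℝ => Real.cos (-θ)) (Real.sin (-θ)) θ := by
    simpa using (hasDerivAt_neg θ).cos
  have h2 : HasDerivAt (fun θ : ℝ => Real.sin (-θ)) (-Real.cos (-θ)) θ := by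
    simpa using (hasDerivAt_neg θ).sin
  have h3 := ((h1.smul_const k).add (h2.smul_const (cross j k))).add
    (((h1.const_sub 1).mul_const (inner ℝ j k)).smul_const j)
  rw [cross_axisRotationFun hj]
  exact h3.congr_deriv (by module)

theorem coeFn_rotateOp_one (R : E3 ≃ₗᵢ[ℝ] E3) (f : OnePhoton) :
    rotateOp R (one_mul 1) f =ᵐ[photonMeasure] fun x => f (R.symm x.1, x.2) := by
  filter_upwards [coeFn_rotateOp R (one_mul 1) f] with x hx
  rw [hx]
  simp [signFn]

/-- The action on one photon of the rotation around the axis `j` by the angle `θ`. -/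
noncomputable def axisRotate (θ : ℝ) : OnePhoton ≃ₗᵢ[ℂ] OnePhoton :=
  rotateEquiv (axisRotation hj θ) (one_mul 1)

theorem inner_axisRotate (θ : ℝ) (g F : OnePhoton) {f : Fin 2 → E3 → ℂ}
    (hF : F =ᵐ[photonMeasure] fun x => f x.2 x.1) :
    inner ℂ g (axisRotate hj θ F)
      = ∫ x, (starRingEnd ℂ) (g x) * f x.2 (axisRotationFun j (-θ) x.1) ∂photonMeasure := by
  rw [inner_onePhoton]
  refine integral_congr_ae ?_
  filter_upwards [coeFn_rotateOp_one (axisRotation hj θ) F,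
    (measurePreserving_rotate (axisRotation hj θ).symm).quasiMeasurePreserving.ae hF] with x h1 h2
  change _ * rotateOp _ (one_mul 1) F x = _
  rw [h1, h2]
  rfl

/-- Differentiation under the integral. The dominating function is |g| times a constant on a ball
centred at 0, which works for all angles because rotations preserve the ball. -/
theorem hasDerivAt_inner_axisRotate {F : OnePhoton × OnePhoton} (hF : F ∈ angularGenerators j)
    (g : OnePhoton) (θ : ℝ) :
    HasDerivAt (fun θ => inner ℂ g (axisRotate hj θ F.1))
      (-Complex.I * inner ℂ g (axisRotate hj θ F.2)) θ := by
  obtain ⟨f, hf, hc, hF1, hF2⟩ := hF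
  simp only [inner_axisRotate hj _ g _ hF1, inner_axisRotate hj _ g F.2
    (f := fun l => angularExpr j (f l)) hF2]
  rw [← integral_const_mul]
  obtain ⟨C, r, hC⟩ := exists_bound (fun l => continuous_angularExpr j (hf l))
    (fun l => hasCompactSupport_angularExpr j (hc l))
  have hcont : ∀ θ : ℝ, Continuous fun k => axisRotationFun j θ k := fun θ =>
    (axisRotation hj θ).continuous
  have hmeas : ∀ (f : Fin 2 → E3 → ℂ), (∀ l, Continuous (f l)) → ∀ θ : ℝ, AEStronglyMeasurable
      (fun x : Photon => (starRingEnd ℂ) (g x) * f x.2 (axisRotationFun j (-θ) x.1))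
      photonMeasure := fun f hf θ =>
    (Lp.aestronglyMeasurable g).star.mul (measurable_helicity
      (f := fun l k => f l (axisRotationFun j (-θ) k))
      fun l => (hf l).comp (hcont _)).aestronglyMeasurable
  refine (hasDerivAt_integral_of_dominated_loc_of_deriv_le (s := Set.univ) (x₀ := θ)
    (bound := fun x => ‖g x‖ * Set.indicator (Metric.closedBall 0 r) (fun _ : E3 => C) x.1)
    (F' := fun θ x => -Complex.I * ((starRingEnd ℂ) (g x) *
      angularExpr j (f x.2) (axisRotationFun j (-θ) x.1))) Filter.univ_mem
    (Filter.Eventually.of_forall (hmeas f fun l => (hf l).continuous)) ?_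
    ((hmeas _ (fun l => continuous_angularExpr j (hf l)) θ).const_mul _) ?_ ?_ ?_).2
  · have h1 := memLp_helicity (f := fun l k => f l (axisRotationFun j (-θ) k))
      (fun l => (hf l).continuous.comp (hcont _))
      (fun l => (hc l).comp_homeomorph (axisRotation hj (-θ)).toHomeomorph)
    exact (Lp.memLp g).star.integrable_mul h1
  · refine Filter.Eventually.of_forall fun x θ _ => ?_
    rw [norm_mul, norm_neg, Complex.norm_I, one_mul, norm_mul, RCLike.norm_conj]
    refine mul_le_mul_of_nonneg_left ((hC _ _).trans (le_of_eq ?_)) (norm_nonneg _)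
    simp only [Set.indicator, Metric.mem_closedBall, dist_zero_right, norm_axisRotationFun hj]
  · exact (Lp.memLp g).norm.integrable_mul (memLp_ball C r)
  · refine Filter.Eventually.of_forall fun x θ _ => ?_
    have h1 := (((hf x.2).differentiable (by simp)) (axisRotationFun j (-θ) x.1)).hasFDerivAt.comp_hasDerivAt
      θ (hasDerivAt_axisRotationFun hj x.1 θ)
    have h2 := h1.const_mul ((starRingEnd ℂ) (g x))
    refine h2.congr_deriv ?_
    rw [angularExpr_eq, map_neg]
    linear_combination -((starRingEnd ℂ) (g x) * fderiv ℝ (f x.2) (axisRotationFun j (-θ) x.1)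
      (cross j (axisRotationFun j (-θ) x.1))) * Complex.I_mul_I

theorem axisRotate_add (θ φ : ℝ) (f : OnePhoton) :
    axisRotate hj θ (axisRotate hj φ f) = axisRotate hj (θ + φ) f := by
  change rotateOp _ (one_mul 1) (rotateOp _ (one_mul 1) f) = rotateOp _ (one_mul 1) f
  rw [rotateOp_rotateOp _ _ _ _ (by norm_num)]
  exact rotateOp_congr (axisRotation_trans hj φ θ) (one_mul 1) _ _ f

theorem axisRotate_zero (f : OnePhoton) : axisRotate hj 0 f = f := by
  change rotateOp _ (one_mul 1) f = f
  rw [rotateOp_congr (R' := LinearIsometryEquiv.refl ℝ E3) (ε' := 1) ?_ rfl _ (one_mul 1),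
    rotateOp_refl]
  ext1 v
  exact axisRotationFun_zero v

theorem inner_axisRotate_right (θ : ℝ) (f g : OnePhoton) :
    inner ℂ g (axisRotate hj θ f) = inner ℂ (axisRotate hj (-θ) g) f := by
  have h := (axisRotate hj (-θ)).inner_map_map g (axisRotate hj θ f)
  rw [axisRotate_add, neg_add_cancel, axisRotate_zero] at h
  exact h.symm

include hj in
-- Differentiating ⟨F, U_θ G⟩ = ⟨U_{-θ} F, G⟩ at θ = 0 yields symmetry of the generator without
-- integration by parts.
theorem symmetricGraph_angularGenerators :
    SymmetricGraph (Submodule.span ℂ (angularGenerators j)) := by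
  refine SymmetricGraph.span fun F hF G hG => ?_
  have h1 := hasDerivAt_inner_axisRotate hj hG F.1 0
  have h2 := (hasDerivAt_inner_axisRotate hj hF G.1 0).scomp_of_eq (0 : ℝ) (hasDerivAt_neg 0)
    (by simp)
  have h3 := (h2.star).congr_of_eventuallyEq (f₁ := fun θ => inner ℂ F.1
    (axisRotate hj θ G.1)) (Filter.Eventually.of_forall fun θ => by
      beta_reduce
      rw [inner_axisRotate_right hj]
      exact (inner_conj_symm (𝕜 := ℂ) _ _).symm)
  have h4 := h1.unique h3
  simp only [axisRotate_zero, neg_smul, one_smul, star_mul, neg_mul, neg_neg] at h4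
  have h5 : star (inner ℂ G.1 F.2) = inner ℂ F.2 G.1 := inner_conj_symm (𝕜 := ℂ) _ _
  rw [h5] at h4
  simp only [RCLike.star_def, Complex.conj_I] at h4
  have h6 : Complex.I * (inner ℂ F.2 G.1 - inner ℂ F.1 G.2) = 0 := by
    linear_combination h4
  exact sub_eq_zero.1 ((mul_eq_zero.1 h6).resolve_left Complex.I_ne_zero)

end AngularGenerators

/-! ### Eigenvectors of the closure of j · ℓ -/

section AngularOperator

theorem angularOp_graph {j : E3} (hj : ‖j‖ = 1) :
    (angularOp j).graph = (Submodule.span ℂ (angularGenerators j)).topologicalClosure := by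
  refine Submodule.toLinearPMap_graph_eq _ fun x hx h0 => ?_
  refine (symmetricGraph_angularGenerators hj).closure.eq_zero (fun h hh => ?_) x hx h0
  exact total_angularGenerators j h fun F hF => hh F (subset_closure (Submodule.subset_span hF))

variable {j : E3} (hj : ‖j‖ = 1)

include hj in
theorem mem_angularOp_graph_of_mem {F : OnePhoton × OnePhoton} (hF : F ∈ angularGenerators j) :
    F ∈ (angularOp j).graph := by
  rw [angularOp_graph hj]
  exact subset_closure (Submodule.subset_span hF)

include hj in
theorem isClosed_angularOp_graph :
    IsClosed ((angularOp j).graph : Set (OnePhoton × OnePhoton)) := by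
  rw [angularOp_graph hj]
  exact Submodule.isClosed_topologicalClosure _

include hj in
theorem isDenseSymmetric_angularOp : IsDenseSymmetric (angularOp j) := by
  constructor
  · rw [angularOp_graph hj]
    exact (symmetricGraph_angularGenerators hj).closure
  · exact fun h hh => total_angularGenerators j h fun F hF =>
      hh _ ((angularOp j).mem_domain_of_mem_graph (mem_angularOp_graph_of_mem hj (F := (F.1, F.2)) hF))

include hj in
/-- Rotations around the axis commute with `j · ℓ`, reflections fixing it anticommute. -/
theorem rotateEquiv_mem_angularOp_graph {R : E3 ≃ₗᵢ[ℝ] E3} {ε : ℝ} (h : FixesAxis j R ε)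
    (x : OnePhoton × OnePhoton) (hx : x ∈ (angularOp j).graph) :
    (rotateEquiv R h.sign x.1, (ε : ℂ) • rotateEquiv R h.sign x.2) ∈ (angularOp j).graph := by
  let L : OnePhoton × OnePhoton →L[ℂ] OnePhoton × OnePhoton :=
    ((rotateEquiv R h.sign).toContinuousLinearEquiv : OnePhoton →L[ℂ] OnePhoton).prodMap
      ((ε : ℂ) • ((rotateEquiv R h.sign).toContinuousLinearEquiv : OnePhoton →L[ℂ] OnePhoton))
  rw [angularOp_graph hj] at hx
  refine (Submodule.topologicalClosure_minimal (t := (angularOp j).graph.comap L.toLinearMap) _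
    (Submodule.span_le.2 fun F hF => ?_)
    ((isClosed_angularOp_graph hj).preimage L.continuous)) hx
  exact mem_angularOp_graph_of_mem hj (rotate_mem_angularGenerators h hF)

/-- Strong continuity: the rotations depend continuously on θ in the compact-open topology and
preserve the measure. -/
theorem continuous_axisRotate (f : OnePhoton) : Continuous fun θ => axisRotate hj θ f := by
  let g : ℝ → C(Photon, Photon) := fun θ =>
    ⟨fun x => (axisRotationFun j (-θ) x.1, x.2),
      ((axisRotation hj (-θ)).continuous.comp continuous_fst).prodMk continuous_snd⟩
  have hg : Continuous g := by
    refine ContinuousMap.continuous_of_continuous_uncurry _ ?_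
    change Continuous fun y : ℝ × Photon => (axisRotationFun j (-y.1) y.2.1, y.2.2)
    have h1 : Continuous fun y : ℝ × Photon => cross j y.2.1 :=
      (continuous_cross_left j).comp (continuous_fst.comp continuous_snd)
    unfold axisRotationFun
    fun_prop
  have h := Continuous.compMeasurePreservingLp (p := 2) (f := fun _ : ℝ => f) continuous_const hg
    (fun θ => measurePreserving_rotate (axisRotation hj (-θ))) (by norm_num)
  refine h.congr fun θ => Lp.ext ?_
  filter_upwards [coeFn_rotateOp_one (axisRotation hj θ) f, Lp.coeFn_compMeasurePreserving f
    (measurePreserving_rotate (axisRotation hj (-θ)))] with x h1 h2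
  exact h2.trans h1.symm

theorem axisRotate_periodic (f : OnePhoton) :
    Function.Periodic (fun θ => axisRotate hj θ f) (2 * Real.pi) := by
  intro θ
  have h : axisRotation hj (θ + 2 * Real.pi) = axisRotation hj θ := by
    ext1 v
    simp [axisRotation_apply, axisRotationFun]
  simp only [axisRotate, h]

/-- The component of `f` on which the rotations around `j` act by the character `n`. -/
noncomputable def fourierComponent (n : ℤ) (f : OnePhoton) : OnePhoton :=
  ∫ θ in (0 : ℝ)..2 * Real.pi, Complex.exp (Complex.I * (n * θ : ℝ)) • axisRotate hj θ f

theorem exp_periodic (n : ℤ) :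
    Function.Periodic (fun θ : ℝ => Complex.exp (Complex.I * (n * θ : ℝ))) (2 * Real.pi) := by
  intro θ
  beta_reduce
  rw [← Complex.exp_periodic.int_mul n (Complex.I * (n * θ : ℝ))]
  congr 1
  push_cast
  ring

theorem continuous_exp_int_mul (n : ℤ) :
    Continuous fun θ : ℝ => Complex.exp (Complex.I * (n * θ : ℝ)) := by
  fun_prop

theorem axisRotate_fourierComponent (n : ℤ) (f : OnePhoton) (φ : ℝ) :
    axisRotate hj φ (fourierComponent hj n f)
      = Complex.exp (-Complex.I * (n * φ : ℝ)) • fourierComponent hj n f := by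
  have hc := continuous_axisRotate hj f
  have hi : Continuous fun θ : ℝ => Complex.exp (Complex.I * (n * θ : ℝ)) • axisRotate hj θ f :=
    Continuous.smul (continuous_exp_int_mul n) hc
  have h1 := ((axisRotate hj φ).toContinuousLinearEquiv : OnePhoton →L[ℂ] OnePhoton).intervalIntegral_comp_comm
    (hi.intervalIntegrable (μ := volume) 0 (2 * Real.pi))
  have h2 : ∀ θ : ℝ, axisRotate hj φ (Complex.exp (Complex.I * (n * θ : ℝ)) • axisRotate hj θ f)
      = Complex.exp (-Complex.I * (n * φ : ℝ)) •
        (Complex.exp (Complex.I * (n * (θ + φ) : ℝ)) • axisRotate hj (θ + φ) f) := fun θ => by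
    rw [map_smul, axisRotate_add, smul_smul, ← Complex.exp_add, add_comm φ θ]
    congr 2
    push_cast
    ring
  have hp : Function.Periodic (fun θ : ℝ => Complex.exp (Complex.I * (n * θ : ℝ)) •
      axisRotate hj θ f) (2 * Real.pi) := fun θ =>
    congrArg₂ (· • ·) (exp_periodic n θ) (axisRotate_periodic hj f θ)
  have h3 := hp.intervalIntegral_add_eq φ 0
  calc axisRotate hj φ (fourierComponent hj n f)
      = ∫ θ in (0 : ℝ)..2 * Real.pi,
          axisRotate hj φ (Complex.exp (Complex.I * (n * θ : ℝ)) • axisRotate hj θ f) := h1.symm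
    _ = _ := by
      simp only [h2]
      rw [intervalIntegral.integral_smul, fourierComponent]
      congr 1
      rw [intervalIntegral.integral_comp_add_right (f := fun θ : ℝ =>
        Complex.exp (Complex.I * (n * θ : ℝ)) • axisRotate hj θ f), zero_add, add_comm _ φ]
      rw [zero_add] at h3
      exact h3

/-- Rotating F by θ and multiplying by a phase stays in the graph. The graph is a closed subspace,
so the integral of this continuous curve lies in it as well. -/
theorem fourierComponent_mem_angularOp_graph (n : ℤ) {F : OnePhoton × OnePhoton}
    (hF : F ∈ angularGenerators j) :
    (fourierComponent hj n F.1, fourierComponent hj n F.2) ∈ (angularOp j).graph := by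
  have := isClosed_angularOp_graph hj
  have hG : CompleteSpace (angularOp j).graph := this.completeSpace_coe
  let e : ℝ → ℂ := fun θ => Complex.exp (Complex.I * (n * θ : ℝ))
  let P : ℝ → (angularOp j).graph := fun θ => ⟨(e θ • axisRotate hj θ F.1, e θ • axisRotate hj θ F.2), by
    refine (angularOp j).graph.smul_mem (e θ) (x := (axisRotate hj θ F.1, axisRotate hj θ F.2)) ?_
    have h := rotateEquiv_mem_angularOp_graph hj (fixesAxis_axisRotation hj θ) F
      (mem_angularOp_graph_of_mem hj hF)
    rwa [Complex.ofReal_one, one_smul] at h⟩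
  have hP : Continuous P := by
    refine Continuous.subtype_mk (Continuous.prodMk ?_ ?_) _
    · exact Continuous.smul (continuous_exp_int_mul n) (continuous_axisRotate hj F.1)
    · exact Continuous.smul (continuous_exp_int_mul n) (continuous_axisRotate hj F.2)
  have hi := hP.intervalIntegrable (μ := volume) 0 (2 * Real.pi)
  have h := (∫ θ in (0 : ℝ)..2 * Real.pi, P θ).2
  have h1 := ((ContinuousLinearMap.fst ℂ OnePhoton OnePhoton).comp
    (angularOp j).graph.subtypeL).intervalIntegral_comp_comm hi
  have h2 := ((ContinuousLinearMap.snd ℂ OnePhoton OnePhoton).comp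
    (angularOp j).graph.subtypeL).intervalIntegral_comp_comm hi
  have h3 : (fourierComponent hj n F.1, fourierComponent hj n F.2)
      = ((∫ θ in (0 : ℝ)..2 * Real.pi, P θ : (angularOp j).graph) : OnePhoton × OnePhoton) :=
    Prod.ext h1 h2
  rw [h3]
  exact h

theorem inner_fourierComponent (n : ℤ) (f g : OnePhoton) :
    inner ℂ g (fourierComponent hj n f)
      = ∫ θ in (0 : ℝ)..2 * Real.pi,
          Complex.exp (Complex.I * (n * θ : ℝ)) * inner ℂ g (axisRotate hj θ f) := by
  have hi : Continuous fun θ : ℝ => Complex.exp (Complex.I * (n * θ : ℝ)) • axisRotate hj θ f :=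
    Continuous.smul (continuous_exp_int_mul n) (continuous_axisRotate hj f)
  have h := (innerSL ℂ g).intervalIntegral_comp_comm
    (hi.intervalIntegrable (μ := volume) 0 (2 * Real.pi))
  simp only [innerSL_apply_apply, inner_smul_right] at h
  exact h.symm

/-- Integrating the derivative of exp(inθ)⟨g, U_θ F⟩ over a full period gives zero; this is the
eigenvalue equation for n, tested against g. -/
theorem fourierComponent_snd (n : ℤ) {F : OnePhoton × OnePhoton} (hF : F ∈ angularGenerators j) :
    fourierComponent hj n F.2 = (n : ℂ) • fourierComponent hj n F.1 := by
  refine ext_inner_left ℂ fun g => ?_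
  rw [inner_smul_right, inner_fourierComponent, inner_fourierComponent]
  let e : ℝ → ℂ := fun θ => Complex.exp (Complex.I * (n * θ : ℝ))
  have hc : ∀ f : OnePhoton, Continuous fun θ => e θ * inner ℂ g (axisRotate hj θ f) := fun f =>
    Continuous.mul (continuous_exp_int_mul n) (continuous_const.inner (continuous_axisRotate hj f))
  have he : ∀ θ, HasDerivAt e (Complex.I * n * e θ) θ := fun θ => by
    have h1 : HasDerivAt (fun θ : ℝ => ((n * θ : ℝ) : ℂ)) ((n * 1 : ℝ) : ℂ) θ :=
      ((hasDerivAt_id θ).const_mul (n : ℝ)).ofReal_comp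
    refine ((h1.const_mul Complex.I).cexp).congr_deriv ?_
    rw [show e θ = Complex.exp (Complex.I * (n * θ : ℝ)) from rfl]
    push_cast
    ring
  have hi1 : IntervalIntegrable (fun θ => Complex.I * n * (e θ * inner ℂ g (axisRotate hj θ F.1)))
      volume 0 (2 * Real.pi) := ((hc F.1).const_mul _).intervalIntegrable _ _
  have hi2 : IntervalIntegrable (fun θ => Complex.I * (e θ * inner ℂ g (axisRotate hj θ F.2)))
      volume 0 (2 * Real.pi) := ((hc F.2).const_mul _).intervalIntegrable _ _
  have h1 := intervalIntegral.integral_eq_sub_of_hasDerivAt (a := 0) (b := 2 * Real.pi)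
    (f := fun θ => e θ * inner ℂ g (axisRotate hj θ F.1))
    (f' := fun θ => Complex.I * n * (e θ * inner ℂ g (axisRotate hj θ F.1))
      - Complex.I * (e θ * inner ℂ g (axisRotate hj θ F.2)))
    (fun θ _ => ((he θ).mul (hasDerivAt_inner_axisRotate hj hF g θ)).congr_deriv (by ring))
    (hi1.sub hi2)
  have h2 : e (2 * Real.pi) * inner ℂ g (axisRotate hj (2 * Real.pi) F.1)
      = e 0 * inner ℂ g (axisRotate hj 0 F.1) := by
    have h3 := exp_periodic n 0
    have h4 := axisRotate_periodic hj F.1 0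
    rw [zero_add] at h3 h4
    rw [show e (2 * Real.pi) = e 0 from h3, show axisRotate hj (2 * Real.pi) F.1 = _ from h4]
  rw [h2, sub_self, intervalIntegral.integral_sub hi1 hi2, intervalIntegral.integral_const_mul,
    intervalIntegral.integral_const_mul] at h1
  have h5 : Complex.I * ((∫ θ in (0 : ℝ)..2 * Real.pi, e θ * inner ℂ g (axisRotate hj θ F.2))
      - n * ∫ θ in (0 : ℝ)..2 * Real.pi, e θ * inner ℂ g (axisRotate hj θ F.1)) = 0 := by
    linear_combination -h1
  exact sub_eq_zero.1 ((mul_eq_zero.1 h5).resolve_left Complex.I_ne_zero)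

/-- All Fourier coefficients of the function on the circle vanish, so its Fourier series is
trivially summable and represents the continuous function pointwise. -/
theorem eq_zero_of_fourier_integrals {φ : ℝ → ℂ} (hφ : Continuous φ)
    (hp : Function.Periodic φ (2 * Real.pi))
    (h : ∀ n : ℤ, ∫ θ in (0 : ℝ)..2 * Real.pi, Complex.exp (Complex.I * (n * θ : ℝ)) * φ θ = 0) :
    φ 0 = 0 := by
  have hT : Fact (0 < 2 * Real.pi) := ⟨by positivity⟩
  let f : C(AddCircle (2 * Real.pi), ℂ) := ⟨hp.lift, by
    exact continuous_coinduced_dom.2 hφ⟩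
  have h1 : fourierCoeff f = 0 := by
    funext n
    rw [fourierCoeff_eq_intervalIntegral f n 0, zero_add]
    have h2 : ∀ θ : ℝ, fourier (-n) (θ : AddCircle (2 * Real.pi)) • f θ
        = Complex.exp (Complex.I * ((-n : ℤ) * θ : ℝ)) * φ θ := fun θ => by
      rw [fourier_coe_apply, smul_eq_mul]
      congr 2
      have := Real.pi_ne_zero
      push_cast
      field_simp
    simp only [h2, h, smul_zero]
    rfl
  have h3 := has_pointwise_sum_fourier_series_of_summable (f := f) (by rw [h1]; exact summable_zero)
    ((0 : ℝ) : AddCircle (2 * Real.pi))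
  rw [h1] at h3
  simp only [Pi.zero_apply, zero_smul] at h3
  exact h3.unique hasSum_zero

/-- The eigenvectors of `j · ℓ` that are characters of the rotation group around `j`. -/
def angularEigenvectors : Set (OnePhoton × ℤ) :=
  {v | (v.1, (v.2 : ℂ) • v.1) ∈ (angularOp j).graph ∧
    ∀ φ : ℝ, axisRotate hj φ v.1 = Complex.exp (-Complex.I * (v.2 * φ : ℝ)) • v.1}

/-- If h is orthogonal to every Fourier component of F, then θ ↦ ⟨h, U_θ F⟩ has no Fourier
coefficients and vanishes at θ = 0. The vectors F are total. -/
theorem total_angularEigenvectors (h : OnePhoton)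
    (hh : ∀ v ∈ angularEigenvectors hj, inner ℂ h v.1 = 0) : h = 0 := by
  refine total_angularGenerators j h fun F hF => ?_
  have h1 := eq_zero_of_fourier_integrals (φ := fun θ => inner ℂ h (axisRotate hj θ F.1))
    (continuous_const.inner (continuous_axisRotate hj F.1))
    (fun θ => by simp only [axisRotate_periodic hj F.1 θ]) fun n => by
      rw [← inner_fourierComponent]
      have h2 := fourierComponent_mem_angularOp_graph hj n hF
      rw [fourierComponent_snd hj n hF] at h2
      exact hh (fourierComponent hj n F.1, n) ⟨h2, axisRotate_fourierComponent hj n F.1⟩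
  rwa [axisRotate_zero] at h1

end AngularOperator

end DiracPolaron
namespace DiracPolaron

/-! ### The total angular momentum and its eigenvectors -/

section AngularMomentum

theorem GammaEquiv_GammaEquiv (u v : OnePhoton ≃ₗᵢ[ℂ] OnePhoton) (Ψ : Fock) :
    GammaEquiv v (GammaEquiv u Ψ) = GammaEquiv (u.trans v) Ψ :=
  Gamma_Gamma v.inner_map_map u.inner_map_map Ψ

theorem symTensor_smul_univ {n : ℕ} (c : Fin n → ℂ) (f : Fin n → OnePhoton) :
    symTensor (fun i => c i • f i) = (∏ i, c i) • symTensor f := by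
  rw [symTensor_eq, symTensor_eq, ← tensorM_apply, ← tensorM_apply,
    ContinuousMultilinearMap.map_smul_univ, map_smul, lp.single_smul]

variable (e : Polarization) {j : E3} (hj : ‖j‖ = 1)

theorem mem_fieldAngularMomentum_graph (x : Fock × Fock) :
    x ∈ (fieldAngularMomentum e j hj).graph ↔
      ((GammaEquiv (changeEquiv e (stdPolarization j hj))).symm x.1,
        (GammaEquiv (changeEquiv e (stdPolarization j hj))).symm x.2) ∈ (dGamma (angularOp j)).graph :=
  mem_conjugate_graph (GammaEquiv (changeEquiv e (stdPolarization j hj))) (fun _ => rfl) _ x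

theorem isClosed_fieldAngularMomentum_graph :
    IsClosed ((fieldAngularMomentum e j hj).graph : Set (Fock × Fock)) := by
  let U := GammaEquiv (changeEquiv e (stdPolarization j hj))
  have h := (isClosed_dGamma_graph (isDenseSymmetric_angularOp hj)).preimage
    (f := fun x : Fock × Fock => (U.symm x.1, U.symm x.2)) (by fun_prop)
  convert h using 1
  ext x
  exact mem_fieldAngularMomentum_graph e hj x

theorem symmetricGraph_fieldAngularMomentum :
    SymmetricGraph (fieldAngularMomentum e j hj).graph := by
  intro x hx y hy
  rw [mem_fieldAngularMomentum_graph] at hx hy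
  have h := symmetricGraph_dGamma (isDenseSymmetric_angularOp hj) _ hx _ hy
  simpa only [LinearIsometryEquiv.inner_map_map] using h

theorem mem_totalAngularMomentum_graph (Ψ Φ : StateSpace) :
    (Ψ, Φ) ∈ (totalAngularMomentum e j hj).graph ↔
      ∀ i, (Ψ i, (Φ - spinor (spin j) Ψ) i) ∈ (fieldAngularMomentum e j hj).graph := by
  rw [totalAngularMomentum, mem_graph_vadd]
  constructor
  · rintro ⟨X, hX, rfl⟩
    rw [add_sub_cancel_left]
    exact (mem_ampliation_graph _ _ _).1 hX
  · exact fun h => ⟨_, (mem_ampliation_graph _ _ _).2 h, by rw [add_sub_cancel]⟩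

theorem continuous_spinor (B : Matrix (Fin 4) (Fin 4) ℂ) : Continuous (spinor B) := by
  refine (PiLp.continuous_toLp 2 (fun _ : Fin 4 => Fock)).comp ?_
  fun_prop

theorem isClosed_totalAngularMomentum_graph :
    IsClosed ((totalAngularMomentum e j hj).graph : Set (StateSpace × StateSpace)) := by
  have h : ((totalAngularMomentum e j hj).graph : Set (StateSpace × StateSpace))
      = ⋂ i, (fun x : StateSpace × StateSpace => (x.1 i, (x.2 - spinor (spin j) x.1) i)) ⁻¹'
        ((fieldAngularMomentum e j hj).graph : Set (Fock × Fock)) := by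
    ext x
    simp only [Set.mem_iInter]
    exact mem_totalAngularMomentum_graph e hj x.1 x.2
  rw [h]
  refine isClosed_iInter fun i => (isClosed_fieldAngularMomentum_graph e hj).preimage ?_
  have h1 := (continuous_spinor (spin j)).comp (continuous_fst (X := StateSpace) (Y := StateSpace))
  have h2 : Continuous fun x : StateSpace × StateSpace => x.2 - spinor (spin j) x.1 :=
    continuous_snd.sub h1
  exact ((PiLp.continuous_apply 2 _ i).comp continuous_fst).prodMk
    ((PiLp.continuous_apply 2 _ i).comp h2)

theorem isHermitian_spin : (spin j).IsHermitian := by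
  have h : spin j = (1 / 2 : ℂ) • spinVec j := by
    rw [spinVec, smul_smul]
    norm_num
  rw [h, IsHermitian, conjTranspose_smul, (isHermitian_spinVec j).eq]
  congr 1
  simp

theorem symmetricGraph_totalAngularMomentum :
    SymmetricGraph (totalAngularMomentum e j hj).graph := by
  rintro ⟨Ψ, Φ⟩ hx ⟨Ψ', Φ'⟩ hy
  rw [mem_totalAngularMomentum_graph] at hx hy
  have h1 := inner_spinor_eq (isHermitian_spin (j := j)) (X := Ψ) (Y := Ψ') (X' := Ψ) (Y' := Ψ')
    fun i l => rfl
  have h2 : inner ℂ (Φ - spinor (spin j) Ψ) Ψ' = inner ℂ Ψ (Φ' - spinor (spin j) Ψ') := by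
    rw [PiLp.inner_apply, PiLp.inner_apply]
    exact Finset.sum_congr rfl fun i _ =>
      symmetricGraph_fieldAngularMomentum e hj _ (hx i) _ (hy i)
  rw [inner_sub_left, inner_sub_right, h1] at h2
  exact sub_left_injective h2

variable {R : E3 ≃ₗᵢ[ℝ] E3} {ε : ℝ}

/-- Symmetry and angular momentum are conjugated by the same change of polarization, which cancels
and leaves the statement for the special vectors. -/
theorem photonSymmetry_fieldAngularMomentum (h : FixesAxis j R ε) (x : Fock × Fock)
    (hx : x ∈ (fieldAngularMomentum e j hj).graph) :
    (GammaEquiv (photonSymmetry e hj h) x.1, (ε : ℂ) • GammaEquiv (photonSymmetry e hj h) x.2)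
      ∈ (fieldAngularMomentum e j hj).graph := by
  rw [mem_fieldAngularMomentum_graph] at hx ⊢
  set U := GammaEquiv (changeEquiv e (stdPolarization j hj)) with hU
  have h1 : ∀ Ψ, U.symm (GammaEquiv (photonSymmetry e hj h) Ψ)
      = GammaEquiv (rotateEquiv R h.sign) (U.symm Ψ) := by
    intro Ψ
    rw [photonSymmetry, ← GammaEquiv_GammaEquiv, ← GammaEquiv_GammaEquiv, ← hU,
      LinearIsometryEquiv.symm_apply_apply]
    rfl
  simp only [map_smul, h1]
  have hT := isDenseSymmetric_angularOp hj
  exact GammaEquiv_mem_dGamma_graph hT hT (rotateEquiv R h.sign) ε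
    (rotateEquiv_mem_angularOp_graph hj h) _ hx

theorem symmetryEquiv_totalAngularMomentum (h : FixesAxis j R ε) (B : Matrix (Fin 4) (Fin 4) ℂ)
    (hB : Bᴴ * B = 1) (hBs : B * spin j = (ε : ℂ) • (spin j * B)) (x : StateSpace × StateSpace)
    (hx : x ∈ (totalAngularMomentum e j hj).graph) :
    (symmetryEquiv B hB (GammaEquiv (photonSymmetry e hj h)) x.1,
      (ε : ℂ) • symmetryEquiv B hB (GammaEquiv (photonSymmetry e hj h)) x.2)
      ∈ (totalAngularMomentum e j hj).graph := by
  obtain ⟨Ψ, Φ⟩ := x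
  rw [mem_totalAngularMomentum_graph] at hx ⊢
  set W := ampliationEquiv (GammaEquiv (photonSymmetry e hj h))
  have h1 : (ε : ℂ) • spinor B (W Φ) - spinor (spin j) (spinor B (W Ψ))
      = spinor B ((ε : ℂ) • W (Φ - spinor (spin j) Ψ)) := by
    rw [map_smul, map_sub, map_sub, ampliationEquiv_spinor, ← spinor_mul, ← spinor_mul, hBs,
      spinor_smul, smul_sub, smul_smul, ← Complex.ofReal_mul, h.sign, Complex.ofReal_one, one_smul]
  simp only [symmetryEquiv_apply]
  rw [h1]
  exact spinor_mem B fun i => photonSymmetry_fieldAngularMomentum e hj h _ (hx i)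

/-- The eigenvectors of the angular momentum of the field that are characters of the rotation
group around the axis. -/
def fieldEigenvectors : Set (Fock × ℤ) :=
  {v | (v.1, (v.2 : ℂ) • v.1) ∈ (fieldAngularMomentum e j hj).graph ∧
    ∀ φ : ℝ, GammaEquiv (photonSymmetry e hj (fixesAxis_axisRotation hj φ)) v.1
      = Complex.exp (-Complex.I * (v.2 * φ : ℝ)) • v.1}

/-- Symmetrized products of one-photon eigenvectors are total. Their eigenvalues add up, and so do
the phases acquired under rotations, so the operator and the rotation group are diagonalized
together. -/
theorem total_fieldEigenvectors (h : Fock)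
    (hh : ∀ v ∈ fieldEigenvectors e hj, inner ℂ h v.1 = 0) : h = 0 := by
  let u := changeEquiv e (stdPolarization j hj)
  have hT := isDenseSymmetric_angularOp hj
  refine (GammaEquiv u).symm.map_eq_zero_iff.1 ?_
  refine eq_zero_of_inner_symTensor_total (T := Prod.fst '' angularEigenvectors hj)
    (fun g hg => total_angularEigenvectors hj g fun v hv => hg _ ⟨v, hv, rfl⟩) fun n f hf => ?_
  choose v hv hvf using hf
  have h1 : inner ℂ ((GammaEquiv u).symm h) (symTensor f) = inner ℂ h (GammaEquiv u (symTensor f)) := by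
    rw [← (GammaEquiv u).inner_map_map, LinearIsometryEquiv.apply_symm_apply]
  rw [h1]
  refine hh (GammaEquiv u (symTensor f), ∑ i, (v i).2) ⟨?_, fun φ => ?_⟩
  · rw [mem_fieldAngularMomentum_graph]
    simp only [map_smul]
    rw [LinearIsometryEquiv.symm_apply_apply]
    have := dGamma_eigenvector hT (f := f) (z := fun i => ((v i).2 : ℂ)) fun i => by
      rw [← hvf i]
      exact (hv i).1
    simpa using this
  · rw [GammaEquiv_symTensor, GammaEquiv_symTensor]
    have h2 : ∀ i, photonSymmetry e hj (fixesAxis_axisRotation hj φ) (u (f i))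
        = Complex.exp (-Complex.I * ((v i).2 * φ : ℝ)) • u (f i) := fun i => by
      rw [← map_smul, ← hvf i, ← (hv i).2 φ]
      change u (axisRotate hj φ (u.symm (u (v i).1))) = _
      rw [LinearIsometryEquiv.symm_apply_apply]
    simp only [h2]
    rw [symTensor_smul_univ, ← Complex.exp_sum]
    congr 2
    push_cast
    rw [Finset.sum_mul, Finset.mul_sum]

/-- The projections to the spin components `±1/2` in the direction of `j`. -/
noncomputable def spinProj (j : E3) (s : ℝ) : Matrix (Fin 4) (Fin 4) ℂ :=
  (1 / 2 : ℂ) • (1 + (s : ℂ) • spinVec j)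

include hj in
theorem spinVec_mul_spinProj {s : ℝ} (hs : s * s = 1) :
    spinVec j * spinProj j s = (s : ℂ) • spinProj j s := by
  have h : (s : ℂ) * s = 1 := by exact_mod_cast hs
  rw [spinProj, mul_smul_comm, mul_add, mul_one, mul_smul_comm, spinVec_mul_self hj, smul_comm (s : ℂ),
    smul_add (s : ℂ), smul_smul (s : ℂ), h, one_smul, add_comm]

include hj in
theorem spin_mul_spinProj {s : ℝ} (hs : s * s = 1) :
    spin j * spinProj j s = ((s / 2 : ℝ) : ℂ) • spinProj j s := by
  have h : spin j = (1 / 2 : ℂ) • spinVec j := by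
    rw [spinVec, smul_smul]
    norm_num
  rw [h, smul_mul_assoc, spinVec_mul_spinProj hj hs, smul_smul]
  congr 1
  push_cast
  ring

include hj in
theorem axisSpin_mul_spinProj {s : ℝ} (hs : s = 1 ∨ s = -1) (θ : ℝ) :
    axisSpin j θ * spinProj j s
      = Complex.exp (-Complex.I * ((s / 2) * θ : ℝ)) • spinProj j s := by
  rw [axisSpin, sub_mul, smul_mul_assoc, smul_mul_assoc, one_mul, spinVec_mul_spinProj hj
    (by rcases hs with rfl | rfl <;> norm_num), smul_smul, ← sub_smul]
  congr 1
  have h : -Complex.I * ((s / 2) * θ : ℝ) = ((-(s * (θ / 2)) : ℝ) : ℂ) * Complex.I := by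
    push_cast
    ring
  rw [h, Complex.exp_mul_I, ← Complex.ofReal_cos, ← Complex.ofReal_sin, Real.cos_neg, Real.sin_neg]
  rcases hs with rfl | rfl
  · rw [one_mul]
    push_cast
    ring
  · rw [neg_one_mul, Real.cos_neg, Real.sin_neg]
    push_cast
    ring

/-- Joint eigenvectors of the spin and of the angular momentum of the field. -/
def totalEigenvectors : Set (StateSpace × ℝ) :=
  {p | ∃ (s : ℝ) (X : StateSpace) (N : ℤ), (s = 1 ∨ s = -1) ∧
    (∀ i, (X i, N) ∈ fieldEigenvectors e hj) ∧ p = (spinor (spinProj j s) X, s / 2 + N)}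

theorem totalEigenvectors_spec (p : StateSpace × ℝ) (hp : p ∈ totalEigenvectors e hj) :
    p.2 ∈ halfIntegers ∧ (p.1, (p.2 : ℂ) • p.1) ∈ (totalAngularMomentum e j hj).graph := by
  obtain ⟨s, X, N, hs, hX, rfl⟩ := hp
  constructor
  · rcases hs with rfl | rfl
    · exact ⟨N, add_comm _ _⟩
    · exact ⟨N - 1, by push_cast; ring⟩
  · rw [mem_totalAngularMomentum_graph]
    have h1 : ((s / 2 + N : ℝ) : ℂ) • spinor (spinProj j s) X
        - spinor (spin j) (spinor (spinProj j s) X) = spinor (spinProj j s) ((N : ℂ) • X) := by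
      rw [← spinor_mul, spin_mul_spinProj hj (by rcases hs with rfl | rfl <;> norm_num), spinor_smul,
        ← sub_smul, map_smul]
      congr 1
      push_cast
      ring
    simp only
    rw [h1]
    exact spinor_mem _ fun i => (hX i).1

theorem total_totalEigenvectors (h : StateSpace)
    (hh : ∀ p ∈ totalEigenvectors e hj, inner ℂ h p.1 = 0) : h = 0 := by
  ext1 i
  refine total_fieldEigenvectors e hj _ fun v hv => ?_
  have hX : ∀ l, ((WithLp.toLp 2 (Pi.single i v.1) : StateSpace) l, v.2) ∈ fieldEigenvectors e hj := by
    intro l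
    by_cases hl : l = i
    · subst hl
      simpa using hv
    · simp only [Pi.single_eq_of_ne hl]
      -- The vanishing components satisfy the eigenvector conditions for every integer, in
      -- particular for the one carried by v.
      refine ⟨?_, fun φ => by simp⟩
      rw [smul_zero]
      exact Submodule.zero_mem _
  set X : StateSpace := WithLp.toLp 2 (Pi.single i v.1) with hXdef
  have h1 := hh _ ⟨1, X, v.2, Or.inl rfl, hX, rfl⟩
  have h2 := hh _ ⟨-1, X, v.2, Or.inr rfl, hX, rfl⟩
  -- The two spin projections add up to the identity, so orthogonality to both parts of X is
  -- orthogonality to X.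
  have h3 : spinor (spinProj j 1) X + spinor (spinProj j (-1)) X = X := by
    rw [← spinor_add]
    have : spinProj j 1 + spinProj j (-1) = 1 := by
      simp only [spinProj]
      push_cast
      module
    rw [this, spinor_one]
  have h4 : inner ℂ h X = 0 := by
    rw [← h3, inner_add_right, h1, h2, add_zero]
  rw [PiLp.inner_apply, Finset.sum_eq_single i] at h4
  · simpa [hXdef] using h4
  · intro l _ hl
    simp [hXdef, hl]
  · simp

theorem symmetryEquiv_totalEigenvectors (θ : ℝ) (p : StateSpace × ℝ)
    (hp : p ∈ totalEigenvectors e hj) :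
    symmetryEquiv (axisSpin j θ) (axisSpin_unitary hj θ)
      (GammaEquiv (photonSymmetry e hj (fixesAxis_axisRotation hj θ))) p.1
      = Complex.exp (-Complex.I * (p.2 * θ : ℝ)) • p.1 := by
  obtain ⟨s, X, N, hs, hX, rfl⟩ := hp
  have h1 : ampliationEquiv (GammaEquiv (photonSymmetry e hj (fixesAxis_axisRotation hj θ))) X
      = Complex.exp (-Complex.I * (N * θ : ℝ)) • X := by
    ext1 i
    exact (hX i).2 θ
  simp only [symmetryEquiv_apply]
  rw [ampliationEquiv_spinor, h1, ← spinor_mul, axisSpin_mul_spinProj hj hs, spinor_smul, map_smul,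
    smul_smul, ← Complex.exp_add]
  congr 2
  push_cast
  ring

include hj in
theorem exists_unit_orthogonal : ∃ n : E3, ‖n‖ = 1 ∧ inner ℝ n j = (0 : ℝ) := by
  obtain ⟨k, hk⟩ := (ae_cross_ne_zero j hj).exists
  refine ⟨‖cross j k‖⁻¹ • cross j k, ?_, ?_⟩
  · rw [norm_smul, norm_inv, norm_norm, inv_mul_cancel₀]
    rwa [cross_neg_swap, norm_neg, norm_ne_zero_iff]
  · rw [inner_smul_left, cross_dot_self_left, mul_zero]

end AngularMomentum

end DiracPolaron
-- The reduction theorem applied to the Dirac polaron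
theorem mainTheorem7 (M q m : ℝ) (hm : 0 ≤ m) (ρ : DiracPolaron.Cutoff)
    (e : DiracPolaron.Polarization) (j p : DiracPolaron.E3) (hj : ‖j‖ = 1) (hp : ∃ t : ℝ, p = t • j)
    (hρ : ∀ R : DiracPolaron.E3 ≃ₗᵢ[ℝ] DiracPolaron.E3, R j = j →
      ∀ᵐ k : DiracPolaron.E3, ρ.fn (R k) = ρ.fn k) :
    DiracPolaron.StronglyCommute (DiracPolaron.hamiltonian e ρ M q m p).closure
      (DiracPolaron.totalAngularMomentum e j hj) ∧
    DiracPolaron.IsOrthogonalDirectSum (DiracPolaron.totalAngularMomentum e j hj)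
      (fun z : DiracPolaron.halfIntegers => DiracPolaron.sector e j hj z) ∧
    DiracPolaron.IsOrthogonalDirectSum (DiracPolaron.hamiltonian e ρ M q m p).closure
      (fun z : DiracPolaron.halfIntegers => DiracPolaron.sector e j hj z) ∧
    (∀ z ∈ DiracPolaron.halfIntegers, DiracPolaron.UnitarilyEquivalent
      (K := DiracPolaron.sector e j hj z) (L := DiracPolaron.sector e j hj (-z))
      (DiracPolaron.part (DiracPolaron.hamiltonian e ρ M q m p).closure
        (DiracPolaron.sector e j hj z))
      (DiracPolaron.part (DiracPolaron.hamiltonian e ρ M q m p).closure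
        (DiracPolaron.sector e j hj (-z)))) ∧
    ∀ E : ℂ,
      FiniteDimensional ℂ
        (DiracPolaron.eigenspace (DiracPolaron.hamiltonian e ρ M q m p).closure E) →
      Even (Module.finrank ℂ
        (DiracPolaron.eigenspace (DiracPolaron.hamiltonian e ρ M q m p).closure E)) := by
  open DiracPolaron in
  obtain ⟨t, rfl⟩ := hp
  -- The plane orthogonal to n contains the axis, so the reflection in it fixes j and has
  -- determinant -1; with the spinor matrix β(σ · n) it supplies the unitary that reverses the
  -- angular momentum.
  obtain ⟨n, hn, hnj⟩ := exists_unit_orthogonal hj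
  have hrot := fixesAxis_axisRotation hj
  have href := fixesAxis_planeReflection hj hn hnj
  have hfix : ∀ {R : E3 ≃ₗᵢ[ℝ] E3} {ε : ℝ}, FixesAxis j R ε → R (t • j) = t • j := fun h => by
    rw [map_smul, h.axis]
  refine reduction_by_eigenspaces (selfAdjointGraph_hamiltonian_closure hm).1
    (isClosed_totalAngularMomentum_graph e hj) (symmetricGraph_totalAngularMomentum e hj)
    (totalEigenvectors_spec e hj) (total_totalEigenvectors e hj)
    (fun θ => symmetryEquiv (axisSpin j θ) (axisSpin_unitary hj θ)
      (GammaEquiv (photonSymmetry e hj (hrot θ))))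
    (fun θ => hamiltonian_photonSymmetry hm (hrot θ) (hρ _ (hrot θ).axis) _ _
      (mul_diracMatrix_of_alphaVec (axisSpin_mul_alphaVec hj θ) (axisSpin_mul_diracBeta θ)
        (hfix (hrot θ)) M)
      (mul_diracAlpha_of_alphaVec (axisSpin_mul_alphaVec hj θ)))
    (symmetryEquiv_totalEigenvectors e hj)
    (symmetryEquiv (diracBeta * spinVec n) (reflectSpin_unitary hn)
      (GammaEquiv (photonSymmetry e hj href)))
    (hamiltonian_photonSymmetry hm href (hρ _ href.axis) _ _
      (mul_diracMatrix_of_alphaVec (reflectSpin_mul_alphaVec hn) reflectSpin_mul_diracBeta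
        (hfix href) M)
      (mul_diracAlpha_of_alphaVec (reflectSpin_mul_alphaVec hn)))
    (fun x hx => ?_)
  have h := symmetryEquiv_totalAngularMomentum e hj href _ (reflectSpin_unitary hn)
    (by rw [reflectSpin_mul_spin hnj]; push_cast; rw [neg_one_smul]) x hx
  rwa [Complex.ofReal_neg, Complex.ofReal_one, neg_one_smul] at h
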